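/- **Setting.** A quantifier-free conjunctive query $\varphi=\alpha_1\wedge\dots\wedge\alpha_d$ ($d\ge 1$) is a conjunction of atoms $R(v_1,\dots,v_r)$, $r\ge1$; $\mathrm{vars}(\varphi)$ is its set of variables, linearly ordered, and $\sigma(\varphi)$ its set of relation symbols. Structures are finite. For a $\sigma(\varphi)$-structure $\mathcal A$, $\varphi(\mathcal A)$ is the set of all homomorphisms from $\varphi$ to $\mathcal A$ (mappings with domain $\mathrm{vars}(\varphi)$), and $\varphi\langle S\rangle(\mathcal A)$, for $S\subseteq \mathrm{vars}(\varphi)$, is the set of mappings $g$ with domain $S$ such that for every atom $\alpha$ of $\varphi$ the restriction of $g$ to $S\cap\mathrm{vars}(\alpha)$ extends to a homomorphism from $\alpha$ to $\mathcal A$. For $S\subseteq\mathrm{vars}(\varphi)$ let $x_S$ list $S$ increasingly and let $R_S$ be a fresh $|S|$-ary relation symbol. For $\mathfrak s\subseteq 2^{\mathrm{vars}(\varphi)}$ put $\sigma_{\mathfrak s}=\sigma(\varphi)\cup\{R_S: S\in\mathfrak s\}$ and $\varphi_{\mathfrak s}=\varphi\wedge\bigwedge_{S\in\mathfrak s}R_S(x_S)$.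 A *refinement* of $\varphi$ and $\mathcal A$ is a pair $(\mathfrak s,\mathcal B)$, where $\mathfrak s\subseteq 2^{\mathrm{vars}(\varphi)}$ is closed under taking subsets and $\mathcal B$ is a $\sigma_{\mathfrak s}$-expansion of $\mathcal A$. Let $\mathbf R_S$ be $R_S^{\mathcal B}$ viewed as a set of mappings with domain $S$, and $\pi_S$ the restriction of mappings to $S$. For a real $M$, the refinement is * *consistent* if $\mathbf R_S=\varphi_{\mathfrak s}\langle S\rangle(\mathcal B)$ for all $S\in\mathfrak s$, and $\mathbf R_S=\pi_S(\mathbf R_T)$ for all $S\subset T$ in $\mathfrak s$; * *$M$-consistent* if it is consistent and, for all $S\subseteq\mathrm{vars}(\varphi)$, $S\in\mathfrak s$ if and only if $|\varphi_{\mathfrak s}\langle T\rangle(\mathcal B)|\le M$ for all $T\subseteq S$; * *strongly $M$-consistent* if it is $M$-consistent and $|\varphi_{\mathfrak s}\langle S\cup T\rangle(\mathcal B)|>M$ whenever $S,T\in\mathfrak s$ and $S\cup T\notin\mathfrak s$; * *$\varepsilon$-uniform* if it is consistent, $R_S^{\mathcal B}\neq\emptyset$ for all $S\in\mathfrak s$,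 and for all $S\subseteq T$ in $\mathfrak s$ $$\max_{g\in\mathbf R_S}|\{h\in\mathbf R_T:\pi_S(h)=g\}|\le m^{\varepsilon}\cdot|\mathbf R_T|/|\mathbf R_S| ,$$ where $m$ is the number of tuples in the largest relation of $\mathcal A$. *Machine model.* Algorithms are programs of a random access machine with the uniform cost measure: registers hold natural numbers, there is indirect addressing (in finitely many arrays), the arithmetic consists of addition and truncated subtraction, every elementary operation takes one time unit, and space is the number of registers accessed. Variables, symbol names and elements of structures are natural numbers stored in one register each. The query, the universe and the relations of the structure (listed in any order) are given in memory; the real inputs $c,\varepsilon$ are accessible through the elementary tests $a\le b\cdot x^{c}$ and $a\le b\cdot x^{\varepsilon}$ for natural numbers $a,b,x$. A refinement $(\mathfrak s,\mathcal B)$ is output by listing the sets $S\in\mathfrak s$ with their relations $R_S^{\mathcal B}$. **Lemma.** There are a computable function $f$, whose value $f(\varphi,c,\varepsilon)\in\mathbb N$ depends only on $\varphi$, $\lceil c\rceil$ and $\lceil 1/\varepsilon\rceil$, and an algorithm that receives a quantifier-free conjunctive query $\varphi$, a $\sigma(\varphi)$-structure $\mathcal A$ whose largest relation contains $m$ tuples,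 and real numbers $c\ge1$ and $\varepsilon>0$, and computes in time at most $f(\varphi,c,\varepsilon)\cdot\max(m,1)^{2c}$ and space at most $f(\varphi,c,\varepsilon)\cdot\max(m,1)^{c}$ a sequence of $\ell\le f(\varphi,c,\varepsilon)$ strongly $m^c$-consistent $\varepsilon$-uniform refinements $(\mathfrak s_1,\mathcal B_1),\dots,(\mathfrak s_\ell,\mathcal B_\ell)$ of $\varphi$ and $\mathcal A$ such that $\varphi(\mathcal A)$ is the disjoint union of the sets $\varphi_{\mathfrak s_1}(\mathcal B_1),\dots,\varphi_{\mathfrak s_\ell}(\mathcal B_\ell)$. -/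

import Mathlib

/-! ### Relation symbols, structures, quantifier-free conjunctive queries

Variables are natural numbers, and so are the elements of a (finite) universe: both fit into one
register of a random access machine. -/

/-- A relation symbol: either an ordinary symbol, given by a name and an arity, or the fresh
symbol `R_S` attached to a finite set `S` of variables. -/
inductive RelSym where
  | base (name arity : ℕ)
  | sub (S : Finset ℕ)
  deriving DecidableEq

/-- The arity of a relation symbol; `R_S` has arity `|S|`. -/
def RelSym.arity : RelSym → ℕ
  | .base _ r => r
  | .sub S => S.card

/-- An atom `R(v₁, …, v_r)`. -/
structure Atom where
  sym : RelSym
  args : List ℕ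
  deriving DecidableEq

/-- The set of variables occurring in an atom. -/
def Atom.vars (α : Atom) : Finset ℕ := α.args.toFinset

/-- The variables of a conjunction of atoms. -/
def conjVars (Ψ : Finset Atom) : Finset ℕ := Ψ.biUnion Atom.vars

/-- The signature of a conjunction of atoms. -/
def conjSignature (Ψ : Finset Atom) : Finset RelSym := Ψ.image Atom.sym

/-- A finite relational structure. A structure over the signature `σ` is one that interprets all
symbols outside `σ` by the empty relation, see `Struct.IsOver`. -/
structure Struct where
  univ : Finset ℕ
  rel : RelSym → Finset (List ℕ)
  length_eq : ∀ R, ∀ t ∈ rel R, t.length = R.arity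
  mem_univ : ∀ R, ∀ t ∈ rel R, ∀ a ∈ t, a ∈ univ

/-- `A` is a `σ`-structure. -/
def Struct.IsOver (A : Struct) (σ : Finset RelSym) : Prop :=
  ∀ R, R ∉ σ → A.rel R = ∅

/-- A quantifier-free conjunctive query, given by its nonempty list of atoms `R(v₁, …, v_r)`,
`r ≥ 1`. The entry `(R, [v₁, …, v_r])` stands for the atom whose symbol has name `R` and
arity `r`. -/
structure QFCQ where
  atoms : List (ℕ × List ℕ)
  atoms_ne_nil : atoms ≠ []
  args_ne_nil : ∀ α ∈ atoms, α.2 ≠ []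

/-- The set of atoms of a quantifier-free conjunctive query. -/
def QFCQ.conj (φ : QFCQ) : Finset Atom :=
  (φ.atoms.map fun α => Atom.mk (RelSym.base α.1 α.2.length) α.2).toFinset

def QFCQ.vars (φ : QFCQ) : Finset ℕ := conjVars φ.conj

def QFCQ.signature (φ : QFCQ) : Finset RelSym := conjSignature φ.conj

/-- The number of tuples in the largest relation of a `σ(φ)`-structure. -/
def maxRelCard (φ : QFCQ) (A : Struct) : ℕ :=
  φ.signature.sup fun R => (A.rel R).card

/-! ### Mappings and query results -/

/-- Mappings from a finite set of variables to elements. -/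
abbrev PMap := ℕ → Option ℕ

/-- `g` is a mapping with domain `S`. -/
def PMap.HasDom (g : PMap) (S : Finset ℕ) : Prop := ∀ x, (g x).isSome ↔ x ∈ S

/-- The restriction of `g` to `S`. -/
def PMap.proj (S : Finset ℕ) (g : PMap) : PMap := fun x => if x ∈ S then g x else none

/-- `g` maps the argument tuple of the atom to a tuple of the corresponding relation of `A`. -/
def Atom.Holds (α : Atom) (A : Struct) (g : PMap) : Prop :=
  ∃ t ∈ A.rel α.sym, α.args.map g = t.map some

/-- The result on `A` of the quantifier-free conjunctive query with set of atoms `Ψ`: the set of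
all homomorphisms, as mappings with domain the set of variables of the query. -/
def evalConj (Ψ : Finset Atom) (A : Struct) : Set PMap :=
  {g | g.HasDom (conjVars Ψ) ∧ ∀ α ∈ Ψ, α.Holds A g}

/-- The result on `A` of the query `Ψ⟨S⟩`, in which the variables outside `S` are existentially
quantified in each atom separately. -/
def evalLocal (Ψ : Finset Atom) (S : Finset ℕ) (A : Struct) : Set PMap :=
  {g | g.HasDom S ∧ ∀ α ∈ Ψ, ∃ h : PMap,
    h.HasDom α.vars ∧ α.Holds A h ∧ ∀ x ∈ α.vars ∩ S, h x = g x}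

theorem finite_of_hasDom (V : Finset ℕ) (S : Finset ℕ) (X : Set PMap)
    (h : ∀ g ∈ X, g.HasDom S ∧ ∀ x ∈ S, ∀ a, g x = some a → a ∈ V) : X.Finite := by
  classical
  have hf : (Set.univ : Set (S → Option V)).Finite := Set.finite_univ
  refine (hf.image (fun k : S → Option V =>
    (fun x => if hx : x ∈ S then (k ⟨x, hx⟩).map Subtype.val else none : PMap))).subset ?_
  intro g hg
  obtain ⟨hd, hv⟩ := h g hg
  refine ⟨fun x => if hx : ∃ a, g x = some a then
    some ⟨hx.choose, hv x x.2 _ hx.choose_spec⟩ else none, trivial, ?_⟩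
  funext x
  by_cases hx : x ∈ S
  · have : ∃ a, g x = some a := Option.isSome_iff_exists.1 ((hd x).2 hx)
    simp only [hx, dif_pos, this]
    simpa using this.choose_spec.symm
  · have : ¬ (g x).isSome := fun h' => hx ((hd x).1 h')
    simp only [hx, dif_neg, not_false_eq_true]
    exact (Option.not_isSome_iff_eq_none.1 this).symm

theorem Atom.Holds.mem {α : Atom} {A : Struct} {g : PMap} (h : α.Holds A g) :
    ∀ x ∈ α.vars, ∀ a, g x = some a → a ∈ A.univ := by
  obtain ⟨t, ht, he⟩ := h
  intro x hx a hga
  have : some a ∈ α.args.map g := List.mem_map.2 ⟨x, List.mem_toFinset.1 hx, hga⟩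
  rw [he] at this
  obtain ⟨b, hb, hba⟩ := List.mem_map.1 this
  cases hba
  exact A.mem_univ _ _ ht _ hb

/-- Query results are finite sets. -/
theorem finite_evalConj (Ψ : Finset Atom) (A : Struct) : (evalConj Ψ A).Finite := by
  refine finite_of_hasDom A.univ (conjVars Ψ) _ ?_
  rintro g ⟨hd, hg⟩
  refine ⟨hd, fun x hx a ha => ?_⟩
  obtain ⟨α, hα, hx⟩ := Finset.mem_biUnion.1 hx
  exact (hg α hα).mem x hx a ha

/-- The results of the queries `Ψ⟨S⟩` are finite sets. -/
theorem finite_evalLocal (Ψ : Finset Atom) (A : Struct) (S : Finset ℕ) (hS : S ⊆ conjVars Ψ) :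
    (evalLocal Ψ S A).Finite := by
  refine finite_of_hasDom A.univ S _ ?_
  rintro g ⟨hd, hg⟩
  refine ⟨hd, fun x hx a ha => ?_⟩
  obtain ⟨α, hα, hx'⟩ := Finset.mem_biUnion.1 (hS hx)
  obtain ⟨h, _, h2, h3⟩ := hg α hα
  exact h2.mem x hx' a ((h3 x (Finset.mem_inter.2 ⟨hx', hx⟩)).trans ha)

/-! ### Refinements -/

/-- The tuple `x_S`: the elements of `S` in increasing order. -/
def varTuple (S : Finset ℕ) : List ℕ := S.sort (· ≤ ·)

/-- The atom `R_S(x_S)`. -/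
def subAtom (S : Finset ℕ) : Atom := ⟨RelSym.sub S, varTuple S⟩

/-- The query `φ_𝔰`, that is `φ` together with the atoms `R_S(x_S)` for `S ∈ 𝔰`. -/
def QFCQ.extend (φ : QFCQ) (𝔰 : Finset (Finset ℕ)) : Finset Atom :=
  φ.conj ∪ 𝔰.image subAtom

/-- A refinement `(𝔰, B)` of `φ` and `A`: a family of sets of variables closed under taking
subsets, and a `σ_𝔰`-expansion `B` of `A`, where `σ_𝔰` is the signature of `φ_𝔰`. -/
structure Refinement (φ : QFCQ) (A : Struct) where
  sets : Finset (Finset ℕ)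
  subset_vars : ∀ S ∈ sets, S ⊆ φ.vars
  down_closed : ∀ S ∈ sets, ∀ T ⊆ S, T ∈ sets
  str : Struct
  isOver : str.IsOver (conjSignature (φ.extend sets))
  univ_eq : str.univ = A.univ
  rel_eq : ∀ R ∈ φ.signature, str.rel R = A.rel R

namespace Refinement

variable {φ : QFCQ} {A : Struct}

/-- The query `φ_𝔰` of a refinement. -/
def query (r : Refinement φ A) : Finset Atom := φ.extend r.sets

/-- The query result `φ_𝔰(B)`. -/
def result (r : Refinement φ A) : Set PMap := evalConj r.query r.str

/-- The query result `φ_𝔰⟨S⟩(B)`. -/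
def localResult (r : Refinement φ A) (S : Finset ℕ) : Set PMap := evalLocal r.query S r.str

/-- The relation `R_S` of `B`, as a set of mappings with domain `S`. -/
def maps (r : Refinement φ A) (S : Finset ℕ) : Set PMap := evalConj {subAtom S} r.str

def Consistent (r : Refinement φ A) : Prop :=
  (∀ S ∈ r.sets, r.maps S = r.localResult S) ∧
  (∀ S ∈ r.sets, ∀ T ∈ r.sets, S ⊂ T → r.maps S = PMap.proj S '' r.maps T)

/-- `M`-consistency, for a real threshold `M`. -/
def MConsistent (r : Refinement φ A) (M : ℝ) : Prop :=
  r.Consistent ∧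
  ∀ S ⊆ φ.vars, (S ∈ r.sets ↔ ∀ T ⊆ S, ((r.localResult T).ncard : ℝ) ≤ M)

def StronglyMConsistent (r : Refinement φ A) (M : ℝ) : Prop :=
  r.MConsistent M ∧
  ∀ S ∈ r.sets, ∀ T ∈ r.sets, S ∪ T ∉ r.sets → M < ((r.localResult (S ∪ T)).ncard : ℝ)

/-- Every additional relation is nonempty. -/
def Nontriv (r : Refinement φ A) : Prop :=
  ∀ S ∈ r.sets, (r.str.rel (RelSym.sub S)).Nonempty

noncomputable def avgdeg (r : Refinement φ A) (S T : Finset ℕ) : ℝ :=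
  ((r.maps T).ncard : ℝ) / ((r.maps S).ncard : ℝ)

/-- The maximal number of extensions in `R_T` of a mapping in `R_S`. -/
noncomputable def maxdeg (r : Refinement φ A) (S T : Finset ℕ) : ℕ :=
  sSup ((fun g => {h ∈ r.maps T | PMap.proj S h = g}.ncard) '' r.maps S)

/-- `ε`-uniformity. -/
def Uniform (r : Refinement φ A) (ε : ℝ) : Prop :=
  r.Nontriv ∧ r.Consistent ∧
  ∀ S ∈ r.sets, ∀ T ∈ r.sets, S ⊆ T →
    (r.maxdeg S T : ℝ) ≤ (maxRelCard φ A : ℝ) ^ ε * r.avgdeg S T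

end Refinement

/-! ### Random access machines with the uniform cost measure

The memory consists of arrays of registers holding natural numbers, with indirect addressing.
The arithmetic is addition and truncated subtraction. As a machine cannot store a real number in
a register, the real parameters `ρ 0`, `ρ 1` of a computation are accessible through the
elementary comparisons `a ≤ b * x ^ ρ j` of natural numbers `a`, `b`, `x`. Every elementary
operation costs one time unit; the space is the number of registers accessed. -/

/-- `μ a i` is the content of register number `i` of array number `a`. -/
abbrev Memory := ℕ → ℕ → ℕ

inductive Expr where
  | const (k : ℕ)
  | read (a : ℕ) (i : Expr)
  | add (e₁ e₂ : Expr)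
  | sub (e₁ e₂ : Expr)
  | powLE (j : Fin 2) (a b x : Expr)

namespace Expr

open Classical in
/-- The value of an expression; comparisons have the values `0` (false) and `1` (true). -/
noncomputable def eval (ρ : Fin 2 → ℝ) (μ : Memory) : Expr → ℕ
  | const k => k
  | read a i => μ a (i.eval ρ μ)
  | add e₁ e₂ => e₁.eval ρ μ + e₂.eval ρ μ
  | sub e₁ e₂ => e₁.eval ρ μ - e₂.eval ρ μ
  | powLE j a b x =>
      if (a.eval ρ μ : ℝ) ≤ (b.eval ρ μ : ℝ) * (x.eval ρ μ : ℝ) ^ ρ j then 1 else 0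

/-- The time for evaluating an expression. -/
def cost : Expr → ℕ
  | const _ => 1
  | read _ i => i.cost + 1
  | add e₁ e₂ => e₁.cost + e₂.cost + 1
  | sub e₁ e₂ => e₁.cost + e₂.cost + 1
  | powLE _ a b x => a.cost + b.cost + x.cost + 1

/-- The registers read when an expression is evaluated. -/
noncomputable def cells (ρ : Fin 2 → ℝ) (μ : Memory) : Expr → Finset (ℕ × ℕ)
  | const _ => ∅
  | read a i => insert (a, i.eval ρ μ) (i.cells ρ μ)
  | add e₁ e₂ => e₁.cells ρ μ ∪ e₂.cells ρ μ
  | sub e₁ e₂ => e₁.cells ρ μ ∪ e₂.cells ρ μ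
  | powLE _ a b x => a.cells ρ μ ∪ b.cells ρ μ ∪ x.cells ρ μ

end Expr

/-- Programs. -/
inductive Prog where
  | skip
  | store (a : ℕ) (i e : Expr)
  | seq (p q : Prog)
  | ifLE (e₁ e₂ : Expr) (p q : Prog)
  | whileLT (e₁ e₂ : Expr) (p : Prog)

/-- The memory after writing `v` into register `i` of array `a`. -/
def Memory.write (μ : Memory) (a i v : ℕ) : Memory :=
  fun b k => if b = a ∧ k = i then v else μ b k

/-- `Exec ρ p μ ν t C`: started with memory `μ`, the program `p` halts with memory `ν` after
`t` time units, and `C` is the set of the registers that it has read or written. -/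
inductive Exec (ρ : Fin 2 → ℝ) : Prog → Memory → Memory → ℕ → Finset (ℕ × ℕ) → Prop
  | skip (μ : Memory) : Exec ρ .skip μ μ 1 ∅
  | store (μ : Memory) (a : ℕ) (i e : Expr) :
      Exec ρ (.store a i e) μ (μ.write a (i.eval ρ μ) (e.eval ρ μ)) (i.cost + e.cost + 1)
        (insert (a, i.eval ρ μ) (i.cells ρ μ ∪ e.cells ρ μ))
  | seq {p q : Prog} {μ ν ξ : Memory} {t u : ℕ} {C D : Finset (ℕ × ℕ)} :
      Exec ρ p μ ν t C → Exec ρ q ν ξ u D → Exec ρ (.seq p q) μ ξ (t + u) (C ∪ D)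
  | ifTrue {e₁ e₂ : Expr} {p q : Prog} {μ ν : Memory} {t : ℕ} {C : Finset (ℕ × ℕ)} :
      e₁.eval ρ μ ≤ e₂.eval ρ μ → Exec ρ p μ ν t C →
      Exec ρ (.ifLE e₁ e₂ p q) μ ν (e₁.cost + e₂.cost + 1 + t)
        (e₁.cells ρ μ ∪ e₂.cells ρ μ ∪ C)
  | ifFalse {e₁ e₂ : Expr} {p q : Prog} {μ ν : Memory} {t : ℕ} {C : Finset (ℕ × ℕ)} :
      ¬ e₁.eval ρ μ ≤ e₂.eval ρ μ → Exec ρ q μ ν t C →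
      Exec ρ (.ifLE e₁ e₂ p q) μ ν (e₁.cost + e₂.cost + 1 + t)
        (e₁.cells ρ μ ∪ e₂.cells ρ μ ∪ C)
  | whileTrue {e₁ e₂ : Expr} {p : Prog} {μ ν ξ : Memory} {t u : ℕ} {C D : Finset (ℕ × ℕ)} :
      e₁.eval ρ μ < e₂.eval ρ μ → Exec ρ p μ ν t C → Exec ρ (.whileLT e₁ e₂ p) ν ξ u D →
      Exec ρ (.whileLT e₁ e₂ p) μ ξ (e₁.cost + e₂.cost + 1 + t + u)
        (e₁.cells ρ μ ∪ e₂.cells ρ μ ∪ C ∪ D)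
  | whileFalse {e₁ e₂ : Expr} {p : Prog} {μ : Memory} :
      ¬ e₁.eval ρ μ < e₂.eval ρ μ →
      Exec ρ (.whileLT e₁ e₂ p) μ μ (e₁.cost + e₂.cost + 1)
        (e₁.cells ρ μ ∪ e₂.cells ρ μ)

/-- The machine is deterministic. -/
theorem Exec.determ {ρ : Fin 2 → ℝ} {p : Prog} {μ ν ν' : Memory} {t t' : ℕ}
    {C C' : Finset (ℕ × ℕ)} (h : Exec ρ p μ ν t C) (h' : Exec ρ p μ ν' t' C') :
    ν = ν' ∧ t = t' ∧ C = C' := by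
  induction h generalizing ν' t' C' with
  | skip => cases h'; simp
  | store => cases h'; simp
  | seq _ _ ih1 ih2 =>
    cases h' with
    | seq a b =>
      obtain ⟨rfl, rfl, rfl⟩ := ih1 a
      obtain ⟨rfl, rfl, rfl⟩ := ih2 b
      simp
  | ifTrue hc _ ih =>
    cases h' with
    | ifTrue _ a => obtain ⟨rfl, rfl, rfl⟩ := ih a; simp
    | ifFalse hn _ => exact absurd hc hn
  | ifFalse hc _ ih =>
    cases h' with
    | ifTrue hn a => exact absurd hn hc
    | ifFalse _ a => obtain ⟨rfl, rfl, rfl⟩ := ih a; simp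
  | whileTrue hc _ _ ih1 ih2 =>
    cases h' with
    | whileTrue _ a b =>
      obtain ⟨rfl, rfl, rfl⟩ := ih1 a
      obtain ⟨rfl, rfl, rfl⟩ := ih2 b
      simp
    | whileFalse hn => exact absurd hc hn
  | whileFalse hc =>
    cases h' with
    | whileTrue hn => exact absurd hn hc
    | whileFalse _ => simp

/-! ### Inputs and outputs -/

/-- Length-prefixed serialisation of a list. -/
def serList {α : Type} (ser : α → List ℕ) (l : List α) : List ℕ :=
  l.length :: l.flatMap ser

/-- Serialisation of a tuple of numbers: its length, followed by its entries. -/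
def serTuple (l : List ℕ) : List ℕ := l.length :: l

def serQuery (atoms : List (ℕ × List ℕ)) : List ℕ :=
  serList (fun α => α.1 :: serTuple α.2) atoms

/-- An explicit presentation of a structure over a signature of ordinary relation symbols: a list
of the universe, and a list of the relations, each given by its name, its arity and a list of its
tuples. -/
structure StructListing where
  univ : List ℕ
  rels : List ((ℕ × ℕ) × List (List ℕ))

/-- The listing `L` presents the `σ`-structure `A` (in any order and without repetitions). -/
def StructListing.Presents (L : StructListing) (σ : Finset RelSym) (A : Struct) : Prop :=
  L.univ.Nodup ∧ L.univ.toFinset = A.univ ∧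
  (L.rels.map Prod.fst).Nodup ∧
  (L.rels.map fun p => RelSym.base p.1.1 p.1.2).toFinset = σ ∧
  ∀ p ∈ L.rels, p.2.Nodup ∧ p.2.toFinset = A.rel (RelSym.base p.1.1 p.1.2)

def serRels (rels : List ((ℕ × ℕ) × List (List ℕ))) : List ℕ :=
  serList (fun p => p.1.1 :: p.1.2 :: serList serTuple p.2) rels

/-- The initial memory: array `0` holds the query, array `1` the universe, array `2` the
relations; all other registers are `0`. -/
def inputMemory (φ : QFCQ) (L : StructListing) : Memory := fun a i =>
  match a with
  | 0 => (serQuery φ.atoms).getD i 0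
  | 1 => (serTuple L.univ).getD i 0
  | 2 => (serRels L.rels).getD i 0
  | _ => 0

/-- The list `d` presents the refinement `r`: it consists, without repetitions, of the tuples
`x_S` for the sets `S` of the family, each together with a list, without repetitions, of the
tuples of the relation `R_S`. (The part of the expansion that belongs to `A` is not copied.) -/
def RefinementListing {φ : QFCQ} {A : Struct} (d : List (List ℕ × List (List ℕ)))
    (r : Refinement φ A) : Prop :=
  (d.map Prod.fst).Nodup ∧
  (d.map Prod.fst).toFinset = r.sets.image varTuple ∧
  ∀ p ∈ d, p.2.Nodup ∧ p.2.toFinset = r.str.rel (RelSym.sub p.1.toFinset)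

def serOutput (D : List (List (List ℕ × List (List ℕ)))) : List ℕ :=
  serList (serList fun p => serTuple p.1 ++ serList serTuple p.2) D

/-- Array `3` of the memory `ν` holds, from register `0` on, the sequence `rs`. -/
def Outputs {φ : QFCQ} {A : Struct} (ν : Memory) (rs : List (Refinement φ A)) : Prop :=
  ∃ D : List (List (List ℕ × List (List ℕ))),
    List.Forall₂ RefinementListing D rs ∧
    ∀ i (hi : i < (serOutput D).length), ν 3 i = (serOutput D)[i]

section

open Finset

/-! ### Bounded executions -/

/-- `Runs ρ B p μ ν T`: the program leads from `μ` to `ν` within `T` time units and accesses only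
registers with small array numbers and indices below `B`. -/
def Runs (ρ : Fin 2 → ℝ) (B : ℕ) (p : Prog) (μ ν : Memory) (T : ℕ) : Prop :=
  ∃ t C, Exec ρ p μ ν t C ∧ t ≤ T ∧ C ⊆ range 200 ×ˢ range B

/-- All registers read by the expression lie in the box of size `B`. -/
def Expr.Fits (ρ : Fin 2 → ℝ) (B : ℕ) (μ : Memory) (e : Expr) : Prop :=
  e.cells ρ μ ⊆ range 200 ×ˢ range B

section Runs

variable {ρ : Fin 2 → ℝ} {B : ℕ} {μ ν ξ : Memory}

theorem Expr.fits_const (k : ℕ) : (Expr.const k).Fits ρ B μ := by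
  simp [Expr.Fits, Expr.cells]

theorem Expr.Fits.read {a : ℕ} {i : Expr} (hi : i.Fits ρ B μ) (ha : a < 200)
    (hB : i.eval ρ μ < B) : (Expr.read a i).Fits ρ B μ := by
  unfold Expr.Fits at *
  rw [Expr.cells]
  exact insert_subset (by simp [ha, hB]) hi

theorem Expr.Fits.add {e f : Expr} (he : e.Fits ρ B μ) (hf : f.Fits ρ B μ) :
    (Expr.add e f).Fits ρ B μ := union_subset he hf

theorem Expr.Fits.sub {e f : Expr} (he : e.Fits ρ B μ) (hf : f.Fits ρ B μ) :
    (Expr.sub e f).Fits ρ B μ := union_subset he hf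

theorem Expr.Fits.powLE {j : Fin 2} {a b x : Expr} (ha : a.Fits ρ B μ) (hb : b.Fits ρ B μ)
    (hx : x.Fits ρ B μ) : (Expr.powLE j a b x).Fits ρ B μ :=
  union_subset (union_subset ha hb) hx

theorem Runs.mono {p : Prog} {T T' : ℕ} (h : Runs ρ B p μ ν T) (hT : T ≤ T') :
    Runs ρ B p μ ν T' := by
  obtain ⟨t, C, h1, h2, h3⟩ := h
  exact ⟨t, C, h1, h2.trans hT, h3⟩

theorem Runs.skip : Runs ρ B .skip μ μ 1 := ⟨_, _, .skip μ, le_rfl, by simp⟩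

theorem Runs.store {a : ℕ} {i e : Expr} (hi : i.Fits ρ B μ) (he : e.Fits ρ B μ) (ha : a < 200)
    (hB : i.eval ρ μ < B) :
    Runs ρ B (.store a i e) μ (μ.write a (i.eval ρ μ) (e.eval ρ μ)) (i.cost + e.cost + 1) :=
  ⟨_, _, .store μ a i e, le_rfl, insert_subset (by simp [ha, hB]) (union_subset hi he)⟩

theorem Runs.seq {p q : Prog} {T U : ℕ} (hp : Runs ρ B p μ ν T) (hq : Runs ρ B q ν ξ U) :
    Runs ρ B (.seq p q) μ ξ (T + U) := by
  obtain ⟨t, C, h1, h2, h3⟩ := hp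
  obtain ⟨u, D, g1, g2, g3⟩ := hq
  exact ⟨_, _, .seq h1 g1, by omega, union_subset h3 g3⟩

theorem Runs.ifTrue {e₁ e₂ : Expr} {p q : Prog} {T : ℕ} (h1 : e₁.Fits ρ B μ)
    (h2 : e₂.Fits ρ B μ) (h : e₁.eval ρ μ ≤ e₂.eval ρ μ) (hp : Runs ρ B p μ ν T) :
    Runs ρ B (.ifLE e₁ e₂ p q) μ ν (e₁.cost + e₂.cost + 1 + T) := by
  obtain ⟨t, C, g1, g2, g3⟩ := hp
  exact ⟨_, _, .ifTrue h g1, by omega, union_subset (union_subset h1 h2) g3⟩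

theorem Runs.ifFalse {e₁ e₂ : Expr} {p q : Prog} {T : ℕ} (h1 : e₁.Fits ρ B μ)
    (h2 : e₂.Fits ρ B μ) (h : ¬ e₁.eval ρ μ ≤ e₂.eval ρ μ) (hp : Runs ρ B q μ ν T) :
    Runs ρ B (.ifLE e₁ e₂ p q) μ ν (e₁.cost + e₂.cost + 1 + T) := by
  obtain ⟨t, C, g1, g2, g3⟩ := hp
  exact ⟨_, _, .ifFalse h g1, by omega, union_subset (union_subset h1 h2) g3⟩

/-- A loop with an invariant `I k` that holds after `k` rounds, and exactly `n` rounds. -/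
theorem Runs.while {e₁ e₂ : Expr} {p : Prog} {T : ℕ} (I : ℕ → Memory → Prop) (n : ℕ)
    (hfit : ∀ k ≤ n, ∀ μ, I k μ → e₁.Fits ρ B μ ∧ e₂.Fits ρ B μ)
    (hlt : ∀ k < n, ∀ μ, I k μ → e₁.eval ρ μ < e₂.eval ρ μ)
    (hge : ∀ μ, I n μ → ¬ e₁.eval ρ μ < e₂.eval ρ μ)
    (hstep : ∀ k < n, ∀ μ, I k μ → ∃ ν, Runs ρ B p μ ν T ∧ I (k + 1) ν) (h0 : I 0 μ) :
    ∃ ν, Runs ρ B (.whileLT e₁ e₂ p) μ ν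
      (n * (e₁.cost + e₂.cost + 1 + T) + (e₁.cost + e₂.cost + 1)) ∧ I n ν := by
  induction n generalizing I μ with
  | zero =>
    have hf := hfit 0 le_rfl μ h0
    exact ⟨μ, ⟨_, _, .whileFalse (hge μ h0), by omega, union_subset hf.1 hf.2⟩, h0⟩
  | succ n ih =>
    obtain ⟨ν, ⟨t, C, g1, g2, g3⟩, h1⟩ := hstep 0 (by omega) μ h0
    obtain ⟨ξ, ⟨u, D, k1, k2, k3⟩, hk⟩ := ih (μ := ν) (fun k => I (k + 1))
      (fun k hk => hfit (k + 1) (by omega)) (fun k hk => hlt (k + 1) (by omega)) hge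
      (fun k hk => hstep (k + 1) (by omega)) h1
    have hf := hfit 0 (by omega) μ h0
    refine ⟨ξ, ⟨_, _, .whileTrue (hlt 0 (by omega) μ h0) g1 k1, ?_,
      union_subset (union_subset (union_subset hf.1 hf.2) g3) k3⟩, hk⟩
    rw [Nat.succ_mul]
    omega

end Runs

@[simp] theorem Memory.write_same (μ : Memory) (a i v : ℕ) : μ.write a i v a i = v := by
  simp [Memory.write]

theorem Memory.write_ne (μ : Memory) {a b : ℕ} (i v : ℕ) (h : b ≠ a) : μ.write a i v b = μ b := by
  funext k
  simp [Memory.write, h]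

/-! ### A loop language with three-index arrays -/

/-- Contents of arrays with three indices. -/
abbrev Mem := ℕ → ℕ → ℕ → ℕ → ℕ

/-- The bounds of loops. -/
inductive Bd
  | one | X | E | TK | NB | D | PP | LL

/-- The constants of a computation. -/
structure Cst where
  ρ : Fin 2 → ℝ
  X : ℕ
  TK : ℕ
  D : ℕ

namespace Cst

def E (c : Cst) : ℕ := 2 ^ c.X
def NB (c : Cst) : ℕ := 2 ^ c.TK
def P (c : Cst) : ℕ := c.NB
def LIM (c : Cst) : ℕ := (c.D + 1) * 2 ^ c.P
/-- The distance between consecutive blocks of the first index. -/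
def C1 (c : Cst) : ℕ := (c.P + 1) * (c.LIM + 1)
/-- The number of registers of an array. -/
def BX (c : Cst) : ℕ := (c.P + 1) * c.C1
def adr (c : Cst) (p q r : ℕ) : ℕ := p * c.C1 + q * (c.LIM + 1) + r

end Cst

def Bd.val (c : Cst) : Bd → ℕ
  | .one => 1
  | .X => c.X
  | .E => c.E
  | .TK => c.TK
  | .NB => c.NB
  | .D => c.D
  | .PP => c.P + 1
  | .LL => c.LIM + 1

/-- The array whose register `0` contains the bound. -/
def Bd.arr : Bd → ℕ
  | .one => 45
  | .X => 46
  | .E => 47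
  | .TK => 48
  | .NB => 49
  | .D => 50
  | .PP => 51
  | .LL => 52

def Bd.isData : Bd → Bool
  | .D => true
  | .LL => true
  | _ => false

/-- Expressions, with bounded sums. -/
inductive EX
  | c (k : ℕ)
  | bd (b : Bd)
  | v (x : ℕ)
  | rd (a : ℕ) (e₁ e₂ e₃ : EX)
  | add (e f : EX)
  | sub (e f : EX)
  | pw (j : Fin 2) (a b x : EX)
  | ite (a b e f : EX)
  | sum (x : ℕ) (b : Bd) (e : EX)

/-- Statements. -/
inductive Stm
  | skip
  | st (a : ℕ) (e₁ e₂ e₃ e : EX)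
  | seq (p q : Stm)
  | ite (a b : EX) (p q : Stm)
  | loop (x : ℕ) (b : Bd) (p : Stm)

namespace EX

/-- Indices other than variables and constants are cut off at the array bounds. -/
def cut : EX → ℕ → ℕ → ℕ
  | .v _, _, n => n
  | .c _, _, n => n
  | _, B, n => min n B

/-- Variables with numbers below `20` are bounded by parameters. -/
def okP : EX → Bool
  | .v x => decide (x < 20)
  | .c k => decide (k = 0)
  | _ => true

def okL : EX → Bool
  | .c k => decide (k = 0)
  | _ => true

open Classical in
/-- The value of an expression. -/
noncomputable def ev (c : Cst) (M : Mem) : (ℕ → ℕ) → EX → ℕ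
  | _, .c k => k
  | _, bd b => b.val c
  | η, v x => η x
  | η, rd a e₁ e₂ e₃ =>
      M a (e₁.cut c.P (e₁.ev c M η)) (e₂.cut c.P (e₂.ev c M η)) (e₃.cut c.LIM (e₃.ev c M η))
  | η, add e f => e.ev c M η + f.ev c M η
  | η, sub e f => e.ev c M η - f.ev c M η
  | η, pw j a b x =>
      if (a.ev c M η : ℝ) ≤ (b.ev c M η : ℝ) * (x.ev c M η : ℝ) ^ c.ρ j then 1 else 0
  | η, ite a b e f => if a.ev c M η ≤ b.ev c M η then e.ev c M η else f.ev c M η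
  | η, sum x b e => ∑ i ∈ range (b.val c), e.ev c M (Function.update η x i)

/-- Well-formedness: `Γ` lists the variables in scope, `d` is the first free temporary. -/
def wf : List ℕ → ℕ → EX → Bool
  | _, d, .c _ => decide (d < 96)
  | _, d, bd _ => decide (d < 96)
  | Γ, d, v x => decide (d < 96) && Γ.contains x
  | Γ, d, rd a e₁ e₂ e₃ =>
      (decide (a < 45) && (e₁.okP && (e₂.okP && e₃.okL))) &&
        (e₁.wf Γ d && (e₂.wf Γ (d + 1) && e₃.wf Γ (d + 2)))
  | Γ, d, add e f => e.wf Γ d && f.wf Γ (d + 1)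
  | Γ, d, sub e f => e.wf Γ d && f.wf Γ (d + 1)
  | Γ, d, pw _ a b x => a.wf Γ d && (b.wf Γ (d + 1) && x.wf Γ (d + 2))
  | Γ, d, ite a b e f => a.wf Γ d && (b.wf Γ (d + 1) && (e.wf Γ d && f.wf Γ d))
  | Γ, d, sum x b e =>
      decide (d < 96) && ((decide (x < 40) && (decide (20 ≤ x) || !b.isData)) &&
        (!Γ.contains x && e.wf (x :: Γ) (d + 1)))

def tmp (d : ℕ) : Expr := .read (100 + d) (.const 0)
def var (x : ℕ) : Expr := .read (60 + x) (.const 0)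
def minE (a b : Expr) : Expr := .sub a (.sub a b)

/-- The address of the register with the indices in the temporaries `d`, `d + 1`, `d + 2`. -/
def addr (d : ℕ) : Expr :=
  .add (.add (.read 55 (minE (tmp d) (.read 53 (.const 0))))
    (.read 56 (minE (tmp (d + 1)) (.read 53 (.const 0)))))
    (minE (tmp (d + 2)) (.read 54 (.const 0)))

/-- The program that evaluates the expression into the temporary `d`. -/
def cp : ℕ → EX → Prog
  | d, .c k => .store (100 + d) (.const 0) (.const k)
  | d, bd b => .store (100 + d) (.const 0) (.read b.arr (.const 0))
  | d, v x => .store (100 + d) (.const 0) (var x)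
  | d, rd a e₁ e₂ e₃ => .seq (e₁.cp d) (.seq (e₂.cp (d + 1)) (.seq (e₃.cp (d + 2))
      (.store (100 + d) (.const 0) (.read a (addr d)))))
  | d, add e f => .seq (e.cp d) (.seq (f.cp (d + 1))
      (.store (100 + d) (.const 0) (.add (tmp d) (tmp (d + 1)))))
  | d, sub e f => .seq (e.cp d) (.seq (f.cp (d + 1))
      (.store (100 + d) (.const 0) (.sub (tmp d) (tmp (d + 1)))))
  | d, pw j a b x => .seq (a.cp d) (.seq (b.cp (d + 1)) (.seq (x.cp (d + 2))
      (.store (100 + d) (.const 0) (.powLE j (tmp d) (tmp (d + 1)) (tmp (d + 2))))))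
  | d, ite a b e f => .seq (a.cp d) (.seq (b.cp (d + 1))
      (.ifLE (tmp d) (tmp (d + 1)) (e.cp d) (f.cp d)))
  | d, sum x b e => .seq (.store (100 + d) (.const 0) (.const 0))
      (.seq (.store (60 + x) (.const 0) (.const 0))
        (.whileLT (var x) (.read b.arr (.const 0)) (.seq (e.cp (d + 1))
          (.seq (.store (100 + d) (.const 0) (.add (tmp d) (tmp (d + 1))))
            (.store (60 + x) (.const 0) (.add (var x) (.const 1)))))))

def cost (c : Cst) : EX → ℕ
  | .c _ => 40
  | bd _ => 40
  | v _ => 40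
  | rd _ e₁ e₂ e₃ => 40 + e₁.cost c + e₂.cost c + e₃.cost c
  | add e f => 40 + e.cost c + f.cost c
  | sub e f => 40 + e.cost c + f.cost c
  | pw _ a b x => 40 + a.cost c + b.cost c + x.cost c
  | ite a b e f => 40 + a.cost c + b.cost c + e.cost c + f.cost c
  | sum _ b e => 40 + b.val c * (e.cost c + 40)

end EX

namespace Stm

/-- Iterated application of indexed functions. -/
def iter {α : Type*} (f : ℕ → α → α) : ℕ → α → α
  | 0, M => M
  | n + 1, M => f n (iter f n M)

def wr (M : Mem) (a p q r x : ℕ) : Mem := fun a' p' q' r' =>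
  if a' = a ∧ p' = p ∧ q' = q ∧ r' = r then x else M a' p' q' r'

noncomputable def den (c : Cst) : (ℕ → ℕ) → Stm → Mem → Mem
  | _, skip, M => M
  | η, st a e₁ e₂ e₃ e, M => wr M a (e₁.cut c.P (e₁.ev c M η)) (e₂.cut c.P (e₂.ev c M η))
      (e₃.cut c.LIM (e₃.ev c M η)) (e.ev c M η)
  | η, seq p q, M => q.den c η (p.den c η M)
  | η, ite a b p q, M => if a.ev c M η ≤ b.ev c M η then p.den c η M else q.den c η M
  | η, loop x b p, M => iter (fun i => p.den c (Function.update η x i)) (b.val c) M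

def wf : List ℕ → Stm → Bool
  | _, skip => true
  | Γ, st a e₁ e₂ e₃ e =>
      (decide (a < 45) && (e₁.okP && (e₂.okP && e₃.okL))) &&
        (e₁.wf Γ 0 && (e₂.wf Γ 1 && (e₃.wf Γ 2 && e.wf Γ 3)))
  | Γ, seq p q => p.wf Γ && q.wf Γ
  | Γ, ite a b p q => a.wf Γ 0 && (b.wf Γ 1 && (p.wf Γ && q.wf Γ))
  | Γ, loop x b p => (decide (x < 40) && (decide (20 ≤ x) || !b.isData)) &&
      (!Γ.contains x && p.wf (x :: Γ))

/-- The compiled program. -/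
def cp : Stm → Prog
  | skip => .skip
  | st a e₁ e₂ e₃ e => .seq (e₁.cp 0) (.seq (e₂.cp 1) (.seq (e₃.cp 2) (.seq (e.cp 3)
      (.store a (EX.addr 0) (EX.tmp 3)))))
  | seq p q => .seq p.cp q.cp
  | ite a b p q => .seq (a.cp 0) (.seq (b.cp 1) (.ifLE (EX.tmp 0) (EX.tmp 1) p.cp q.cp))
  | loop x b p => .seq (.store (60 + x) (.const 0) (.const 0))
      (.whileLT (EX.var x) (.read b.arr (.const 0))
        (.seq p.cp (.store (60 + x) (.const 0) (.add (EX.var x) (.const 1)))))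

def cost (c : Cst) : Stm → ℕ
  | skip => 40
  | st _ e₁ e₂ e₃ e => 40 + e₁.cost c + e₂.cost c + e₃.cost c + e.cost c
  | seq p q => p.cost c + q.cost c
  | ite a b p q => 40 + a.cost c + b.cost c + p.cost c + q.cost c
  | loop _ b p => 40 + b.val c * (p.cost c + 40)

end Stm

/-- The values of the variables lie in their ranges. -/
def EnvOK (c : Cst) (Γ : List ℕ) (η : ℕ → ℕ) : Prop :=
  ∀ x ∈ Γ, (x < 20 → η x ≤ c.P) ∧ η x ≤ c.LIM

/-- The memory `μ` represents the array contents `M`, the constants `c`, and the values `η` of the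
variables listed in `Γ`. -/
structure Holds3 (c : Cst) (Γ : List ℕ) (η : ℕ → ℕ) (M : Mem) (μ : Memory) : Prop where
  data : ∀ a < 45, ∀ p ≤ c.P, ∀ q ≤ c.P, ∀ r ≤ c.LIM, μ a (c.adr p q r) = M a p q r
  bd : ∀ b : Bd, μ b.arr 0 = b.val c
  regP : μ 53 0 = c.P
  regL : μ 54 0 = c.LIM
  row1 : ∀ p ≤ c.P, μ 55 p = p * c.C1
  row2 : ∀ p ≤ c.P, μ 56 p = p * (c.LIM + 1)
  lt : ∀ x ∈ Γ, x < 40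
  env : EnvOK c Γ η
  var : ∀ x ∈ Γ, μ (60 + x) 0 = η x

/-- The arrays that evaluation into temporary `d` keeps. -/
def Keeps (Γ : List ℕ) (d a : ℕ) : Prop := a < 60 ∨ (∃ x ∈ Γ, a = 60 + x) ∨ (100 ≤ a ∧ a < 100 + d)

theorem Bd.arr_lt (b : Bd) : b.arr < 53 := by cases b <;> decide
theorem Bd.le_arr (b : Bd) : 45 ≤ b.arr := by cases b <;> decide

namespace Holds3

variable {c : Cst} {Γ : List ℕ} {η : ℕ → ℕ} {M : Mem} {μ ν : Memory}

theorem congr (h : Holds3 c Γ η M μ) {d : ℕ} (hν : ∀ a, Keeps Γ d a → ν a = μ a) :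
    Holds3 c Γ η M ν where
  data a ha p hp q hq r hr := by rw [hν a (Or.inl (by omega))]; exact h.data a ha p hp q hq r hr
  bd b := by rw [hν _ (Or.inl (by have := b.arr_lt; omega))]; exact h.bd b
  regP := by rw [hν _ (Or.inl (by omega))]; exact h.regP
  regL := by rw [hν _ (Or.inl (by omega))]; exact h.regL
  row1 := by rw [hν _ (Or.inl (by omega))]; exact h.row1
  row2 := by rw [hν _ (Or.inl (by omega))]; exact h.row2
  lt := h.lt
  env := h.env
  var x hx := by rw [hν _ (Or.inr (Or.inl ⟨x, hx, rfl⟩))]; exact h.var x hx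

end Holds3

theorem Cst.adr_lt (c : Cst) {p q r : ℕ} (hp : p ≤ c.P) (hq : q ≤ c.P) (hr : r ≤ c.LIM) :
    c.adr p q r < c.BX := by
  have h1 : q * (c.LIM + 1) + r < c.C1 := by
    unfold Cst.C1
    calc q * (c.LIM + 1) + r < (q + 1) * (c.LIM + 1) := by rw [Nat.succ_mul]; omega
      _ ≤ _ := Nat.mul_le_mul_right _ (by omega)
  unfold Cst.adr Cst.BX
  calc p * c.C1 + q * (c.LIM + 1) + r < (p + 1) * c.C1 := by rw [Nat.succ_mul]; omega
      _ ≤ _ := Nat.mul_le_mul_right _ (by omega)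

theorem Nat.mul_add_inj {a b a' b' n : ℕ} (h : a * n + b = a' * n + b') (hb : b < n)
    (hb' : b' < n) : a = a' ∧ b = b' := by
  have h1 : (a * n + b) % n = b := by rw [mul_comm, Nat.mul_add_mod, Nat.mod_eq_of_lt hb]
  have h2 : (a' * n + b') % n = b' := by rw [mul_comm, Nat.mul_add_mod, Nat.mod_eq_of_lt hb']
  have hbb : b = b' := by rw [← h1, ← h2, h]
  subst hbb
  exact ⟨Nat.eq_of_mul_eq_mul_right (by omega) (by omega : a * n = a' * n), rfl⟩

theorem Cst.adr_inj (c : Cst) {p q r p' q' r' : ℕ} (hq : q ≤ c.P) (hr : r ≤ c.LIM)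
    (hq' : q' ≤ c.P) (hr' : r' ≤ c.LIM) (h : c.adr p q r = c.adr p' q' r') :
    p = p' ∧ q = q' ∧ r = r' := by
  have key : ∀ q ≤ c.P, ∀ r ≤ c.LIM, q * (c.LIM + 1) + r < c.C1 := fun q hq r hr => by
    unfold Cst.C1
    calc q * (c.LIM + 1) + r < (q + 1) * (c.LIM + 1) := by rw [Nat.succ_mul]; omega
      _ ≤ _ := Nat.mul_le_mul_right _ (by omega)
  unfold Cst.adr at h
  rw [add_assoc, add_assoc] at h
  obtain ⟨rfl, h2⟩ := Nat.mul_add_inj h (key q hq r hr) (key q' hq' r' hr')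
  obtain ⟨rfl, rfl⟩ := Nat.mul_add_inj h2 (by omega) (by omega)
  exact ⟨rfl, rfl, rfl⟩

theorem Cst.le_LIM (c : Cst) : c.P < c.LIM := by
  unfold Cst.LIM
  calc c.P < 2 ^ c.P := Nat.lt_two_pow_self
    _ ≤ _ := Nat.le_mul_of_pos_left _ (by omega)

theorem Cst.LIM_lt_BX (c : Cst) : c.LIM < c.BX := by
  have := c.adr_lt (p := 0) (q := 0) (r := c.LIM) (by omega) (by omega) le_rfl
  simpa [Cst.adr] using this

theorem Cst.BX_pos (c : Cst) : 0 < c.BX := by have := c.LIM_lt_BX; omega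

/-- The constants fit together. -/
structure Cst.OK (c : Cst) : Prop where
  X_le : c.X ≤ c.TK

namespace Cst.OK

variable {c : Cst} (h : c.OK)
include h

theorem val_le (b : Bd) (hb : b.isData = false) : b.val c ≤ c.P + 1 := by
  have h1 : c.X < 2 ^ c.X := Nat.lt_two_pow_self
  have h2 : c.TK < 2 ^ c.TK := Nat.lt_two_pow_self
  have h3 : 2 ^ c.X ≤ 2 ^ c.TK := Nat.pow_le_pow_right (by omega) h.X_le
  cases b <;> simp only [Bd.isData, Bool.true_eq_false] at hb <;>
    simp only [Bd.val, Cst.P, Cst.NB, Cst.E] <;> omega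

theorem val_le' (b : Bd) : b.val c ≤ c.LIM + 1 := by
  have h1 := c.le_LIM
  rcases hb : b.isData with _ | _
  · have := h.val_le b hb; omega
  · have : c.D ≤ c.LIM := by
      unfold Cst.LIM
      calc c.D ≤ c.D + 1 := by omega
        _ ≤ _ := Nat.le_mul_of_pos_right _ (by positivity)
    cases b <;> simp only [Bd.isData, Bool.false_eq_true] at hb <;>
      simp only [Bd.val] <;> omega

end Cst.OK

theorem EX.minE_eval (ρ : Fin 2 → ℝ) (μ : Memory) (a b : Expr) :
    (EX.minE a b).eval ρ μ = min (a.eval ρ μ) (b.eval ρ μ) := by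
  simp only [EX.minE, Expr.eval]
  omega

namespace Holds3

variable {c : Cst} {Γ : List ℕ} {η : ℕ → ℕ} {M : Mem} {μ ν : Memory}

theorem fits_tmp (_h : Holds3 c Γ η M μ) {d : ℕ} (hd : d < 100) :
    (EX.tmp d).Fits c.ρ c.BX μ :=
  (Expr.fits_const 0).read (by omega) (by simpa [Expr.eval] using c.BX_pos)

theorem fits_reg (_h : Holds3 c Γ η M μ) {a : ℕ} (ha : a < 200) :
    (Expr.read a (.const 0)).Fits c.ρ c.BX μ :=
  (Expr.fits_const 0).read ha (by simpa [Expr.eval] using c.BX_pos)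

theorem addr_spec (h : Holds3 c Γ η M μ) {d : ℕ} (hd : d < 98) :
    (EX.addr d).Fits c.ρ c.BX μ ∧
    (EX.addr d).eval c.ρ μ = c.adr (min (μ (100 + d) 0) c.P) (min (μ (100 + (d + 1)) 0) c.P)
      (min (μ (100 + (d + 2)) 0) c.LIM) := by
  have hP := c.le_LIM
  have hL := c.LIM_lt_BX
  have e1 : (EX.minE (EX.tmp d) (.read 53 (.const 0))).eval c.ρ μ = min (μ (100 + d) 0) c.P := by
    rw [EX.minE_eval]; simp [EX.tmp, Expr.eval, h.regP]
  have e2 : (EX.minE (EX.tmp (d + 1)) (.read 53 (.const 0))).eval c.ρ μ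
      = min (μ (100 + (d + 1)) 0) c.P := by
    rw [EX.minE_eval]; simp [EX.tmp, Expr.eval, h.regP]
  have e3 : (EX.minE (EX.tmp (d + 2)) (.read 54 (.const 0))).eval c.ρ μ
      = min (μ (100 + (d + 2)) 0) c.LIM := by
    rw [EX.minE_eval]; simp [EX.tmp, Expr.eval, h.regL]
  have f : ∀ d' < 100, ∀ a < 200,
      (EX.minE (EX.tmp d') (.read a (.const 0))).Fits c.ρ c.BX μ := fun d' hd' a ha =>
    (h.fits_tmp hd').sub ((h.fits_tmp hd').sub (h.fits_reg ha))
  refine ⟨(((f d (by omega) 53 (by omega)).read (by omega) ?_).add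
    ((f (d + 1) (by omega) 53 (by omega)).read (by omega) ?_)).add
    (f (d + 2) (by omega) 54 (by omega)), ?_⟩
  · rw [e1]; omega
  · rw [e2]; omega
  · simp only [EX.addr, Expr.eval, e1, e2, e3]
    rw [h.row1 _ (min_le_right _ _), h.row2 _ (min_le_right _ _)]
    rfl

theorem store_tmp (_h : Holds3 c Γ η M μ) {d : ℕ} (hd : d < 100) {e : Expr} {n : ℕ}
    (he : e.Fits c.ρ c.BX μ) (hn : e.cost + 2 ≤ n) :
    Runs c.ρ c.BX (.store (100 + d) (.const 0) e) μ (μ.write (100 + d) 0 (e.eval c.ρ μ)) n :=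
  (Runs.store (Expr.fits_const 0) he (by omega) (by simpa [Expr.eval] using c.BX_pos)).mono
    (by simp only [Expr.cost]; omega)

end Holds3

theorem keeps_write {Γ : List ℕ} {d d' a : ℕ} {μ : Memory} (hΓ : ∀ x ∈ Γ, x < 40) (hd : d' ≤ d)
    (ha : Keeps Γ d' a) (i v : ℕ) : μ.write (100 + d) i v a = μ a := by
  refine Memory.write_ne _ _ _ ?_
  rcases ha with h | ⟨x, hx, rfl⟩ | h
  · omega
  · have := hΓ x hx; omega
  · omega

theorem Keeps.mono {Γ : List ℕ} {d d' a : ℕ} (h : Keeps Γ d a) (hd : d ≤ d') : Keeps Γ d' a := by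
  rcases h with h | h | h
  · exact Or.inl h
  · exact Or.inr (Or.inl h)
  · exact Or.inr (Or.inr ⟨h.1, by omega⟩)

/-- `Evals c Γ η M d e n`: the compiled expression works in every memory representing `M`. -/
def Evals (c : Cst) (Γ : List ℕ) (η : ℕ → ℕ) (M : Mem) (d : ℕ) (e : EX) : Prop :=
  ∀ μ, Holds3 c Γ η M μ → ∃ ν, Runs c.ρ c.BX (e.cp d) μ ν (e.cost c) ∧
    ν (100 + d) 0 = e.ev c M η ∧ ∀ a, Keeps Γ d a → ν a = μ a

theorem Evals.two {c : Cst} {Γ : List ℕ} {η : ℕ → ℕ} {M : Mem} {d : ℕ} {e f : EX}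
    (he : Evals c Γ η M d e) (hf : Evals c Γ η M (d + 1) f) {μ : Memory} (h : Holds3 c Γ η M μ) :
    ∃ ν, (∀ q ξ T, Runs c.ρ c.BX q ν ξ T →
        Runs c.ρ c.BX (.seq (e.cp d) (.seq (f.cp (d + 1)) q)) μ ξ (T + e.cost c + f.cost c)) ∧
      Holds3 c Γ η M ν ∧ ν (100 + d) 0 = e.ev c M η ∧ ν (100 + (d + 1)) 0 = f.ev c M η ∧
      ∀ a, Keeps Γ d a → ν a = μ a := by
  obtain ⟨ν, r1, v1, k1⟩ := he μ h
  have h1 := h.congr k1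
  obtain ⟨ξ, r2, v2, k2⟩ := hf ν h1
  refine ⟨ξ, fun q ζ T hq => ?_, h1.congr k2, ?_, v2, fun a ha => ?_⟩
  · exact (r1.seq (r2.seq hq)).mono (by omega)
  · rw [k2 _ (Or.inr (Or.inr ⟨by omega, by omega⟩)), v1]
  · rw [k2 a (ha.mono (by omega)), k1 a ha]

theorem EX.wf_lt (e : EX) : ∀ {Γ : List ℕ} {d : ℕ}, e.wf Γ d = true → d < 96 := by
  induction e with
  | c _ => intro Γ d h; simpa [wf] using h
  | bd _ => intro Γ d h; simpa [wf] using h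
  | v _ => intro Γ d h; simp only [wf, Bool.and_eq_true, decide_eq_true_eq] at h; exact h.1
  | rd _ _ _ _ i => intro Γ d h; simp only [wf, Bool.and_eq_true] at h; exact i h.2.1
  | add _ _ i => intro Γ d h; simp only [wf, Bool.and_eq_true] at h; exact i h.1
  | sub _ _ i => intro Γ d h; simp only [wf, Bool.and_eq_true] at h; exact i h.1
  | pw _ _ _ _ i => intro Γ d h; simp only [wf, Bool.and_eq_true] at h; exact i h.1
  | ite _ _ _ _ i => intro Γ d h; simp only [wf, Bool.and_eq_true] at h; exact i h.1
  | sum _ _ _ => intro Γ d h; simp only [wf, Bool.and_eq_true, decide_eq_true_eq] at h; exact h.1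

theorem EnvOK.enter {c : Cst} {Γ : List ℕ} {η : ℕ → ℕ} (h : EnvOK c Γ η) (hc : c.OK) {b : Bd}
    {x k : ℕ} (hb : 20 ≤ x ∨ b.isData = false) (hk : k < b.val c) :
    EnvOK c (x :: Γ) (Function.update η x k) := by
  intro y hy
  by_cases hyx : y = x
  · subst hyx
    rw [Function.update_self]
    have := hc.val_le' b
    refine ⟨fun h => ?_, by omega⟩
    have := hc.val_le b (hb.resolve_left (by omega))
    omega
  · rw [Function.update_of_ne hyx]
    exact h y ((List.mem_cons.1 hy).resolve_left hyx)

theorem EX.cut_eq {c : Cst} {Γ : List ℕ} {η : ℕ → ℕ} {M : Mem} (h : EnvOK c Γ η) {e : EX} {d : ℕ}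
    (hw : e.wf Γ d = true) (he : e.okP = true) :
    e.cut c.P (e.ev c M η) = min (e.ev c M η) c.P := by
  cases e with
  | v x =>
    simp only [wf, Bool.and_eq_true, List.contains_iff_mem] at hw
    simp only [okP, decide_eq_true_eq] at he
    exact (min_eq_left ((h x hw.2).1 he)).symm
  | c k =>
    simp only [okP, decide_eq_true_eq] at he
    simp [cut, ev, he]
  | _ => rfl

theorem EX.cut_eq' {c : Cst} {Γ : List ℕ} {η : ℕ → ℕ} {M : Mem} (h : EnvOK c Γ η) {e : EX} {d : ℕ}
    (hw : e.wf Γ d = true) (he : e.okL = true) :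
    e.cut c.LIM (e.ev c M η) = min (e.ev c M η) c.LIM := by
  cases e with
  | v x =>
    simp only [wf, Bool.and_eq_true, List.contains_iff_mem] at hw
    exact (min_eq_left (h x hw.2).2).symm
  | c k =>
    simp only [okL, decide_eq_true_eq] at he
    simp [cut, ev, he]
  | _ => rfl

theorem Holds3.enter {c : Cst} {Γ : List ℕ} {η : ℕ → ℕ} {M : Mem} {μ : Memory} {x k : ℕ} {b : Bd}
    (h : Holds3 c Γ η M μ) (hc : c.OK) (hx : x ∉ Γ) (hx' : x < 40)
    (hb : 20 ≤ x ∨ b.isData = false) (hkb : k < b.val c) (hk : μ (60 + x) 0 = k) :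
    Holds3 c (x :: Γ) (Function.update η x k) M μ where
  data := h.data
  bd := h.bd
  regP := h.regP
  regL := h.regL
  row1 := h.row1
  row2 := h.row2
  lt y hy := by
    rcases List.mem_cons.1 hy with rfl | hy
    · exact hx'
    · exact h.lt y hy
  env := h.env.enter hc hb hkb
  var y hy := by
    rcases List.mem_cons.1 hy with rfl | hy
    · simp [hk]
    · have : y ≠ x := fun e => hx (e ▸ hy)
      rw [Function.update_of_ne this]
      exact h.var y hy

theorem Holds3.leave {c : Cst} {Γ : List ℕ} {η : ℕ → ℕ} {M : Mem} {μ : Memory} {x k : ℕ}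
    (h : Holds3 c (x :: Γ) (Function.update η x k) M μ) (hx : x ∉ Γ) : Holds3 c Γ η M μ where
  data := h.data
  bd := h.bd
  regP := h.regP
  regL := h.regL
  row1 := h.row1
  row2 := h.row2
  lt y hy := h.lt y (List.mem_cons_of_mem _ hy)
  env y hy := by
    have : y ≠ x := fun e => hx (e ▸ hy)
    have := h.env y (List.mem_cons_of_mem _ hy)
    rwa [Function.update_of_ne ‹y ≠ x›] at this
  var y hy := by
    have : y ≠ x := fun e => hx (e ▸ hy)
    have := h.var y (List.mem_cons_of_mem _ hy)
    rwa [Function.update_of_ne ‹y ≠ x›] at this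

theorem Holds3.write_var {c : Cst} {Γ : List ℕ} {η : ℕ → ℕ} {M : Mem} {μ : Memory} {x k : ℕ}
    (h : Holds3 c Γ η M μ) (hx : x ∉ Γ) :
    Holds3 c Γ η M (μ.write (60 + x) 0 k) where
  data a ha p hp q hq r hr := by
    rw [Memory.write_ne _ _ _ (by omega)]; exact h.data a ha p hp q hq r hr
  bd b := by rw [Memory.write_ne _ _ _ (by have := b.arr_lt; omega)]; exact h.bd b
  regP := by rw [Memory.write_ne _ _ _ (by omega)]; exact h.regP
  regL := by rw [Memory.write_ne _ _ _ (by omega)]; exact h.regL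
  row1 := by rw [Memory.write_ne _ _ _ (by omega)]; exact h.row1
  row2 := by rw [Memory.write_ne _ _ _ (by omega)]; exact h.row2
  lt := h.lt
  env := h.env
  var y hy := by
    have : y ≠ x := fun e => hx (e ▸ hy)
    rw [Memory.write_ne _ _ _ (by omega)]; exact h.var y hy

theorem Holds3.store_var {c : Cst} {Γ : List ℕ} {η : ℕ → ℕ} {M : Mem} {μ : Memory}
    (_h : Holds3 c Γ η M μ) {x : ℕ} (hx : x < 40) {e : Expr} {n : ℕ}
    (he : e.Fits c.ρ c.BX μ) (hn : e.cost + 2 ≤ n) :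
    Runs c.ρ c.BX (.store (60 + x) (.const 0) e) μ (μ.write (60 + x) 0 (e.eval c.ρ μ)) n :=
  (Runs.store (Expr.fits_const 0) he (by omega) (by simpa [Expr.eval] using c.BX_pos)).mono
    (by simp only [Expr.cost]; omega)

theorem EX.evals {c : Cst} (hc : c.OK) {M : Mem} (e : EX) : ∀ {Γ : List ℕ} {η : ℕ → ℕ} {d : ℕ},
    e.wf Γ d = true → Evals c Γ η M d e := by
  induction e with
  | c k =>
    intro Γ η d hw μ h
    simp only [wf, decide_eq_true_eq] at hw
    have hΓ := h.lt
    exact ⟨_, h.store_tmp (by omega) (Expr.fits_const k) (by simp [Expr.cost, cost]),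
      by simp [Expr.eval, ev], fun a ha => keeps_write hΓ le_rfl ha _ _⟩
  | bd b =>
    intro Γ η d hw μ h
    simp only [wf, decide_eq_true_eq] at hw
    have hΓ := h.lt
    exact ⟨_, h.store_tmp (by omega) (h.fits_reg (by have := b.arr_lt; omega))
      (by simp [Expr.cost, cost]),
      by simp [Expr.eval, ev, h.bd], fun a ha => keeps_write hΓ le_rfl ha _ _⟩
  | v x =>
    intro Γ η d hw μ h
    simp only [wf, decide_eq_true_eq, Bool.and_eq_true, List.contains_iff_mem] at hw
    have hΓ := h.lt
    have hx := h.var x hw.2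
    have := hΓ x hw.2
    exact ⟨_, h.store_tmp (by omega) (h.fits_reg (a := 60 + x) (by omega))
      (by simp [Expr.cost, var, cost]),
      by simp [Expr.eval, ev, var, hx], fun a ha => keeps_write hΓ le_rfl ha _ _⟩
  | rd a e₁ e₂ e₃ ih1 ih2 ih3 =>
    intro Γ η d hw μ h
    simp only [wf, Bool.and_eq_true, decide_eq_true_eq] at hw
    have hΓ := h.lt
    have hd := EX.wf_lt _ hw.2.2.2
    obtain ⟨ν, r1, h1, v1, v2, k1⟩ := (ih1 hw.2.1).two (ih2 hw.2.2.1) h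
    obtain ⟨ξ, r3, v3, k3⟩ := ih3 hw.2.2.2 ν h1
    have h3 := h1.congr k3
    obtain ⟨f, fe⟩ := h3.addr_spec (d := d) (by omega)
    rw [k3 (100 + d) (Or.inr (Or.inr ⟨by omega, by omega⟩)),
      k3 (100 + (d + 1)) (Or.inr (Or.inr ⟨by omega, by omega⟩)), v1, v2, v3] at fe
    have hB := c.adr_lt (min_le_right (e₁.ev c M η) c.P) (min_le_right (e₂.ev c M η) c.P)
      (min_le_right (e₃.ev c M η) c.LIM)
    refine ⟨_, (r1 _ _ _ (r3.seq (h3.store_tmp (by omega)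
      (f.read (by omega) (by rw [fe]; exact hB)) le_rfl))).mono ?_, ?_, ?_⟩
    · simp only [Expr.cost, addr, minE, tmp, cost]; omega
    · simp only [Memory.write_same, Expr.eval, fe, ev]
      rw [cut_eq h.env hw.2.1 hw.1.2.1, cut_eq h.env hw.2.2.1 hw.1.2.2.1,
        cut_eq' h.env hw.2.2.2 hw.1.2.2.2]
      exact h3.data a hw.1.1 _ (min_le_right _ _) _ (min_le_right _ _) _ (min_le_right _ _)
    · intro b hb
      rw [keeps_write hΓ le_rfl hb, k3 b (hb.mono (by omega)), k1 b hb]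
  | add e f ih1 ih2 =>
    intro Γ η d hw μ h
    simp only [wf, Bool.and_eq_true] at hw
    have hΓ := h.lt
    have hd := EX.wf_lt _ hw.2
    obtain ⟨ν, r1, h1, v1, v2, k1⟩ := (ih1 hw.1).two (ih2 hw.2) h
    refine ⟨_, (r1 _ _ _ (h1.store_tmp (by omega)
      ((h1.fits_tmp (by omega)).add (h1.fits_tmp (by omega))) le_rfl)).mono ?_, ?_, ?_⟩
    · simp only [Expr.cost, tmp, cost]; omega
    · simp only [Memory.write_same, Expr.eval, tmp, ev, v1, v2]
    · intro b hb
      rw [keeps_write hΓ le_rfl hb, k1 b hb]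
  | sub e f ih1 ih2 =>
    intro Γ η d hw μ h
    simp only [wf, Bool.and_eq_true] at hw
    have hΓ := h.lt
    have hd := EX.wf_lt _ hw.2
    obtain ⟨ν, r1, h1, v1, v2, k1⟩ := (ih1 hw.1).two (ih2 hw.2) h
    refine ⟨_, (r1 _ _ _ (h1.store_tmp (by omega)
      ((h1.fits_tmp (by omega)).sub (h1.fits_tmp (by omega))) le_rfl)).mono ?_, ?_, ?_⟩
    · simp only [Expr.cost, tmp, cost]; omega
    · simp only [Memory.write_same, Expr.eval, tmp, ev, v1, v2]
    · intro b hb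
      rw [keeps_write hΓ le_rfl hb, k1 b hb]
  | pw j a b x ih1 ih2 ih3 =>
    intro Γ η d hw μ h
    simp only [wf, Bool.and_eq_true] at hw
    have hΓ := h.lt
    have hd := EX.wf_lt _ hw.2.2
    obtain ⟨ν, r1, h1, v1, v2, k1⟩ := (ih1 hw.1).two (ih2 hw.2.1) h
    obtain ⟨ξ, r3, v3, k3⟩ := ih3 hw.2.2 ν h1
    have h3 := h1.congr k3
    refine ⟨_, (r1 _ _ _ (r3.seq (h3.store_tmp (by omega)
      ((h3.fits_tmp (by omega)).powLE (h3.fits_tmp (by omega)) (h3.fits_tmp (by omega)))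
      le_rfl))).mono ?_, ?_, ?_⟩
    · simp only [Expr.cost, tmp, cost]; omega
    · rw [Memory.write_same]
      simp only [Expr.eval, tmp, ev, v3,
        k3 (100 + d) (Or.inr (Or.inr ⟨by omega, by omega⟩)),
        k3 (100 + (d + 1)) (Or.inr (Or.inr ⟨by omega, by omega⟩)), v1, v2]
    · intro b hb
      rw [keeps_write hΓ le_rfl hb, k3 b (hb.mono (by omega)), k1 b hb]
  | ite a b e f ih1 ih2 ih3 ih4 =>
    intro Γ η d hw μ h
    simp only [wf, Bool.and_eq_true] at hw
    have hd := EX.wf_lt _ hw.2.1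
    obtain ⟨ν, r1, h1, v1, v2, k1⟩ := (ih1 hw.1).two (ih2 hw.2.1) h
    have e1 : (tmp d).eval c.ρ ν = a.ev c M η := by simp [tmp, Expr.eval, v1]
    have e2 : (tmp (d + 1)).eval c.ρ ν = b.ev c M η := by simp [tmp, Expr.eval, v2]
    by_cases hc : a.ev c M η ≤ b.ev c M η
    · obtain ⟨ξ, r3, v3, k3⟩ := ih3 hw.2.2.1 ν h1
      refine ⟨ξ, (r1 _ _ _ (Runs.ifTrue (h1.fits_tmp (by omega)) (h1.fits_tmp (by omega))
        (by rw [e1, e2]; exact hc) r3)).mono ?_, ?_, ?_⟩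
      · simp only [Expr.cost, tmp, cost]; omega
      · simp only [ev, hc, if_true, v3]
      · intro b hb; rw [k3 b hb, k1 b hb]
    · obtain ⟨ξ, r3, v3, k3⟩ := ih4 hw.2.2.2 ν h1
      refine ⟨ξ, (r1 _ _ _ (Runs.ifFalse (h1.fits_tmp (by omega)) (h1.fits_tmp (by omega))
        (by rw [e1, e2]; exact hc) r3)).mono ?_, ?_, ?_⟩
      · simp only [Expr.cost, tmp, cost]; omega
      · simp only [ev, hc, if_false, v3]
      · intro b hb; rw [k3 b hb, k1 b hb]
  | sum x b e ih =>
    intro Γ η d hw μ h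
    simp only [wf, Bool.and_eq_true, decide_eq_true_eq, Bool.not_eq_true',
      List.contains_eq_mem, decide_eq_false_iff_not] at hw
    obtain ⟨hd, ⟨hx, hxb⟩, hxΓ, hwe⟩ := hw
    have hxb : 20 ≤ x ∨ b.isData = false := by simpa using hxb
    have hd' := EX.wf_lt _ hwe
    have hΓ := h.lt
    have hb := b.arr_lt
    have r0 := h.store_tmp (d := d) (n := 3) (by omega) (Expr.fits_const 0) (by simp [Expr.cost])
    have h0 := h.congr (d := d) fun a ha => keeps_write (μ := μ) hΓ le_rfl ha 0 0
    have r0' := h0.store_var (n := 3) hx (Expr.fits_const 0) (by simp [Expr.cost])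
    have h0' := h0.write_var (k := 0) hxΓ
    let I : ℕ → Memory → Prop := fun k ν => Holds3 c Γ η M ν ∧ ν (60 + x) 0 = k ∧
      ν (100 + d) 0 = ∑ i ∈ range k, e.ev c M (Function.update η x i) ∧
      ∀ a, Keeps Γ d a → ν a = μ a
    have hI0 : I 0 (Memory.write (Memory.write μ (100 + d) 0 0) (60 + x) 0 0) := by
      refine ⟨h0', by simp, ?_, ?_⟩
      · rw [Memory.write_ne _ _ _ (by omega)]; simp
      · intro a ha
        rw [Memory.write_ne, keeps_write hΓ le_rfl ha]
        rintro rfl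
        rcases ha with h | ⟨y, hy, h⟩ | h
        · omega
        · exact hxΓ (by have : x = y := by omega
                        exact this ▸ hy)
        · omega
    have hfit : ∀ ν, Holds3 c Γ η M ν → (var x).Fits c.ρ c.BX ν ∧
        (Expr.read b.arr (.const 0)).Fits c.ρ c.BX ν := fun ν hν =>
      ⟨hν.fits_reg (by omega), hν.fits_reg (by omega)⟩
    obtain ⟨ν, rν, hν⟩ := Runs.while (ρ := c.ρ) (B := c.BX) (e₁ := var x)
      (e₂ := Expr.read b.arr (.const 0)) (T := e.cost c + 13) (p := .seq (e.cp (d + 1))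
          (.seq (.store (100 + d) (.const 0) (.add (tmp d) (tmp (d + 1))))
            (.store (60 + x) (.const 0) (.add (var x) (.const 1))))) I (b.val c)
      (fun k _ ν hν => hfit ν hν.1)
      (fun k hk ν hν => by simp only [var, Expr.eval, hν.2.1, hν.1.bd]; exact hk)
      (fun ν hν => by simp [var, Expr.eval, hν.2.1, hν.1.bd])
      (fun k hk ν hν => by
        obtain ⟨ν₁, r1, v1, k1⟩ := ih hwe ν (hν.1.enter hc hxΓ hx hxb hk hν.2.1)
        have hK : ∀ a, Keeps Γ (d + 1) a → ν₁ a = ν a := fun a ha => k1 a (by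
          rcases ha with h | ⟨y, hy, h⟩ | h
          · exact Or.inl h
          · exact Or.inr (Or.inl ⟨y, List.mem_cons_of_mem _ hy, h⟩)
          · exact Or.inr (Or.inr h))
        have h1 : Holds3 c Γ η M ν₁ := hν.1.congr hK
        have vx : ν₁ (60 + x) 0 = k := by
          rw [k1 _ (Or.inr (Or.inl ⟨x, List.mem_cons_self, rfl⟩)), hν.2.1]
        have vd : ν₁ (100 + d) 0 = ν (100 + d) 0 := by
          rw [hK _ (Or.inr (Or.inr ⟨by omega, by omega⟩))]
        have r2 := h1.store_tmp (d := d) (n := 7) (by omega)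
          ((h1.fits_tmp (d := d) (by omega)).add (h1.fits_tmp (d := d + 1) (by omega)))
          (by simp [Expr.cost, tmp])
        have h2 : Holds3 c Γ η M (Memory.write ν₁ (100 + d) 0
            ((Expr.add (tmp d) (tmp (d + 1))).eval c.ρ ν₁)) :=
          h1.congr fun a ha => keeps_write hΓ le_rfl ha _ _
        have r3 := h2.store_var (n := 6) hx ((hfit _ h2).1.add (Expr.fits_const 1))
          (by simp [Expr.cost, var])
        refine ⟨_, (r1.seq (r2.seq r3)).mono (by omega), h2.write_var hxΓ, ?_, ?_, ?_⟩
        · rw [Memory.write_same]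
          simp only [var, Expr.eval]
          rw [Memory.write_ne _ _ _ (by omega), vx]
        · rw [Memory.write_ne _ _ _ (by omega), Memory.write_same, sum_range_succ]
          simp only [tmp, Expr.eval]
          rw [vd, v1, hν.2.2.1]
        · intro a ha
          rw [Memory.write_ne, keeps_write hΓ le_rfl ha, hK a (ha.mono (by omega)), hν.2.2.2 a ha]
          rintro rfl
          rcases ha with h | ⟨y, hy, h⟩ | h
          · omega
          · exact hxΓ (by have : x = y := by omega
                          exact this ▸ hy)
          · omega) hI0
    refine ⟨ν, (r0.seq (r0'.seq rν)).mono ?_, hν.2.2.1, hν.2.2.2⟩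
    simp only [Expr.cost, var, cost]
    have : b.val c * (2 + 2 + 1 + (e.cost c + 13)) ≤ b.val c * (e.cost c + 40) :=
      Nat.mul_le_mul_left _ (by omega)
    simp only [Nat.reduceAdd] at *
    omega

theorem Holds3.write_data {c : Cst} {Γ : List ℕ} {η : ℕ → ℕ} {M : Mem} {μ : Memory}
    (h : Holds3 c Γ η M μ) {a p q r : ℕ} (ha : a < 45) (hp : p ≤ c.P) (hq : q ≤ c.P)
    (hr : r ≤ c.LIM) (k : ℕ) : Holds3 c Γ η (Stm.wr M a p q r k) (μ.write a (c.adr p q r) k) where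
  data a' ha' p' hp' q' hq' r' hr' := by
    simp only [Memory.write, Stm.wr]
    by_cases e : a' = a ∧ p' = p ∧ q' = q ∧ r' = r
    · obtain ⟨rfl, rfl, rfl, rfl⟩ := e
      simp
    · rw [if_neg e, if_neg, h.data a' ha' p' hp' q' hq' r' hr']
      rintro ⟨e1, e2⟩
      exact e ⟨e1, c.adr_inj hq' hr' hq hr e2⟩
  bd b := by rw [Memory.write_ne _ _ _ (by have := b.le_arr; omega)]; exact h.bd b
  regP := by rw [Memory.write_ne _ _ _ (by omega)]; exact h.regP
  regL := by rw [Memory.write_ne _ _ _ (by omega)]; exact h.regL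
  row1 := by rw [Memory.write_ne _ _ _ (by omega)]; exact h.row1
  row2 := by rw [Memory.write_ne _ _ _ (by omega)]; exact h.row2
  lt := h.lt
  env := h.env
  var y hy := by rw [Memory.write_ne _ _ _ (by omega)]; exact h.var y hy

/-- Correctness, running time and space of compiled programs. -/
theorem Stm.exec {c : Cst} (hc : c.OK) (p : Stm) : ∀ {Γ : List ℕ} {η : ℕ → ℕ} {M : Mem} {μ : Memory},
    p.wf Γ = true → Holds3 c Γ η M μ →
    ∃ ν, Runs c.ρ c.BX p.cp μ ν (p.cost c) ∧ Holds3 c Γ η (p.den c η M) ν := by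
  induction p with
  | skip => exact fun {Γ η M μ} _ h => ⟨μ, Runs.skip.mono (by simp [cost]), h⟩
  | st a e₁ e₂ e₃ e =>
    intro Γ η M μ hw h
    simp only [wf, Bool.and_eq_true, decide_eq_true_eq] at hw
    obtain ⟨ν, r1, h1, v1, v2, k1⟩ := (e₁.evals hc hw.2.1).two (e₂.evals hc hw.2.2.1) h
    obtain ⟨ξ, r3, h3, v3, v4, k3⟩ := Evals.two (e₃.evals hc hw.2.2.2.1) (e.evals hc hw.2.2.2.2) h1
    obtain ⟨f, fe⟩ := h3.addr_spec (d := 0) (by omega)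
    rw [k3 (100 + 0) (Or.inr (Or.inr ⟨by omega, by omega⟩)),
      k3 (100 + (0 + 1)) (Or.inr (Or.inr ⟨by omega, by omega⟩)), v1, v2, v3] at fe
    have hB := c.adr_lt (min_le_right (e₁.ev c M η) c.P) (min_le_right (e₂.ev c M η) c.P)
      (min_le_right (e₃.ev c M η) c.LIM)
    have r5 := Runs.store (ρ := c.ρ) (a := a) f (h3.fits_tmp (d := 3) (by omega)) (by omega)
      (by rw [fe]; exact hB)
    refine ⟨_, (r1 _ _ _ (r3 _ _ _ r5)).mono ?_, ?_⟩
    · simp only [Expr.cost, EX.addr, EX.minE, EX.tmp, cost]; omega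
    · rw [fe]
      simp only [EX.tmp, Expr.eval]
      rw [v4]
      rw [den, EX.cut_eq h.env hw.2.1 hw.1.2.1, EX.cut_eq h.env hw.2.2.1 hw.1.2.2.1,
        EX.cut_eq' h.env hw.2.2.2.1 hw.1.2.2.2]
      exact h3.write_data hw.1.1 (min_le_right _ _) (min_le_right _ _) (min_le_right _ _) _
  | seq p q ih1 ih2 =>
    intro Γ η M μ hw h
    simp only [wf, Bool.and_eq_true] at hw
    obtain ⟨ν, r1, h1⟩ := ih1 hw.1 h
    obtain ⟨ξ, r2, h2⟩ := ih2 hw.2 h1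
    exact ⟨ξ, r1.seq r2, h2⟩
  | ite a b p q ih1 ih2 =>
    intro Γ η M μ hw h
    simp only [wf, Bool.and_eq_true] at hw
    obtain ⟨ν, r1, h1, v1, v2, k1⟩ := (a.evals hc hw.1).two (b.evals hc hw.2.1) h
    have e1 : (EX.tmp 0).eval c.ρ ν = a.ev c M η := by simpa [EX.tmp, Expr.eval] using v1
    have e2 : (EX.tmp 1).eval c.ρ ν = b.ev c M η := by simpa [EX.tmp, Expr.eval] using v2
    by_cases hc : a.ev c M η ≤ b.ev c M η
    · obtain ⟨ξ, r3, h3⟩ := ih1 hw.2.2.1 h1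
      refine ⟨ξ, (r1 _ _ _ (Runs.ifTrue (h1.fits_tmp (by omega)) (h1.fits_tmp (by omega))
        (by rw [e1, e2]; exact hc) r3)).mono ?_, by simpa only [den, hc, if_true] using h3⟩
      simp only [Expr.cost, EX.tmp, cost]; omega
    · obtain ⟨ξ, r3, h3⟩ := ih2 hw.2.2.2 h1
      refine ⟨ξ, (r1 _ _ _ (Runs.ifFalse (h1.fits_tmp (by omega)) (h1.fits_tmp (by omega))
        (by rw [e1, e2]; exact hc) r3)).mono ?_, by simpa only [den, hc, if_false] using h3⟩
      simp only [Expr.cost, EX.tmp, cost]; omega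
  | loop x b p ih =>
    intro Γ η M μ hw h
    simp only [wf, Bool.and_eq_true, decide_eq_true_eq, Bool.not_eq_true',
      List.contains_eq_mem, decide_eq_false_iff_not] at hw
    obtain ⟨⟨hx, hxb⟩, hxΓ, hwp⟩ := hw
    have hxb : 20 ≤ x ∨ b.isData = false := by simpa using hxb
    have hb := b.arr_lt
    have r0 := h.store_var (n := 3) hx (Expr.fits_const 0) (by simp [Expr.cost])
    have h0 := h.write_var (k := 0) hxΓ
    let I : ℕ → Memory → Prop := fun k ν =>
      Holds3 c Γ η (iter (fun i => p.den c (Function.update η x i)) k M) ν ∧ ν (60 + x) 0 = k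
    obtain ⟨ν, rν, hν⟩ := Runs.while (ρ := c.ρ) (B := c.BX) (e₁ := EX.var x)
      (e₂ := Expr.read b.arr (.const 0)) (T := p.cost c + 6) (p := .seq p.cp
            (.store (60 + x) (.const 0) (.add (EX.var x) (.const 1)))) I (b.val c)
      (fun k _ ν hν => ⟨hν.1.fits_reg (by omega), hν.1.fits_reg (by omega)⟩)
      (fun k hk ν hν => by simp only [EX.var, Expr.eval, hν.2, hν.1.bd]; exact hk)
      (fun ν hν => by simp [EX.var, Expr.eval, hν.2, hν.1.bd])
      (fun k hk ν hν => by
        obtain ⟨ν₁, r1, h1⟩ := ih hwp (hν.1.enter hc hxΓ hx hxb hk hν.2)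
        have vx := h1.var x List.mem_cons_self
        rw [Function.update_self] at vx
        have h2 := h1.leave hxΓ
        refine ⟨_, r1.seq (h2.store_var (n := 6) hx
          ((h2.fits_reg (a := 60 + x) (by omega)).add (Expr.fits_const 1))
          (by simp [Expr.cost, EX.var])), h2.write_var hxΓ, ?_⟩
        rw [Memory.write_same]
        simp only [EX.var, Expr.eval, vx]) ⟨h0, by simp⟩
    refine ⟨ν, (r0.seq rν).mono ?_, hν.1⟩
    simp only [Expr.cost, EX.var, cost]
    have : b.val c * (2 + 2 + 1 + (p.cost c + 6)) ≤ b.val c * (p.cost c + 40) :=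
      Nat.mul_le_mul_left _ (by omega)
    simp only [Nat.reduceAdd] at *
    omega

end

section

open Finset

/-! ### Cost bounds -/

namespace EX

def dataDepth : EX → ℕ
  | .c _ => 0
  | bd _ => 0
  | v _ => 0
  | rd _ e f g => max (max e.dataDepth f.dataDepth) g.dataDepth
  | add e f => max e.dataDepth f.dataDepth
  | sub e f => max e.dataDepth f.dataDepth
  | pw _ e f g => max (max e.dataDepth f.dataDepth) g.dataDepth
  | ite a b e f => max (max a.dataDepth b.dataDepth) (max e.dataDepth f.dataDepth)
  | sum _ b e => e.dataDepth + if b.isData then 1 else 0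

def paramDepth : EX → ℕ
  | .c _ => 0
  | bd _ => 0
  | v _ => 0
  | rd _ e f g => max (max e.paramDepth f.paramDepth) g.paramDepth
  | add e f => max e.paramDepth f.paramDepth
  | sub e f => max e.paramDepth f.paramDepth
  | pw _ e f g => max (max e.paramDepth f.paramDepth) g.paramDepth
  | ite a b e f => max (max a.paramDepth b.paramDepth) (max e.paramDepth f.paramDepth)
  | sum _ b e => e.paramDepth + if b.isData then 0 else 1

def size : EX → ℕ
  | .c _ => 40
  | bd _ => 40
  | v _ => 40
  | rd _ e f g => 40 + e.size + f.size + g.size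
  | add e f => 40 + e.size + f.size
  | sub e f => 40 + e.size + f.size
  | pw _ e f g => 40 + e.size + f.size + g.size
  | ite a b e f => 40 + a.size + b.size + e.size + f.size
  | sum _ _ e => 80 + e.size

end EX

namespace Stm

def dataDepth : Stm → ℕ
  | skip => 0
  | st _ e f g h => max (max e.dataDepth f.dataDepth) (max g.dataDepth h.dataDepth)
  | seq p q => max p.dataDepth q.dataDepth
  | ite a b p q => max (max a.dataDepth b.dataDepth) (max p.dataDepth q.dataDepth)
  | loop _ b p => p.dataDepth + if b.isData then 1 else 0

def paramDepth : Stm → ℕ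
  | skip => 0
  | st _ e f g h => max (max e.paramDepth f.paramDepth) (max g.paramDepth h.paramDepth)
  | seq p q => max p.paramDepth q.paramDepth
  | ite a b p q => max (max a.paramDepth b.paramDepth) (max p.paramDepth q.paramDepth)
  | loop _ b p => p.paramDepth + if b.isData then 0 else 1

def size : Stm → ℕ
  | skip => 40
  | st _ e f g h => 40 + e.size + f.size + g.size + h.size
  | seq p q => p.size + q.size
  | ite a b p q => 40 + a.size + b.size + p.size + q.size
  | loop _ _ p => 80 + p.size

end Stm

theorem mul_pow_le {k a b p q K a' b' : ℕ} (hk : k ≤ K) (ha : a ≤ a') (hb : b ≤ b') (hp : 1 ≤ p)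
    (hq : 1 ≤ q) : k * p ^ a * q ^ b ≤ K * p ^ a' * q ^ b' :=
  Nat.mul_le_mul (Nat.mul_le_mul hk (Nat.pow_le_pow_right hp ha)) (Nat.pow_le_pow_right hq hb)

theorem bound_weaken {p q m k a b A B : ℕ} (hp : 1 ≤ p) (hq : 1 ≤ q)
    (hm : m ≤ k * p ^ a * q ^ b) (h : a ≤ A ∧ b ≤ B) : m ≤ k * p ^ A * q ^ B :=
  hm.trans (mul_pow_le le_rfl h.1 h.2 hp hq)

theorem bound_const {p q : ℕ} (hp : 1 ≤ p) (hq : 1 ≤ q) (k A B : ℕ) : k ≤ k * p ^ A * q ^ B := by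
  simpa using mul_pow_le (le_refl k) (Nat.zero_le A) (Nat.zero_le B) hp hq

theorem bound_loop {c : Cst} (h : c.OK) (b : Bd) {n k A B : ℕ}
    (hn : n ≤ k * (c.P + 1) ^ A * (c.LIM + 1) ^ B) :
    40 + b.val c * (n + 40) ≤ (80 + k) * (c.P + 1) ^ (A + if b.isData then 0 else 1) *
      (c.LIM + 1) ^ (B + if b.isData then 1 else 0) := by
  have h40 := bound_const (p := c.P + 1) (q := c.LIM + 1) (by omega) (by omega) 40 A B
  have h1 : n + 40 ≤ (k + 40) * (c.P + 1) ^ A * (c.LIM + 1) ^ B := by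
    rw [add_mul, add_mul]; omega
  have key : b.val c * (n + 40) ≤ (k + 40) * (c.P + 1) ^ (A + if b.isData then 0 else 1) *
      (c.LIM + 1) ^ (B + if b.isData then 1 else 0) := by
    rcases hb : b.isData with _ | _
    · calc b.val c * (n + 40) ≤ (c.P + 1) * ((k + 40) * (c.P + 1) ^ A * (c.LIM + 1) ^ B) :=
            Nat.mul_le_mul (h.val_le b hb) h1
        _ = _ := by simp; ring
    · calc b.val c * (n + 40) ≤ (c.LIM + 1) * ((k + 40) * (c.P + 1) ^ A * (c.LIM + 1) ^ B) :=
            Nat.mul_le_mul (h.val_le' b) h1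
        _ = _ := by simp; ring
  have h40' := bound_const (p := c.P + 1) (q := c.LIM + 1) (by omega) (by omega) 40
    (A + if b.isData then 0 else 1) (B + if b.isData then 1 else 0)
  have : 80 + k = 40 + (k + 40) := by omega
  rw [this, add_mul, add_mul]
  omega

theorem EX.cost_le {c : Cst} (h : c.OK) (e : EX) :
    e.cost c ≤ e.size * (c.P + 1) ^ e.paramDepth * (c.LIM + 1) ^ e.dataDepth := by
  have hp : 1 ≤ c.P + 1 := by omega
  have hq : 1 ≤ c.LIM + 1 := by omega
  have hc := fun A B => bound_const hp hq 40 A B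
  induction e with
  | c => exact hc _ _
  | bd => exact hc _ _
  | v => exact hc _ _
  | rd a e f g i j k =>
    have i := bound_weaken (A := (rd a e f g).paramDepth) (B := (rd a e f g).dataDepth) hp hq i
      (by simp [paramDepth, dataDepth])
    have j := bound_weaken (A := (rd a e f g).paramDepth) (B := (rd a e f g).dataDepth) hp hq j
      (by simp [paramDepth, dataDepth])
    have k := bound_weaken (A := (rd a e f g).paramDepth) (B := (rd a e f g).dataDepth) hp hq k
      (by simp [paramDepth, dataDepth])
    have := hc (rd a e f g).paramDepth (rd a e f g).dataDepth
    rw [cost, size, add_mul, add_mul, add_mul, add_mul, add_mul, add_mul]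
    omega
  | pw a e f g i j k =>
    have i := bound_weaken (A := (pw a e f g).paramDepth) (B := (pw a e f g).dataDepth) hp hq i
      (by simp [paramDepth, dataDepth])
    have j := bound_weaken (A := (pw a e f g).paramDepth) (B := (pw a e f g).dataDepth) hp hq j
      (by simp [paramDepth, dataDepth])
    have k := bound_weaken (A := (pw a e f g).paramDepth) (B := (pw a e f g).dataDepth) hp hq k
      (by simp [paramDepth, dataDepth])
    have := hc (pw a e f g).paramDepth (pw a e f g).dataDepth
    rw [cost, size, add_mul, add_mul, add_mul, add_mul, add_mul, add_mul]
    omega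
  | add e f i j =>
    have i := bound_weaken (A := (add e f).paramDepth) (B := (add e f).dataDepth) hp hq i
      (by simp [paramDepth, dataDepth])
    have j := bound_weaken (A := (add e f).paramDepth) (B := (add e f).dataDepth) hp hq j
      (by simp [paramDepth, dataDepth])
    have := hc (add e f).paramDepth (add e f).dataDepth
    rw [cost, size, add_mul, add_mul, add_mul, add_mul]
    omega
  | sub e f i j =>
    have i := bound_weaken (A := (sub e f).paramDepth) (B := (sub e f).dataDepth) hp hq i
      (by simp [paramDepth, dataDepth])
    have j := bound_weaken (A := (sub e f).paramDepth) (B := (sub e f).dataDepth) hp hq j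
      (by simp [paramDepth, dataDepth])
    have := hc (sub e f).paramDepth (sub e f).dataDepth
    rw [cost, size, add_mul, add_mul, add_mul, add_mul]
    omega
  | ite a b e f i j k l =>
    have i := bound_weaken (A := (ite a b e f).paramDepth) (B := (ite a b e f).dataDepth) hp hq i
      (by simp [paramDepth, dataDepth])
    have j := bound_weaken (A := (ite a b e f).paramDepth) (B := (ite a b e f).dataDepth) hp hq j
      (by simp [paramDepth, dataDepth])
    have k := bound_weaken (A := (ite a b e f).paramDepth) (B := (ite a b e f).dataDepth) hp hq k
      (by simp [paramDepth, dataDepth])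
    have l := bound_weaken (A := (ite a b e f).paramDepth) (B := (ite a b e f).dataDepth) hp hq l
      (by simp [paramDepth, dataDepth])
    have := hc (ite a b e f).paramDepth (ite a b e f).dataDepth
    rw [cost, size, add_mul, add_mul, add_mul, add_mul, add_mul, add_mul, add_mul, add_mul]
    omega
  | sum x b e i => exact bound_loop h b i

theorem Stm.cost_le {c : Cst} (h : c.OK) (p : Stm) :
    p.cost c ≤ p.size * (c.P + 1) ^ p.paramDepth * (c.LIM + 1) ^ p.dataDepth := by
  have hp : 1 ≤ c.P + 1 := by omega
  have hq : 1 ≤ c.LIM + 1 := by omega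
  have hc := fun A B => bound_const hp hq 40 A B
  induction p with
  | skip => exact hc _ _
  | st a e f g k =>
    have h1 := bound_weaken (A := (st a e f g k).paramDepth) (B := (st a e f g k).dataDepth) hp hq
      (e.cost_le h) (by simp [paramDepth, dataDepth])
    have h2 := bound_weaken (A := (st a e f g k).paramDepth) (B := (st a e f g k).dataDepth) hp hq
      (f.cost_le h) (by simp [paramDepth, dataDepth])
    have h3 := bound_weaken (A := (st a e f g k).paramDepth) (B := (st a e f g k).dataDepth) hp hq
      (g.cost_le h) (by simp [paramDepth, dataDepth])
    have h4 := bound_weaken (A := (st a e f g k).paramDepth) (B := (st a e f g k).dataDepth) hp hq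
      (k.cost_le h) (by simp [paramDepth, dataDepth])
    have := hc (st a e f g k).paramDepth (st a e f g k).dataDepth
    rw [cost, size, add_mul, add_mul, add_mul, add_mul, add_mul, add_mul, add_mul, add_mul]
    omega
  | seq p q i j =>
    have i := bound_weaken (A := (seq p q).paramDepth) (B := (seq p q).dataDepth) hp hq i
      (by simp [paramDepth, dataDepth])
    have j := bound_weaken (A := (seq p q).paramDepth) (B := (seq p q).dataDepth) hp hq j
      (by simp [paramDepth, dataDepth])
    rw [cost, size, add_mul, add_mul]
    omega
  | ite a b p q i j =>
    have h1 := bound_weaken (A := (ite a b p q).paramDepth) (B := (ite a b p q).dataDepth) hp hq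
      (a.cost_le h) (by simp [paramDepth, dataDepth])
    have h2 := bound_weaken (A := (ite a b p q).paramDepth) (B := (ite a b p q).dataDepth) hp hq
      (b.cost_le h) (by simp [paramDepth, dataDepth])
    have i := bound_weaken (A := (ite a b p q).paramDepth) (B := (ite a b p q).dataDepth) hp hq i
      (by simp [paramDepth, dataDepth])
    have j := bound_weaken (A := (ite a b p q).paramDepth) (B := (ite a b p q).dataDepth) hp hq j
      (by simp [paramDepth, dataDepth])
    have := hc (ite a b p q).paramDepth (ite a b p q).dataDepth
    rw [cost, size, add_mul, add_mul, add_mul, add_mul, add_mul, add_mul, add_mul, add_mul]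
    omega
  | loop x b p i => exact bound_loop h b i

/-! ### Frames -/

/-- `e.avoids Z`: the expression reads no array from the list `Z`. -/
def EX.avoids (Z : List ℕ) : EX → Bool
  | .c _ => true
  | .bd _ => true
  | .v _ => true
  | .rd a e f g => !Z.contains a && (e.avoids Z && (f.avoids Z && g.avoids Z))
  | .add e f => e.avoids Z && f.avoids Z
  | .sub e f => e.avoids Z && f.avoids Z
  | .pw _ e f g => e.avoids Z && (f.avoids Z && g.avoids Z)
  | .ite a b e f => a.avoids Z && (b.avoids Z && (e.avoids Z && f.avoids Z))
  | .sum _ _ e => e.avoids Z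

/-- The statement neither reads nor writes arrays from the list `Z`. -/
def Stm.avoids (Z : List ℕ) : Stm → Bool
  | .skip => true
  | .st a e f g h =>
      !Z.contains a && (e.avoids Z && (f.avoids Z && (g.avoids Z && h.avoids Z)))
  | .seq p q => p.avoids Z && q.avoids Z
  | .ite a b p q => a.avoids Z && (b.avoids Z && (p.avoids Z && q.avoids Z))
  | .loop _ _ p => p.avoids Z

/-- The arrays written by a statement. -/
def Stm.writes : Stm → List ℕ
  | .skip => []
  | .st a _ _ _ _ => [a]
  | .seq p q => p.writes ++ q.writes
  | .ite _ _ p q => p.writes ++ q.writes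
  | .loop _ _ p => p.writes

theorem EX.ev_congr {c : Cst} {Z : List ℕ} {M M' : Mem} (h : ∀ a, a ∉ Z → M a = M' a) (e : EX) :
    ∀ η, e.avoids Z = true → e.ev c M η = e.ev c M' η := by
  induction e with
  | c => intros; rfl
  | bd => intros; rfl
  | v => intros; rfl
  | rd a _ _ _ i j k =>
    intro η hz
    simp only [avoids, Bool.and_eq_true, Bool.not_eq_true', List.contains_eq_mem,
      decide_eq_false_iff_not] at hz
    simp only [ev, i η hz.2.1, j η hz.2.2.1, k η hz.2.2.2, h a hz.1]
  | add _ _ i j =>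
    intro η hz
    simp only [avoids, Bool.and_eq_true] at hz
    simp only [ev, i η hz.1, j η hz.2]
  | sub _ _ i j =>
    intro η hz
    simp only [avoids, Bool.and_eq_true] at hz
    simp only [ev, i η hz.1, j η hz.2]
  | pw _ _ _ _ i j k =>
    intro η hz
    simp only [avoids, Bool.and_eq_true] at hz
    simp only [ev, i η hz.1, j η hz.2.1, k η hz.2.2]
  | ite _ _ _ _ i j k l =>
    intro η hz
    simp only [avoids, Bool.and_eq_true] at hz
    simp only [ev, i η hz.1, j η hz.2.1, k η hz.2.2.1, l η hz.2.2.2]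
  | sum _ _ _ i =>
    intro η hz
    simp only [ev]
    exact sum_congr rfl fun x _ => i _ hz

theorem EX.ev_env {c : Cst} {M : Mem} (e : EX) : ∀ {Γ : List ℕ} {d : ℕ} {η η' : ℕ → ℕ},
    e.wf Γ d = true → (∀ x ∈ Γ, η x = η' x) → e.ev c M η = e.ev c M η' := by
  induction e with
  | c => intros; rfl
  | bd => intros; rfl
  | v x =>
    intro Γ d η η' hw h
    simp only [wf, Bool.and_eq_true, List.contains_iff_mem] at hw
    exact h x hw.2
  | rd _ _ _ _ i j k =>
    intro Γ d η η' hw h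
    simp only [wf, Bool.and_eq_true] at hw
    simp only [ev, i hw.2.1 h, j hw.2.2.1 h, k hw.2.2.2 h]
  | add _ _ i j =>
    intro Γ d η η' hw h
    simp only [wf, Bool.and_eq_true] at hw
    simp only [ev, i hw.1 h, j hw.2 h]
  | sub _ _ i j =>
    intro Γ d η η' hw h
    simp only [wf, Bool.and_eq_true] at hw
    simp only [ev, i hw.1 h, j hw.2 h]
  | pw _ _ _ _ i j k =>
    intro Γ d η η' hw h
    simp only [wf, Bool.and_eq_true] at hw
    simp only [ev, i hw.1 h, j hw.2.1 h, k hw.2.2 h]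
  | ite _ _ _ _ i j k l =>
    intro Γ d η η' hw h
    simp only [wf, Bool.and_eq_true] at hw
    simp only [ev, i hw.1 h, j hw.2.1 h, k hw.2.2.1 h, l hw.2.2.2 h]
  | sum x _ _ i =>
    intro Γ d η η' hw h
    simp only [wf, Bool.and_eq_true] at hw
    simp only [ev]
    refine sum_congr rfl fun n _ => i hw.2.2.2 fun y hy => ?_
    by_cases hyx : y = x
    · subst hyx; simp
    · rw [Function.update_of_ne hyx, Function.update_of_ne hyx]
      exact h y ((List.mem_cons.1 hy).resolve_left hyx)

namespace Stm

theorem iter_congr {α : Type*} {f g : ℕ → α → α} {n : ℕ} (h : ∀ i < n, f i = g i) (x : α) :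
    iter f n x = iter g n x := by
  induction n with
  | zero => rfl
  | succ n ih => rw [iter, iter, ih fun i hi => h i (by omega), h n (by omega)]

/-- Invariants of iterations. -/
theorem iter_inv {α : Type*} {f : ℕ → α → α} (I : ℕ → α → Prop) {n : ℕ} {x : α} (h0 : I 0 x)
    (hs : ∀ i < n, ∀ y, I i y → I (i + 1) (f i y)) : I n (iter f n x) := by
  induction n with
  | zero => exact h0
  | succ n ih => exact hs n (by omega) _ (ih fun i hi => hs i (by omega))

theorem den_env {c : Cst} (p : Stm) : ∀ {Γ : List ℕ} {η η' : ℕ → ℕ}, p.wf Γ = true →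
    (∀ x ∈ Γ, η x = η' x) → p.den c η = p.den c η' := by
  induction p with
  | skip => intros; rfl
  | st _ e f g k =>
    intro Γ η η' hw h
    simp only [wf, Bool.and_eq_true] at hw
    funext M
    simp only [den, e.ev_env hw.2.1 h, f.ev_env hw.2.2.1 h, g.ev_env hw.2.2.2.1 h,
      k.ev_env hw.2.2.2.2 h]
  | seq _ _ i j =>
    intro Γ η η' hw h
    simp only [wf, Bool.and_eq_true] at hw
    funext M
    simp only [den, i hw.1 h, j hw.2 h]
  | ite a b _ _ i j =>
    intro Γ η η' hw h
    simp only [wf, Bool.and_eq_true] at hw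
    funext M
    simp only [den, a.ev_env hw.1 h, b.ev_env hw.2.1 h, i hw.2.2.1 h, j hw.2.2.2 h]
  | loop x _ _ i =>
    intro Γ η η' hw h
    simp only [wf, Bool.and_eq_true] at hw
    funext M
    simp only [den]
    refine iter_congr (fun n _ => i hw.2.2 fun y hy => ?_) M
    by_cases hyx : y = x
    · subst hyx; simp
    · rw [Function.update_of_ne hyx, Function.update_of_ne hyx]
      exact h y ((List.mem_cons.1 hy).resolve_left hyx)

theorem wr_ne {M : Mem} {a b : ℕ} (p q r x : ℕ) (h : b ≠ a) : wr M a p q r x b = M b := by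
  funext i j k
  simp [wr, h]

theorem den_frame {c : Cst} (p : Stm) {a : ℕ} : ∀ (η : ℕ → ℕ) (M : Mem), a ∉ p.writes →
    p.den c η M a = M a := by
  induction p with
  | skip => intros; rfl
  | st b => intro η M h; exact wr_ne _ _ _ _ (by simpa [writes] using h)
  | seq _ _ i j =>
    intro η M h
    simp only [writes, List.mem_append, not_or] at h
    simp only [den, j _ _ h.2, i _ _ h.1]
  | ite _ _ _ _ i j =>
    intro η M h
    simp only [writes, List.mem_append, not_or] at h
    simp only [den]
    split_ifs
    · exact i _ _ h.1
    · exact j _ _ h.2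
  | loop x b p i =>
    intro η M h
    exact iter_inv (fun _ (M' : Mem) => M' a = M a) rfl fun n _ M' hM' => (i _ _ h).trans hM'

theorem den_congr {c : Cst} {Z : List ℕ} (p : Stm) : ∀ (η : ℕ → ℕ) (M M' : Mem),
    p.avoids Z = true → (∀ a, a ∉ Z → M a = M' a) →
    ∀ a, a ∉ Z → p.den c η M a = p.den c η M' a := by
  induction p with
  | skip => exact fun _ _ _ _ h => h
  | st b e f g k =>
    intro η M M' hz h a ha
    simp only [avoids, Bool.and_eq_true] at hz
    simp only [den, e.ev_congr h η hz.2.1, f.ev_congr h η hz.2.2.1, g.ev_congr h η hz.2.2.2.1,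
      k.ev_congr h η hz.2.2.2.2]
    funext i j l
    simp only [wr, h a ha]
  | seq _ _ i j =>
    intro η M M' hz h
    simp only [avoids, Bool.and_eq_true] at hz
    exact j _ _ _ hz.2 (i _ _ _ hz.1 h)
  | ite a b _ _ i j =>
    intro η M M' hz h
    simp only [avoids, Bool.and_eq_true] at hz
    simp only [den, a.ev_congr h η hz.1, b.ev_congr h η hz.2.1]
    split_ifs
    · exact i _ _ _ hz.2.2.1 h
    · exact j _ _ _ hz.2.2.2 h
  | loop x b p i =>
    intro η M M' hz h
    simp only [den]
    induction b.val c with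
    | zero => exact h
    | succ n ih => exact i _ _ _ hz ih

/-- Statements do not change anything outside the index ranges. -/
theorem den_outside {c : Cst} (hc : c.OK) (p : Stm) {a i j k : ℕ}
    (h : ¬ (i ≤ c.P ∧ j ≤ c.P ∧ k ≤ c.LIM)) : ∀ {Γ : List ℕ} {η : ℕ → ℕ} (M : Mem),
    p.wf Γ = true → EnvOK c Γ η → p.den c η M a i j k = M a i j k := by
  induction p with
  | skip => intros; rfl
  | st b e f g l =>
    intro Γ η M hw hη
    simp only [wf, Bool.and_eq_true, decide_eq_true_eq] at hw
    simp only [den, wr]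
    rw [EX.cut_eq hη hw.2.1 hw.1.2.1, EX.cut_eq hη hw.2.2.1 hw.1.2.2.1,
      EX.cut_eq' hη hw.2.2.2.1 hw.1.2.2.2, if_neg]
    rintro ⟨-, rfl, rfl, rfl⟩
    exact h ⟨min_le_right _ _, min_le_right _ _, min_le_right _ _⟩
  | seq _ _ i j =>
    intro Γ η M hw hη
    simp only [wf, Bool.and_eq_true] at hw
    simp only [den]
    rw [j _ hw.2 hη, i _ hw.1 hη]
  | ite _ _ _ _ i j =>
    intro Γ η M hw hη
    simp only [wf, Bool.and_eq_true] at hw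
    simp only [den]
    split_ifs
    · exact i _ hw.2.2.1 hη
    · exact j _ hw.2.2.2 hη
  | loop x b p ih =>
    intro Γ η M hw hη
    simp only [wf, Bool.and_eq_true, Bool.or_eq_true, Bool.not_eq_true', decide_eq_true_eq] at hw
    exact iter_inv (fun _ (M' : Mem) => M' a i j k = M a i j k) rfl fun n hn M' hM' =>
      (ih _ hw.2.2 (hη.enter hc hw.1.2 hn)).trans hM'

theorem den_loop_inv {c : Cst} {x : ℕ} {b : Bd} {p : Stm} {η : ℕ → ℕ} {M : Mem}
    (I : ℕ → Mem → Prop) (h0 : I 0 M)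
    (hs : ∀ i < b.val c, ∀ M, I i M → I (i + 1) (p.den c (Function.update η x i) M)) :
    I (b.val c) ((loop x b p).den c η M) :=
  iter_inv I h0 hs

end Stm

/-! ### Derived expressions and statements -/

namespace EX

def notE (p : EX) : EX := .ite p (.c 0) (.c 1) (.c 0)
def andE (p q : EX) : EX := .ite p (.c 0) (.c 0) q
def orE (p q : EX) : EX := .ite p (.c 0) q (.c 1)
def impE (p q : EX) : EX := .ite p (.c 0) (.c 1) q
def iffE (p q : EX) : EX := .ite p (.c 0) (notE q) q
def leE (a b : EX) : EX := .ite a b (.c 1) (.c 0)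
def ltE (a b : EX) : EX := .ite b a (.c 0) (.c 1)
def eqE (a b : EX) : EX := .ite a b (.ite b a (.c 1) (.c 0)) (.c 0)
def exE (x : ℕ) (b : Bd) (p : EX) : EX := .sum x b p
def allE (x : ℕ) (b : Bd) (p : EX) : EX := notE (.sum x b (notE p))
/-- `e` if `p` is positive, and `f` otherwise. -/
def ifE (p e f : EX) : EX := .ite p (.c 0) f e
def flag (p : EX) : EX := ifE p (.c 1) (.c 0)

variable {c : Cst} {M : Mem} {η : ℕ → ℕ} {p q a b e f : EX} {x : ℕ} {B : Bd}

theorem ev_ite_zero : (ite p (.c 0) e f).ev c M η =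
    if 0 < p.ev c M η then f.ev c M η else e.ev c M η := by
  change (if p.ev c M η ≤ 0 then e.ev c M η else f.ev c M η) = _
  by_cases h : 0 < p.ev c M η
  · rw [if_pos h, if_neg (by omega)]
  · rw [if_neg h, if_pos (by omega)]
theorem ev_ifE : (ifE p e f).ev c M η = if 0 < p.ev c M η then e.ev c M η else f.ev c M η :=
  ev_ite_zero
theorem ev_flag : (flag p).ev c M η = if 0 < p.ev c M η then 1 else 0 := ev_ite_zero
theorem pos_notE : 0 < (notE p).ev c M η ↔ ¬ 0 < p.ev c M η := by
  rw [notE, ev_ite_zero]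
  split_ifs with h <;> simp [h, ev]
theorem pos_andE : 0 < (andE p q).ev c M η ↔ 0 < p.ev c M η ∧ 0 < q.ev c M η := by
  rw [andE, ev_ite_zero]
  split_ifs with h <;> simp [h, ev]
theorem pos_orE : 0 < (orE p q).ev c M η ↔ 0 < p.ev c M η ∨ 0 < q.ev c M η := by
  rw [orE, ev_ite_zero]
  split_ifs with h <;> simp [h, ev]
theorem pos_impE : 0 < (impE p q).ev c M η ↔ (0 < p.ev c M η → 0 < q.ev c M η) := by
  rw [impE, ev_ite_zero]
  split_ifs with h <;> simp [h, ev]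
theorem pos_iffE : 0 < (iffE p q).ev c M η ↔ (0 < p.ev c M η ↔ 0 < q.ev c M η) := by
  rw [iffE, ev_ite_zero]
  split_ifs with h
  · simp [h]
  · rw [pos_notE]; simp [h]
theorem pos_leE : 0 < (leE a b).ev c M η ↔ a.ev c M η ≤ b.ev c M η := by
  change (0 < if a.ev c M η ≤ b.ev c M η then 1 else 0) ↔ _
  split_ifs with h <;> simp [h]
theorem pos_ltE : 0 < (ltE a b).ev c M η ↔ a.ev c M η < b.ev c M η := by
  change (0 < if b.ev c M η ≤ a.ev c M η then 0 else 1) ↔ _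
  split_ifs with h <;> simp <;> omega
theorem pos_eqE : 0 < (eqE a b).ev c M η ↔ a.ev c M η = b.ev c M η := by
  change (0 < if a.ev c M η ≤ b.ev c M η then if b.ev c M η ≤ a.ev c M η then 1 else 0 else 0) ↔ _
  split_ifs <;> simp <;> omega
theorem pos_exE : 0 < (exE x B p).ev c M η ↔
    ∃ i < B.val c, 0 < p.ev c M (Function.update η x i) := by
  simp only [exE, ev, sum_pos_iff, mem_range]
theorem pos_allE : 0 < (allE x B p).ev c M η ↔
    ∀ i < B.val c, 0 < p.ev c M (Function.update η x i) := by
  simp only [allE, pos_notE, ev, sum_pos_iff, mem_range]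
  push Not
  rfl
theorem pos_pw {j : Fin 2} : 0 < (pw j a b e).ev c M η ↔
    (a.ev c M η : ℝ) ≤ (b.ev c M η : ℝ) * (e.ev c M η : ℝ) ^ c.ρ j := by
  simp only [ev]
  split_ifs with h <;> simp [h]

end EX

namespace Stm

open EX

/-- The statement `p` is executed if the condition is positive. -/
def whenS (e : EX) (p : Stm) : Stm := .ite e (.c 0) .skip p

theorem den_whenS {c : Cst} {η : ℕ → ℕ} {e : EX} {p : Stm} {M : Mem} :
    (whenS e p).den c η M = if 0 < e.ev c M η then p.den c η M else M := by
  change (if e.ev c M η ≤ 0 then M else p.den c η M) = _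
  by_cases h : 0 < e.ev c M η
  · rw [if_pos h, if_neg (by omega)]
  · rw [if_neg h, if_pos (by omega)]

/-- Execution of a list of statements. -/
def blk : List Stm → Stm
  | [] => .skip
  | p :: l => .seq p (blk l)

/-- The environment with the values of the variables `0`, `1` and `20` replaced. -/
def env3 (η : ℕ → ℕ) (p q r : ℕ) : ℕ → ℕ :=
  Function.update (Function.update (Function.update η 0 p) 1 q) 20 r

def fors (b₁ b₂ b₃ : Bd) (p : Stm) : Stm := .loop 0 b₁ (.loop 1 b₂ (.loop 20 b₃ p))

/-- Simultaneous assignment to the entries of an array. -/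
def asg (T : ℕ) (b₁ b₂ b₃ : Bd) (e : EX) : Stm :=
  fors b₁ b₂ b₃ (.st T (.v 0) (.v 1) (.v 20) e)

/-- Conditional marking of entries of an array. -/
def mrk (T : ℕ) (b₁ b₂ b₃ : Bd) (p e₁ e₂ e₃ : EX) : Stm :=
  fors b₁ b₂ b₃ (whenS p (.st T e₁ e₂ e₃ (.c 1)))

/-- Simultaneous assignment in which the old values may be used; `U` is auxiliary. -/
def upd (T U : ℕ) (b₁ b₂ b₃ : Bd) (e : EX) : Stm :=
  .seq (asg U b₁ b₂ b₃ e) (asg T b₁ b₂ b₃ (.rd U (.v 0) (.v 1) (.v 20)))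

def setA (M : Mem) (T n₁ n₂ n₃ : ℕ) (f : ℕ → ℕ → ℕ → ℕ) : Mem := fun a p q r =>
  if a = T ∧ p < n₁ ∧ q < n₂ ∧ r < n₃ then f p q r else M a p q r

@[simp] theorem setA_ne {M : Mem} {T n₁ n₂ n₃ a : ℕ} {f : ℕ → ℕ → ℕ → ℕ} (h : a ≠ T) :
    setA M T n₁ n₂ n₃ f a = M a := by
  funext p q r
  simp [setA, h]

theorem setA_same {M : Mem} {T n₁ n₂ n₃ p q r : ℕ} {f : ℕ → ℕ → ℕ → ℕ} (h₁ : p < n₁)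
    (h₂ : q < n₂) (h₃ : r < n₃) : setA M T n₁ n₂ n₃ f T p q r = f p q r := by
  simp [setA, h₁, h₂, h₃]

theorem iter_eq_foldl {α : Type*} (f : ℕ → α → α) (n : ℕ) (x : α) :
    iter f n x = (List.range n).foldl (fun y i => f i y) x := by
  induction n with
  | zero => rfl
  | succ n ih => rw [iter, ih, List.range_succ, List.foldl_append]; rfl

theorem den_fors {c : Cst} {η : ℕ → ℕ} {b₁ b₂ b₃ : Bd} {p : Stm} {M : Mem} :
    (fors b₁ b₂ b₃ p).den c η M =
      ((List.range (b₁.val c)).flatMap fun i => (List.range (b₂.val c)).flatMap fun j =>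
        (List.range (b₃.val c)).map fun k => (i, j, k)).foldl
        (fun M t => p.den c (env3 η t.1 t.2.1 t.2.2) M) M := by
  simp only [fors, den, iter_eq_foldl, List.foldl_flatMap, List.foldl_map, env3]

theorem mem_triples {n₁ n₂ n₃ : ℕ} {t : ℕ × ℕ × ℕ} :
    t ∈ ((List.range n₁).flatMap fun i => (List.range n₂).flatMap fun j =>
        (List.range n₃).map fun k => (i, j, k)) ↔ t.1 < n₁ ∧ t.2.1 < n₂ ∧ t.2.2 < n₃ := by
  obtain ⟨i, j, k⟩ := t
  simp only [List.mem_flatMap, List.mem_range, List.mem_map, Prod.mk.injEq]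
  constructor
  · rintro ⟨_, h1, _, h2, _, h3, rfl, rfl, rfl⟩; exact ⟨h1, h2, h3⟩
  · rintro ⟨h1, h2, h3⟩; exact ⟨_, h1, _, h2, _, h3, rfl, rfl, rfl⟩

theorem den_asg {c : Cst} {η : ℕ → ℕ} {T : ℕ} {b₁ b₂ b₃ : Bd} {e : EX} {M : Mem}
    (he : e.avoids [T] = true) :
    (asg T b₁ b₂ b₃ e).den c η M = setA M T (b₁.val c) (b₂.val c) (b₃.val c)
      fun p q r => e.ev c M (env3 η p q r) := by
  rw [asg, den_fors]
  suffices h : ∀ L : List (ℕ × ℕ × ℕ),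
      (∀ t ∈ L, t.1 < b₁.val c ∧ t.2.1 < b₂.val c ∧ t.2.2 < b₃.val c) → ∀ M' : Mem,
      (∀ a, a ≠ T → M' a = M a) →
      L.foldl (fun M t => (Stm.st T (.v 0) (.v 1) (.v 20) e).den c (env3 η t.1 t.2.1 t.2.2) M) M' =
        fun a p q r => if a = T ∧ (p, q, r) ∈ L then e.ev c M (env3 η p q r) else M' a p q r by
    rw [h _ (fun t ht => mem_triples.1 ht) M fun _ _ => rfl]
    funext a p q r
    simp only [mem_triples, setA]
  intro L
  induction L with
  | nil => intro _ M' _; funext a p q r; simp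
  | cons t L ih =>
    intro hL M' hM'
    obtain ⟨i, j, k⟩ := t
    have ht := hL _ List.mem_cons_self
    simp only at ht
    have hstep : (Stm.st T (.v 0) (.v 1) (.v 20) e).den c (env3 η i j k) M' =
        wr M' T i j k (e.ev c M (env3 η i j k)) := by
      simp only [den, ev, cut]
      rw [e.ev_congr (M' := M) (fun a ha => hM' a (by simpa using ha)) _ he]
      congr 1
    rw [List.foldl_cons, hstep, ih (fun t ht => hL t (List.mem_cons_of_mem _ ht))]
    · funext a p q r
      simp only [wr, List.mem_cons, Prod.mk.injEq]
      by_cases h1 : a = T ∧ (p, q, r) ∈ L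
      · rw [if_pos h1, if_pos ⟨h1.1, Or.inr h1.2⟩]
      · rw [if_neg h1]
        by_cases h2 : a = T ∧ p = i ∧ q = j ∧ r = k
        · rw [if_pos h2, if_pos ⟨h2.1, Or.inl h2.2⟩]
          obtain ⟨-, rfl, rfl, rfl⟩ := h2
          rfl
        · rw [if_neg h2, if_neg]
          rintro ⟨h3, h4 | h4⟩
          · exact h2 ⟨h3, h4⟩
          · exact h1 ⟨h3, h4⟩
    · intro a ha
      rw [wr_ne _ _ _ _ ha, hM' a ha]

theorem den_upd {c : Cst} {η : ℕ → ℕ} {T U : ℕ} {b₁ b₂ b₃ : Bd} {e : EX} {M : Mem}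
    (he : e.avoids [U] = true) (hTU : U ≠ T) :
    (upd T U b₁ b₂ b₃ e).den c η M =
      setA (setA M U (b₁.val c) (b₂.val c) (b₃.val c) fun p q r => e.ev c M (env3 η p q r))
        T (b₁.val c) (b₂.val c) (b₃.val c) fun p q r => e.ev c M (env3 η p q r) := by
  rw [upd, den, den_asg he, den_asg (by simp [EX.avoids, hTU])]
  funext a p q r
  by_cases h : a = T ∧ p < b₁.val c ∧ q < b₂.val c ∧ r < b₃.val c
  · obtain ⟨rfl, h3, h4, h5⟩ := h
    rw [setA_same h3 h4 h5, setA_same h3 h4 h5]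
    exact setA_same h3 h4 h5
  · conv_lhs => rw [setA]
    conv_rhs => rw [setA]
    rw [if_neg h, if_neg h]

theorem den_mrk {c : Cst} {η : ℕ → ℕ} {T : ℕ} {b₁ b₂ b₃ : Bd} {e e₁ e₂ e₃ : EX} {M : Mem}
    (he : e.avoids [T] = true) (h₁ : e₁.avoids [T] = true) (h₂ : e₂.avoids [T] = true)
    (h₃ : e₃.avoids [T] = true) (p q r : ℕ) :
    0 < (mrk T b₁ b₂ b₃ e e₁ e₂ e₃).den c η M T p q r ↔ 0 < M T p q r ∨
      ∃ i < b₁.val c, ∃ j < b₂.val c, ∃ k < b₃.val c, 0 < e.ev c M (env3 η i j k) ∧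
        p = e₁.cut c.P (e₁.ev c M (env3 η i j k)) ∧ q = e₂.cut c.P (e₂.ev c M (env3 η i j k)) ∧
        r = e₃.cut c.LIM (e₃.ev c M (env3 η i j k)) := by
  rw [mrk, den_fors]
  suffices h : ∀ L : List (ℕ × ℕ × ℕ), ∀ M' : Mem, (∀ a, a ≠ T → M' a = M a) →
      (0 < L.foldl (fun M t => (whenS e (.st T e₁ e₂ e₃ (.c 1))).den c
        (env3 η t.1 t.2.1 t.2.2) M) M' T p q r ↔ 0 < M' T p q r ∨
      ∃ t ∈ L, 0 < e.ev c M (env3 η t.1 t.2.1 t.2.2) ∧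
        p = e₁.cut c.P (e₁.ev c M (env3 η t.1 t.2.1 t.2.2)) ∧
        q = e₂.cut c.P (e₂.ev c M (env3 η t.1 t.2.1 t.2.2)) ∧
        r = e₃.cut c.LIM (e₃.ev c M (env3 η t.1 t.2.1 t.2.2))) by
    rw [h _ M fun _ _ => rfl]
    refine or_congr_right ⟨?_, ?_⟩
    · rintro ⟨t, ht, h⟩
      obtain ⟨h1, h2, h3⟩ := mem_triples.1 ht
      exact ⟨_, h1, _, h2, _, h3, h⟩
    · rintro ⟨i, h1, j, h2, k, h3, h⟩
      exact ⟨(i, j, k), mem_triples.2 ⟨h1, h2, h3⟩, h⟩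
  intro L
  induction L with
  | nil => intro M' _; simp
  | cons t L ih =>
    intro M' hM'
    have hz : ∀ a, a ∉ [T] → M' a = M a := fun a ha => hM' a (by simpa using ha)
    rw [List.foldl_cons, ih]
    · rw [den_whenS, e.ev_congr hz _ he]
      simp only [List.mem_cons, exists_eq_or_imp, den]
      rw [e₁.ev_congr hz _ h₁, e₂.ev_congr hz _ h₂, e₃.ev_congr hz _ h₃]
      by_cases hpos : 0 < e.ev c M (env3 η t.1 t.2.1 t.2.2)
      · simp only [hpos, if_true, wr, true_and, ev]
        split_ifs with h
        · simp [h]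
        · tauto
      · simp only [hpos, if_false, false_and, false_or]
    · intro a ha
      rw [den_whenS]
      split_ifs
      · exact (wr_ne _ _ _ _ ha).trans (hM' a ha)
      · exact hM' a ha

end Stm

end

section

open Finset

/-! ### Families of relations and refinements -/

/-- A family of sets of variables with a relation for each of them. -/
structure Fam where
  sets : Finset (Finset ℕ)
  rel : Finset ℕ → Set PMap

theorem PMap.hasDom_proj {g : PMap} {S T : Finset ℕ} (hg : g.HasDom T) (hS : S ⊆ T) :
    (g.proj S).HasDom S := by
  intro x
  simp only [PMap.proj]
  split_ifs with h
  · simp [h, hg x, hS h]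
  · simp [h]

theorem PMap.HasDom.ext {g h : PMap} {S : Finset ℕ} (hg : g.HasDom S) (hh : h.HasDom S)
    (e : ∀ x ∈ S, g x = h x) : g = h := by
  funext x
  by_cases hx : x ∈ S
  · exact e x hx
  · have h1 : ¬ (g x).isSome := fun h' => hx ((hg x).1 h')
    have h2 : ¬ (h x).isSome := fun h' => hx ((hh x).1 h')
    rw [Option.not_isSome_iff_eq_none.1 h1, Option.not_isSome_iff_eq_none.1 h2]

theorem PMap.proj_proj {g : PMap} {S T : Finset ℕ} (h : S ⊆ T) :
    (g.proj T).proj S = g.proj S := by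
  funext x
  simp only [PMap.proj]
  split_ifs with h1 h2 <;> first | rfl | exact absurd (h h1) h2

theorem PMap.proj_self {g : PMap} {S : Finset ℕ} (hg : g.HasDom S) : g.proj S = g :=
  (PMap.hasDom_proj hg (Subset.refl S)).ext hg fun x hx => by simp [PMap.proj, hx]

theorem PMap.proj_eq_proj {g h : PMap} {S : Finset ℕ} :
    g.proj S = h.proj S ↔ ∀ x ∈ S, g x = h x := by
  constructor
  · intro e x hx
    have := congrFun e x
    simpa [PMap.proj, hx] using this
  · intro e
    funext x
    simp only [PMap.proj]
    split_ifs with hx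
    · exact e x hx
    · rfl

theorem PMap.proj_empty (g h : PMap) : g.proj ∅ = h.proj ∅ := by
  rw [PMap.proj_eq_proj]; simp

namespace Fam

/-- The solutions that are compatible with all relations of the family. -/
def sol (φ : QFCQ) (A : Struct) (σ : Fam) : Set PMap :=
  {g | g ∈ evalConj φ.conj A ∧ ∀ S ∈ σ.sets, g.proj S ∈ σ.rel S}

/-- The locally consistent mappings with domain `G`. -/
def loc (σ : Fam) (G : Finset ℕ) : Set PMap :=
  {g | g.HasDom G ∧ ∀ U ∈ σ.sets, ∃ u ∈ σ.rel U, ∀ x ∈ U ∩ G, u x = g x}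

def Cons (σ : Fam) : Prop :=
  ∀ S ∈ σ.sets, ∀ T ∈ σ.sets, S ⊆ T → σ.rel S = PMap.proj S '' σ.rel T

/-- Basic well-formedness. -/
structure WF (φ : QFCQ) (A : Struct) (σ : Fam) : Prop where
  sub : ∀ S ∈ σ.sets, S ⊆ φ.vars
  down : ∀ S ∈ σ.sets, ∀ T ⊆ S, T ∈ σ.sets
  dom : ∀ S ∈ σ.sets, ∀ g ∈ σ.rel S, g.HasDom S ∧ ∀ x a, g x = some a → a ∈ A.univ

/-- Every atom of the query is represented in the family. -/
def Atoms (φ : QFCQ) (A : Struct) (σ : Fam) : Prop :=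
  ∀ α ∈ φ.conj, α.vars ∈ σ.sets ∧ ∀ g ∈ σ.rel α.vars, α.Holds A g

/-- The final states of the splitting process. -/
structure Good (φ : QFCQ) (A : Struct) (σ : Fam) (M ε : ℝ) : Prop where
  cons : σ.Cons
  card_le : ∀ S ∈ σ.sets, ((σ.rel S).ncard : ℝ) ≤ M
  strong : ∀ S ∈ σ.sets, ∀ T ∈ σ.sets, S ∪ T ∉ σ.sets → M < ((σ.loc (S ∪ T)).ncard : ℝ)
  unif : ∀ S ∈ σ.sets, ∀ T ∈ σ.sets, S ⊆ T → ∀ g ∈ σ.rel S,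
    ({h ∈ σ.rel T | h.proj S = g}.ncard : ℝ) * ((σ.rel S).ncard : ℝ) ≤
      (maxRelCard φ A : ℝ) ^ ε * ((σ.rel T).ncard : ℝ)

variable {φ : QFCQ} {A : Struct} {σ : Fam}

theorem WF.finite (h : σ.WF φ A) {S : Finset ℕ} (hS : S ∈ σ.sets) : (σ.rel S).Finite :=
  finite_of_hasDom A.univ S _ fun g hg =>
    ⟨(h.dom S hS g hg).1, fun x _ a hx => (h.dom S hS g hg).2 x a hx⟩

theorem Cons.rel_subset_loc (hc : σ.Cons) (h : σ.WF φ A) {S : Finset ℕ} (hS : S ∈ σ.sets) :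
    σ.rel S = σ.loc S := by
  ext g
  constructor
  · intro hg
    refine ⟨(h.dom S hS g hg).1, fun U hU => ?_⟩
    have hW : U ∩ S ∈ σ.sets := h.down S hS _ inter_subset_right
    have h1 : g.proj (U ∩ S) ∈ σ.rel (U ∩ S) := by
      rw [hc _ hW S hS inter_subset_right]; exact ⟨g, hg, rfl⟩
    rw [hc _ hW U hU inter_subset_left] at h1
    obtain ⟨u, hu, e⟩ := h1
    exact ⟨u, hu, PMap.proj_eq_proj.1 e⟩
  · rintro ⟨hd, hg⟩
    obtain ⟨u, hu, e⟩ := hg S hS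
    have : u = g := (h.dom S hS u hu).1.ext hd (by simpa using e)
    exact this ▸ hu

theorem Atoms.empty_mem (ha : σ.Atoms φ A) (h : σ.WF φ A) : ∅ ∈ σ.sets := by
  obtain ⟨p, hp⟩ := List.exists_mem_of_ne_nil _ φ.atoms_ne_nil
  have : Atom.mk (RelSym.base p.1 p.2.length) p.2 ∈ φ.conj := by
    simp only [QFCQ.conj, List.mem_toFinset, List.mem_map]
    exact ⟨p, hp, rfl⟩
  exact h.down _ (ha _ this).1 _ (empty_subset _)

theorem Atoms.singleton_mem (ha : σ.Atoms φ A) (h : σ.WF φ A) {x : ℕ} (hx : x ∈ φ.vars) :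
    {x} ∈ σ.sets := by
  obtain ⟨α, hα, hx⟩ := mem_biUnion.1 hx
  exact h.down _ (ha α hα).1 _ (singleton_subset_iff.2 hx)

open Classical in
/-- The structure belonging to a family. -/
noncomputable def str (σ : Fam) (h : σ.WF φ A) : Struct where
  univ := A.univ
  rel
    | .base n r => A.rel (.base n r)
    | .sub S => if hS : S ∈ σ.sets then
        (h.finite hS).toFinset.image fun g => (varTuple S).map fun x => (g x).getD 0 else ∅
  length_eq R t ht := by
    cases R with
    | base n r => exact A.length_eq _ t ht
    | sub S =>
      simp only at ht
      split_ifs at ht with hS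
      · obtain ⟨g, -, rfl⟩ := mem_image.1 ht
        simp [varTuple, RelSym.arity]
      · simp at ht
  mem_univ R t ht a ha := by
    cases R with
    | base n r => exact A.mem_univ _ t ht a ha
    | sub S =>
      simp only at ht
      split_ifs at ht with hS
      · obtain ⟨g, hg, rfl⟩ := mem_image.1 ht
        obtain ⟨x, hx, rfl⟩ := List.mem_map.1 ha
        obtain ⟨hd, hu⟩ := h.dom S hS g ((h.finite hS).mem_toFinset.1 hg)
        obtain ⟨b, hb⟩ := Option.isSome_iff_exists.1 ((hd x).2 (by simpa [varTuple] using hx))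
        rw [hb]
        exact hu x b hb
      · simp at ht

theorem holds_str_sub (h : σ.WF φ A) {S : Finset ℕ} (hS : S ∈ σ.sets) {g : PMap} :
    (subAtom S).Holds (σ.str h) g ↔ ∃ u ∈ σ.rel S, ∀ x ∈ S, g x = u x := by
  have key : ∀ u ∈ σ.rel S, (varTuple S).map g =
      ((varTuple S).map fun x => (u x).getD 0).map some ↔ ∀ x ∈ S, g x = u x := by
    intro u hu
    rw [List.map_map, List.map_inj_left]
    simp only [varTuple, mem_sort, Function.comp_apply]
    refine forall₂_congr fun x hx => ?_
    obtain ⟨b, hb⟩ := Option.isSome_iff_exists.1 (((h.dom S hS u hu).1 x).2 hx)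
    rw [hb]; rfl
  constructor
  · rintro ⟨t, ht, e⟩
    simp only [subAtom, str, dif_pos hS, mem_image, Set.Finite.mem_toFinset] at ht
    obtain ⟨u, hu, rfl⟩ := ht
    exact ⟨u, hu, (key u hu).1 e⟩
  · rintro ⟨u, hu, e⟩
    refine ⟨(varTuple S).map fun x => (u x).getD 0, ?_, (key u hu).2 e⟩
    simp only [subAtom, str, dif_pos hS, mem_image, Set.Finite.mem_toFinset]
    exact ⟨u, hu, rfl⟩

theorem base_of_mem_conj {α : Atom} (hα : α ∈ φ.conj) : ∃ n r, α.sym = .base n r := by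
  simp only [QFCQ.conj, List.mem_toFinset, List.mem_map] at hα
  obtain ⟨p, -, rfl⟩ := hα
  exact ⟨_, _, rfl⟩

theorem holds_str_base (h : σ.WF φ A) {α : Atom} (hα : α ∈ φ.conj) {g : PMap} :
    α.Holds (σ.str h) g ↔ α.Holds A g := by
  obtain ⟨n, r, e⟩ := base_of_mem_conj hα
  simp only [Atom.Holds, e, str]

/-- The refinement belonging to a family. -/
noncomputable def ref (σ : Fam) (h : σ.WF φ A) (hA : A.IsOver φ.signature) : Refinement φ A where
  sets := σ.sets
  subset_vars := h.sub
  down_closed := h.down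
  str := σ.str h
  isOver R hR := by
    simp only [conjSignature, QFCQ.extend, mem_image, mem_union, not_exists, not_and] at hR
    cases R with
    | base n r =>
      refine hA _ fun hR' => ?_
      obtain ⟨α, hα, e⟩ := mem_image.1 hR'
      exact hR α (Or.inl hα) e
    | sub S =>
      simp only [str]
      rw [dif_neg]
      intro hS
      exact hR (subAtom S) (Or.inr ⟨S, hS, rfl⟩) rfl
  univ_eq := rfl
  rel_eq R hR := by
    obtain ⟨α, hα, rfl⟩ := mem_image.1 hR
    obtain ⟨n, r, e⟩ := base_of_mem_conj hα
    rw [e]; rfl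

theorem subAtom_vars (S : Finset ℕ) : (subAtom S).vars = S := by
  simp [subAtom, Atom.vars, varTuple]

variable (h : σ.WF φ A) (hA : A.IsOver φ.signature)

theorem maps_ref {S : Finset ℕ} (hS : S ∈ σ.sets) : (σ.ref h hA).maps S = σ.rel S := by
  ext g
  simp only [Refinement.maps, evalConj, conjVars, singleton_biUnion, mem_singleton, forall_eq,
    Set.mem_ofPred_eq, subAtom_vars]
  rw [show (σ.ref h hA).str = σ.str h from rfl, holds_str_sub h hS]
  constructor
  · rintro ⟨hd, u, hu, e⟩
    exact hd.ext (h.dom S hS u hu).1 e ▸ hu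
  · exact fun hg => ⟨(h.dom S hS g hg).1, g, hg, fun _ _ => rfl⟩

theorem localResult_ref (ha : σ.Atoms φ A) (S : Finset ℕ) :
    (σ.ref h hA).localResult S = σ.loc S := by
  ext g
  simp only [Refinement.localResult, evalLocal, loc, Set.mem_ofPred_eq, Refinement.query,
    QFCQ.extend, mem_union, mem_image]
  rw [show (σ.ref h hA).str = σ.str h from rfl]
  refine and_congr_right fun _ => ⟨fun H U hU => ?_, ?_⟩
  · obtain ⟨f, hd, hf, e⟩ := H (subAtom U) (Or.inr ⟨U, hU, rfl⟩)
    rw [subAtom_vars] at hd e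
    obtain ⟨u, hu, e'⟩ := (holds_str_sub h hU).1 hf
    exact ⟨u, hu, fun x hx => (e' x (mem_inter.1 hx).1).symm.trans (e x hx)⟩
  · rintro H α (hα | ⟨U, hU, rfl⟩)
    · obtain ⟨u, hu, e⟩ := H _ (ha α hα).1
      exact ⟨u, (h.dom _ (ha α hα).1 u hu).1, (holds_str_base h hα).2 ((ha α hα).2 u hu), e⟩
    · obtain ⟨u, hu, e⟩ := H U hU
      refine ⟨u, ?_, (holds_str_sub h hU).2 ⟨u, hu, fun _ _ => rfl⟩, ?_⟩
      · rw [subAtom_vars]; exact (h.dom U hU u hu).1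
      · rw [subAtom_vars]; exact e

theorem result_ref : (σ.ref h hA).result = σ.sol φ A := by
  have hv : conjVars (φ.extend σ.sets) = φ.vars := by
    unfold QFCQ.extend QFCQ.vars conjVars
    rw [union_biUnion, union_eq_left, image_biUnion]
    intro x hx
    simp only [mem_biUnion, subAtom_vars] at hx
    obtain ⟨S, hS, hx⟩ := hx
    exact h.sub S hS hx
  ext g
  simp only [Refinement.result, Refinement.query, evalConj, sol, Set.mem_ofPred_eq]
  rw [show (σ.ref h hA).str = σ.str h from rfl, show (σ.ref h hA).sets = σ.sets from rfl, hv]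
  change g.HasDom φ.vars ∧ _ ↔ (g.HasDom φ.vars ∧ _) ∧ _
  rw [and_assoc]
  refine and_congr_right fun hd => ⟨fun H => ⟨fun α hα => ?_, fun S hS => ?_⟩, ?_⟩
  · exact (holds_str_base h hα).1 (H α (mem_union_left _ hα))
  · obtain ⟨u, hu, e⟩ := (holds_str_sub h hS).1
      (H _ (mem_union_right _ (mem_image_of_mem _ hS)))
    have : g.proj S = u := (PMap.hasDom_proj hd (h.sub S hS)).ext (h.dom S hS u hu).1
      fun x hx => by simpa [PMap.proj, hx] using e x hx
    exact this ▸ hu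
  · rintro ⟨H1, H2⟩ α hα
    rcases mem_union.1 hα with hα | hα
    · exact (holds_str_base h hα).2 (H1 α hα)
    · obtain ⟨S, hS, rfl⟩ := mem_image.1 hα
      exact (holds_str_sub h hS).2 ⟨_, H2 S hS, fun x hx => by simp [PMap.proj, hx]⟩

theorem consistent_ref (ha : σ.Atoms φ A) (hc : σ.Cons) : (σ.ref h hA).Consistent := by
  refine ⟨fun S hS => ?_, fun S hS T hT hST => ?_⟩
  · rw [maps_ref h hA hS, localResult_ref h hA ha, hc.rel_subset_loc h hS]
  · rw [maps_ref h hA hS, maps_ref h hA hT, hc S hS T hT hST.subset]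

theorem strongly_ref (ha : σ.Atoms φ A) {M ε : ℝ} (hg : σ.Good φ A M ε) :
    (σ.ref h hA).StronglyMConsistent M := by
  have hsets : (σ.ref h hA).sets = σ.sets := rfl
  refine ⟨⟨consistent_ref h hA ha hg.cons, fun S hS => ⟨fun hS' T hT => ?_, fun H => ?_⟩⟩,
    fun S hS T hT hST => ?_⟩
  · rw [localResult_ref h hA ha, ← hg.cons.rel_subset_loc h (h.down S hS' T hT)]
    exact hg.card_le T (h.down S hS' T hT)
  · rw [hsets]
    induction S using Finset.strongInduction with
    | H S ih =>
      have hsub : ∀ T, T ⊂ S → T ∈ σ.sets := fun T hT =>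
        ih T hT (hT.subset.trans hS) fun U hU => H U (hU.trans hT.subset)
      rcases S.eq_empty_or_nonempty with rfl | ⟨x, hx⟩
      · exact ha.empty_mem h
      · by_contra hSn
        have h1 : S.erase x ∈ σ.sets := hsub _ (erase_ssubset hx)
        have h2 : {x} ∈ σ.sets := ha.singleton_mem h (hS hx)
        have e : S.erase x ∪ {x} = S := by
          ext y; simp only [mem_union, mem_erase, mem_singleton]
          by_cases hy : y = x
          · subst hy; simp [hx]
          · simp [hy]
        have := hg.strong _ h1 _ h2 (by rw [e]; exact hSn)
        rw [e, ← localResult_ref h hA ha] at this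
        exact absurd (H S (Subset.refl S)) (not_le.2 this)
  · rw [localResult_ref h hA ha]
    exact hg.strong S hS T hT hST

theorem uniform_ref (ha : σ.Atoms φ A) {M ε : ℝ} (hg : σ.Good φ A M ε)
    (hne : (σ.rel ∅).Nonempty) : (σ.ref h hA).Uniform ε := by
  have h0 := ha.empty_mem h
  have hne' : ∀ S ∈ σ.sets, (σ.rel S).Nonempty := fun S hS => by
    rw [hg.cons ∅ h0 S hS (empty_subset _)] at hne
    exact hne.of_image
  refine ⟨fun S hS => ?_, consistent_ref h hA ha hg.cons, fun S hS T hT hST => ?_⟩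
  · obtain ⟨g, hg⟩ := hne' S hS
    have : (subAtom S).Holds (σ.str h) g := (holds_str_sub h hS).2 ⟨g, hg, fun _ _ => rfl⟩
    obtain ⟨t, ht, -⟩ := this
    exact ⟨t, ht⟩
  · have hpos : (0 : ℝ) < (σ.rel S).ncard := by
      exact_mod_cast (Set.ncard_pos (h.finite hS)).2 (hne' S hS)
    rw [Refinement.avgdeg, Refinement.maxdeg, maps_ref h hA hS, maps_ref h hA hT, ← mul_div_assoc,
      le_div_iff₀ hpos]
    have hne2 : ((fun g => {h ∈ σ.rel T | PMap.proj S h = g}.ncard) '' σ.rel S).Nonempty :=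
      (hne' S hS).image _
    obtain ⟨g, hgS, e⟩ := Nat.sSup_mem hne2 ((h.finite hS).image _).bddAbove
    rw [← e]
    exact hg.unif S hS T hT hST g hgS

/-! ### The potential -/

/-- The maximal number of extensions in `R_T` of a mapping with domain `S`. -/
noncomputable def maxExt (σ : Fam) (S T : Finset ℕ) : ℕ :=
  sSup (Set.range fun g => {h ∈ σ.rel T | PMap.proj S h = g}.ncard)

open Classical in
/-- The potential of a family. -/
noncomputable def pot (V : Finset ℕ) (L δ : ℝ) (σ : Fam) : ℝ :=
  ((V.powerset \ σ.sets).card : ℝ) + ∑ p ∈ V.powerset ×ˢ V.powerset,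
    (if p.2 ∈ σ.sets then Real.log (σ.maxExt p.1 p.2) else L) / δ

theorem bddAbove_ext {S T : Finset ℕ} (hf : (σ.rel T).Finite) :
    BddAbove (Set.range fun g => {h ∈ σ.rel T | PMap.proj S h = g}.ncard) := by
  refine ⟨(σ.rel T).ncard, ?_⟩
  rintro _ ⟨g, rfl⟩
  exact Set.ncard_le_ncard (Set.sep_subset _ _) hf

theorem le_maxExt {S T : Finset ℕ} (hf : (σ.rel T).Finite) (g : PMap) :
    {h ∈ σ.rel T | PMap.proj S h = g}.ncard ≤ σ.maxExt S T :=
  le_csSup (bddAbove_ext hf) ⟨g, rfl⟩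

theorem maxExt_mem (σ : Fam) (S T : Finset ℕ) (hf : (σ.rel T).Finite) :
    ∃ g, {h ∈ σ.rel T | PMap.proj S h = g}.ncard = σ.maxExt S T :=
  Nat.sSup_mem (Set.range_nonempty _) (bddAbove_ext hf)

theorem maxExt_le_card {S T : Finset ℕ} (hf : (σ.rel T).Finite) :
    σ.maxExt S T ≤ (σ.rel T).ncard := by
  obtain ⟨g, e⟩ := maxExt_mem σ S T hf
  rw [← e]
  exact Set.ncard_le_ncard (Set.sep_subset _ _) hf

theorem maxExt_pos {S T : Finset ℕ} (hf : (σ.rel T).Finite) (hn : (σ.rel T).Nonempty) :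
    0 < σ.maxExt S T := by
  obtain ⟨g, hg⟩ := hn
  refine lt_of_lt_of_le ?_ (le_maxExt hf (g.proj S))
  have hmem : g ∈ {h ∈ σ.rel T | PMap.proj S h = PMap.proj S g} := ⟨hg, rfl⟩
  exact (Set.ncard_pos (hf.subset (Set.sep_subset _ _))).2 ⟨g, hmem⟩

theorem maxExt_empty {T : Finset ℕ} (hf : (σ.rel T).Finite) :
    σ.maxExt ∅ T = (σ.rel T).ncard := by
  refine le_antisymm (maxExt_le_card hf) ?_
  refine le_trans (le_of_eq ?_) (le_maxExt hf (PMap.proj ∅ fun _ => none))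
  congr 1
  ext h
  simp [PMap.proj_empty h fun _ => none]

theorem ncard_sep_mono {Y Z : Set PMap} (hs : Y ⊆ Z) (hf : Z.Finite) (p : PMap → Prop) :
    {h ∈ Y | p h}.ncard ≤ {h ∈ Z | p h}.ncard := by
  refine Set.ncard_le_ncard ?_ (hf.subset (Set.sep_subset _ _))
  rintro h ⟨h1, h2⟩
  exact ⟨hs h1, h2⟩

theorem maxExt_mono {σ' : Fam} {S T : Finset ℕ} (hf : (σ.rel T).Finite)
    (hs : σ'.rel T ⊆ σ.rel T) : σ'.maxExt S T ≤ σ.maxExt S T := by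
  obtain ⟨g, e⟩ := maxExt_mem σ' S T (hf.subset hs)
  rw [← e]
  exact (ncard_sep_mono hs hf _).trans (le_maxExt hf g)

/-- `σ` is below `τ`: it has more sets and smaller relations. -/
structure Below (σ τ : Fam) : Prop where
  sets : τ.sets ⊆ σ.sets
  rel : ∀ S ∈ τ.sets, σ.rel S ⊆ τ.rel S

/-- Finite nonempty relations of size at most `M`. -/
def Bounded (σ : Fam) (M : ℝ) : Prop :=
  ∀ S ∈ σ.sets, (σ.rel S).Finite ∧ (σ.rel S).Nonempty ∧ ((σ.rel S).ncard : ℝ) ≤ M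

theorem log_maxExt_nonneg (S T : Finset ℕ) : 0 ≤ Real.log (σ.maxExt S T) :=
  Real.log_natCast_nonneg _

theorem pot_nonneg {V : Finset ℕ} {L δ : ℝ} (hL : 0 ≤ L) (hδ : 0 ≤ δ) : 0 ≤ σ.pot V L δ := by
  refine add_nonneg (Nat.cast_nonneg _) (sum_nonneg fun p _ => div_nonneg ?_ hδ)
  split_ifs
  · exact log_maxExt_nonneg _ _
  · exact hL

theorem Bounded.log_le {M : ℝ} (hb : σ.Bounded M) {S T : Finset ℕ} (hT : T ∈ σ.sets) :
    Real.log (σ.maxExt S T) ≤ Real.log M := by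
  obtain ⟨hf, hn, hM⟩ := hb T hT
  refine Real.log_le_log (by exact_mod_cast maxExt_pos hf hn) (le_trans ?_ hM)
  exact_mod_cast maxExt_le_card hf

theorem pot_le {V : Finset ℕ} {M δ : ℝ} (hδ : 0 ≤ δ) (hb : σ.Bounded M) :
    σ.pot V (Real.log M) δ ≤ 2 ^ V.card + 4 ^ V.card * (Real.log M / δ) := by
  refine add_le_add ?_ ?_
  · refine le_trans (Nat.cast_le.2 (card_le_card sdiff_subset)) ?_
    rw [card_powerset]; simp
  · refine (sum_le_card_nsmul _ _ (Real.log M / δ) fun p _ => ?_).trans ?_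
    · refine div_le_div_of_nonneg_right ?_ hδ
      split_ifs with hp
      · exact hb.log_le hp
      · exact le_rfl
    · rw [card_product, card_powerset, nsmul_eq_mul]
      push_cast
      rw [← mul_pow]; norm_num

/-- Passing to a smaller family decreases the potential by one, if a set is added or a maximal
degree drops by a factor `exp δ`. -/
theorem pot_drop {τ : Fam} {V : Finset ℕ} {M δ : ℝ} (hδ : 0 ≤ δ) (hb : σ.Bounded M)
    (hb' : τ.Bounded M) (hV : ∀ S ∈ σ.sets, S ⊆ V) (hle : σ.Below τ)
    (hd : (∃ S ∈ σ.sets, S ∉ τ.sets) ∨ (0 < δ ∧ ∃ S T, S ⊆ V ∧ T ∈ τ.sets ∧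
      Real.exp δ * (σ.maxExt S T : ℝ) ≤ τ.maxExt S T)) :
    σ.pot V (Real.log M) δ + 1 ≤ τ.pot V (Real.log M) δ := by
  have hterm : ∀ p ∈ V.powerset ×ˢ V.powerset,
      (if p.2 ∈ σ.sets then Real.log (σ.maxExt p.1 p.2) else Real.log M) / δ ≤
      (if p.2 ∈ τ.sets then Real.log (τ.maxExt p.1 p.2) else Real.log M) / δ := by
    intro p _
    refine div_le_div_of_nonneg_right ?_ hδ
    by_cases h1 : p.2 ∈ τ.sets
    · rw [if_pos (hle.sets h1), if_pos h1]
      obtain ⟨hf, hn, -⟩ := hb _ (hle.sets h1)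
      refine Real.log_le_log (by exact_mod_cast maxExt_pos hf hn) ?_
      exact_mod_cast maxExt_mono (hb' _ h1).1 (hle.rel _ h1)
    · rw [if_neg h1]
      split_ifs with h2
      · exact hb.log_le h2
      · exact le_rfl
  have hcard : V.powerset \ σ.sets ⊆ V.powerset \ τ.sets :=
    sdiff_subset_sdiff (Subset.refl _) hle.sets
  rcases hd with ⟨S, hS, hS'⟩ | ⟨hδ', S, T, hS, hT, hdrop⟩
  · have h1 : (V.powerset \ σ.sets).card < (V.powerset \ τ.sets).card := by
      refine card_lt_card ⟨hcard, fun hc => ?_⟩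
      have : S ∈ V.powerset \ τ.sets := mem_sdiff.2 ⟨mem_powerset.2 (hV S hS), hS'⟩
      exact (mem_sdiff.1 (hc this)).2 hS
    have h2 : ((V.powerset \ σ.sets).card : ℝ) + 1 ≤ ((V.powerset \ τ.sets).card : ℝ) := by
      exact_mod_cast h1
    have h3 := sum_le_sum hterm
    unfold pot
    linarith
  · have h2 : ((V.powerset \ σ.sets).card : ℝ) ≤ ((V.powerset \ τ.sets).card : ℝ) := by
      exact_mod_cast card_le_card hcard
    have hmem : (S, T) ∈ V.powerset ×ˢ V.powerset :=
      mem_product.2 ⟨mem_powerset.2 hS, mem_powerset.2 (hV T (hle.sets hT))⟩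
    have h3 := add_le_add (a := (if T ∈ σ.sets then Real.log (σ.maxExt S T) else Real.log M) / δ + 1)
      (b := (if T ∈ τ.sets then Real.log (τ.maxExt S T) else Real.log M) / δ) (by
        rw [if_pos (hle.sets hT), if_pos hT]
        obtain ⟨hf, hn, -⟩ := hb _ (hle.sets hT)
        have hpos : (0 : ℝ) < σ.maxExt S T := by exact_mod_cast maxExt_pos hf hn
        have := Real.log_le_log (by positivity) hdrop
        rw [Real.log_mul (Real.exp_pos _).ne' hpos.ne', Real.log_exp] at this
        rw [div_add_one hδ'.ne']
        exact div_le_div_of_nonneg_right (by linarith) hδ)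
      (sum_le_sum fun p (hp : p ∈ (V.powerset ×ˢ V.powerset).erase (S, T)) =>
        hterm p (mem_of_mem_erase hp))
    unfold pot
    rw [← add_sum_erase _ _ hmem, ← add_sum_erase _ _ hmem]
    simp only at h3 ⊢
    linarith

end Fam

end

section

open Finset

namespace Fam

variable {φ : QFCQ} {A : Struct} {σ τ : Fam}

/-- The number of extensions in `R_T` of a mapping. -/
noncomputable def ext (σ : Fam) (S T : Finset ℕ) (g : PMap) : ℕ :=
  {h ∈ σ.rel T | PMap.proj S h = g}.ncard

theorem sum_ext_le {S T : Finset ℕ} (hf : (τ.rel T).Finite) {Y : Finset PMap} :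
    ∑ g ∈ Y, τ.ext S T g ≤ (τ.rel T).ncard := by
  classical
  have e : ∀ g, τ.ext S T g = (hf.toFinset.filter fun h => PMap.proj S h = g).card := by
    intro g
    rw [ext, ← Set.ncard_coe_finset]
    congr 1
    ext h
    simp
  simp only [e]
  rw [Set.ncard_eq_toFinset_card _ hf]
  refine le_trans (le_of_eq ?_) (card_filter_le hf.toFinset fun h => PMap.proj S h ∈ Y)
  convert sum_card_fiberwise_eq_card_filter hf.toFinset Y (PMap.proj S)

theorem Below.refl (σ : Fam) : σ.Below σ := ⟨Subset.refl _, fun _ _ => Set.Subset.rfl⟩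

theorem Below.trans {ρ : Fam} (h : σ.Below τ) (h' : τ.Below ρ) : σ.Below ρ :=
  ⟨h'.sets.trans h.sets, fun S hS => (h.rel S (h'.sets hS)).trans (h'.rel S hS)⟩

/-- Keeping the mappings of large degree decreases the relation. -/
theorem maxExt_large {S T : Finset ℕ} (hfS : (τ.rel S).Finite) (hfT : (τ.rel T).Finite) (hne : (τ.rel T).Nonempty)
    (hrel : σ.rel S ⊆ τ.rel S) {r : ℝ}
    (hl : ∀ g ∈ σ.rel S, r * (τ.rel T).ncard ≤ (τ.ext S T g : ℝ) * (τ.rel S).ncard) :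
    r * (σ.maxExt ∅ S : ℝ) ≤ τ.maxExt ∅ S := by
  have hfσ := hfS.subset hrel
  rw [maxExt_empty hfσ, maxExt_empty hfS]
  have hpos : (0 : ℝ) < (τ.rel T).ncard := by exact_mod_cast (Set.ncard_pos hfT).2 hne
  have h1 : ∑ g ∈ hfσ.toFinset, r * ((τ.rel T).ncard : ℝ) ≤
      ∑ g ∈ hfσ.toFinset, (τ.ext S T g : ℝ) * (τ.rel S).ncard :=
    sum_le_sum fun g hg => hl g (hfσ.mem_toFinset.1 hg)
  rw [sum_const, nsmul_eq_mul, ← sum_mul, ← Set.ncard_eq_toFinset_card _ hfσ] at h1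
  have h2 : (∑ g ∈ hfσ.toFinset, (τ.ext S T g : ℝ)) ≤ (τ.rel T).ncard := by
    exact_mod_cast sum_ext_le hfT
  have h3 := mul_le_mul_of_nonneg_right h2 (Nat.cast_nonneg (α := ℝ) (τ.rel S).ncard)
  refine le_of_mul_le_mul_right ?_ hpos
  nlinarith

/-- Keeping the mappings of small degree decreases the maximal degree. -/
theorem maxExt_small (hc : σ.Cons) {S T : Finset ℕ} (hS : S ∈ σ.sets) (hT : T ∈ σ.sets)
    (hST : S ⊆ T) (hfS : (τ.rel S).Finite) (hfT : (τ.rel T).Finite) (hneS : (τ.rel S).Nonempty)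
    (hrel : σ.rel T ⊆ τ.rel T) {r : ℝ} (hr : 0 ≤ r)
    (hl : ∀ g ∈ σ.rel S, (τ.ext S T g : ℝ) * (τ.rel S).ncard ≤ r * (τ.rel T).ncard)
    {g₀ : PMap} (hg₀ : r ^ 2 * (τ.rel T).ncard ≤ (τ.ext S T g₀ : ℝ) * (τ.rel S).ncard) :
    r * (σ.maxExt S T : ℝ) ≤ τ.maxExt S T := by
  have hpos : (0 : ℝ) < (τ.rel S).ncard := by exact_mod_cast (Set.ncard_pos hfS).2 hneS
  have h0 : (τ.ext S T g₀ : ℝ) ≤ τ.maxExt S T := by exact_mod_cast le_maxExt hfT g₀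
  obtain ⟨g, hg⟩ := maxExt_mem σ S T (hfT.subset hrel)
  have h1 : (σ.maxExt S T : ℝ) * (τ.rel S).ncard ≤ r * (τ.rel T).ncard := by
    by_cases hgS : g ∈ σ.rel S
    · refine le_trans (mul_le_mul_of_nonneg_right ?_ hpos.le) (hl g hgS)
      rw [← hg]
      exact_mod_cast ncard_sep_mono hrel hfT fun h => PMap.proj S h = g
    · have : {h ∈ σ.rel T | PMap.proj S h = g} = ∅ := by
        rw [Set.eq_empty_iff_forall_notMem]
        rintro h ⟨h1, h2⟩
        refine hgS ?_
        rw [hc S hS T hT hST]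
        exact ⟨h, h1, h2⟩
      rw [← hg, this, Set.ncard_empty, Nat.cast_zero, zero_mul]
      positivity
  refine le_of_mul_le_mul_right ?_ hpos
  calc r * (σ.maxExt S T : ℝ) * (τ.rel S).ncard = r * ((σ.maxExt S T : ℝ) * (τ.rel S).ncard) := by
        ring
    _ ≤ r * (r * (τ.rel T).ncard) := mul_le_mul_of_nonneg_left h1 hr
    _ = r ^ 2 * (τ.rel T).ncard := by ring
    _ ≤ _ := hg₀.trans (mul_le_mul_of_nonneg_right h0 hpos.le)

/-- All consistent families below `σ` have potential at most `n`. -/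
def PotLE (φ : QFCQ) (A : Struct) (V : Finset ℕ) (M δ n : ℝ) (σ : Fam) : Prop :=
  ∀ σ' : Fam, σ'.WF φ A → σ'.Cons → σ'.Bounded M → σ'.Below σ → σ'.pot V (Real.log M) δ ≤ n

variable {V : Finset ℕ} {M δ n : ℝ}

theorem PotLE.below (h : PotLE φ A V M δ n τ) (hb : σ.Below τ) : PotLE φ A V M δ n σ :=
  fun σ' h1 h2 h3 h4 => h σ' h1 h2 h3 (h4.trans hb)

theorem PotLE.join (hV : φ.vars ⊆ V) (hδ : 0 ≤ δ) (hw : τ.WF φ A) (hc : τ.Cons)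
    (hbd : τ.Bounded M) (h : PotLE φ A V M δ n τ) (hb : σ.Below τ) {G : Finset ℕ}
    (hG : G ∈ σ.sets) (hG' : G ∉ τ.sets) : PotLE φ A V M δ (n - 1) σ := by
  intro σ' h1 h2 h3 h4
  have := pot_drop hδ h3 hbd (fun S hS => (h1.sub S hS).trans hV) (h4.trans hb)
    (Or.inl ⟨G, h4.sets hG, hG'⟩)
  have := h τ hw hc hbd (Below.refl τ)
  linarith

theorem PotLE.drop (hV : φ.vars ⊆ V) (hδ : 0 < δ) (hw : τ.WF φ A) (hc : τ.Cons)
    (hbd : τ.Bounded M) (h : PotLE φ A V M δ n τ) (hb : σ.Below τ) {S T : Finset ℕ}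
    (hS : S ⊆ V) (hT : T ∈ τ.sets)
    (hd : ∀ σ' : Fam, σ'.Cons → σ'.Below σ → Real.exp δ * (σ'.maxExt S T : ℝ) ≤ τ.maxExt S T) :
    PotLE φ A V M δ (n - 1) σ := by
  intro σ' h1 h2 h3 h4
  have := pot_drop hδ.le h3 hbd (fun S hS => (h1.sub S hS).trans hV) (h4.trans hb)
    (Or.inr ⟨hδ, S, T, hS, hT, hd σ' h2 h4⟩)
  have := h τ hw hc hbd (Below.refl τ)
  linarith

/-- The mapping `g` has large degree. -/
def Large (φ : QFCQ) (A : Struct) (ε : ℝ) (τ : Fam) (S T : Finset ℕ) (g : PMap) : Prop :=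
  ¬ (((τ.ext S T g * (τ.rel S).ncard) ^ 2 : ℕ) : ℝ) ≤
    (((τ.rel T).ncard ^ 2 : ℕ) : ℝ) * (maxRelCard φ A : ℝ) ^ ε

/-- The mapping `g` has degree too large for a uniform family. -/
def TooLarge (φ : QFCQ) (A : Struct) (ε : ℝ) (τ : Fam) (S T : Finset ℕ) (g : PMap) : Prop :=
  ¬ ((τ.ext S T g * (τ.rel S).ncard : ℕ) : ℝ) ≤
    ((τ.rel T).ncard : ℝ) * (maxRelCard φ A : ℝ) ^ ε

theorem ext_le (hf : (τ.rel T).Finite) (S : Finset ℕ) (g : PMap) :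
    τ.ext S T g ≤ (τ.rel T).ncard :=
  Set.ncard_le_ncard (Set.sep_subset _ _) hf

theorem TooLarge.two_le {c ε : ℝ} (hc : 0 < c) (hbd : τ.Bounded ((maxRelCard φ A : ℝ) ^ c))
    {S T : Finset ℕ} (hS : S ∈ τ.sets) (hT : T ∈ τ.sets) {g : PMap}
    (hg : TooLarge φ A ε τ S T g) : 2 ≤ maxRelCard φ A := by
  by_contra hm
  refine hg ?_
  have hcase : maxRelCard φ A = 0 ∨ maxRelCard φ A = 1 := by omega
  obtain ⟨hfT, hnT, hbT⟩ := hbd T hT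
  obtain ⟨hfS, hnS, hbS⟩ := hbd S hS
  have h1 := (Set.ncard_pos hfT).2 hnT
  rcases hcase with h | h
  · rw [h, Nat.cast_zero, Real.zero_rpow hc.ne'] at hbT
    have : (1 : ℝ) ≤ (τ.rel T).ncard := by exact_mod_cast h1
    linarith
  · rw [h, Nat.cast_one, Real.one_rpow] at hbS ⊢
    have hbS : (τ.rel S).ncard ≤ 1 := by exact_mod_cast hbS
    rw [mul_one]
    have := Nat.mul_le_mul (ext_le hfT S g) hbS
    exact_mod_cast (by simpa using this)

theorem rpow_half {m ε : ℝ} (hm : 1 ≤ m) :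
    Real.exp (ε / 2 * Real.log m) ^ 2 = m ^ ε := by
  rw [← Real.exp_nat_mul, Real.rpow_def_of_pos (by linarith)]
  congr 1
  push_cast
  ring

theorem PotLE.split {c ε : ℝ} (hV : φ.vars ⊆ V) (hc0 : 0 < c) (hε : 0 < ε) (hw : τ.WF φ A)
    (hc : τ.Cons) (hbd : τ.Bounded ((maxRelCard φ A : ℝ) ^ c))
    (h : PotLE φ A V ((maxRelCard φ A : ℝ) ^ c) (ε / 2 * Real.log (maxRelCard φ A)) n τ)
    (hb : σ.Below τ) {S T : Finset ℕ} (hS : S ∈ τ.sets) (hT : T ∈ τ.sets) (hST : S ⊆ T)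
    {g₀ : PMap} (hg₀ : TooLarge φ A ε τ S T g₀)
    (hd : (∀ g ∈ σ.rel S, Large φ A ε τ S T g) ∨ ∀ g ∈ σ.rel S, ¬ Large φ A ε τ S T g) :
    PotLE φ A V ((maxRelCard φ A : ℝ) ^ c) (ε / 2 * Real.log (maxRelCard φ A)) (n - 1) σ := by
  have hm := hg₀.two_le hc0 hbd hS hT
  have hm1 : (1 : ℝ) < maxRelCard φ A := by exact_mod_cast hm
  have hδ : 0 < ε / 2 * Real.log (maxRelCard φ A) := by have := Real.log_pos hm1; positivity
  obtain ⟨hfT, hnT, -⟩ := hbd T hT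
  obtain ⟨hfS, hnS, -⟩ := hbd S hS
  have hsq := rpow_half (ε := ε) hm1.le
  set r := Real.exp (ε / 2 * Real.log (maxRelCard φ A)) with hr
  have hr0 : 0 ≤ r := (Real.exp_pos _).le
  have hlarge : ∀ g, Large φ A ε τ S T g ↔
      ¬ (τ.ext S T g : ℝ) * (τ.rel S).ncard ≤ r * (τ.rel T).ncard := by
    intro g
    rw [Large, ← hsq]
    push_cast
    rw [← mul_pow, mul_comm (((τ.rel T).ncard : ℝ)) r,
      pow_le_pow_iff_left₀ (by positivity) (by positivity) (by norm_num)]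
  rcases hd with hd | hd
  · refine h.drop hV hδ hw hc hbd hb (empty_subset V) hS fun σ' h1 h2 => ?_
    refine maxExt_large hfS hfT hnT ((h2.trans hb).rel S hS) fun g hg => ?_
    exact (not_le.1 ((hlarge g).1 (hd g (h2.rel S (hb.sets hS) hg)))).le
  · refine h.drop hV hδ hw hc hbd hb ((hw.sub S hS).trans hV) hT fun σ' h1 h2 => ?_
    refine maxExt_small (g₀ := g₀) h1 ((h2.trans hb).sets hS) ((h2.trans hb).sets hT) hST hfS hfT hnS
      ((h2.trans hb).rel T hT) hr0 (fun g hg => ?_) ?_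
    · exact not_not.1 (mt (hlarge g).2 (hd g (h2.rel S (hb.sets hS) hg)))
    · rw [hsq, mul_comm]
      have := (not_le.1 hg₀).le
      push_cast at this
      exact this

theorem PotLE.init {X : ℕ} {c ε : ℝ} (hc : 1 ≤ c) (hε : 0 < ε) :
    PotLE φ A (range X) ((maxRelCard φ A : ℝ) ^ c) (ε / 2 * Real.log (maxRelCard φ A))
      (2 ^ (2 * X + 3 + ⌈c⌉₊ + ⌈1 / ε⌉₊) - 2) σ := by
  intro σ' _ _ h3 _
  have hlog : 0 ≤ Real.log (maxRelCard φ A) := Real.log_natCast_nonneg _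
  refine (pot_le (by positivity) h3).trans ?_
  rw [card_range]
  have h1 : Real.log ((maxRelCard φ A : ℝ) ^ c) / (ε / 2 * Real.log (maxRelCard φ A)) ≤
      2 * (c * (1 / ε)) := by
    rcases hlog.eq_or_lt with h | h
    · rw [← h, mul_zero, div_zero]; positivity
    · have hm : (0 : ℝ) < maxRelCard φ A := by
        by_contra h0
        have : maxRelCard φ A = 0 := by
          have : (maxRelCard φ A : ℝ) ≤ 0 := not_lt.1 h0
          exact Nat.le_zero.1 (by exact_mod_cast this)
        rw [this] at h; simp at h
      rw [Real.log_rpow hm]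
      apply le_of_eq
      field_simp
  set a := ⌈c⌉₊
  set b := ⌈1 / ε⌉₊
  have h2 : c * (1 / ε) ≤ 2 ^ a * 2 ^ b := by
    refine mul_le_mul ?_ ?_ (by positivity) (by positivity)
    · exact (Nat.le_ceil c).trans (by exact_mod_cast Nat.lt_two_pow_self.le)
    · exact (Nat.le_ceil (1 / ε)).trans (by exact_mod_cast Nat.lt_two_pow_self.le)
  have h4 : (4 : ℝ) ^ X = 2 ^ X * 2 ^ X := by rw [← mul_pow]; norm_num
  have hx : (1 : ℝ) ≤ 2 ^ X := one_le_pow₀ (by norm_num)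
  have ha : (1 : ℝ) ≤ 2 ^ a := one_le_pow₀ (by norm_num)
  have hb : (1 : ℝ) ≤ 2 ^ b := one_le_pow₀ (by norm_num)
  have e : (2 : ℝ) ^ (2 * X + 3 + a + b) = 8 * (2 ^ X * 2 ^ X * (2 ^ a * 2 ^ b)) := by
    rw [pow_add, pow_add, pow_add, pow_mul, ← mul_pow]
    norm_num
    ring
  rw [e, h4]
  have h5 : (2 : ℝ) ^ X * 2 ^ X * (Real.log ((maxRelCard φ A : ℝ) ^ c) /
      (ε / 2 * Real.log (maxRelCard φ A))) ≤ 2 ^ X * 2 ^ X * (2 * (2 ^ a * 2 ^ b)) :=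
    mul_le_mul_of_nonneg_left (h1.trans (by linarith)) (by positivity)
  have hab : (1 : ℝ) ≤ 2 ^ a * 2 ^ b := one_le_mul_of_one_le_of_one_le ha hb
  have hxx : (2 : ℝ) ^ X ≤ 2 ^ X * 2 ^ X := by nlinarith
  have hq : (2 : ℝ) ^ X * 2 ^ X ≤ 2 ^ X * 2 ^ X * (2 ^ a * 2 ^ b) := by nlinarith
  have hq1 : (1 : ℝ) ≤ 2 ^ X * 2 ^ X * (2 ^ a * 2 ^ b) := by nlinarith
  nlinarith

/-- The empty relations of a family that has no solutions. -/
def Dead (σ : Fam) : Prop := σ.rel ∅ = ∅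

theorem Dead.sol_eq (h : σ.Dead) (h0 : ∅ ∈ σ.sets) : σ.sol φ A = ∅ := by
  rw [Set.eq_empty_iff_forall_notMem]
  rintro g ⟨-, hg⟩
  have := hg ∅ h0
  rw [h] at this
  exact this

theorem Cons.nonempty (hc : σ.Cons) (h0 : ∅ ∈ σ.sets) (hd : ¬ σ.Dead) {S : Finset ℕ}
    (hS : S ∈ σ.sets) : (σ.rel S).Nonempty := by
  have : (σ.rel ∅).Nonempty := Set.nonempty_iff_ne_empty.2 hd
  rw [hc ∅ h0 S hS (empty_subset _)] at this
  exact this.of_image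

theorem not_tooLarge_iff {ε : ℝ} {S T : Finset ℕ} {g : PMap} : ¬ TooLarge φ A ε τ S T g ↔
    ({h ∈ τ.rel T | PMap.proj S h = g}.ncard : ℝ) * ((τ.rel S).ncard : ℝ) ≤
      (maxRelCard φ A : ℝ) ^ ε * ((τ.rel T).ncard : ℝ) := by
  rw [TooLarge, not_not, ext, mul_comm ((maxRelCard φ A : ℝ) ^ ε)]
  push_cast
  rfl

end Fam

/-! ### Binary branching -/

/-- The state after `n` steps with the given choices. -/
def runBits {α : Type*} (step : Bool → α → α) (x : α) (β : ℕ → Bool) : ℕ → α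
  | 0 => x
  | n + 1 => step (β n) (runBits step x β n)

theorem runBits_congr {α : Type*} {step : Bool → α → α} {x : α} {β β' : ℕ → Bool} {n : ℕ}
    (h : ∀ i < n, β i = β' i) : runBits step x β n = runBits step x β' n := by
  induction n with
  | zero => rfl
  | succ n ih => rw [runBits, runBits, ih fun i hi => h i (by omega), h n (by omega)]

theorem runBits_unique {α γ : Type*} {step : Bool → α → α} {x : α} {S : α → Set γ} {I : α → Prop}
    (h0 : I x) (hI : ∀ b y, I y → I (step b y))
    (hS : ∀ y, I y → (S (step false y) ∪ S (step true y) = S y) ∧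
      Disjoint (S (step false y)) (S (step true y))) (n : ℕ) {g : γ} (hg : g ∈ S x) :
    (∃ b < 2 ^ n, g ∈ S (runBits step x b.testBit n)) ∧
    ∀ β β' : ℕ → Bool, g ∈ S (runBits step x β n) → g ∈ S (runBits step x β' n) →
      ∀ i < n, β i = β' i := by
  have hrun : ∀ β n, I (runBits step x β n) := fun β n => by
    induction n with
    | zero => exact h0
    | succ n ih => exact hI _ _ ih
  constructor
  · induction n with
    | zero => exact ⟨0, by simp, hg⟩
    | succ n ih =>
      obtain ⟨b, hb, hgb⟩ := ih
      rw [← (hS _ (hrun _ _)).1] at hgb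
      rcases hgb with hgb | hgb
      · refine ⟨b, by rw [pow_succ]; omega, ?_⟩
        rw [runBits, Nat.testBit_lt_two_pow hb]
        exact hgb
      · refine ⟨2 ^ n + b, by rw [pow_succ]; omega, ?_⟩
        rw [runBits, runBits_congr (β' := b.testBit) fun i hi => Nat.testBit_two_pow_add_gt hi b,
          Nat.testBit_two_pow_add_eq, Nat.testBit_lt_two_pow hb]
        exact hgb
  · intro β β' h1 h2
    induction n with
    | zero => intro i hi; omega
    | succ n ih =>
      have mono : ∀ β : ℕ → Bool, g ∈ S (runBits step x β (n + 1)) →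
          g ∈ S (runBits step x β n) := fun β h => by
        rw [← (hS _ (hrun _ _)).1]
        rw [runBits] at h
        cases hb : β n <;> rw [hb] at h
        · exact Or.inl h
        · exact Or.inr h
      have hi := ih (mono β h1) (mono β' h2)
      intro i hin
      rcases Nat.lt_succ_iff_lt_or_eq.1 hin with h | rfl
      · exact hi i h
      · rw [runBits] at h1 h2
        rw [← runBits_congr hi] at h2
        have hd := Set.disjoint_left.1 (hS _ (hrun β i)).2
        cases hb : β i <;> cases hb' : β' i <;> rw [hb] at h1 <;> rw [hb'] at h2
        all_goals first | rfl | exact absurd h2 (hd h1) | exact absurd h1 (hd h2)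

end

section

open Finset

/-! ### The program -/

namespace Pr

open EX Stm

/-! Arrays. -/

abbrev aQ : ℕ := 0
abbrev aR : ℕ := 2
abbrev aOUT : ℕ := 3
abbrev aOP : ℕ := 4
abbrev aLC : ℕ := 5
abbrev aM : ℕ := 6
abbrev aATP : ℕ := 7
abbrev aRLP : ℕ := 8
abbrev aPW : ℕ := 9
abbrev aMEM : ℕ := 10
abbrev aCAP : ℕ := 11
abbrev aCUP : ℕ := 12
abbrev aIN : ℕ := 20
abbrev aINb : ℕ := 21
abbrev aAL : ℕ := 22
abbrev aALb : ℕ := 23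
abbrev aDT : ℕ := 24
abbrev aDTb : ℕ := 25
abbrev aPR : ℕ := 26
abbrev aCOV : ℕ := 27
abbrev aDN : ℕ := 28
abbrev aSP : ℕ := 29
abbrev aSS : ℕ := 30
abbrev aXN : ℕ := 31
abbrev aXD : ℕ := 32
abbrev aXA : ℕ := 33
abbrev aG : ℕ := 34
abbrev aRS : ℕ := 35
abbrev aTA : ℕ := 36
abbrev aMK : ℕ := 37
abbrev aDG : ℕ := 38
abbrev aP1 : ℕ := 39
abbrev aP2 : ℕ := 40
abbrev aP3 : ℕ := 41
abbrev aLG : ℕ := 42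
abbrev aBT : ℕ := 43
abbrev aNN : ℕ := 44

/-! Reading arrays with one, two or three relevant indices. -/

def reg (a : ℕ) : EX := .rd a (.c 0) (.c 0) (.c 0)
def flat (a : ℕ) (e : EX) : EX := .rd a (.c 0) (.c 0) e
def fst (a : ℕ) (e : EX) : EX := .rd a e (.c 0) (.c 0)
def two (a : ℕ) (e f : EX) : EX := .rd a e f (.c 0)
def fl2 (a : ℕ) (e f : EX) : EX := .rd a e (.c 0) f
def setR (a : ℕ) (e : EX) : Stm := .st a (.c 0) (.c 0) (.c 0) e

/-! Tables for sets of variables, represented by numbers. -/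

def quotE : EX :=
  .sum 2 .NB (leE (.sum 3 .NB (.ite (.v 3) (.v 2) (flat aPW (.v 1)) (.c 0))) (.v 0))
def halfE : EX := .sum 4 .NB (leE (.add (.add (.v 4) (.v 4)) (.c 2)) quotE)
def mem (e f : EX) : EX := two aMEM e f
def findE (p : EX) : EX := .sum 2 .E (ifE (allE 3 .X (iffE (mem (.v 2) (.v 3)) p)) (.v 2) (.c 0))

def tables : Stm := blk [
  asg aMEM .NB .TK .one (.sub (.sub quotE halfE) halfE),
  asg aCAP .E .E .one (findE (andE (mem (.v 0) (.v 3)) (mem (.v 1) (.v 3)))),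
  asg aCUP .E .E .one (findE (orE (mem (.v 0) (.v 3)) (mem (.v 1) (.v 3))))]

/-! Adding a relation, given by the rows `aXD` with the flags `aXA`, for the set `aG`. -/

def cap (e f : EX) : EX := two aCAP e f
def subE (e f : EX) : EX := eqE (cap e f) e

/-- The new row `21` agrees on the set `0` with the row in the third argument. -/
def sameX (e : EX) : EX :=
  allE 2 .X (impE (mem (.v 0) (.v 2)) (eqE (.rd aXD (.c 0) (.v 2) (.v 21)) e))

def keepOld : EX := andE (fl2 aAL (.v 0) (.v 20))
  (exE 21 .D (andE (flat aXA (.v 21)) (sameX (.rd aDT (.v 0) (.v 2) (.v 20)))))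

def takeNew : EX := andE (flat aXA (.v 20)) (notE (exE 21 .D (andE (ltE (.v 21) (.v 20))
  (andE (flat aXA (.v 21)) (sameX (.rd aXD (.c 0) (.v 2) (.v 20)))))))

def addAlive : EX :=
  ifE (subE (.v 0) (reg aG)) (ifE (fst aIN (.v 0)) keepOld takeNew) (fl2 aAL (.v 0) (.v 20))

def addData : EX :=
  ifE (andE (subE (.v 0) (reg aG)) (notE (fst aIN (.v 0))))
    (ifE (mem (.v 0) (.v 1)) (.rd aXD (.c 0) (.v 1) (.v 20)) (.c 0))
    (.rd aDT (.v 0) (.v 1) (.v 20))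

def addlist : Stm := blk [
  asg aALb .E .one .D addAlive,
  upd aDT aDTb .E .X .D addData,
  asg aAL .E .one .D (.rd aALb (.v 0) (.v 1) (.v 20)),
  upd aIN aINb .E .one .one (orE (fst aIN (.v 0)) (subE (.v 0) (reg aG)))]

/-! The relations belonging to the atoms. -/

/-- The variable `7` is the number of the atom. -/
def atp : EX := flat aATP (.v 7)
def arity : EX := flat aQ (.add atp (.c 1))
def arg (j : EX) : EX := flat aQ (.add (.add atp (.c 2)) j)
def isArg (j : EX) : EX := leE (.add j (.c 1)) arity
def entry (i j : EX) : EX := flat aR (.add (.add (flat aTA i) (.c 1)) j)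
def count : EX := flat aR (.add (reg aRS) (.c 2))

def findRel : EX :=
  .sum 2 .X (ifE (andE (leE (.add (.v 2) (.c 1)) (reg aR))
    (andE (eqE (flat aR (flat aRLP (.v 2))) (flat aQ atp))
      (eqE (flat aR (.add (flat aRLP (.v 2)) (.c 1))) arity))) (flat aRLP (.v 2)) (.c 0))

def atom : Stm := blk [
  setR aRS findRel,
  asg aTA .one .one .D (.add (.add (reg aRS) (.c 3)) (.sum 2 .X (.ite (.v 2) arity (.v 20) (.c 0)))),
  asg aXD .one .X .D (.sum 2 .X (ifE (andE (isArg (.v 2)) (andE (eqE (arg (.v 2)) (.v 1))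
      (notE (exE 3 .X (andE (ltE (.v 3) (.v 2)) (eqE (arg (.v 3)) (.v 1)))))))
    (.add (entry (.v 20) (.v 2)) (.c 1)) (.c 0))),
  asg aXA .one .one .D (andE (ltE (.v 20) count) (allE 2 .X (impE (isArg (.v 2))
    (eqE (.rd aXD (.c 0) (arg (.v 2)) (.v 20)) (.add (entry (.v 20) (.v 2)) (.c 1)))))),
  setR aG (findE (exE 4 .X (andE (isArg (.v 4)) (eqE (arg (.v 4)) (.v 3))))),
  addlist]

def atoms : Stm := .loop 7 .X (whenS (ltE (.v 7) (reg aQ)) atom)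

/-! Consistency. -/

def links : Stm :=
  asg aPR .E .E .D (.sum 21 .D (ifE (andE (fl2 aAL (.v 1) (.v 21)) (allE 2 .X
    (impE (mem (.v 1) (.v 2)) (eqE (.rd aDT (.v 0) (.v 2) (.v 20)) (.rd aDT (.v 1) (.v 2) (.v 21))))))
    (.add (.v 21) (.c 1)) (.c 0)))

def keepE : EX :=
  andE (fl2 aAL (.v 0) (.v 20)) (allE 2 .E (impE (fst aIN (.v 2)) (andE
    (impE (subE (.v 2) (.v 0)) (andE (.rd aPR (.v 0) (.v 2) (.v 20))
      (fl2 aAL (.v 2) (.sub (.rd aPR (.v 0) (.v 2) (.v 20)) (.c 1)))))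
    (impE (subE (.v 0) (.v 2)) (.rd aCOV (.v 2) (.v 0) (.v 20))))))

def round : Stm := blk [
  asg aCOV .E .E .D (.c 0),
  mrk aCOV .E .E .D (andE (fl2 aAL (.v 0) (.v 20)) (.rd aPR (.v 0) (.v 1) (.v 20)))
    (.v 0) (.v 1) (.sub (.rd aPR (.v 0) (.v 1) (.v 20)) (.c 1)),
  upd aAL aALb .E .one .D keepE]

def clean : Stm := .loop 9 .E (.loop 24 .D round)

/-! Joins: the variables `7` and `8` are two sets. -/

def maxE (e f : EX) : EX := .ite e f f e

def markE : EX := andE (fl2 aAL (.v 0) (.v 20))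
  (eqE (.rd aPR (.v 0) (cap (.v 0) (.v 7)) (.v 20)) (.rd aPR (.v 7) (cap (.v 0) (.v 7)) (.v 22)))

def matchE : EX := andE (fl2 aAL (.v 8) (.v 23)) (allE 10 .E (impE (fst aIN (.v 10))
  (fl2 aMK (.v 10) (.sub (.rd aPR (.v 8) (cap (.v 10) (.v 8)) (.v 23)) (.c 1)))))

def pushRow : Stm := blk [
  whenS (ltE (reg aXN) (.bd .D))
    (.loop 11 .X (.st aXD (.c 0) (.v 11) (reg aXN)
      (maxE (.rd aDT (.v 7) (.v 11) (.v 22)) (.rd aDT (.v 8) (.v 11) (.v 23))))),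
  setR aXN (.add (reg aXN) (.c 1))]

def enumRow : Stm := blk [
  asg aMK .E .one .D (.c 0),
  mrk aMK .E .one .D markE (.v 0) (.c 0) (.sub (.rd aPR (.v 0) (cap (.v 0) (.v 8)) (.v 20)) (.c 1)),
  .loop 23 .D (whenS matchE pushRow)]

def enumRows : Stm := .loop 22 .D (whenS (fl2 aAL (.v 7) (.v 22)) enumRow)

def join : Stm :=
  whenS (andE (notE (reg aDN)) (andE (fst aIN (.v 7)) (andE (fst aIN (.v 8))
      (notE (fst aIN (two aCUP (.v 7) (.v 8))))))) (blk [
    setR aXN (.c 0),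
    enumRows,
    whenS (leE (reg aXN) (.bd .D)) (blk [
      asg aXA .one .one .D (ltE (.v 20) (reg aXN)),
      setR aG (two aCUP (.v 7) (.v 8)),
      addlist,
      setR aDN (.c 1)])])

/-! Splits. -/

/-- The product of two numbers, the first of which is at most `D`. -/
def prodE (e f : EX) : EX := .sum 25 .D (.ite (.add (.v 25) (.c 1)) e f (.c 0))
def cardE (s : EX) : EX := .sum 25 .D (flag (fl2 aAL s (.v 25)))

def splitTest : EX :=
  exE 22 .D (andE (fl2 aAL (.v 7) (.v 22))
    (notE (.pw 1 (flat aP1 (.v 22)) (fst aNN (.v 8)) (reg aM))))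

def split : Stm :=
  whenS (andE (notE (reg aDN)) (andE (fst aIN (.v 7)) (andE (fst aIN (.v 8))
      (subE (.v 7) (.v 8))))) (blk [
    asg aNN .E .one .one (cardE (.v 0)),
    asg aDG .one .one .D (.sum 21 .D (flag (andE (fl2 aAL (.v 8) (.v 21))
      (eqE (.rd aPR (.v 8) (.v 7) (.v 21)) (.add (.v 20) (.c 1)))))),
    asg aP1 .one .one .D (prodE (flat aDG (.v 20)) (fst aNN (.v 7))),
    whenS splitTest (blk [
      asg aP2 .one .one .D (prodE (fst aNN (.v 7)) (flat aP1 (.v 20))),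
      asg aP3 .one .one .D (prodE (flat aDG (.v 20)) (flat aP2 (.v 20))),
      asg aLG .one .one .D (notE (.pw 1 (flat aP3 (.v 20))
        (prodE (fst aNN (.v 8)) (fst aNN (.v 8))) (reg aM))),
      setR aDN (.c 1),
      setR aSP (.c 1),
      setR aSS (.v 7)])])

/-! Branches. -/

def tickA : Stm := blk [
  setR aDN (.c 0),
  setR aSP (.c 0),
  links,
  clean,
  .loop 7 .E (.loop 8 .E join),
  .loop 7 .E (.loop 8 .E split)]

def tickB : Stm :=
  upd aAL aALb .E .one .D (andE (fl2 aAL (.v 0) (.v 20))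
    (ifE (reg aSP) (orE (notE (eqE (.v 0) (reg aSS))) (iffE (reg aBT) (flat aLG (.v 20))))
      (notE (reg aBT))))

def branchArrays : List ℕ :=
  [aIN, aINb, aAL, aALb, aDT, aDTb, aPR, aCOV, aDN, aSP, aSS, aXN, aXD, aXA, aG, aRS, aTA, aMK,
    aDG, aP1, aP2, aP3, aLG, aBT, aNN]

def zero : Stm := blk (branchArrays.map fun a => asg a .PP .PP .LL (.c 0))

/-- The variable `5` is the number of the branch, the variable `6` is the time. -/
def ticks : Stm := .loop 6 .TK (blk [tickA, setR aBT (flag (mem (.v 5) (.v 6))), tickB])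

/-! Output. -/

def emit (e : EX) : Stm := blk [.st aOUT (.c 0) (.c 0) (reg aOP) e, setR aOP (.add (reg aOP) (.c 1))]

def emitTuple (e : EX) : Stm := blk [
  emit (.sum 12 .X (flag (mem (.v 7) (.v 12)))),
  .loop 11 .X (whenS (mem (.v 7) (.v 11)) (emit e))]

def emitFam : Stm := blk [
  emit (.sum 12 .E (flag (fst aIN (.v 12)))),
  .loop 7 .E (whenS (fst aIN (.v 7)) (blk [
    emitTuple (.v 11),
    emit (cardE (.v 7)),
    .loop 22 .D (whenS (fl2 aAL (.v 7) (.v 22))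
      (emitTuple (.sub (.rd aDT (.v 7) (.v 11) (.v 22)) (.c 1))))]))]

def branch : Stm := blk [
  zero, atoms, ticks,
  whenS (exE 21 .D (flat aAL (.v 21))) (blk [
    setR aLC (.add (reg aLC) (.c 1)),
    emitFam])]

def main : Stm := blk [
  tables,
  setR aOP (.c 1),
  .loop 5 .NB branch,
  .st aOUT (.c 0) (.c 0) (.c 0) (reg aLC)]

theorem main_wf : main.wf [] = true := by decide +kernel

theorem main_dataDepth : main.dataDepth = 2 := by decide +kernel

end Pr

end

section

open Finset

/-! ### Sets of variables as numbers -/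

namespace Pr

open EX Stm

/-- The set of numbers below `X` represented by a number. -/
def fs (X s : ℕ) : Finset ℕ := (range X).filter fun k => s.testBit k = true

theorem mem_fs {X s k : ℕ} : k ∈ fs X s ↔ k < X ∧ s.testBit k = true := by
  simp [fs]

theorem fs_subset (X s : ℕ) : fs X s ⊆ range X := filter_subset _ _

theorem fs_inj {X s t : ℕ} (hs : s < 2 ^ X) (ht : t < 2 ^ X) (h : fs X s = fs X t) : s = t := by
  refine Nat.eq_of_testBit_eq fun k => ?_
  by_cases hk : k < X
  · have := congrArg (k ∈ ·) h
    simp only [mem_fs, hk, true_and, eq_iff_iff] at this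
    exact Bool.eq_iff_iff.2 this
  · have hX : 2 ^ X ≤ 2 ^ k := Nat.pow_le_pow_right (by omega) (by omega)
    rw [Nat.testBit_lt_two_pow (hs.trans_le hX), Nat.testBit_lt_two_pow (ht.trans_le hX)]

theorem exists_fs {X : ℕ} {S : Finset ℕ} (hS : S ⊆ range X) : ∃ s < 2 ^ X, fs X s = S := by
  have h : (range (2 ^ X)).image (fs X) = (range X).powerset := by
    refine eq_of_subset_of_card_le ?_ ?_
    · intro T hT
      obtain ⟨s, -, rfl⟩ := mem_image.1 hT
      exact mem_powerset.2 (fs_subset X s)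
    · rw [card_image_of_injOn, card_powerset, card_range, card_range]
      intro s hs t ht
      exact fs_inj (mem_range.1 hs) (mem_range.1 ht)
  have := mem_powerset.2 hS
  rw [← h] at this
  obtain ⟨s, hs, e⟩ := mem_image.1 this
  exact ⟨s, mem_range.1 hs, e⟩

theorem fs_and (X s t : ℕ) : fs X (s &&& t) = fs X s ∩ fs X t := by
  ext k
  simp only [mem_fs, Nat.testBit_and, mem_inter, Bool.and_eq_true]
  tauto

theorem fs_or (X s t : ℕ) : fs X (s ||| t) = fs X s ∪ fs X t := by
  ext k
  simp only [mem_fs, Nat.testBit_or, mem_union, Bool.or_eq_true]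
  tauto

theorem and_eq_iff {X s t : ℕ} (hs : s < 2 ^ X) : s &&& t = s ↔ fs X s ⊆ fs X t := by
  rw [← inter_eq_left, ← fs_and]
  exact ⟨fun h => by rw [h], fs_inj (lt_of_le_of_lt Nat.and_le_left hs) hs⟩

/-! ### Tables -/

/-- The tables for sets of variables are correct. -/
structure Tab (c : Cst) (M : Mem) : Prop where
  bit : ∀ s < c.NB, ∀ k < c.TK, 0 < M aMEM s k 0 ↔ s.testBit k = true
  cap : ∀ s < c.E, ∀ t < c.E, M aCAP s t 0 = s &&& t
  cup : ∀ s < c.E, ∀ t < c.E, M aCUP s t 0 = s ||| t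

theorem _root_.Cst.OK.E_le {c : Cst} (hc : c.OK) : c.E ≤ c.NB :=
  Nat.pow_le_pow_right (by omega) hc.X_le

theorem _root_.Cst.OK.E_lt {c : Cst} (hc : c.OK) {s : ℕ} (hs : s < c.E) : s < c.NB ∧ s ≤ c.P := by
  have := hc.E_le
  unfold Cst.P
  omega

theorem _root_.Cst.OK.X_lt {c : Cst} (hc : c.OK) {k : ℕ} (hk : k < c.X) : k < c.TK ∧ k ≤ c.P := by
  have := hc.X_le
  have h : c.TK < 2 ^ c.TK := Nat.lt_two_pow_self
  unfold Cst.P Cst.NB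
  omega

theorem Tab.mem {c : Cst} (hc : c.OK) {M : Mem} (h : Tab c M) {s k : ℕ} (hs : s < c.E)
    (hk : k < c.X) : 0 < M aMEM s k 0 ↔ k ∈ fs c.X s := by
  rw [h.bit s (hc.E_lt hs).1 k (hc.X_lt hk).1, mem_fs]
  simp [hk]

theorem Tab.congr {c : Cst} {M M' : Mem} (h : Tab c M) (h1 : M' aMEM = M aMEM)
    (h2 : M' aCAP = M aCAP) (h3 : M' aCUP = M aCUP) : Tab c M' :=
  ⟨by rw [h1]; exact h.bit, by rw [h2]; exact h.cap, by rw [h3]; exact h.cup⟩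

theorem ev_leE {c : Cst} {M : Mem} {η : ℕ → ℕ} {a b : EX} :
    (leE a b).ev c M η = if a.ev c M η ≤ b.ev c M η then 1 else 0 := rfl

theorem sum_ite_le (n a : ℕ) (h : a ≤ n) : (∑ y ∈ range n, if y + 1 ≤ a then 1 else 0) = a := by
  rw [sum_boole]
  have : (range n).filter (fun y => y + 1 ≤ a) = range a := by
    ext y; simp only [mem_filter, mem_range]; omega
  rw [this, card_range]; rfl

theorem sum_ite_mul (n y v : ℕ) (h : y < n) :
    (∑ z ∈ range n, if z ≤ y then v else 0) = (y + 1) * v := by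
  rw [← sum_filter, sum_const, smul_eq_mul]
  have : (range n).filter (fun z => z ≤ y) = range (y + 1) := by
    ext z; simp only [mem_filter, mem_range]; omega
  rw [this, card_range]

theorem ev_quotE {c : Cst} {M : Mem} {η : ℕ → ℕ} {s k : ℕ} (hs : η 0 = s) (hk : η 1 = k)
    (hsN : s < c.NB) (hpw : M aPW 0 0 k = 2 ^ k) : quotE.ev c M η = s / 2 ^ k := by
  have hp : 0 < 2 ^ k := by positivity
  rw [← sum_ite_le c.NB (s / 2 ^ k) ((Nat.div_le_self _ _).trans hsN.le)]
  simp only [quotE, ev]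
  refine sum_congr rfl fun y hy => ?_
  rw [ev_leE]
  simp only [ev, flat, cut, Function.update_apply]
  simp only [Nat.reduceEqDiff, if_true, if_false, OfNat.zero_ne_ofNat,
    OfNat.one_ne_ofNat, hs, hk, hpw, Bd.val]
  rw [sum_ite_mul _ _ _ (mem_range.1 hy)]
  simp only [Nat.le_div_iff_mul_le hp]

theorem ev_halfE {c : Cst} {M : Mem} {η : ℕ → ℕ} {s k : ℕ} (hs : η 0 = s) (hk : η 1 = k)
    (hsN : s < c.NB) (hpw : M aPW 0 0 k = 2 ^ k) : halfE.ev c M η = s / 2 ^ k / 2 := by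
  rw [← sum_ite_le c.NB (s / 2 ^ k / 2)
    ((Nat.div_le_self _ _).trans ((Nat.div_le_self _ _).trans hsN.le))]
  simp only [halfE, ev]
  refine sum_congr rfl fun y hy => ?_
  rw [ev_leE, ev_quotE (s := s) (k := k) (by simp [hs])
    (by simp [hk]) hsN hpw]
  simp only [ev, Function.update_self]
  congr 1
  rw [eq_iff_iff]
  omega

@[simp] theorem env3_zero (η : ℕ → ℕ) (p q r : ℕ) : env3 η p q r 0 = p := by simp [env3]
@[simp] theorem env3_one (η : ℕ → ℕ) (p q r : ℕ) : env3 η p q r 1 = q := by simp [env3]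
@[simp] theorem env3_row (η : ℕ → ℕ) (p q r : ℕ) : env3 η p q r 20 = r := by simp [env3]
theorem env3_of_ne (η : ℕ → ℕ) (p q r x : ℕ) (h0 : x ≠ 0) (h1 : x ≠ 1) (h2 : x ≠ 20) :
    env3 η p q r x = η x := by simp [env3, h0, h1, h2]

theorem ev_findE {c : Cst} (hc : c.OK) {M : Mem} {η : ℕ → ℕ}
    (hm : ∀ s < c.NB, ∀ k < c.TK, 0 < M aMEM s k 0 ↔ s.testBit k = true) {p : EX} {s : ℕ}
    (hs : s < c.E) (hp : ∀ w < c.E, ∀ k < c.X,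
      (0 < p.ev c M (Function.update (Function.update η 2 w) 3 k) ↔ s.testBit k = true)) :
    (findE p).ev c M η = s := by
  have key : ∀ w < c.E,
      (0 < (allE 3 .X (iffE (mem (.v 2) (.v 3)) p)).ev c M (Function.update η 2 w) ↔ w = s) := by
    intro w hw
    simp only [pos_allE, pos_iffE, Bd.val]
    constructor
    · intro h
      refine fs_inj hw hs ?_
      ext k
      simp only [mem_fs]
      refine and_congr_right fun hk => ?_
      rw [← hp w hw k hk, ← h k hk]
      simp only [mem, two, ev, cut, Function.update_apply]
      exact (hm w (hc.E_lt hw).1 k (hc.X_lt hk).1).symm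
    · rintro rfl k hk
      rw [hp w hw k hk]
      simp only [mem, two, ev, cut, Function.update_apply]
      exact hm w (hc.E_lt hw).1 k (hc.X_lt hk).1
  simp only [findE, ev]
  rw [sum_eq_single s]
  · rw [ev_ifE, if_pos ((key s hs).2 rfl)]
    simp [ev]
  · intro w hw hne
    rw [ev_ifE, if_neg (fun h => hne ((key w (mem_range.1 hw)).1 h))]
    rfl
  · exact fun h => absurd (mem_range.2 hs) h

theorem tables_spec {c : Cst} (hc : c.OK) {M : Mem} (η : ℕ → ℕ)
    (hpw : ∀ k < c.TK, M aPW 0 0 k = 2 ^ k) :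
    Tab c (tables.den c η M) ∧ ∀ a, a ≠ aMEM → a ≠ aCAP → a ≠ aCUP → tables.den c η M a = M a := by
  refine ⟨?_, fun a h1 h2 h3 => den_frame _ _ _ (by simp [tables, blk, writes, asg, fors, h1, h2, h3])⟩
  simp only [tables, blk, den]
  rw [den_asg (by decide), den_asg (by decide), den_asg (by decide)]
  simp only [Bd.val]
  set M₁ := setA M aMEM c.NB c.TK 1 _ with hM₁
  have hbit : ∀ s < c.NB, ∀ k < c.TK, 0 < M₁ aMEM s k 0 ↔ s.testBit k = true := by
    intro s hs k hk
    rw [hM₁, setA_same hs hk one_pos]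
    simp only [ev]
    rw [ev_quotE (s := s) (k := k) (by simp) (by simp) hs (hpw k hk),
      ev_halfE (s := s) (k := k) (by simp) (by simp) hs (hpw k hk), Nat.testBit_eq_decide_div_mod_eq]
    simp only [decide_eq_true_eq]
    omega
  have hand : ∀ s < c.E, ∀ t, s &&& t < c.E := fun s hs t => lt_of_le_of_lt Nat.and_le_left hs
  have hor : ∀ s < c.E, ∀ t < c.E, s ||| t < c.E := fun s hs t ht => Nat.or_lt_two_pow hs ht
  refine ⟨?_, ?_, ?_⟩
  · intro s hs k hk
    rw [setA_ne (by decide), setA_ne (by decide)]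
    exact hbit s hs k hk
  · intro s hs t ht
    rw [setA_ne (by decide), setA_same hs ht one_pos]
    refine ev_findE hc hbit (hand s hs t) fun w _ k hk => ?_
    rw [pos_andE]
    simp only [mem, two, ev, cut]
    simp only [Function.update_apply, OfNat.zero_ne_ofNat, OfNat.one_ne_ofNat, if_false, if_true,
      env3_zero, env3_one]
    rw [hbit s (hc.E_lt hs).1 k (hc.X_lt hk).1, hbit t (hc.E_lt ht).1 k (hc.X_lt hk).1,
      Nat.testBit_and, Bool.and_eq_true]
  · intro s hs t ht
    rw [setA_same hs ht one_pos]
    refine ev_findE hc (fun s hs k hk => ?_) (hor s hs t ht) fun w _ k hk => ?_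
    · rw [setA_ne (by decide)]; exact hbit s hs k hk
    rw [pos_orE]
    simp only [mem, two, ev, cut]
    simp only [Function.update_apply, OfNat.zero_ne_ofNat, OfNat.one_ne_ofNat, if_false, if_true,
      env3_zero, env3_one]
    rw [setA_ne (by decide), hbit s (hc.E_lt hs).1 k (hc.X_lt hk).1,
      hbit t (hc.E_lt ht).1 k (hc.X_lt hk).1, Nat.testBit_or, Bool.or_eq_true]

end Pr

end

section

open Finset

namespace Pr

open EX Stm

/-! ### The family represented by the memory -/

/-- Entries of data arrays: `0` stands for an undefined value. -/
def dec : ℕ → Option ℕ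
  | 0 => none
  | n + 1 => some n

theorem dec_inj {a b : ℕ} : dec a = dec b ↔ a = b := by
  cases a <;> cases b <;> simp [dec]

theorem isSome_dec {a : ℕ} : (dec a).isSome ↔ 0 < a := by
  cases a <;> simp [dec]

def In (M : Mem) (s : ℕ) : Prop := 0 < M aIN s 0 0
def Al (M : Mem) (s i : ℕ) : Prop := 0 < M aAL s 0 i

/-- Row number `i` of the relation of the set number `s`. -/
def row (c : Cst) (M : Mem) (s i : ℕ) : PMap := fun k => if k < c.X then dec (M aDT s k i) else none

open Classical in
noncomputable def fam (c : Cst) (M : Mem) : Fam where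
  sets := ((range c.E).filter fun s => In M s).image (fs c.X)
  rel S := {g | ∃ s < c.E, fs c.X s = S ∧ ∃ i < c.D, Al M s i ∧ row c M s i = g}

variable {φ : QFCQ} {A : Struct} {c : Cst} {M M' : Mem}

theorem mem_sets {s : ℕ} (hs : s < c.E) : fs c.X s ∈ (fam c M).sets ↔ In M s := by
  simp only [fam, mem_image, mem_filter, mem_range]
  constructor
  · rintro ⟨t, ⟨ht, hi⟩, e⟩
    exact fs_inj ht hs e ▸ hi
  · exact fun h => ⟨s, ⟨hs, h⟩, rfl⟩

theorem exists_of_mem_sets {S : Finset ℕ} (hS : S ∈ (fam c M).sets) :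
    ∃ s < c.E, In M s ∧ fs c.X s = S := by
  simp only [fam, mem_image, mem_filter, mem_range] at hS
  obtain ⟨s, ⟨h1, h2⟩, h3⟩ := hS
  exact ⟨s, h1, h2, h3⟩

theorem mem_rel {s : ℕ} (hs : s < c.E) {g : PMap} :
    g ∈ (fam c M).rel (fs c.X s) ↔ ∃ i < c.D, Al M s i ∧ row c M s i = g := by
  constructor
  · rintro ⟨t, ht, e, h⟩
    exact fs_inj ht hs e ▸ h
  · exact fun h => ⟨s, hs, rfl, h⟩

/-- The memory represents a well-formed family, without repetitions. -/
structure Inv (φ : QFCQ) (A : Struct) (c : Cst) (M : Mem) : Prop where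
  tab : Tab c M
  wf : (fam c M).WF φ A
  al : ∀ s < c.E, ∀ i < c.D, Al M s i → In M s
  inj : ∀ s < c.E, ∀ i < c.D, ∀ j < c.D, Al M s i → Al M s j → row c M s i = row c M s j → i = j

theorem row_congr (h : M' aDT = M aDT) : row c M' = row c M := by
  funext s i k
  simp only [row, h]

theorem fam_congr (h1 : M' aIN = M aIN) (h2 : M' aAL = M aAL) (h3 : M' aDT = M aDT) :
    fam c M' = fam c M := by
  have e1 : In M' = In M := by funext s; simp only [In, h1]
  have e2 : Al M' = Al M := by funext s i; simp only [Al, h2]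
  unfold fam
  rw [e1, e2, row_congr h3]

theorem Inv.congr (h : Inv φ A c M) (h1 : M' aMEM = M aMEM) (h2 : M' aCAP = M aCAP)
    (h3 : M' aCUP = M aCUP) (h4 : M' aIN = M aIN) (h5 : M' aAL = M aAL) (h6 : M' aDT = M aDT) :
    Inv φ A c M' where
  tab := h.tab.congr h1 h2 h3
  wf := by rw [fam_congr h4 h5 h6]; exact h.wf
  al := by simp only [In, Al, h4, h5]; exact h.al
  inj := by simp only [Al, row_congr h6, h5]; exact h.inj

theorem Inv.hasDom (h : Inv φ A c M) {s i : ℕ} (hs : s < c.E) (hi : i < c.D) (ha : Al M s i) :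
    (row c M s i).HasDom (fs c.X s) :=
  (h.wf.dom _ ((mem_sets hs).2 (h.al s hs i hi ha)) _ ((mem_rel hs).2 ⟨i, hi, ha, rfl⟩)).1

theorem row_eq_proj {s w i j : ℕ} (hd : (row c M w j).HasDom (fs c.X w)) :
    (∀ k < c.X, k ∈ fs c.X w → M aDT s k i = M aDT w k j) ↔
      row c M w j = (row c M s i).proj (fs c.X w) := by
  constructor
  · intro h
    funext k
    simp only [PMap.proj]
    split_ifs with hk
    · have hX := (mem_fs.1 hk).1
      simp only [row, hX, if_true, h k hX hk]
    · exact Option.not_isSome_iff_eq_none.1 fun h' => hk ((hd k).1 h')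
  · intro h k hX hk
    have := congrFun h k
    simp only [PMap.proj, hk, if_true, row, hX, dec_inj] at this
    exact this.symm

/-! ### Links -/

/-- The links point to the restrictions of the rows. -/
structure Lk (c : Cst) (M : Mem) : Prop where
  link : ∀ s < c.E, ∀ w < c.E, ∀ i < c.D, ∀ j < c.D, Al M s i → Al M w j →
    row c M w j = (row c M s i).proj (fs c.X w) → M aPR s w i = j + 1
  back : ∀ s < c.E, ∀ w < c.E, ∀ i < c.D, Al M s i → 0 < M aPR s w i →
    ∃ j < c.D, M aPR s w i = j + 1 ∧ row c M w j = (row c M s i).proj (fs c.X w)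

theorem sum_ite_unique {n : ℕ} {p : ℕ → Prop} [DecidablePred p] {f : ℕ → ℕ}
    (hu : ∀ i < n, ∀ j < n, p i → p j → i = j) {j : ℕ} (hj : j < n) (hp : p j) :
    (∑ i ∈ range n, if p i then f i else 0) = f j := by
  rw [sum_eq_single j]
  · rw [if_pos hp]
  · exact fun i hi hne => if_neg fun h => hne (hu i (mem_range.1 hi) j hj h hp)
  · exact fun h => absurd (mem_range.2 hj) h

theorem exists_of_sum_pos {n : ℕ} {p : ℕ → Prop} [DecidablePred p] {f : ℕ → ℕ}
    (h : 0 < ∑ i ∈ range n, if p i then f i else 0) : ∃ j < n, p j := by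
  obtain ⟨j, hj, hp⟩ := sum_pos_iff.1 h
  refine ⟨j, mem_range.1 hj, ?_⟩
  by_contra hn
  rw [if_neg hn] at hp
  exact lt_irrefl _ hp

theorem links_spec (hc : c.OK) (h : Inv φ A c M) (η : ℕ → ℕ) :
    Lk c (links.den c η M) ∧ ∀ a, a ≠ aPR → links.den c η M a = M a := by
  have hfr : ∀ a, a ≠ aPR → links.den c η M a = M a := fun a ha =>
    den_frame _ _ _ (by simp [links, writes, asg, fors, ha])
  refine ⟨?_, hfr⟩
  have h22 := hfr aAL (by decide)
  have h24 := hfr aDT (by decide)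
  have hrow : row c (links.den c η M) = row c M := row_congr h24
  classical
  have key : ∀ s < c.E, ∀ w < c.E, ∀ i < c.D, links.den c η M aPR s w i =
      ∑ j ∈ range c.D, if Al M w j ∧ row c M w j = (row c M s i).proj (fs c.X w)
        then j + 1 else 0 := by
    intro s hs w hw i hi
    rw [links, den_asg (by decide)]
    simp only [Bd.val]
    rw [setA_same hs hw hi]
    simp only [ev, Bd.val]
    refine sum_congr rfl fun j hj => ?_
    have hj := mem_range.1 hj
    rw [ev_ifE]
    refine if_congr ?_ ?_ rfl
    · rw [pos_andE]
      refine and_congr_right' ?_ |>.trans (and_congr_left' ?_) |>.trans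
        (and_congr_right fun ha => row_eq_proj (h.hasDom hw hj ha))
      · simp only [pos_allE, pos_impE, pos_eqE, Bd.val]
        refine forall₂_congr fun k hk => ?_
        simp only [mem, two, ev, cut]
        simp [h.tab.mem hc hw hk]
      · simp [fl2, ev, cut, Al]
    · simp [ev]
  have uniq : ∀ s < c.E, ∀ w < c.E, ∀ i < c.D, ∀ j < c.D, ∀ j' < c.D,
      (Al M w j ∧ row c M w j = (row c M s i).proj (fs c.X w)) →
      (Al M w j' ∧ row c M w j' = (row c M s i).proj (fs c.X w)) → j = j' :=
    fun s _ w hw i _ j hj j' hj' h1 h2 => h.inj w hw j hj j' hj' h1.1 h2.1 (h1.2.trans h2.2.symm)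
  constructor
  · intro s hs w hw i hi j hj _ ha hr
    rw [hrow] at hr
    simp only [Al, h22] at ha
    rw [key s hs w hw i hi]
    exact sum_ite_unique (f := fun j => j + 1) (uniq s hs w hw i hi) hj ⟨ha, hr⟩
  · intro s hs w hw i hi _ hp
    rw [key s hs w hw i hi] at hp ⊢
    obtain ⟨j, hj, hpj⟩ := exists_of_sum_pos hp
    refine ⟨j, hj, sum_ite_unique (f := fun j => j + 1) (uniq s hs w hw i hi) hj hpj, ?_⟩
    rw [hrow]
    exact hpj.2

/-! ### Removing rows -/

/-- Some rows have been removed. -/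
structure Shrink (c : Cst) (M M' : Mem) : Prop where
  same : ∀ a, a ≠ aAL → a ≠ aALb → a ≠ aCOV → M' a = M a
  le : ∀ s < c.E, ∀ i < c.D, Al M' s i → Al M s i

theorem Shrink.trans {M'' : Mem} (h : Shrink c M M') (h' : Shrink c M' M'') : Shrink c M M'' :=
  ⟨fun a h1 h2 h3 => (h'.same a h1 h2 h3).trans (h.same a h1 h2 h3),
    fun s hs i hi ha => h.le s hs i hi (h'.le s hs i hi ha)⟩

namespace Shrink

variable (h : Shrink c M M')
include h

theorem row_eq : row c M' = row c M :=
  row_congr (h.same aDT (by decide) (by decide) (by decide))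

theorem in_iff {s : ℕ} : In M' s ↔ In M s := by
  simp only [In, h.same aIN (by decide) (by decide) (by decide)]

theorem sets_eq : (fam c M').sets = (fam c M).sets := by
  have e1 : In M' = In M := by
    funext s; simp only [In, h.same aIN (by decide) (by decide) (by decide)]
  unfold fam
  rw [e1]

theorem rel_subset (S : Finset ℕ) : (fam c M').rel S ⊆ (fam c M).rel S := by
  rintro g ⟨s, hs, e, i, hi, ha, hg⟩
  rw [h.row_eq] at hg
  exact ⟨s, hs, e, i, hi, h.le s hs i hi ha, hg⟩

theorem below : (fam c M').Below (fam c M) :=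
  ⟨h.sets_eq.ge, fun S _ => h.rel_subset S⟩

theorem tab (ht : Tab c M) : Tab c M' :=
  ht.congr (h.same _ (by decide) (by decide) (by decide))
    (h.same _ (by decide) (by decide) (by decide)) (h.same _ (by decide) (by decide) (by decide))

theorem inv (hI : Inv φ A c M) : Inv φ A c M' where
  tab := h.tab hI.tab
  wf := by
    refine ⟨?_, ?_, ?_⟩
    · rw [h.sets_eq]; exact hI.wf.sub
    · rw [h.sets_eq]; exact hI.wf.down
    · rw [h.sets_eq]; exact fun S hS g hg => hI.wf.dom S hS g (h.rel_subset S hg)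
  al s hs i hi ha := h.in_iff.2 (hI.al s hs i hi (h.le s hs i hi ha))
  inj s hs i hi j hj h1 h2 e := by
    rw [h.row_eq] at e
    exact hI.inj s hs i hi j hj (h.le s hs i hi h1) (h.le s hs j hj h2) e

theorem lk (hL : Lk c M) : Lk c M' where
  link s hs w hw i hi j hj h1 h2 e := by
    rw [h.row_eq] at e
    rw [h.same aPR (by decide) (by decide) (by decide)]
    exact hL.link s hs w hw i hi j hj (h.le s hs i hi h1) (h.le w hw j hj h2) e
  back s hs w hw i hi h1 h2 := by
    rw [h.same aPR (by decide) (by decide) (by decide)] at h2 ⊢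
    rw [h.row_eq]
    exact hL.back s hs w hw i hi (h.le s hs i hi h1) h2

end Shrink

/-! ### Consistency -/

/-- The row survives a round. -/
def Keep (c : Cst) (M : Mem) (s i : ℕ) : Prop :=
  Al M s i ∧ ∀ w < c.E, In M w →
    (fs c.X w ⊆ fs c.X s → ∃ j < c.D, Al M w j ∧ row c M w j = (row c M s i).proj (fs c.X w)) ∧
    (fs c.X s ⊆ fs c.X w → ∃ j < c.D, Al M w j ∧ row c M s i = (row c M w j).proj (fs c.X s))

theorem D_le_LIM (hc : c.OK) : c.D ≤ c.LIM + 1 := hc.val_le' .D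

theorem ev_subE {η : ℕ → ℕ} (ht : Tab c M) {x y s t : ℕ} (hs : s < c.E) (ht' : t < c.E)
    (hx : η x = s) (hy : η y = t) :
    0 < (subE (.v x) (.v y)).ev c M η ↔ fs c.X s ⊆ fs c.X t := by
  simp only [subE, pos_eqE, cap, two, ev, cut, hx, hy]
  rw [ht.cap s hs t ht', and_eq_iff hs]

theorem round_spec (hc : c.OK) (h : Inv φ A c M) (hL : Lk c M) (η : ℕ → ℕ) :
    Shrink c M (round.den c η M) ∧
    ∀ s < c.E, ∀ i < c.D, (Al (round.den c η M) s i ↔ Keep c M s i) := by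
  have hmin : ∀ k ≤ c.D, min (k - 1) c.LIM = k - 1 := fun k hk => by
    have := D_le_LIM hc; omega
  have hsame : ∀ a, a ≠ aAL → a ≠ aALb → a ≠ aCOV → round.den c η M a = M a := fun a h1 h2 h3 =>
    den_frame _ _ _ (by simp [round, blk, upd, mrk, asg, whenS, fors, writes, h1, h2, h3])
  have hal : ∀ s < c.E, ∀ i < c.D, (Al (round.den c η M) s i ↔ Keep c M s i) := by
    intro s hs i hi
    simp only [round, blk, den]
    set M₁ := (asg aCOV .E .E .D (.c 0)).den c η M with hM₁
    have h1 : ∀ a, a ≠ aCOV → M₁ a = M a := fun a ha =>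
      den_frame _ _ _ (by simp [asg, fors, writes, ha])
    have h1' : ∀ s < c.E, ∀ w < c.E, ∀ i < c.D, M₁ aCOV s w i = 0 := by
      intro s hs w hw i hi
      rw [hM₁, den_asg (by decide)]
      simp only [Bd.val]
      rw [setA_same hs hw hi]
      rfl
    set M₂ := (mrk aCOV _ _ _ _ _ _ _).den c η M₁ with hM₂
    have h2 : ∀ a, a ≠ aCOV → M₂ a = M a := fun a ha =>
      (den_frame _ _ _ (by simp [mrk, whenS, fors, writes, ha])).trans (h1 a ha)
    have hcov : ∀ w < c.E, (0 < M₂ aCOV w s i ↔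
        ∃ k < c.D, Al M w k ∧ 0 < M aPR w s k ∧ i = min (M aPR w s k - 1) c.LIM) := by
      intro w hw
      rw [hM₂, den_mrk (by decide) (by decide) (by decide) (by decide), h1' w hw s hs i hi]
      simp only [lt_irrefl, false_or, pos_andE]
      simp only [fl2, ev, cut, Bd.val, env3_zero, env3_one, env3_row, h1 aAL (by decide),
        h1 aPR (by decide)]
      constructor
      · rintro ⟨w', hw', s', hs', k, hk, ⟨h3, h4⟩, rfl, rfl, h5⟩
        exact ⟨k, hk, h3, h4, h5⟩
      · rintro ⟨k, hk, h3, h4, h5⟩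
        exact ⟨w, hw, s, hs, k, hk, ⟨h3, h4⟩, rfl, rfl, h5⟩
    have hcov' : Al M s i → ∀ w < c.E, (0 < M₂ aCOV w s i ↔
        ∃ k < c.D, Al M w k ∧ row c M s i = (row c M w k).proj (fs c.X s)) := by
      intro ha w hw
      rw [hcov w hw]
      refine exists_congr fun k => and_congr_right fun hk => and_congr_right fun hak => ?_
      constructor
      · rintro ⟨hp, e⟩
        obtain ⟨j, hj, e1, e2⟩ := hL.back w hw s hs k hk hak hp
        rw [hmin _ (by omega)] at e
        have : i = j := by omega
        rw [this]; exact e2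
      · intro e
        have := hL.link w hw s hs k hk i hi hak ha e
        rw [this, hmin _ (by omega)]
        exact ⟨by omega, by omega⟩
    have hpr : Al M s i → ∀ w < c.E, ((0 < M aPR s w i ∧
        0 < M aAL w 0 (min (M aPR s w i - 1) c.LIM)) ↔
        ∃ j < c.D, Al M w j ∧ row c M w j = (row c M s i).proj (fs c.X w)) := by
      intro ha w hw
      constructor
      · rintro ⟨hp, ha'⟩
        obtain ⟨j, hj, e1, e2⟩ := hL.back s hs w hw i hi ha hp
        rw [hmin _ (by omega), e1, Nat.add_sub_cancel] at ha'
        exact ⟨j, hj, ha', e2⟩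
      · rintro ⟨j, hj, ha', e⟩
        have := hL.link s hs w hw i hi j hj ha ha' e
        rw [this, hmin _ (by omega), Nat.add_sub_cancel]
        exact ⟨by omega, ha'⟩
    rw [Al, den_upd (by decide) (by decide)]
    simp only [Bd.val]
    rw [setA_same hs one_pos hi]
    have ht2 : Tab c M₂ := h.tab.congr (h2 _ (by decide)) (h2 _ (by decide)) (h2 _ (by decide))
    simp only [keepE, pos_andE, pos_allE, pos_impE, Bd.val, Keep]
    have e0 : 0 < ev c M₂ (env3 η s 0 i) (fl2 aAL (.v 0) (.v 20)) ↔ Al M s i := by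
      simp [fl2, ev, cut, h2, Al]
    rw [e0]
    refine and_congr_right fun ha => forall₂_congr fun w hw => ?_
    rw [ev_subE ht2 hw hs (by simp) (by simp),
      ev_subE ht2 hs hw (by simp) (by simp), ← hcov' ha w hw,
      ← hpr ha w hw]
    simp [fst, fl2, ev, cut, h2, In]
  exact ⟨⟨hsame, fun s hs i hi ha => ((hal s hs i hi).1 ha).1⟩, hal⟩

/-- No row is removed by a round. -/
def Stable (c : Cst) (M : Mem) : Prop := ∀ s < c.E, ∀ i < c.D, Al M s i → Keep c M s i

theorem Stable.cons (hs : Stable c M) : (fam c M).Cons := by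
  intro S hS T hT hST
  obtain ⟨s, hsE, hsI, rfl⟩ := exists_of_mem_sets hS
  obtain ⟨t, htE, htI, rfl⟩ := exists_of_mem_sets hT
  ext g
  rw [mem_rel hsE]
  constructor
  · rintro ⟨i, hi, ha, rfl⟩
    obtain ⟨j, hj, haj, e⟩ := ((hs s hsE i hi ha).2 t htE htI).2 hST
    exact ⟨_, (mem_rel htE).2 ⟨j, hj, haj, rfl⟩, e.symm⟩
  · rintro ⟨u, hu, rfl⟩
    obtain ⟨j, hj, haj, rfl⟩ := (mem_rel htE).1 hu
    exact ((hs t htE j hj haj).2 s hsE hsI).1 hST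

theorem Stable.of_cons (hc : (fam c M).Cons) (h : Inv φ A c M) : Stable c M := by
  intro s hs i hi ha
  have hS := (mem_sets hs).2 (h.al s hs i hi ha)
  have hg := (mem_rel hs).2 ⟨i, hi, ha, rfl⟩
  refine ⟨ha, fun w hw hwI => ⟨fun hsub => ?_, fun hsub => ?_⟩⟩
  · have : (row c M s i).proj (fs c.X w) ∈ (fam c M).rel (fs c.X w) := by
      rw [hc _ ((mem_sets hw).2 hwI) _ hS hsub]; exact ⟨_, hg, rfl⟩
    exact (mem_rel hw).1 this
  · rw [hc _ hS _ ((mem_sets hw).2 hwI) hsub] at hg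
    obtain ⟨u, hu, e⟩ := hg
    obtain ⟨j, hj, haj, rfl⟩ := (mem_rel hw).1 hu
    exact ⟨j, hj, haj, e.symm⟩

theorem sol_eq_of_keep (h : Shrink c M M')
    (hk : ∀ s < c.E, ∀ i < c.D, Keep c M s i → Al M' s i) :
    (fam c M').sol φ A = (fam c M).sol φ A := by
  ext g
  constructor
  · rintro ⟨h1, h2⟩
    exact ⟨h1, fun S hS => h.rel_subset S (h2 S (by rw [h.sets_eq]; exact hS))⟩
  · rintro ⟨h1, h2⟩
    refine ⟨h1, fun S hS => ?_⟩
    rw [h.sets_eq] at hS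
    obtain ⟨s, hs, hsI, rfl⟩ := exists_of_mem_sets hS
    have hg := h2 _ hS
    rw [mem_rel hs] at hg ⊢
    obtain ⟨i, hi, ha, e⟩ := hg
    refine ⟨i, hi, hk s hs i hi ⟨ha, fun w hw hwI => ?_⟩, by rw [h.row_eq]; exact e⟩
    obtain ⟨j, hj, haj, ej⟩ := (mem_rel hw).1 (h2 _ ((mem_sets hw).2 hwI))
    refine ⟨fun hsub => ⟨j, hj, haj, ?_⟩, fun hsub => ⟨j, hj, haj, ?_⟩⟩
    · rw [ej, e, PMap.proj_proj hsub]
    · rw [ej, e, PMap.proj_proj hsub]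

open Classical in
/-- The number of all rows. -/
noncomputable def rows (c : Cst) (M : Mem) : ℕ :=
  ((range c.E ×ˢ range c.D).filter fun p => Al M p.1 p.2).card

theorem rows_le : rows c M ≤ c.E * c.D := by
  classical
  refine (card_filter_le _ _).trans ?_
  simp

theorem rows_lt (h : Shrink c M M') {s i : ℕ} (hs : s < c.E) (hi : i < c.D) (ha : Al M s i)
    (ha' : ¬ Al M' s i) : rows c M' < rows c M := by
  classical
  unfold rows
  refine card_lt_card ⟨?_, fun hsub => ?_⟩
  · intro p hp
    simp only [mem_filter, mem_product, mem_range] at hp ⊢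
    exact ⟨hp.1, h.le _ hp.1.1 _ hp.1.2 hp.2⟩
  · have := @hsub (s, i) (by simp [hs, hi, ha])
    simp only [mem_filter] at this
    exact ha' this.2

/-- The memory after several rounds. -/
structure Cleaned (φ : QFCQ) (A : Struct) (c : Cst) (M : Mem) (n : ℕ) (M' : Mem) : Prop where
  shrink : Shrink c M M'
  sol : (fam c M').sol φ A = (fam c M).sol φ A
  fix : Stable c M → ∀ s < c.E, ∀ i < c.D, (Al M' s i ↔ Al M s i)
  progress : Stable c M' ∨ rows c M' + n ≤ c.E * c.D

theorem Cleaned.step (hc : c.OK) (h : Inv φ A c M) (hL : Lk c M) (η : ℕ → ℕ) {n : ℕ}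
    (hr : Cleaned φ A c M n M') : Cleaned φ A c M (n + 1) (round.den c η M') := by
  have hI := hr.shrink.inv h
  obtain ⟨h1, h2⟩ := round_spec hc hI (hr.shrink.lk hL) η
  have same : Stable c M' → ∀ s < c.E, ∀ i < c.D, (Al (round.den c η M') s i ↔ Al M' s i) :=
    fun hst s hs i hi => ⟨h1.le s hs i hi, fun ha => (h2 s hs i hi).2 (hst s hs i hi ha)⟩
  have hkeep : (∀ s < c.E, ∀ i < c.D, (Al (round.den c η M') s i ↔ Al M' s i)) →
      Stable c M' → Stable c (round.den c η M') := by
    intro he hst s hs i hi ha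
    obtain ⟨-, hw⟩ := hst s hs i hi ((he s hs i hi).1 ha)
    refine ⟨ha, fun w hwE hwI => ?_⟩
    rw [h1.row_eq]
    obtain ⟨h3, h4⟩ := hw w hwE (h1.in_iff.1 hwI)
    refine ⟨fun hsub => ?_, fun hsub => ?_⟩
    · obtain ⟨j, hj, ha', e⟩ := h3 hsub
      exact ⟨j, hj, (he w hwE j hj).2 ha', e⟩
    · obtain ⟨j, hj, ha', e⟩ := h4 hsub
      exact ⟨j, hj, (he w hwE j hj).2 ha', e⟩
  refine ⟨hr.shrink.trans h1, (sol_eq_of_keep h1 fun s hs i hi => (h2 s hs i hi).2).trans hr.sol,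
    fun hst s hs i hi => ?_, ?_⟩
  · have hst' : Stable c M' := by
      intro s hs i hi ha
      obtain ⟨-, hw⟩ := hst s hs i hi ((hr.fix hst s hs i hi).1 ha)
      refine ⟨ha, fun w hwE hwI => ?_⟩
      rw [hr.shrink.row_eq]
      obtain ⟨h3, h4⟩ := hw w hwE (hr.shrink.in_iff.1 hwI)
      refine ⟨fun hsub => ?_, fun hsub => ?_⟩
      · obtain ⟨j, hj, ha', e⟩ := h3 hsub
        exact ⟨j, hj, (hr.fix hst w hwE j hj).2 ha', e⟩
      · obtain ⟨j, hj, ha', e⟩ := h4 hsub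
        exact ⟨j, hj, (hr.fix hst w hwE j hj).2 ha', e⟩
    exact (same hst' s hs i hi).trans (hr.fix hst s hs i hi)
  · rcases hr.progress with hst | hn
    · exact Or.inl (hkeep (same hst) hst)
    · by_cases hst : Stable c M'
      · exact Or.inl (hkeep (same hst) hst)
      · right
        simp only [Stable, not_forall] at hst
        obtain ⟨s, hs, i, hi, ha, hk⟩ := hst
        have := rows_lt h1 hs hi ha fun ha' => hk ((h2 s hs i hi).1 ha')
        omega

theorem clean_spec (hc : c.OK) (h : Inv φ A c M) (hL : Lk c M) (η : ℕ → ℕ) :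
    Shrink c M (clean.den c η M) ∧ (fam c (clean.den c η M)).sol φ A = (fam c M).sol φ A ∧
    (fam c (clean.den c η M)).Cons ∧
    ((fam c M).Cons → ∀ s < c.E, ∀ i < c.D, (Al (clean.den c η M) s i ↔ Al M s i)) := by
  have key : Cleaned φ A c M (c.E * c.D) (clean.den c η M) := by
    unfold clean
    refine den_loop_inv (b := .E) (fun n M' => Cleaned φ A c M (n * c.D) M') ?_ fun n _ M' hM' => ?_
    · refine ⟨⟨fun _ _ _ _ => rfl, fun _ _ _ _ h => h⟩, rfl, fun _ _ _ _ _ => Iff.rfl, Or.inr ?_⟩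
      simpa using rows_le
    · rw [Nat.succ_mul]
      refine den_loop_inv (b := .D) (fun k M' => Cleaned φ A c M (n * c.D + k) M') hM' fun k _ M'' hM'' => ?_
      exact hM''.step hc h hL _
  refine ⟨key.shrink, key.sol, ?_, fun hcons => key.fix (Stable.of_cons hcons h)⟩
  have hst : Stable c (clean.den c η M) := by
    classical
    rcases key.progress with hst | hn
    · exact hst
    · have h0 : rows c (clean.den c η M) = 0 := by omega
      intro s hs i hi ha
      rw [rows, card_eq_zero] at h0
      exact absurd ha (filter_eq_empty_iff.1 h0
        (mem_product.2 ⟨mem_range.2 hs, mem_range.2 hi⟩ : (s, i) ∈ range c.E ×ˢ range c.D))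
  exact hst.cons

end Pr

end

section

open Finset

namespace Pr

open EX Stm

variable {φ : QFCQ} {A : Struct} {c : Cst} {M M' : Mem}

/-! ### Adding a relation -/

/-- New rows. -/
def xrow (c : Cst) (M : Mem) (i : ℕ) : PMap := fun k => if k < c.X then dec (M aXD 0 k i) else none

def Xa (M : Mem) (i : ℕ) : Prop := 0 < M aXA 0 0 i

/-- The new rows are mappings with the domain given by `aG`. -/
structure NewRows (φ : QFCQ) (A : Struct) (c : Cst) (M : Mem) (G : ℕ) : Prop where
  lt : G < c.E
  reg : M aG 0 0 0 = G
  vars : fs c.X G ⊆ φ.vars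
  dom : ∀ i < c.D, Xa M i → (xrow c M i).HasDom (fs c.X G) ∧
    ∀ x a, xrow c M i x = some a → a ∈ A.univ

/-- The effect of adding a relation. -/
structure Added (c : Cst) (M M' : Mem) (G : ℕ) : Prop where
  same : ∀ a, a ≠ aIN → a ≠ aINb → a ≠ aAL → a ≠ aALb → a ≠ aDT → a ≠ aDTb → M' a = M a
  in_iff : ∀ s < c.E, (In M' s ↔ In M s ∨ fs c.X s ⊆ fs c.X G)
  rel_sub : ∀ s < c.E, fs c.X s ⊆ fs c.X G → ∀ g, g ∈ (fam c M').rel (fs c.X s) ↔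
    (In M s → g ∈ (fam c M).rel (fs c.X s)) ∧ ∃ i < c.D, Xa M i ∧ (xrow c M i).proj (fs c.X s) = g
  rel_not : ∀ s < c.E, ¬ fs c.X s ⊆ fs c.X G → (fam c M').rel (fs c.X s) = (fam c M).rel (fs c.X s)

theorem xrow_eq {s i j : ℕ} : (∀ k < c.X, k ∈ fs c.X s → M aXD 0 k j = M aXD 0 k i) ↔
    (xrow c M j).proj (fs c.X s) = (xrow c M i).proj (fs c.X s) := by
  rw [PMap.proj_eq_proj]
  constructor
  · intro h k hk
    have hX := (mem_fs.1 hk).1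
    simp only [xrow, hX, if_true, h k hX hk]
  · intro h k hX hk
    have := h k hk
    simpa only [xrow, hX, if_true, dec_inj] using this

theorem xrow_eq_row {s i j : ℕ} (hd : (row c M s i).HasDom (fs c.X s)) :
    (∀ k < c.X, k ∈ fs c.X s → M aXD 0 k j = M aDT s k i) ↔
      (xrow c M j).proj (fs c.X s) = row c M s i := by
  constructor
  · intro h
    funext k
    simp only [PMap.proj]
    split_ifs with hk
    · have hX := (mem_fs.1 hk).1
      simp only [row, xrow, hX, if_true, h k hX hk]
    · exact (Option.not_isSome_iff_eq_none.1 fun h' => hk ((hd k).1 h')).symm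
  · intro h k hX hk
    have := congrFun h k
    simpa only [PMap.proj, hk, if_true, row, xrow, hX, dec_inj] using this

theorem ev_subG (hc : c.OK) (ht : Tab c M) {η : ℕ → ℕ} {s G : ℕ} (hs : s < c.E) (hG : G < c.E)
    (h : M aG 0 0 0 = G) (h0 : η 0 = s) :
    0 < (subE (.v 0) (reg aG)).ev c M η ↔ fs c.X s ⊆ fs c.X G := by
  simp only [subE, pos_eqE, cap, two, ev, cut, Pr.reg, h0, h]
  rw [min_eq_left (hc.E_lt hG).2, ht.cap s hs G hG, and_eq_iff hs]

theorem ev_sameX (hc : c.OK) (ht : Tab c M) {η : ℕ → ℕ} {s i j : ℕ} (hs : s < c.E)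
    (h0 : η 0 = s) (h20 : η 20 = i) (h21 : η 21 = j) :
    (0 < (sameX (.rd aDT (.v 0) (.v 2) (.v 20))).ev c M η ↔
      ∀ k < c.X, k ∈ fs c.X s → M aXD 0 k j = M aDT s k i) ∧
    (0 < (sameX (.rd aXD (.c 0) (.v 2) (.v 20))).ev c M η ↔
      ∀ k < c.X, k ∈ fs c.X s → M aXD 0 k j = M aXD 0 k i) := by
  constructor
  all_goals
    simp only [sameX, pos_allE, pos_impE, pos_eqE, Bd.val]
    refine forall₂_congr fun k hk => ?_
    simp only [mem, two, ev, cut]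
    simp [h0, h20, h21, ht.mem hc hs hk]

open Classical in
theorem addlist_data (hc : c.OK) (ht : Tab c M) {G : ℕ} (hG : G < c.E) (hr : M aG 0 0 0 = G)
    (η : ℕ → ℕ) :
    (∀ a, a ≠ aIN → a ≠ aINb → a ≠ aAL → a ≠ aALb → a ≠ aDT → a ≠ aDTb →
      addlist.den c η M a = M a) ∧
    (∀ s < c.E, (In (addlist.den c η M) s ↔ In M s ∨ fs c.X s ⊆ fs c.X G)) ∧
    (∀ s < c.E, ∀ i < c.D, (Al (addlist.den c η M) s i ↔
      if fs c.X s ⊆ fs c.X G then (if In M s then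
        Al M s i ∧ ∃ j < c.D, Xa M j ∧ ∀ k < c.X, k ∈ fs c.X s → M aXD 0 k j = M aDT s k i
        else Xa M i ∧ ¬ ∃ j < c.D, j < i ∧ Xa M j ∧
          ∀ k < c.X, k ∈ fs c.X s → M aXD 0 k j = M aXD 0 k i)
      else Al M s i)) ∧
    (∀ s < c.E, ∀ i < c.D, ∀ k < c.X, addlist.den c η M aDT s k i =
      if fs c.X s ⊆ fs c.X G ∧ ¬ In M s then if k ∈ fs c.X s then M aXD 0 k i else 0
      else M aDT s k i) := by
  refine ⟨fun a h1 h2 h3 h4 h5 h6 => den_frame _ _ _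
    (by simp [addlist, blk, upd, asg, fors, writes, h1, h2, h3, h4, h5, h6]), ?_⟩
  simp only [addlist, blk, den]
  set M₁ := (asg aALb .E .one .D addAlive).den c η M with hM₁
  have h1 : ∀ a, a ≠ aALb → M₁ a = M a := fun a ha =>
    den_frame _ _ _ (by simp [asg, fors, writes, ha])
  set M₂ := (upd aDT aDTb .E .X .D addData).den c η M₁ with hM₂
  have h2 : ∀ a, a ≠ aALb → a ≠ aDT → a ≠ aDTb → M₂ a = M a := fun a ha hb hd =>
    (den_frame _ _ _ (by simp [upd, asg, fors, writes, hb, hd])).trans (h1 a ha)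
  have h2' : M₂ aALb = M₁ aALb := den_frame _ _ _ (by simp [upd, asg, fors, writes])
  set M₃ := (asg aAL .E .one .D (.rd aALb (.v 0) (.v 1) (.v 20))).den c η M₂ with hM₃
  have h3 : ∀ a, a ≠ aALb → a ≠ aDT → a ≠ aDTb → a ≠ aAL → M₃ a = M a := fun a ha hb hd he =>
    (den_frame _ _ _ (by simp [asg, fors, writes, he])).trans (h2 a ha hb hd)
  have h3' : M₃ aDT = M₂ aDT := den_frame _ _ _ (by simp [asg, fors, writes])
  set M₄ := (upd aIN aINb .E .one .one (orE (fst aIN (.v 0)) (subE (.v 0) (reg aG)))).den c η M₃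
    with hM₄
  have h4 : M₄ aDT = M₂ aDT :=
    (den_frame _ _ _ (by simp [upd, asg, fors, writes])).trans h3'
  have h4' : M₄ aAL = M₃ aAL := den_frame _ _ _ (by simp [upd, asg, fors, writes])
  refine ⟨fun s hs => ?_, fun s hs i hi => ?_, fun s hs i hi k hk => ?_⟩
  · rw [In, hM₄, den_upd (by decide) (by decide)]
    simp only [Bd.val]
    rw [setA_same hs one_pos one_pos, pos_orE, ev_subG hc (ht.congr (h3 _ (by decide) (by decide)
      (by decide) (by decide)) (h3 _ (by decide) (by decide) (by decide) (by decide))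
      (h3 _ (by decide) (by decide) (by decide) (by decide))) hs hG
      (by rw [h3 _ (by decide) (by decide) (by decide) (by decide), hr]) (by simp)]
    simp only [fst, ev, cut, env3_zero, h3 aIN (by decide) (by decide) (by decide) (by decide), In]
  · rw [Al, h4', hM₃, den_asg (by decide)]
    simp only [Bd.val]
    rw [setA_same hs one_pos hi]
    simp only [ev, cut, env3_zero, env3_one, env3_row]
    rw [h2', hM₁, den_asg (by decide)]
    simp only [Bd.val]
    rw [setA_same hs one_pos hi, addAlive, ev_ifE]
    simp only [ev_subG hc ht hs hG hr (env3_zero η s 0 i)]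
    by_cases hsub : fs c.X s ⊆ fs c.X G
    · rw [if_pos hsub, if_pos hsub, ev_ifE]
      have e : 0 < (fst aIN (.v 0)).ev c M (env3 η s 0 i) ↔ In M s := by
        simp [fst, ev, cut, In]
      simp only [e]
      by_cases hin : In M s
      · rw [if_pos hin, if_pos hin]
        simp only [keepOld, pos_andE, pos_exE, Bd.val]
        refine and_congr (by simp [fl2, ev, cut, Al]) ?_
        refine exists_congr fun j => and_congr_right fun _ => and_congr ?_ ?_
        · simp [flat, ev, cut, Xa]
        · exact (ev_sameX hc ht hs (by simp)
            (by simp) (by simp)).1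
      · rw [if_neg hin, if_neg hin]
        simp only [takeNew, pos_andE, pos_notE, pos_exE, pos_ltE, Bd.val]
        refine and_congr (by simp [flat, ev, cut, Xa]) (not_congr ?_)
        refine exists_congr fun j => and_congr_right fun _ => and_congr ?_ (and_congr ?_ ?_)
        · simp [ev]
        · simp [flat, ev, cut, Xa]
        · exact (ev_sameX hc ht hs (by simp)
            (by simp) (by simp)).2
    · rw [if_neg hsub, if_neg hsub]
      simp [fl2, ev, cut, Al]
  · rw [h4, hM₂, den_upd (by decide) (by decide)]
    simp only [Bd.val]
    rw [setA_same hs hk hi, addData, ev_ifE]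
    have e1 : 0 < (andE (subE (.v 0) (reg aG)) (notE (fst aIN (.v 0)))).ev c M₁ (env3 η s k i) ↔
        fs c.X s ⊆ fs c.X G ∧ ¬ In M s := by
      rw [pos_andE, pos_notE, ev_subG hc (ht.congr (h1 _ (by decide)) (h1 _ (by decide))
        (h1 _ (by decide))) hs hG (by rw [h1 _ (by decide), hr]) (by simp)]
      simp [fst, ev, cut, In, h1]
    have e2 : 0 < (mem (.v 0) (.v 1)).ev c M₁ (env3 η s k i) ↔ k ∈ fs c.X s := by
      rw [← ht.mem hc hs hk]
      simp [mem, two, ev, cut, h1]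
    simp only [e1, ev_ifE, e2]
    simp [ev, cut, h1]

theorem addlist_spec (hc : c.OK) (h : Inv φ A c M) {G : ℕ} (hG : NewRows φ A c M G) (η : ℕ → ℕ) :
    Added c M (addlist.den c η M) G ∧ Inv φ A c (addlist.den c η M) := by
  classical
  obtain ⟨d1, d2, d3, d4⟩ := addlist_data hc h.tab hG.lt hG.reg η
  set M' := addlist.den c η M with hM'
  have hrow : ∀ s < c.E, ∀ i < c.D, row c M' s i =
      if fs c.X s ⊆ fs c.X G ∧ ¬ In M s then (xrow c M i).proj (fs c.X s) else row c M s i := by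
    intro s hs i hi
    funext k
    by_cases hk : k < c.X
    · simp only [row, hk, if_true, d4 s hs i hi k hk]
      split_ifs with h1 h2
      · simp [PMap.proj, h2, xrow, hk]
      · simp [PMap.proj, h2, dec]
      · simp [row, hk]
    · have : k ∉ fs c.X s := fun h' => hk (mem_fs.1 h').1
      split_ifs with h1
      · simp [row, hk, PMap.proj, this]
      · simp [row, hk]
  have hal : ∀ s < c.E, ∀ i < c.D, (Al M' s i ↔
      if fs c.X s ⊆ fs c.X G then (if In M s then
        Al M s i ∧ ∃ j < c.D, Xa M j ∧ (xrow c M j).proj (fs c.X s) = row c M s i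
        else Xa M i ∧ ¬ ∃ j < c.D, j < i ∧ Xa M j ∧
          (xrow c M j).proj (fs c.X s) = (xrow c M i).proj (fs c.X s))
      else Al M s i) := by
    intro s hs i hi
    rw [d3 s hs i hi]
    simp only [xrow_eq]
    split_ifs with h1 h2
    · exact and_congr_right fun ha => by simp only [xrow_eq_row (h.hasDom hs hi ha)]
    · rfl
    · rfl
  have hadd : Added c M M' G := by
    refine ⟨d1, d2, fun s hs hsub g => ?_, fun s hs hsub => ?_⟩
    · rw [mem_rel hs, mem_rel hs]
      by_cases hin : In M s
      · simp only [hin, true_implies]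
        constructor
        · rintro ⟨i, hi, ha, rfl⟩
          rw [hal s hs i hi, if_pos hsub, if_pos hin] at ha
          rw [hrow s hs i hi, if_neg (by simp [hin])]
          obtain ⟨ha, j, hj, hx, e⟩ := ha
          exact ⟨⟨i, hi, ha, rfl⟩, j, hj, hx, e⟩
        · rintro ⟨⟨i, hi, ha, rfl⟩, j, hj, hx, e⟩
          refine ⟨i, hi, ?_, by rw [hrow s hs i hi, if_neg (by simp [hin])]⟩
          rw [hal s hs i hi, if_pos hsub, if_pos hin]
          exact ⟨ha, j, hj, hx, e⟩
      · simp only [hin, false_implies, true_and]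
        constructor
        · rintro ⟨i, hi, ha, rfl⟩
          rw [hal s hs i hi, if_pos hsub, if_neg hin] at ha
          rw [hrow s hs i hi, if_pos ⟨hsub, hin⟩]
          exact ⟨i, hi, ha.1, rfl⟩
        · rintro ⟨i, hi, hx, rfl⟩
          have hex : ∃ j, j < c.D ∧ Xa M j ∧ (xrow c M j).proj (fs c.X s) =
            (xrow c M i).proj (fs c.X s) := ⟨i, hi, hx, rfl⟩
          obtain ⟨hj, hxj, ej⟩ := Nat.find_spec hex
          refine ⟨Nat.find hex, hj, ?_, by rw [hrow s hs _ hj, if_pos ⟨hsub, hin⟩, ej]⟩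
          rw [hal s hs _ hj, if_pos hsub, if_neg hin]
          refine ⟨hxj, ?_⟩
          rintro ⟨j', hj', hlt, hx', e'⟩
          exact Nat.find_min hex hlt ⟨hj', hx', e'.trans ej⟩
    · ext g
      rw [mem_rel hs, mem_rel hs]
      refine exists_congr fun i => and_congr_right fun hi => ?_
      rw [hal s hs i hi, if_neg hsub, hrow s hs i hi, if_neg (by simp [hsub])]
  refine ⟨hadd, ⟨h.tab.congr (d1 _ (by decide) (by decide) (by decide) (by decide) (by decide)
    (by decide)) (d1 _ (by decide) (by decide) (by decide) (by decide) (by decide) (by decide))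
    (d1 _ (by decide) (by decide) (by decide) (by decide) (by decide) (by decide)),
    ⟨?_, ?_, ?_⟩, ?_, ?_⟩⟩
  · intro S hS
    obtain ⟨s, hs, hin, rfl⟩ := exists_of_mem_sets hS
    rcases (d2 s hs).1 hin with h1 | h1
    · exact h.wf.sub _ ((mem_sets hs).2 h1)
    · exact h1.trans hG.vars
  · intro S hS T hT
    obtain ⟨s, hs, hin, rfl⟩ := exists_of_mem_sets hS
    obtain ⟨t, ht, rfl⟩ := exists_fs (hT.trans (fs_subset _ _))
    rw [mem_sets (show t < c.E from ht), d2 t ht]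
    rcases (d2 s hs).1 hin with h1 | h1
    · exact Or.inl ((mem_sets ht).1 (h.wf.down _ ((mem_sets hs).2 h1) _ hT))
    · exact Or.inr (hT.trans h1)
  · intro S hS g hg
    obtain ⟨s, hs, hin, rfl⟩ := exists_of_mem_sets hS
    by_cases hsub : fs c.X s ⊆ fs c.X G
    · obtain ⟨-, i, hi, hx, rfl⟩ := (hadd.rel_sub s hs hsub g).1 hg
      obtain ⟨h1, h2⟩ := hG.dom i hi hx
      refine ⟨PMap.hasDom_proj h1 hsub, fun x a hx => h2 x a ?_⟩
      simp only [PMap.proj] at hx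
      split_ifs at hx
      exact hx
    · rw [hadd.rel_not s hs hsub] at hg
      exact h.wf.dom _ ((mem_sets hs).2 (((d2 s hs).1 hin).resolve_right hsub)) g hg
  · intro s hs i hi ha
    rw [d2 s hs]
    by_cases hsub : fs c.X s ⊆ fs c.X G
    · exact Or.inr hsub
    · rw [hal s hs i hi, if_neg hsub] at ha
      exact Or.inl (h.al s hs i hi ha)
  · intro s hs i hi j hj h1 h2 e
    rw [hal s hs i hi] at h1
    rw [hal s hs j hj] at h2
    rw [hrow s hs i hi, hrow s hs j hj] at e
    by_cases hsub : fs c.X s ⊆ fs c.X G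
    · by_cases hin : In M s
      · simp only [hsub, hin, if_true, not_true, and_false, if_false] at h1 h2 e
        exact h.inj s hs i hi j hj h1.1 h2.1 e
      · simp only [hsub, hin, if_true, if_false, not_false_eq_true, and_true] at h1 h2 e
        rcases lt_trichotomy i j with hlt | rfl | hlt
        · exact absurd ⟨i, hi, hlt, h1.1, e⟩ h2.2
        · rfl
        · exact absurd ⟨j, hj, hlt, h2.1, e.symm⟩ h1.2
    · simp only [hsub, if_false, false_and] at h1 h2 e
      exact h.inj s hs i hi j hj h1 h2 e

namespace Added

variable {G : ℕ} (h : Added c M M' G)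
include h

theorem sets_subset : (fam c M).sets ⊆ (fam c M').sets := by
  intro S hS
  obtain ⟨s, hs, hin, rfl⟩ := exists_of_mem_sets hS
  exact (mem_sets hs).2 ((h.in_iff s hs).2 (Or.inl hin))

theorem mem_sets' (hG : G < c.E) : fs c.X G ∈ (fam c M').sets :=
  (mem_sets hG).2 ((h.in_iff G hG).2 (Or.inr (Subset.refl _)))

theorem below : (fam c M').Below (fam c M) := by
  refine ⟨h.sets_subset, fun S hS g hg => ?_⟩
  obtain ⟨s, hs, hin, rfl⟩ := exists_of_mem_sets hS
  by_cases hsub : fs c.X s ⊆ fs c.X G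
  · exact ((h.rel_sub s hs hsub g).1 hg).1 hin
  · rwa [h.rel_not s hs hsub] at hg

theorem sol_eq (hG : ∀ g ∈ (fam c M).sol φ A, ∃ i < c.D, Xa M i ∧
    ∀ x ∈ fs c.X G, xrow c M i x = g x) : (fam c M').sol φ A = (fam c M).sol φ A := by
  ext g
  constructor
  · rintro ⟨h1, h2⟩
    exact ⟨h1, fun S hS => h.below.rel S hS (h2 S (h.sets_subset hS))⟩
  · intro hg
    obtain ⟨i, hi, hx, e⟩ := hG g hg
    obtain ⟨h1, h2⟩ := hg
    refine ⟨h1, fun S hS => ?_⟩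
    obtain ⟨s, hs, hin, rfl⟩ := exists_of_mem_sets hS
    by_cases hsub : fs c.X s ⊆ fs c.X G
    · refine (h.rel_sub s hs hsub _).2 ⟨fun hin => h2 _ ((mem_sets hs).2 hin), i, hi, hx, ?_⟩
      exact PMap.proj_eq_proj.2 fun x hx => e x (hsub hx)
    · rw [h.rel_not s hs hsub]
      exact h2 _ ((mem_sets hs).2 (((h.in_iff s hs).1 hin).resolve_right hsub))

end Added

end Pr

end

section

open Finset

namespace Pr

open EX Stm

variable {φ : QFCQ} {A : Struct} {c : Cst} {M M' : Mem}

/-! ### Joins -/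

/-- The union of two rows. -/
def mrow (c : Cst) (M : Mem) (s t i j : ℕ) : PMap := fun k =>
  if k < c.X then dec (max (M aDT s k i) (M aDT t k j)) else none

/-- The rows have a common extension in each relation. -/
def Match (c : Cst) (M : Mem) (s t i j : ℕ) : Prop :=
  ∀ u < c.E, In M u → ∃ k < c.D, Al M u k ∧
    (row c M u k).proj (fs c.X u ∩ fs c.X s) = (row c M s i).proj (fs c.X u ∩ fs c.X s) ∧
    (row c M u k).proj (fs c.X u ∩ fs c.X t) = (row c M t j).proj (fs c.X u ∩ fs c.X t)

/-- The state before joins and splits. -/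
structure Lkd (φ : QFCQ) (A : Struct) (c : Cst) (M : Mem) : Prop where
  inv : Inv φ A c M
  lk : Lk c M
  cons : (fam c M).Cons

/-- The arrays describing the family and the links agree. -/
structure Same (c : Cst) (M M' : Mem) : Prop where
  mem : M' aMEM = M aMEM
  cap : M' aCAP = M aCAP
  cup : M' aCUP = M aCUP
  ins : M' aIN = M aIN
  al : M' aAL = M aAL
  dt : M' aDT = M aDT
  pr : M' aPR = M aPR

theorem Same.refl (c : Cst) (M : Mem) : Same c M M := ⟨rfl, rfl, rfl, rfl, rfl, rfl, rfl⟩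

theorem Same.of {Z : List ℕ} (h : ∀ a, a ∉ Z → M' a = M a)
    (hZ : ∀ a ∈ [aMEM, aCAP, aCUP, aIN, aAL, aDT, aPR], a ∉ Z) : Same c M M' :=
  ⟨h _ (hZ _ (by simp)), h _ (hZ _ (by simp)), h _ (hZ _ (by simp)), h _ (hZ _ (by simp)),
    h _ (hZ _ (by simp)), h _ (hZ _ (by simp)), h _ (hZ _ (by simp))⟩

theorem Same.trans {M'' : Mem} (h : Same c M M') (h' : Same c M' M'') : Same c M M'' :=
  ⟨h'.mem.trans h.mem, h'.cap.trans h.cap, h'.cup.trans h.cup, h'.ins.trans h.ins,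
    h'.al.trans h.al, h'.dt.trans h.dt, h'.pr.trans h.pr⟩

theorem Same.fam (h : Same c M M') : fam c M' = fam c M := fam_congr h.ins h.al h.dt

theorem Same.lkd (h : Same c M M') (hM : Lkd φ A c M) : Lkd φ A c M' where
  inv := hM.inv.congr h.mem h.cap h.cup h.ins h.al h.dt
  lk := by
    refine ⟨?_, ?_⟩
    · simp only [Al, row_congr h.dt, h.al, h.pr]; exact hM.lk.link
    · simp only [Al, row_congr h.dt, h.al, h.pr]; exact hM.lk.back
  cons := by rw [h.fam]; exact hM.cons

namespace Lkd

variable (h : Lkd φ A c M)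
include h

theorem pr_spec {s w i : ℕ} (hs : s < c.E) (hw : w < c.E) (hi : i < c.D) (ha : Al M s i)
    (hsub : fs c.X w ⊆ fs c.X s) : ∃ j < c.D, Al M w j ∧
      row c M w j = (row c M s i).proj (fs c.X w) ∧ M aPR s w i = j + 1 := by
  have hS := (mem_sets hs).2 (h.inv.al s hs i hi ha)
  have hW := h.inv.wf.down _ hS _ hsub
  have hg : (row c M s i).proj (fs c.X w) ∈ (Pr.fam c M).rel (fs c.X w) := by
    rw [h.cons _ hW _ hS hsub]
    exact ⟨_, (mem_rel hs).2 ⟨i, hi, ha, rfl⟩, rfl⟩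
  obtain ⟨j, hj, haj, e⟩ := (mem_rel hw).1 hg
  exact ⟨j, hj, haj, e, h.lk.link s hs w hw i hi j hj ha haj e⟩

theorem pr_eq_iff {s t w i j : ℕ} (hs : s < c.E) (ht : t < c.E) (hw : w < c.E) (hi : i < c.D)
    (hj : j < c.D) (ha : Al M s i) (hb : Al M t j) (hws : fs c.X w ⊆ fs c.X s)
    (hwt : fs c.X w ⊆ fs c.X t) : M aPR s w i = M aPR t w j ↔
      (row c M s i).proj (fs c.X w) = (row c M t j).proj (fs c.X w) := by
  obtain ⟨k, hk, hak, e1, e2⟩ := h.pr_spec hs hw hi ha hws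
  obtain ⟨l, hl, hal, e3, e4⟩ := h.pr_spec ht hw hj hb hwt
  rw [e2, e4, ← e1, ← e3]
  constructor
  · intro e
    have : k = l := by omega
    rw [this]
  · intro e
    rw [h.inv.inj w hw k hk l hl hak hal e]

theorem match_agree {s t i j : ℕ} (hs : s < c.E) (hi : i < c.D) (ha : Al M s i)
    (hm : Match c M s t i j) : ∀ k ∈ fs c.X s ∩ fs c.X t, row c M s i k = row c M t j k := by
  obtain ⟨l, hl, hal, e1, e2⟩ := hm s hs (h.inv.al s hs i hi ha)
  rw [inter_self, PMap.proj_self (h.inv.hasDom hs hl hal), PMap.proj_self (h.inv.hasDom hs hi ha)]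
    at e1
  rw [e1] at e2
  exact PMap.proj_eq_proj.1 e2

theorem eq_zero {s i k : ℕ} (hs : s < c.E) (hi : i < c.D) (ha : Al M s i) (hk : k < c.X)
    (hn : k ∉ fs c.X s) : M aDT s k i = 0 := by
  have := (not_congr (h.inv.hasDom hs hi ha k)).2 hn
  simp only [row, hk, if_true, isSome_dec] at this
  omega

theorem mrow_eq {s t i j : ℕ} (hs : s < c.E) (ht : t < c.E) (hi : i < c.D) (hj : j < c.D)
    (ha : Al M s i) (hb : Al M t j)
    (hag : ∀ k ∈ fs c.X s ∩ fs c.X t, row c M s i k = row c M t j k) :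
    (∀ k ∈ fs c.X s, mrow c M s t i j k = row c M s i k) ∧
    (∀ k ∈ fs c.X t, mrow c M s t i j k = row c M t j k) ∧
    (mrow c M s t i j).HasDom (fs c.X s ∪ fs c.X t) := by
  have key : ∀ k < c.X, k ∈ fs c.X s → k ∈ fs c.X t → M aDT s k i = M aDT t k j := by
    intro k hk h1 h2
    have := hag k (mem_inter.2 ⟨h1, h2⟩)
    simpa only [row, hk, if_true, dec_inj] using this
  refine ⟨fun k hk => ?_, fun k hk => ?_, fun k => ?_⟩
  · have hX := (mem_fs.1 hk).1
    simp only [mrow, row, hX, if_true]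
    by_cases h2 : k ∈ fs c.X t
    · rw [key k hX hk h2, max_self]
    · rw [h.eq_zero ht hj hb hX h2, max_eq_left (Nat.zero_le _)]
  · have hX := (mem_fs.1 hk).1
    simp only [mrow, row, hX, if_true]
    by_cases h2 : k ∈ fs c.X s
    · rw [key k hX h2 hk, max_self]
    · rw [h.eq_zero hs hi ha hX h2, max_eq_right (Nat.zero_le _)]
  · by_cases hX : k < c.X
    · have h1 := h.inv.hasDom hs hi ha k
      have h2 := h.inv.hasDom ht hj hb k
      simp only [row, hX, if_true, isSome_dec] at h1 h2
      simp only [mrow, hX, if_true, isSome_dec, lt_max_iff, h1, h2, mem_union]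
    · simp [mrow, hX, mem_union, mem_fs]

/-- The locally consistent mappings are the unions of matching rows. -/
theorem mem_loc {s t : ℕ} (hs : s < c.E) (ht : t < c.E) (hsI : In M s) (htI : In M t) {g : PMap} :
    g ∈ (Pr.fam c M).loc (fs c.X s ∪ fs c.X t) ↔ ∃ i < c.D, Al M s i ∧ ∃ j < c.D, Al M t j ∧
      Match c M s t i j ∧ mrow c M s t i j = g := by
  constructor
  · rintro ⟨hd, hg⟩
    have hpart : ∀ w < c.E, In M w → fs c.X w ⊆ fs c.X s ∪ fs c.X t → ∃ i < c.D, Al M w i ∧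
        ∀ k ∈ fs c.X w, row c M w i k = g k := by
      intro w hw hwI hsub
      obtain ⟨u, hu, e⟩ := hg _ ((mem_sets hw).2 hwI)
      obtain ⟨i, hi, ha, rfl⟩ := (mem_rel hw).1 hu
      exact ⟨i, hi, ha, fun k hk => e k (mem_inter.2 ⟨hk, hsub hk⟩)⟩
    obtain ⟨i, hi, ha, ei⟩ := hpart s hs hsI subset_union_left
    obtain ⟨j, hj, hb, ej⟩ := hpart t ht htI subset_union_right
    have hag : ∀ k ∈ fs c.X s ∩ fs c.X t, row c M s i k = row c M t j k := fun k hk =>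
      (ei k (mem_inter.1 hk).1).trans (ej k (mem_inter.1 hk).2).symm
    obtain ⟨h1, h2, h3⟩ := h.mrow_eq hs ht hi hj ha hb hag
    refine ⟨i, hi, ha, j, hj, hb, fun u hu huI => ?_, h3.ext hd fun k hk => ?_⟩
    · obtain ⟨v, hv, e⟩ := hg _ ((mem_sets hu).2 huI)
      obtain ⟨k, hk, hak, rfl⟩ := (mem_rel hu).1 hv
      refine ⟨k, hk, hak, PMap.proj_eq_proj.2 fun x hx => ?_, PMap.proj_eq_proj.2 fun x hx => ?_⟩
      · obtain ⟨hx1, hx2⟩ := mem_inter.1 hx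
        rw [e x (mem_inter.2 ⟨hx1, mem_union_left _ hx2⟩), ei x hx2]
      · obtain ⟨hx1, hx2⟩ := mem_inter.1 hx
        rw [e x (mem_inter.2 ⟨hx1, mem_union_right _ hx2⟩), ej x hx2]
    · rcases mem_union.1 hk with hk | hk
      · rw [h1 k hk, ei k hk]
      · rw [h2 k hk, ej k hk]
  · rintro ⟨i, hi, ha, j, hj, hb, hm, rfl⟩
    obtain ⟨h1, h2, h3⟩ := h.mrow_eq hs ht hi hj ha hb (h.match_agree hs hi ha hm)
    refine ⟨h3, fun U hU => ?_⟩
    obtain ⟨u, hu, huI, rfl⟩ := exists_of_mem_sets hU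
    obtain ⟨k, hk, hak, e1, e2⟩ := hm u hu huI
    refine ⟨_, (mem_rel hu).2 ⟨k, hk, hak, rfl⟩, fun x hx => ?_⟩
    obtain ⟨hx1, hx2⟩ := mem_inter.1 hx
    rcases mem_union.1 hx2 with hx2 | hx2
    · rw [h1 x hx2]
      exact PMap.proj_eq_proj.1 e1 x (mem_inter.2 ⟨hx1, hx2⟩)
    · rw [h2 x hx2]
      exact PMap.proj_eq_proj.1 e2 x (mem_inter.2 ⟨hx1, hx2⟩)

end Lkd

open Classical in
/-- The list of the unions of matching rows. -/
noncomputable def joinList (c : Cst) (M : Mem) (s t : ℕ) : List PMap :=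
  (List.range c.D).flatMap fun i => if Al M s i then (List.range c.D).flatMap fun j =>
    if Al M t j ∧ Match c M s t i j then [mrow c M s t i j] else [] else []

theorem mem_joinList {s t : ℕ} {g : PMap} : g ∈ joinList c M s t ↔
    ∃ i < c.D, Al M s i ∧ ∃ j < c.D, Al M t j ∧ Match c M s t i j ∧ mrow c M s t i j = g := by
  classical
  simp only [joinList, List.mem_flatMap, List.mem_range]
  refine exists_congr fun i => and_congr_right fun _ => ?_
  by_cases ha : Al M s i
  · simp only [ha, if_true, List.mem_flatMap, List.mem_range, true_and]
    refine exists_congr fun j => and_congr_right fun _ => ?_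
    by_cases hb : Al M t j ∧ Match c M s t i j
    · simp only [hb, and_self, if_true, List.mem_singleton, true_and, eq_comm]
    · simp only [hb, if_false, List.not_mem_nil, false_iff]
      exact fun h' => hb ⟨h'.1, h'.2.1⟩
  · simp [ha]

namespace Lkd

variable (h : Lkd φ A c M)
include h

theorem nodup_joinList {s t : ℕ} (hs : s < c.E) (ht : t < c.E) : (joinList c M s t).Nodup := by
  classical
  have part : ∀ i < c.D, ∀ j < c.D, Al M s i → Al M t j → Match c M s t i j →
      (mrow c M s t i j).proj (fs c.X s) = row c M s i ∧
      (mrow c M s t i j).proj (fs c.X t) = row c M t j := by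
    intro i hi j hj ha hb hm
    obtain ⟨h1, h2, -⟩ := h.mrow_eq hs ht hi hj ha hb (h.match_agree hs hi ha hm)
    constructor
    · rw [← PMap.proj_self (h.inv.hasDom hs hi ha)]
      exact PMap.proj_eq_proj.2 h1
    · rw [← PMap.proj_self (h.inv.hasDom ht hj hb)]
      exact PMap.proj_eq_proj.2 h2
  rw [joinList, List.nodup_flatMap]
  constructor
  · intro i hi
    have hi := List.mem_range.1 hi
    split_ifs with ha
    · rw [List.nodup_flatMap]
      refine ⟨fun j _ => by split_ifs <;> simp, ?_⟩
      refine List.Pairwise.imp_of_mem ?_ List.nodup_range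
      intro j j' hj hj' hne
      have hj := List.mem_range.1 hj
      have hj' := List.mem_range.1 hj'
      simp only [Function.onFun]
      intro g hg hg'
      split_ifs at hg hg' with h1 h2
      · simp only [List.mem_singleton] at hg hg'
        refine hne (h.inv.inj t ht j hj j' hj' h1.1 h2.1 ?_)
        rw [← (part i hi j hj ha h1.1 h1.2).2, ← (part i hi j' hj' ha h2.1 h2.2).2, ← hg, ← hg']
      all_goals simp_all
    · exact List.nodup_nil
  · refine List.Pairwise.imp_of_mem ?_ List.nodup_range
    intro i i' hi hi' hne
    have hi := List.mem_range.1 hi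
    have hi' := List.mem_range.1 hi'
    simp only [Function.onFun]
    intro g hg hg'
    split_ifs at hg hg' with ha ha'
    · simp only [List.mem_flatMap, List.mem_range] at hg hg'
      obtain ⟨j, hj, hg⟩ := hg
      obtain ⟨j', hj', hg'⟩ := hg'
      split_ifs at hg hg' with h1 h2
      · simp only [List.mem_singleton] at hg hg'
        refine hne (h.inv.inj s hs i hi i' hi' ha ha' ?_)
        rw [← (part i hi j hj ha h1.1 h1.2).1, ← (part i' hi' j' hj' ha' h2.1 h2.2).1, ← hg, ← hg']
      all_goals simp_all
    all_goals simp_all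

theorem ncard_loc {s t : ℕ} (hs : s < c.E) (ht : t < c.E) (hsI : In M s) (htI : In M t) :
    ((Pr.fam c M).loc (fs c.X s ∪ fs c.X t)).ncard = (joinList c M s t).length := by
  classical
  rw [← List.toFinset_card_of_nodup (h.nodup_joinList hs ht), ← Set.ncard_coe_finset]
  congr 1
  ext g
  rw [h.mem_loc hs ht hsI htI]
  simp only [List.coe_toFinset, Set.mem_ofPred_eq, mem_joinList]

end Lkd

/-- The state while the new rows are enumerated: the rows in `L` have been found. -/
structure Enum (c : Cst) (M : Mem) (L : List PMap) (M' : Mem) : Prop where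
  same : ∀ a, a ∉ [aXN, aXD, aMK] → M' a = M a
  num : M' aXN 0 0 0 = L.length
  rows : ∀ n (hn : n < L.length), n < c.D → xrow c M' n = L[n]

theorem Enum.toSame {L : List PMap} (h : Enum c M L M') : Same c M M' :=
  Same.of h.same (by decide)

theorem Enum.push (hc : c.OK) {L : List PMap} (h : Enum c M L M') {η : ℕ → ℕ} {s t i j : ℕ}
    (h7 : η 7 = s) (h8 : η 8 = t) (h22 : η 22 = i) (h23 : η 23 = j) :
    Enum c M (L ++ [mrow c M s t i j]) (pushRow.den c η M') := by
  have hX : ∀ k < c.X, k ≤ c.P := fun k hk => (hc.X_lt hk).2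
  have hD := D_le_LIM hc
  simp only [pushRow, blk, den]
  set M₁ := (whenS _ _).den c η M' with hM₁
  have hfr : ∀ a, a ≠ aXD → M₁ a = M' a := fun a ha =>
    den_frame _ _ _ (by simp [whenS, writes, ha])
  have hM₁' : (setR aXN ((reg aXN).add (.c 1))).den c η M₁ =
      wr M₁ aXN 0 0 0 (L.length + 1) := by
    simp only [setR, den, ev, cut, reg, hfr aXN (by decide), h.num]
  rw [hM₁']
  have hdata : L.length < c.D → ∀ k < c.X, ∀ r, M₁ aXD 0 k r =
      if r = L.length then max (M aDT s k i) (M aDT t k j) else M' aXD 0 k r := by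
    intro hL
    rw [hM₁, den_whenS, if_pos (by rw [pos_ltE]; simp only [ev, cut, reg, h.num, Bd.val]; exact hL)]
    have := den_loop_inv (c := c) (x := 11) (b := .X) (η := η) (M := M')
      (p := .st aXD (.c 0) (.v 11) (reg aXN)
        (maxE (.rd aDT (.v 7) (.v 11) (.v 22)) (.rd aDT (.v 8) (.v 11) (.v 23))))
      (fun n M'' => (∀ a, a ≠ aXD → M'' a = M' a) ∧ ∀ k r, M'' aXD 0 k r =
        if k < n ∧ r = L.length then max (M aDT s k i) (M aDT t k j) else M' aXD 0 k r)
      ⟨fun _ _ => rfl, by simp⟩ ?_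
    · intro k hk r
      rw [this.2 k r]
      simp only [Bd.val, hk, true_and]
    · intro n hn M'' hM''
      have hn : n < c.X := hn
      have hdt : M'' aDT = M aDT := (hM''.1 _ (by decide)).trans (h.same _ (by decide))
      have e : Stm.den c (Function.update η 11 n) (.st aXD (.c 0) (.v 11) (reg aXN)
          (maxE (.rd aDT (.v 7) (.v 11) (.v 22)) (.rd aDT (.v 8) (.v 11) (.v 23)))) M'' =
          wr M'' aXD 0 n L.length (max (M aDT s n i) (M aDT t n j)) := by
        simp only [den, ev, cut, reg, maxE, hdt, hM''.1 aXN (by decide), h.num]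
        simp only [Function.update_apply, Nat.reduceEqDiff, if_true, if_false, h7, h8, h22, h23]
        rw [min_eq_left (by omega)]
        congr 1
      rw [e]
      refine ⟨fun a ha => (wr_ne _ _ _ _ ha).trans (hM''.1 a ha), fun k r => ?_⟩
      simp only [wr, true_and, hM''.2 k r]
      by_cases h1 : k = n ∧ r = L.length
      · rw [if_pos h1, if_pos ⟨by omega, h1.2⟩, h1.1]
      · rw [if_neg h1]
        refine if_congr ⟨fun h2 => ⟨by omega, h2.2⟩, fun h2 => ⟨?_, h2.2⟩⟩ rfl rfl
        by_contra h3
        exact h1 ⟨by omega, h2.2⟩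
  refine ⟨fun a ha => ?_, by simp [wr], fun n hn hnD => ?_⟩
  · simp only [List.mem_cons, not_or] at ha
    rw [wr_ne _ _ _ _ ha.1, hfr a ha.2.1, h.same a (by simp [ha])]
  · have hxd : wr M₁ aXN 0 0 0 (L.length + 1) aXD = M₁ aXD := wr_ne _ _ _ _ (by decide)
    by_cases hLD : L.length < c.D
    swap
    · have hsk : M₁ = M' := by
        rw [hM₁, den_whenS, if_neg]
        rw [pos_ltE]
        simp only [ev, cut, reg, h.num, Bd.val]
        exact hLD
      rw [List.getElem_append_left (by omega), ← h.rows n (by omega) hnD]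
      funext k
      rw [xrow, xrow, hxd, hsk]
    simp only [List.length_append, List.length_singleton] at hn
    funext k
    simp only [xrow, hxd]
    by_cases hk : k < c.X
    · rw [if_pos hk, hdata hLD k hk]
      rcases Nat.lt_succ_iff_lt_or_eq.1 hn with h1 | rfl
      · rw [if_neg (by omega), List.getElem_append_left h1]
        have := congrFun (h.rows n h1 hnD) k
        simpa only [xrow, hk, if_true] using this
      · rw [if_pos rfl]
        simp [mrow, hk]
    · rw [if_neg hk]
      rcases Nat.lt_succ_iff_lt_or_eq.1 hn with h1 | rfl
      · rw [List.getElem_append_left h1]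
        have := congrFun (h.rows n h1 hnD) k
        simpa only [xrow, hk, if_false] using this
      · simp [mrow, hk]

theorem Tab.min_cap (hc : c.OK) (h : Tab c M) {s t : ℕ} (hs : s < c.E) (ht : t < c.E) :
    min (M aCAP s t 0) c.P = s &&& t := by
  rw [h.cap s hs t ht]
  exact min_eq_left (hc.E_lt (lt_of_le_of_lt Nat.and_le_left hs)).2

theorem enumRow_spec (hc : c.OK) (h : Lkd φ A c M) {s t i : ℕ} (hs : s < c.E) (ht : t < c.E)
    (hi : i < c.D) (ha : Al M s i) {L : List PMap} (hL : Enum c M L M') {η : ℕ → ℕ}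
    (h7 : η 7 = s) (h8 : η 8 = t) (h22 : η 22 = i) [∀ j, Decidable (Al M t j ∧ Match c M s t i j)] :
    Enum c M (L ++ (List.range c.D).flatMap fun j =>
      if Al M t j ∧ Match c M s t i j then [mrow c M s t i j] else []) (enumRow.den c η M') := by
  have hD := D_le_LIM hc
  simp only [enumRow, blk, den]
  set M₁ := (asg aMK .E .one .D (.c 0)).den c η M' with hM₁
  have h1 : ∀ a, a ≠ aMK → M₁ a = M' a := fun a ha =>
    den_frame _ _ _ (by simp [asg, fors, writes, ha])
  set M₂ := (mrk aMK _ _ _ _ _ _ _).den c η M₁ with hM₂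
  have h2 : ∀ a, a ≠ aMK → M₂ a = M' a := fun a ha =>
    (den_frame _ _ _ (by simp [mrk, whenS, fors, writes, ha])).trans (h1 a ha)
  have hS : Same c M M₁ := hL.toSame.trans (Same.of (Z := [aMK]) (fun a ha => h1 a (by simpa using ha))
    (by decide))
  have hmk : ∀ u < c.E, ∀ r < c.D, (0 < M₂ aMK u 0 r ↔ ∃ k < c.D, Al M u k ∧
      M aPR u (u &&& s) k = M aPR s (u &&& s) i ∧
      r = min (M aPR u (u &&& t) k - 1) c.LIM) := by
    intro u hu r hr
    rw [hM₂, den_mrk (by decide) (by decide) (by decide) (by decide)]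
    have h0 : M₁ aMK u 0 r = 0 := by
      rw [hM₁, den_asg (by decide)]
      simp only [Bd.val]
      rw [setA_same hu one_pos hr]
      rfl
    rw [h0]
    simp only [lt_irrefl, false_or, markE, pos_andE, pos_eqE]
    have e7 := fun p q r => env3_of_ne η p q r 7 (by decide) (by decide) (by decide)
    have e8 := fun p q r => env3_of_ne η p q r 8 (by decide) (by decide) (by decide)
    have e22 := fun p q r => env3_of_ne η p q r 22 (by decide) (by decide) (by decide)
    have ht1 := h.inv.tab
    simp only [fl2, cap, two, ev, cut, Bd.val, env3_zero, env3_row, hS.al, hS.pr, hS.cap, e7, e8,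
      e22, h7, h8, h22]
    constructor
    · rintro ⟨v, hv, q, -, k, hk, ⟨h3, h4⟩, rfl, -, h6⟩
      rw [ht1.min_cap hc hv hs] at h4
      rw [ht1.min_cap hc hv ht] at h6
      exact ⟨k, hk, h3, h4, h6⟩
    · rintro ⟨k, hk, h3, h4, h6⟩
      refine ⟨u, hu, 0, one_pos, k, hk, ⟨h3, ?_⟩, rfl, trivial, ?_⟩
      · rwa [ht1.min_cap hc hu hs]
      · rwa [ht1.min_cap hc hu ht]
  have hE2 : Enum c M L M₂ := by
    refine ⟨fun a ha => ?_, ?_, fun n hn hnD => ?_⟩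
    · rw [h2 a (by simp at ha; exact ha.2.2), hL.same a ha]
    · rw [h2 _ (by decide), hL.num]
    · rw [← hL.rows n hn hnD]
      funext k
      rw [xrow, xrow, h2 aXD (by decide)]
  have hmatch : ∀ j < c.D, ∀ M₃, (∀ a, a ≠ aXN → a ≠ aXD → M₃ a = M₂ a) →
      (0 < matchE.ev c M₃ (Function.update η 23 j) ↔ Al M t j ∧ Match c M s t i j) := by
    intro j hj M₃ h3
    have hS3 : Same c M M₃ := hE2.toSame.trans (Same.of (Z := [aXN, aXD]) (fun a ha => by
      simp at ha; exact h3 a ha.1 ha.2) (by decide))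
    simp only [matchE, pos_andE, pos_allE, pos_impE, Bd.val]
    have e0 : 0 < (fl2 aAL (.v 8) (.v 23)).ev c M₃ (Function.update η 23 j) ↔ Al M t j := by
      simp [fl2, ev, cut, Al, hS3.al, h8]
    rw [e0]
    refine and_congr_right fun hb => forall₂_congr fun u hu => ?_
    have e1 : 0 < (fst aIN (.v 10)).ev c M₃ (Function.update (Function.update η 23 j) 10 u) ↔
        In M u := by simp [fst, ev, cut, hS3.ins, In]
    rw [e1]
    refine imp_congr_right fun huI => ?_
    simp only [fl2, cap, two, ev, cut, Function.update_apply, Nat.reduceEqDiff, if_true, if_false,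
      h8, hS3.pr, hS3.cap, h3 aMK (by decide) (by decide)]
    rw [h.inv.tab.min_cap hc hu ht]
    have hcE : ∀ w, u &&& w < c.E := fun w => lt_of_le_of_lt Nat.and_le_left hu
    have hsub : ∀ w, fs c.X (u &&& w) ⊆ fs c.X u := fun w => by
      rw [fs_and]; exact inter_subset_left
    have hsub' : ∀ w, fs c.X (u &&& w) ⊆ fs c.X w := fun w => by
      rw [fs_and]; exact inter_subset_right
    obtain ⟨l, hl, -, -, el⟩ := h.pr_spec ht (hcE t) hj hb (hsub' t)
    rw [el, Nat.add_sub_cancel, min_eq_left (by omega), hmk u hu l hl]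
    refine exists_congr fun k => and_congr_right fun hk => and_congr_right fun hak => ?_
    rw [h.pr_eq_iff hu hs (hcE s) hk hi hak ha (hsub s) (hsub' s), fs_and, ← fs_and c.X u t,
      ← h.pr_eq_iff hu ht (hcE t) hk hj hak hb (hsub t) (hsub' t)]
    refine and_congr_right fun _ => ?_
    obtain ⟨l', hl', -, -, el'⟩ := h.pr_spec hu (hcE t) hk hak (hsub t)
    rw [el', el, Nat.add_sub_cancel, min_eq_left (by omega)]
    omega
  have := den_loop_inv (c := c) (x := 23) (b := .D) (η := η) (M := M₂) (p := whenS matchE pushRow)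
    (fun n M₃ => Enum c M (L ++ (List.range n).flatMap fun j =>
      if Al M t j ∧ Match c M s t i j then [mrow c M s t i j] else []) M₃ ∧
      ∀ a, a ≠ aXN → a ≠ aXD → M₃ a = M₂ a) ⟨by simpa using hE2, fun _ _ _ => rfl⟩ ?_
  · exact this.1
  · rintro n hn M₃ ⟨h3, h4⟩
    have hn : n < c.D := hn
    rw [den_whenS, List.range_succ, List.flatMap_append, ← List.append_assoc]
    simp only [List.flatMap_cons, List.flatMap_nil, List.append_nil]
    have hiff := hmatch n hn M₃ h4
    by_cases hm : Al M t n ∧ Match c M s t i n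
    · rw [if_pos (hiff.2 hm), if_pos hm]
      refine ⟨h3.push hc (by simp [h7]) (by simp [h8])
        (by simp [h22]) (by simp), fun a h5 h6 => ?_⟩
      rw [den_frame _ _ _ (by simp [pushRow, blk, whenS, setR, writes, h5, h6]), h4 a h5 h6]
    · rw [if_neg fun h' => hm (hiff.1 h'), if_neg hm, List.append_nil]
      exact ⟨h3, h4⟩

theorem enumRows_spec (hc : c.OK) (h : Lkd φ A c M) {s t : ℕ} (hs : s < c.E) (ht : t < c.E)
    (h0 : Enum c M [] M') {η : ℕ → ℕ} (h7 : η 7 = s) (h8 : η 8 = t) :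
    Enum c M (joinList c M s t) (enumRows.den c η M') := by
  classical
  refine den_loop_inv (b := .D) (fun n M₃ => Enum c M ((List.range n).flatMap fun i =>
    if Al M s i then (List.range c.D).flatMap fun j =>
      if Al M t j ∧ Match c M s t i j then [mrow c M s t i j] else [] else []) M₃) h0 ?_
  intro n hn M₃ h3
  have hn : n < c.D := hn
  rw [den_whenS, List.range_succ, List.flatMap_append]
  simp only [List.flatMap_cons, List.flatMap_nil, List.append_nil]
  have hiff : 0 < (fl2 aAL (.v 7) (.v 22)).ev c M₃ (Function.update η 22 n) ↔ Al M s n := by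
    simp [fl2, ev, cut, Al, h3.toSame.al, h7]
  by_cases ha : Al M s n
  · rw [if_pos (hiff.2 ha), if_pos ha]
    exact enumRow_spec hc h hs ht hn ha h3 (by simp [h7])
      (by simp [h8]) (by simp)
  · rw [if_neg fun h' => ha (hiff.1 h'), if_neg ha, List.append_nil]
    exact h3

/-- The step in which two sets are joined is possible. -/
def JoinCond (M : Mem) (s t : ℕ) : Prop := M aDN 0 0 0 = 0 ∧ In M s ∧ In M t ∧ ¬ In M (s ||| t)

theorem join_spec (hc : c.OK) (h : Lkd φ A c M) {s t : ℕ} (hs : s < c.E) (ht : t < c.E)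
    {η : ℕ → ℕ} (h7 : η 7 = s) (h8 : η 8 = t) :
    ((∀ a, a ∉ [aXN, aXD, aMK] → join.den c η M a = M a) ∧
      (JoinCond M s t → c.D < ((fam c M).loc (fs c.X s ∪ fs c.X t)).ncard)) ∨
    (JoinCond M s t ∧ ((fam c M).loc (fs c.X s ∪ fs c.X t)).ncard ≤ c.D ∧
      0 < join.den c η M aDN 0 0 0 ∧ Inv φ A c (join.den c η M) ∧
      (fam c (join.den c η M)).Below (fam c M) ∧
      fs c.X (s ||| t) ∈ (fam c (join.den c η M)).sets ∧
      (fam c (join.den c η M)).sol φ A = (fam c M).sol φ A) := by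
  have hst : s ||| t < c.E := Nat.or_lt_two_pow hs ht
  have hcond : 0 < (andE (notE (reg aDN)) (andE (fst aIN (.v 7)) (andE (fst aIN (.v 8))
      (notE (fst aIN (two aCUP (.v 7) (.v 8))))))).ev c M η ↔ JoinCond M s t := by
    simp only [pos_andE, pos_notE, JoinCond, In]
    simp only [reg, fst, two, ev, cut, h7, h8, h.inv.tab.cup s hs t ht,
      min_eq_left (hc.E_lt hst).2]
    simp
  rw [join, den_whenS]
  by_cases hJ : JoinCond M s t
  swap
  · rw [if_neg fun h' => hJ (hcond.1 h')]
    exact Or.inl ⟨fun _ _ => rfl, fun h' => absurd h' hJ⟩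
  rw [if_pos (hcond.2 hJ)]
  obtain ⟨hJ1, hsI, htI, hst'⟩ := hJ
  simp only [blk, den]
  set M₁ := (setR aXN (.c 0)).den c η M with hM₁
  have h1 : Enum c M [] M₁ := by
    refine ⟨fun a ha => ?_, ?_, by simp⟩
    · exact den_frame _ _ _ (by simp at ha; simp [setR, writes, ha])
    · simp [hM₁, setR, den, ev, cut, wr]
  set M₂ := enumRows.den c η M₁ with hM₂
  have h2 : Enum c M (joinList c M s t) M₂ := enumRows_spec hc h hs ht h1 h7 h8
  have hlen := h.ncard_loc hs ht hsI htI
  rw [den_whenS]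
  have hle : 0 < (leE (reg aXN) (.bd .D)).ev c M₂ η ↔ (joinList c M s t).length ≤ c.D := by
    rw [pos_leE]
    simp only [reg, ev, cut, h2.num, Bd.val]
  by_cases hLD : (joinList c M s t).length ≤ c.D
  swap
  · rw [if_neg fun h' => hLD (hle.1 h')]
    exact Or.inl ⟨h2.same, fun _ => by omega⟩
  rw [if_pos (hle.2 hLD)]
  right
  refine ⟨⟨hJ1, hsI, htI, hst'⟩, by omega, ?_⟩
  simp only [den]
  set M₃ := (asg aXA .one .one .D (ltE (.v 20) (reg aXN))).den c η M₂ with hM₃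
  have h3 : ∀ a, a ≠ aXA → M₃ a = M₂ a := fun a ha =>
    den_frame _ _ _ (by simp [asg, fors, writes, ha])
  have h3' : ∀ i < c.D, (Xa M₃ i ↔ i < (joinList c M s t).length) := by
    intro i hi
    rw [Xa, hM₃, den_asg (by decide)]
    simp only [Bd.val]
    rw [setA_same one_pos one_pos hi, pos_ltE]
    simp [ev, cut, reg, h2.num]
  set M₄ := (setR aG (two aCUP (.v 7) (.v 8))).den c η M₃ with hM₄
  have h4 : ∀ a, a ≠ aG → M₄ a = M₃ a := fun a ha => den_frame _ _ _ (by simp [setR, writes, ha])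
  have hS3 : Same c M M₃ := h2.toSame.trans (Same.of (Z := [aXA])
    (fun a ha => h3 a (by simpa using ha)) (by decide))
  have hS : Same c M M₄ := hS3.trans (Same.of (Z := [aG]) (fun a ha => h4 a (by simpa using ha))
    (by decide))
  have hG : M₄ aG 0 0 0 = s ||| t := by
    rw [hM₄]
    simp only [setR, two, den, ev, cut, wr, h7, h8, (hS3.lkd h).inv.tab.cup s hs t ht]
    simp
  have hXa : ∀ i < c.D, (Xa M₄ i ↔ i < (joinList c M s t).length) := fun i hi => by
    rw [Xa, h4 _ (by decide)]; exact h3' i hi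
  have hxr : ∀ n (hn : n < (joinList c M s t).length), n < c.D →
      xrow c M₄ n = (joinList c M s t)[n] := by
    intro n hn hnD
    rw [← h2.rows n hn hnD]
    funext k
    rw [xrow, xrow, h4 _ (by decide), h3 _ (by decide)]
  have hloc : ∀ g, g ∈ joinList c M s t ↔ g ∈ (fam c M).loc (fs c.X s ∪ fs c.X t) := fun g => by
    rw [mem_joinList, h.mem_loc hs ht hsI htI]
  have hw := (hS.lkd h).inv
  have hnew : NewRows φ A c M₄ (s ||| t) := by
    refine ⟨hst, hG, ?_, fun i hi hx => ?_⟩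
    · rw [fs_or]
      exact union_subset (h.inv.wf.sub _ ((mem_sets hs).2 hsI)) (h.inv.wf.sub _ ((mem_sets ht).2 htI))
    · have hi' := (hXa i hi).1 hx
      have hg := (hloc _).1 (List.getElem_mem hi')
      rw [← hxr i hi' hi] at hg
      refine ⟨by rw [fs_or]; exact hg.1, fun x a hxa => ?_⟩
      have hxd := (hg.1 x).1 (by rw [hxa]; rfl)
      rcases mem_union.1 hxd with hxs | hxs
      · obtain ⟨u, hu, e⟩ := hg.2 _ ((mem_sets hs).2 hsI)
        exact (h.inv.wf.dom _ ((mem_sets hs).2 hsI) u hu).2 x a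
          ((e x (mem_inter.2 ⟨hxs, hxd⟩)).trans hxa)
      · obtain ⟨u, hu, e⟩ := hg.2 _ ((mem_sets ht).2 htI)
        exact (h.inv.wf.dom _ ((mem_sets ht).2 htI) u hu).2 x a
          ((e x (mem_inter.2 ⟨hxs, hxd⟩)).trans hxa)
  obtain ⟨h5, h6⟩ := addlist_spec hc hw hnew η
  set M₅ := addlist.den c η M₄ with hM₅
  set M₆ := (setR aDN (.c 1)).den c η M₅ with hM₆
  have h7' : ∀ a, a ≠ aDN → M₆ a = M₅ a := fun a ha => den_frame _ _ _ (by simp [setR, writes, ha])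
  have hS6 : Same c M₅ M₆ := Same.of (Z := [aDN]) (fun a ha => h7' a (by simpa using ha)) (by decide)
  refine ⟨by simp [hM₆, setR, den, ev, cut, wr], h6.congr hS6.mem hS6.cap hS6.cup hS6.ins hS6.al
    hS6.dt, ?_, ?_, ?_⟩
  · rw [hS6.fam, ← hS.fam]; exact h5.below
  · rw [hS6.fam]; exact h5.mem_sets' hst
  · rw [hS6.fam, ← hS.fam]
    refine h5.sol_eq fun g hg => ?_
    rw [hS.fam] at hg
    have hgl : g.proj (fs c.X s ∪ fs c.X t) ∈ (fam c M).loc (fs c.X s ∪ fs c.X t) := by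
      refine ⟨PMap.hasDom_proj hg.1.1 (union_subset (h.inv.wf.sub _ ((mem_sets hs).2 hsI))
        (h.inv.wf.sub _ ((mem_sets ht).2 htI))), fun U hU => ⟨_, hg.2 U hU, fun x hx => ?_⟩⟩
      obtain ⟨hx1, hx2⟩ := mem_inter.1 hx
      simp [PMap.proj, hx1, mem_union.1 hx2]
    obtain ⟨n, hn, e⟩ := List.getElem_of_mem ((hloc _).2 hgl)
    refine ⟨n, by omega, (hXa n (by omega)).2 hn, fun x hx => ?_⟩
    rw [hxr n hn (by omega), e, PMap.proj, if_pos (by rwa [fs_or] at hx)]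

end Pr

end

section

open Finset

namespace Pr

open EX Stm

variable {φ : QFCQ} {A : Struct} {c : Cst} {M M' : Mem}

/-! ### Splits -/

theorem ncard_rows (h : Inv φ A c M) {s : ℕ} (hs : s < c.E) (q : ℕ → Prop)
    [DecidablePred fun i => Al M s i ∧ q i] :
    {g | ∃ i < c.D, Al M s i ∧ q i ∧ row c M s i = g}.ncard =
      ∑ i ∈ range c.D, if Al M s i ∧ q i then 1 else 0 := by
  classical
  rw [sum_boole, Nat.cast_id, ← card_image_of_injOn (f := row c M s), ← Set.ncard_coe_finset]
  · congr 1
    ext g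
    simp only [Set.mem_ofPred_eq, coe_image, coe_filter, mem_range, Set.mem_image]
    constructor
    · rintro ⟨i, h1, h2, h3, h4⟩; exact ⟨i, ⟨h1, h2, h3⟩, h4⟩
    · rintro ⟨i, ⟨h1, h2, h3⟩, h4⟩; exact ⟨i, h1, h2, h3, h4⟩
  · intro i hi j hj e
    simp only [coe_filter, mem_range, Set.mem_ofPred_eq] at hi hj
    exact h.inj s hs i hi.1 j hj.1 hi.2.1 hj.2.1 e

theorem ev_cardE {η : ℕ → ℕ} (h : Inv φ A c M) {x s : ℕ} (hs : s < c.E) (hx : η x = s)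
    (hx' : x ≠ 25) : (cardE (.v x)).ev c M η = ((fam c M).rel (fs c.X s)).ncard := by
  classical
  have e : (fam c M).rel (fs c.X s) = {g | ∃ i < c.D, Al M s i ∧ True ∧ row c M s i = g} := by
    ext g
    rw [mem_rel hs]
    simp
  rw [e, ncard_rows h hs]
  simp only [cardE, ev, Bd.val]
  refine sum_congr rfl fun i _ => ?_
  rw [ev_flag]
  refine if_congr ?_ rfl rfl
  simp [fl2, ev, cut, Al, hx, hx']

theorem ncard_rel_le (h : Inv φ A c M) {s : ℕ} (hs : s < c.E) :
    ((fam c M).rel (fs c.X s)).ncard ≤ c.D := by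
  rw [← ev_cardE (η := fun _ => s) (x := 0) h hs rfl (by decide)]
  simp only [cardE, ev, Bd.val]
  refine (sum_le_card_nsmul _ _ 1 fun i _ => ?_).trans (by simp)
  rw [ev_flag]
  split_ifs <;> omega

theorem ev_prodE {η : ℕ → ℕ} {e f : EX} {a b : ℕ} (he : ∀ y, e.ev c M (Function.update η 25 y) = a)
    (hf : ∀ y, f.ev c M (Function.update η 25 y) = b) (ha : a ≤ c.D) :
    (prodE e f).ev c M η = a * b := by
  simp only [prodE, ev, Bd.val, he, hf, Function.update_self]
  rw [← sum_filter, sum_const, smul_eq_mul]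
  have : (range c.D).filter (fun y => y + 1 ≤ a) = range a := by
    ext y; simp only [mem_filter, mem_range]; omega
  rw [this, card_range]

open Fam in
/-- The result of a split step. -/
structure Split (φ : QFCQ) (A : Struct) (ε : ℝ) (c : Cst) (M M' : Mem) (s t : ℕ) : Prop where
  same : Same c M M'
  done : 0 < M' aDN 0 0 0
  split : 0 < M' aSP 0 0 0
  set : M' aSS 0 0 0 = s
  lt : s < c.E ∧ t < c.E
  mem : In M s ∧ In M t ∧ fs c.X s ⊆ fs c.X t
  large : ∀ i < c.D, Al M s i →
    (0 < M' aLG 0 0 i ↔ Large φ A ε (fam c M) (fs c.X s) (fs c.X t) (row c M s i))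
  ex : ∃ g, TooLarge φ A ε (fam c M) (fs c.X s) (fs c.X t) g

def SplitCond (c : Cst) (M : Mem) (s t : ℕ) : Prop :=
  M aDN 0 0 0 = 0 ∧ In M s ∧ In M t ∧ fs c.X s ⊆ fs c.X t

open Fam in
theorem split_spec (hc : c.OK) (h : Lkd φ A c M) {ε : ℝ} (hε : c.ρ 1 = ε)
    (hm : M aM 0 0 0 = maxRelCard φ A) {s t : ℕ} (hs : s < c.E) (ht : t < c.E)
    {η : ℕ → ℕ} (h7 : η 7 = s) (h8 : η 8 = t) :
    ((∀ a, a ∉ [aNN, aDG, aP1] → split.den c η M a = M a) ∧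
      (SplitCond c M s t → ∀ g ∈ (fam c M).rel (fs c.X s),
        ¬ TooLarge φ A ε (fam c M) (fs c.X s) (fs c.X t) g)) ∨
    (M aDN 0 0 0 = 0 ∧ Split φ A ε c M (split.den c η M) s t) := by
  classical
  have hcond : 0 < (andE (notE (reg aDN)) (andE (fst aIN (.v 7)) (andE (fst aIN (.v 8))
      (subE (.v 7) (.v 8))))).ev c M η ↔ SplitCond c M s t := by
    simp only [pos_andE, pos_notE, SplitCond, In, ev_subE h.inv.tab hs ht h7 h8]
    simp only [reg, fst, ev, cut, h7, h8]
    simp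
  rw [split, den_whenS]
  by_cases hJ : SplitCond c M s t
  swap
  · rw [if_neg fun h' => hJ (hcond.1 h')]
    exact Or.inl ⟨fun _ _ => rfl, fun h' => absurd h' hJ⟩
  rw [if_pos (hcond.2 hJ)]
  obtain ⟨hJ1, hsI, htI, hst⟩ := hJ
  simp only [blk, den]
  have e7 := fun p q r => env3_of_ne η p q r 7 (by decide) (by decide) (by decide)
  have e8 := fun p q r => env3_of_ne η p q r 8 (by decide) (by decide) (by decide)
  set M₁ := (asg aNN .E .one .one (cardE (.v 0))).den c η M with hM₁
  have h1 : ∀ a, a ≠ aNN → M₁ a = M a := fun a ha =>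
    den_frame _ _ _ (by simp [asg, fors, writes, ha])
  have hnn : ∀ u < c.E, M₁ aNN u 0 0 = ((fam c M).rel (fs c.X u)).ncard := by
    intro u hu
    rw [hM₁, den_asg (by decide)]
    simp only [Bd.val]
    rw [setA_same hu one_pos one_pos, ev_cardE h.inv hu (by simp) (by decide)]
  set M₂ := (asg aDG _ _ _ _).den c η M₁ with hM₂
  have h2 : ∀ a, a ≠ aDG → M₂ a = M₁ a := fun a ha =>
    den_frame _ _ _ (by simp [asg, fors, writes, ha])
  have hdg : ∀ i < c.D, Al M s i →
      M₂ aDG 0 0 i = (fam c M).ext (fs c.X s) (fs c.X t) (row c M s i) := by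
    intro i hi ha
    have e : {g ∈ (fam c M).rel (fs c.X t) | PMap.proj (fs c.X s) g = row c M s i} =
        {g | ∃ j < c.D, Al M t j ∧ M aPR t s j = i + 1 ∧ row c M t j = g} := by
      ext g
      simp only [Set.mem_ofPred_eq, mem_rel ht]
      constructor
      · rintro ⟨⟨j, hj, hb, rfl⟩, e⟩
        exact ⟨j, hj, hb, h.lk.link t ht s hs j hj i hi hb ha e.symm, rfl⟩
      · rintro ⟨j, hj, hb, e, rfl⟩
        obtain ⟨i', hi', e1, e2⟩ := h.lk.back t ht s hs j hj hb (by omega)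
        have : i' = i := by omega
        exact ⟨⟨j, hj, hb, rfl⟩, this ▸ e2.symm⟩
    rw [Fam.ext, e, ncard_rows h.inv ht, hM₂, den_asg (by decide)]
    simp only [Bd.val]
    rw [setA_same one_pos one_pos hi]
    simp only [ev, Bd.val]
    refine sum_congr rfl fun j _ => ?_
    rw [ev_flag]
    refine if_congr ?_ rfl rfl
    simp only [pos_andE, pos_eqE]
    simp [fl2, ev, cut, Al, e7, e8, h7, h8, h1]
  have hfin := h.inv.wf.finite ((mem_sets ht).2 htI)
  have hext : ∀ g, (fam c M).ext (fs c.X s) (fs c.X t) g ≤ c.D := fun g =>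
    (ext_le hfin _ g).trans (ncard_rel_le h.inv ht)
  set M₃ := (asg aP1 _ _ _ _).den c η M₂ with hM₃
  have h3 : ∀ a, a ≠ aP1 → M₃ a = M₂ a := fun a ha =>
    den_frame _ _ _ (by simp [asg, fors, writes, ha])
  have hp1 : ∀ i < c.D, Al M s i → M₃ aP1 0 0 i =
      (fam c M).ext (fs c.X s) (fs c.X t) (row c M s i) * ((fam c M).rel (fs c.X s)).ncard := by
    intro i hi ha
    rw [hM₃, den_asg (by decide)]
    simp only [Bd.val]
    rw [setA_same one_pos one_pos hi]
    refine ev_prodE (fun y => ?_) (fun y => ?_) (hext _)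
    · simp only [flat, ev, cut, Function.update_apply, Nat.reduceEqDiff, if_false, env3_row]
      exact hdg i hi ha
    · simp only [fst, ev, cut, Function.update_apply, Nat.reduceEqDiff, if_false, e7, h7,
        h2 aNN (by decide)]
      exact hnn s hs
  have hsame3 : ∀ a, a ∉ [aNN, aDG, aP1] → M₃ a = M a := fun a ha => by
    simp only [List.mem_cons, not_or] at ha
    rw [h3 a ha.2.2.1, h2 a ha.2.1, h1 a ha.1]
  have hnn3 : M₃ aNN = M₁ aNN := (h3 _ (by decide)).trans (h2 _ (by decide))
  have hS3 : Same c M M₃ := Same.of hsame3 (by decide)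
  have htest : 0 < splitTest.ev c M₃ η ↔ ∃ i < c.D, Al M s i ∧
      TooLarge φ A ε (fam c M) (fs c.X s) (fs c.X t) (row c M s i) := by
    simp only [splitTest, pos_exE, pos_andE, pos_notE, pos_pw, Bd.val]
    refine exists_congr fun i => and_congr_right fun hi => ?_
    have e0 : 0 < (fl2 aAL (.v 7) (.v 22)).ev c M₃ (Function.update η 22 i) ↔ Al M s i := by
      simp [fl2, ev, cut, Al, hS3.al, h7]
    rw [e0]
    refine and_congr_right fun ha => ?_
    rw [TooLarge]
    simp only [flat, fst, reg, ev, cut, Function.update_apply, Nat.reduceEqDiff, if_true, if_false,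
      h8, hp1 i hi ha, hnn3, hnn t ht, hε, hsame3 aM (by decide), hm]
  rw [den_whenS]
  by_cases hex : ∃ i < c.D, Al M s i ∧
      TooLarge φ A ε (fam c M) (fs c.X s) (fs c.X t) (row c M s i)
  swap
  · rw [if_neg fun h' => hex (htest.1 h')]
    refine Or.inl ⟨hsame3, fun _ g hg => ?_⟩
    obtain ⟨i, hi, ha, rfl⟩ := (mem_rel hs).1 hg
    exact fun h' => hex ⟨i, hi, ha, h'⟩
  rw [if_pos (htest.2 hex)]
  simp only [den]
  right
  refine ⟨hJ1, ?_⟩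
  set M₄ := (asg aP2 _ _ _ _).den c η M₃ with hM₄
  have h4 : ∀ a, a ≠ aP2 → M₄ a = M₃ a := fun a ha =>
    den_frame _ _ _ (by simp [asg, fors, writes, ha])
  have hp2 : ∀ i < c.D, Al M s i → M₄ aP2 0 0 i = ((fam c M).rel (fs c.X s)).ncard *
      ((fam c M).ext (fs c.X s) (fs c.X t) (row c M s i) * ((fam c M).rel (fs c.X s)).ncard) := by
    intro i hi ha
    rw [hM₄, den_asg (by decide)]
    simp only [Bd.val]
    rw [setA_same one_pos one_pos hi]
    refine ev_prodE (fun y => ?_) (fun y => ?_) (ncard_rel_le h.inv hs)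
    · simp only [fst, ev, cut, Function.update_apply, Nat.reduceEqDiff, if_false, e7, h7, hnn3]
      exact hnn s hs
    · simp only [flat, ev, cut, Function.update_apply, Nat.reduceEqDiff, if_false, env3_row]
      exact hp1 i hi ha
  set M₅ := (asg aP3 _ _ _ _).den c η M₄ with hM₅
  have h5 : ∀ a, a ≠ aP3 → M₅ a = M₄ a := fun a ha =>
    den_frame _ _ _ (by simp [asg, fors, writes, ha])
  have hp3 : ∀ i < c.D, Al M s i → M₅ aP3 0 0 i =
      ((fam c M).ext (fs c.X s) (fs c.X t) (row c M s i) *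
        ((fam c M).rel (fs c.X s)).ncard) ^ 2 := by
    intro i hi ha
    rw [hM₅, den_asg (by decide)]
    simp only [Bd.val]
    rw [setA_same one_pos one_pos hi]
    refine (ev_prodE (b := ((fam c M).rel (fs c.X s)).ncard *
      ((fam c M).ext (fs c.X s) (fs c.X t) (row c M s i) * ((fam c M).rel (fs c.X s)).ncard))
      (fun y => ?_) (fun y => ?_) (hext (row c M s i))).trans ?_
    · simp only [flat, ev, cut, Function.update_apply, Nat.reduceEqDiff, if_false, env3_row]
      rw [h4 _ (by decide), h3 _ (by decide)]
      exact hdg i hi ha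
    · simp only [flat, ev, cut, Function.update_apply, Nat.reduceEqDiff, if_false, env3_row]
      exact hp2 i hi ha
    · ring
  set M₆ := (asg aLG _ _ _ _).den c η M₅ with hM₆
  have h6 : ∀ a, a ≠ aLG → M₆ a = M₅ a := fun a ha =>
    den_frame _ _ _ (by simp [asg, fors, writes, ha])
  have hlg : ∀ i < c.D, Al M s i → (0 < M₆ aLG 0 0 i ↔
      Large φ A ε (fam c M) (fs c.X s) (fs c.X t) (row c M s i)) := by
    intro i hi ha
    rw [hM₆, den_asg (by decide)]
    simp only [Bd.val]
    rw [setA_same one_pos one_pos hi, pos_notE, pos_pw]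
    have hnt : ∀ η', (fst aNN (.v 8)).ev c M₅ (Function.update (env3 η 0 0 i) 25 η') =
        ((fam c M).rel (fs c.X t)).ncard := by
      intro y
      simp only [fst, ev, cut, Function.update_apply, Nat.reduceEqDiff, if_false, e8, h8]
      rw [h5 _ (by decide), h4 _ (by decide), hnn3]
      exact hnn t ht
    rw [ev_prodE hnt hnt (ncard_rel_le h.inv ht), Large, ← hp3 i hi ha, sq]
    have hmm : M₅ aM 0 0 0 = maxRelCard φ A := by
      rw [h5 _ (by decide), h4 _ (by decide), hsame3 _ (by decide), hm]
    simp only [flat, reg, ev, cut, env3_row, hε, hmm]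
  set M₇ := (setR aDN (.c 1)).den c η M₆ with hM₇
  set M₈ := (setR aSP (.c 1)).den c η M₇ with hM₈
  set M₉ := (setR aSS (.v 7)).den c η M₈ with hM₉
  have h7' : ∀ a, a ≠ aDN → M₇ a = M₆ a := fun a ha => den_frame _ _ _ (by simp [setR, writes, ha])
  have h8' : ∀ a, a ≠ aSP → M₈ a = M₇ a := fun a ha => den_frame _ _ _ (by simp [setR, writes, ha])
  have h9' : ∀ a, a ≠ aSS → M₉ a = M₈ a := fun a ha => den_frame _ _ _ (by simp [setR, writes, ha])
  refine ⟨hS3.trans (Same.of (Z := [aP2, aP3, aLG, aDN, aSP, aSS]) (fun a ha => ?_) (by decide)),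
    ?_, ?_, ?_, ⟨hs, ht⟩, ⟨hsI, htI, hst⟩, fun i hi ha => ?_, ?_⟩
  · simp only [List.mem_cons, not_or] at ha
    rw [h9' a ha.2.2.2.2.2.1, h8' a ha.2.2.2.2.1, h7' a ha.2.2.2.1, h6 a ha.2.2.1, h5 a ha.2.1,
      h4 a ha.1]
  · rw [h9' _ (by decide), h8' _ (by decide)]
    simp [hM₇, setR, den, ev, cut, wr]
  · rw [h9' _ (by decide)]
    simp [hM₈, setR, den, ev, cut, wr]
  · simp [hM₉, setR, den, ev, cut, wr, h7]
  · rw [h9' _ (by decide), h8' _ (by decide), h7' _ (by decide)]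
    exact hlg i hi ha
  · obtain ⟨i, -, -, h'⟩ := hex
    exact ⟨_, h'⟩

end Pr

end

section

open Finset

namespace Pr

open EX Stm

variable {φ : QFCQ} {A : Struct} {c : Cst} {M M' : Mem}

/-! ### One time step of a branch -/

theorem join_skip {η : ℕ → ℕ} (h : 0 < M aDN 0 0 0) : join.den c η M = M := by
  rw [join, den_whenS, if_neg]
  simp only [pos_andE, pos_notE, not_and_or, not_not]
  exact Or.inl h

theorem split_skip {η : ℕ → ℕ} (h : 0 < M aDN 0 0 0) : split.den c η M = M := by
  rw [split, den_whenS, if_neg]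
  simp only [pos_andE, pos_notE, not_and_or, not_not]
  exact Or.inl h

theorem den_loop_two {x y : ℕ} {b : Bd} {p : Stm} {η : ℕ → ℕ} (I : (ℕ → ℕ → Prop) → Mem → Prop)
    (h0 : I (fun _ _ => False) M)
    (hs : ∀ s < b.val c, ∀ t < b.val c, ∀ M' Q, I Q M' →
      I (fun i j => Q i j ∨ i = s ∧ j = t)
        (p.den c (Function.update (Function.update η x s) y t) M')) :
    ∃ Q, I Q ((loop x b (loop y b p)).den c η M) ∧ ∀ s < b.val c, ∀ t < b.val c, Q s t := by
  refine den_loop_inv (fun n M' => ∃ Q, I Q M' ∧ ∀ s < n, ∀ t < b.val c, Q s t)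
    ⟨_, h0, by simp⟩ ?_
  rintro n hn M' ⟨Q, hQ, hQ'⟩
  have := den_loop_inv (c := c) (x := y) (b := b) (p := p) (η := Function.update η x n) (M := M')
    (fun k M' => ∃ Q, I Q M' ∧ (∀ s < n, ∀ t < b.val c, Q s t) ∧ ∀ t < k, Q n t)
    ⟨Q, hQ, hQ', by simp⟩ ?_
  · obtain ⟨Q, h1, h2, h3⟩ := this
    refine ⟨Q, h1, fun s hsn t ht => ?_⟩
    rcases Nat.lt_succ_iff_lt_or_eq.1 hsn with h | rfl
    · exact h2 s h t ht
    · exact h3 t ht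
  · rintro k hk M'' ⟨Q, h1, h2, h3⟩
    refine ⟨_, hs n hn k hk M'' Q h1, fun s hs t ht => Or.inl (h2 s hs t ht), fun t ht => ?_⟩
    rcases Nat.lt_succ_iff_lt_or_eq.1 ht with h | rfl
    · exact Or.inl (h3 t h)
    · exact Or.inr ⟨rfl, rfl⟩

/-- The result of the joins. -/
def Joined (φ : QFCQ) (A : Struct) (c : Cst) (M M' : Mem) : Prop :=
  0 < M' aDN 0 0 0 ∧ M' aSP 0 0 0 = 0 ∧ Inv φ A c M' ∧ (fam c M').Below (fam c M) ∧
    (∃ S ∈ (fam c M).sets, ∃ T ∈ (fam c M).sets, S ∪ T ∉ (fam c M).sets ∧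
      ((fam c M).loc (S ∪ T)).ncard ≤ c.D ∧ S ∪ T ∈ (fam c M').sets) ∧ (fam c M').sol φ A = (fam c M).sol φ A

theorem joins_spec (hc : c.OK) (h : Lkd φ A c M) (hdn : M aDN 0 0 0 = 0) (hsp : M aSP 0 0 0 = 0)
    (η : ℕ → ℕ) :
    Joined φ A c M ((loop 7 .E (loop 8 .E join)).den c η M) ∨
    (Same c M ((loop 7 .E (loop 8 .E join)).den c η M) ∧
      (loop 7 .E (loop 8 .E join)).den c η M aDN 0 0 0 = 0 ∧
      (loop 7 .E (loop 8 .E join)).den c η M aSP 0 0 0 = 0 ∧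
      ∀ s < c.E, ∀ t < c.E, In M s → In M t → ¬ In M (s ||| t) →
        c.D < ((fam c M).loc (fs c.X s ∪ fs c.X t)).ncard) := by
  have := den_loop_two (c := c) (x := 7) (y := 8) (b := .E) (p := join) (η := η)
    (M := M) (fun Q M' => Joined φ A c M M' ∨ (Same c M M' ∧ M' aDN 0 0 0 = 0 ∧ M' aSP 0 0 0 = 0 ∧
      ∀ s < c.E, ∀ t < c.E, Q s t → In M s → In M t → ¬ In M (s ||| t) →
        c.D < ((fam c M).loc (fs c.X s ∪ fs c.X t)).ncard))
    (Or.inr ⟨Same.refl c M, hdn, hsp, by simp⟩) ?_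
  · obtain ⟨Q, hI, hQ⟩ := this
    exact hI.imp_right fun ⟨h1, h2, h3, h4⟩ => ⟨h1, h2, h3, fun s hs t ht => h4 s hs t ht (hQ s hs t ht)⟩
  · intro s hs t ht M' Q hI
    have hs : s < c.E := hs
    have ht : t < c.E := ht
    rcases hI with hJ | ⟨h1, h2, h3, h4⟩
    · left
      rwa [join_skip hJ.1]
    · have hL := h1.lkd h
      have hcond : JoinCond M' s t ↔ In M s ∧ In M t ∧ ¬ In M (s ||| t) := by
        simp only [JoinCond, In, h1.ins, h2, true_and]
      set η' := Function.update (Function.update η 7 s) 8 t with hη'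
      have hfr : join.den c η' M' aSP = M' aSP := den_frame _ _ _ (by decide)
      rcases join_spec hc hL hs ht (η := η') (by simp [hη'])
        (by simp [hη']) with ⟨h5, h6⟩ | ⟨h5, h5', h6, h7, h8, h9, h10⟩
      · right
        refine ⟨h1.trans (Same.of h5 (by decide)), by rw [h5 _ (by decide), h2],
          by rw [hfr, h3], fun s' hs' t' ht' hq hi hj hk => ?_⟩
        rcases hq with hq | ⟨rfl, rfl⟩
        · exact h4 s' hs' t' ht' hq hi hj hk
        · rw [← h1.fam]; exact h6 (hcond.2 ⟨hi, hj, hk⟩)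
      · left
        rw [h1.fam] at h5' h8 h10
        obtain ⟨-, hi, hj, hij⟩ := h5
        rw [← mem_sets hs, h1.fam] at hi
        rw [← mem_sets ht, h1.fam] at hj
        rw [← mem_sets (Nat.or_lt_two_pow hs ht), fs_or, h1.fam] at hij
        rw [fs_or] at h9
        exact ⟨h6, by rw [hfr, h3], h7, h8, ⟨_, hi, _, hj, hij, h5', h9⟩, h10⟩

open Fam in
theorem splits_spec (hc : c.OK) (h : Lkd φ A c M) {ε : ℝ} (hε : c.ρ 1 = ε)
    (hm : M aM 0 0 0 = maxRelCard φ A) (hsp : M aSP 0 0 0 = 0) (hdn : M aDN 0 0 0 = 0)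
    (η : ℕ → ℕ) :
    (∃ s t, Split φ A ε c M ((loop 7 .E (loop 8 .E split)).den c η M) s t) ∨
    (Same c M ((loop 7 .E (loop 8 .E split)).den c η M) ∧
      (loop 7 .E (loop 8 .E split)).den c η M aSP 0 0 0 = 0 ∧
      ∀ s < c.E, ∀ t < c.E, In M s → In M t → fs c.X s ⊆ fs c.X t →
        ∀ g ∈ (fam c M).rel (fs c.X s), ¬ TooLarge φ A ε (fam c M) (fs c.X s) (fs c.X t) g) := by
  have := den_loop_two (c := c) (x := 7) (y := 8) (b := .E) (p := split) (η := η)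
    (M := M) (fun Q M' => (∃ s t, Split φ A ε c M M' s t) ∨
      (Same c M M' ∧ M' aDN 0 0 0 = 0 ∧ M' aSP 0 0 0 = 0 ∧ M' aM 0 0 0 = maxRelCard φ A ∧
      ∀ s < c.E, ∀ t < c.E, Q s t → In M s → In M t → fs c.X s ⊆ fs c.X t →
        ∀ g ∈ (fam c M).rel (fs c.X s), ¬ TooLarge φ A ε (fam c M) (fs c.X s) (fs c.X t) g))
    (Or.inr ⟨Same.refl c M, hdn, hsp, hm, by simp⟩) ?_
  · obtain ⟨Q, hI, hQ⟩ := this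
    exact hI.imp_right fun ⟨h1, _, h3, _, h4⟩ => ⟨h1, h3, fun s hs t ht => h4 s hs t ht (hQ s hs t ht)⟩
  · intro s hs t ht M' Q hI
    have hs : s < c.E := hs
    have ht : t < c.E := ht
    rcases hI with ⟨s', t', hJ⟩ | ⟨h1, h2, h3, h3', h4⟩
    · left
      rw [split_skip hJ.done]
      exact ⟨s', t', hJ⟩
    · have hL := h1.lkd h
      set η' := Function.update (Function.update η 7 s) 8 t with hη'
      rcases split_spec hc hL hε h3' hs ht (η := η') (by simp [hη'])
        (by simp [hη']) with ⟨h5, h6⟩ | ⟨-, h5⟩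
      · right
        refine ⟨h1.trans (Same.of h5 (by decide)), by rw [h5 _ (by decide), h2],
          by rw [h5 _ (by decide), h3], by rw [h5 _ (by decide), h3'],
          fun s' hs' t' ht' hq hi hj hk => ?_⟩
        rcases hq with hq | ⟨rfl, rfl⟩
        · exact h4 s' hs' t' ht' hq hi hj hk
        · rw [← h1.fam]
          exact h6 ⟨h2, by simpa only [In, h1.ins] using hi, by simpa only [In, h1.ins] using hj, hk⟩
      · left
        refine ⟨s, t, ⟨h1.trans h5.same, h5.done, h5.split, h5.set, h5.lt, ?_, ?_, ?_⟩⟩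
        · simpa only [In, h1.ins] using h5.mem
        · have := h5.large
          rw [h1.fam] at this
          simpa only [Al, h1.al, row_congr h1.dt] using this
        · rw [← h1.fam]; exact h5.ex

theorem splits_skip (h : 0 < M aDN 0 0 0) (η : ℕ → ℕ) :
    (loop 7 .E (loop 8 .E split)).den c η M = M := by
  refine den_loop_inv (b := .E) (fun _ M' => M' = M) rfl fun n _ M' hM' => ?_
  refine den_loop_inv (b := .E) (fun _ M' => M' = M) hM' fun k _ M'' hM'' => ?_
  rw [hM'', split_skip h]

theorem fam_eq (h : Shrink c M M') (h' : ∀ s < c.E, ∀ i < c.D, (Al M' s i ↔ Al M s i)) :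
    fam c M' = fam c M := by
  have e1 := h.sets_eq
  have e2 : (fam c M').rel = (fam c M).rel := by
    funext S
    refine Set.Subset.antisymm (h.rel_subset S) ?_
    rintro g ⟨s, hs, e, i, hi, ha, hg⟩
    exact ⟨s, hs, e, i, hi, (h' s hs i hi).2 ha, by rwa [h.row_eq]⟩
  calc fam c M' = ⟨(fam c M').sets, (fam c M').rel⟩ := rfl
    _ = _ := by rw [e1, e2]

/-- The family after cleaning. -/
structure CleanFam (φ : QFCQ) (A : Struct) (c : Cst) (M : Mem) (τ : Fam) : Prop where
  wf : τ.WF φ A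
  cons : τ.Cons
  below : τ.Below (fam c M)
  sets : τ.sets = (fam c M).sets
  sol : τ.sol φ A = (fam c M).sol φ A
  card : ∀ S ∈ τ.sets, (τ.rel S).ncard ≤ c.D
  eq : (fam c M).Cons → τ = fam c M

/-- The effect of a time step before the bit is used. -/
inductive Mid (φ : QFCQ) (A : Struct) (ε : ℝ) (c : Cst) (τ : Fam) (M : Mem) : Prop
  | join (h₁ : M aSP 0 0 0 = 0) (h₂ : (fam c M).Below τ)
      (h₃ : ∃ S ∈ τ.sets, ∃ T ∈ τ.sets, S ∪ T ∉ τ.sets ∧ (τ.loc (S ∪ T)).ncard ≤ c.D ∧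
        S ∪ T ∈ (fam c M).sets) (h₄ : (fam c M).sol φ A = τ.sol φ A)
  | split (s t : ℕ) (h₁ : 0 < M aSP 0 0 0) (h₂ : fam c M = τ) (h₃ : M aSS 0 0 0 = s) (h₄ : s < c.E)
      (h₅ : fs c.X s ∈ τ.sets) (h₆ : fs c.X t ∈ τ.sets) (h₇ : fs c.X s ⊆ fs c.X t)
      (h₈ : ∀ i < c.D, Al M s i →
        (0 < M aLG 0 0 i ↔ Fam.Large φ A ε τ (fs c.X s) (fs c.X t) (row c M s i)))
      (h₉ : ∃ g, Fam.TooLarge φ A ε τ (fs c.X s) (fs c.X t) g)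
  | idle (h₁ : M aSP 0 0 0 = 0) (h₂ : fam c M = τ)
      (h₃ : ∀ S ∈ τ.sets, ∀ T ∈ τ.sets, S ∪ T ∉ τ.sets → c.D < (τ.loc (S ∪ T)).ncard)
      (h₄ : ∀ S ∈ τ.sets, ∀ T ∈ τ.sets, S ⊆ T → ∀ g ∈ τ.rel S, ¬ Fam.TooLarge φ A ε τ S T g)

theorem tickA_spec (hc : c.OK) (h : Inv φ A c M) {ε : ℝ} (hε : c.ρ 1 = ε)
    (hm : M aM 0 0 0 = maxRelCard φ A) (η : ℕ → ℕ) :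
    Inv φ A c (tickA.den c η M) ∧
      ∃ τ, CleanFam φ A c M τ ∧ Mid φ A ε c τ (tickA.den c η M) := by
  set M₁ := (setR aDN (.c 0)).den c η M with hM₁
  set M₂ := (setR aSP (.c 0)).den c η M₁ with hM₂
  set M₃ := links.den c η M₂ with hM₃
  set M₄ := clean.den c η M₃ with hM₄
  have h1 : ∀ a, a ≠ aDN → M₁ a = M a := fun a ha => den_frame _ _ _ (by simp [setR, writes, ha])
  have h2 : ∀ a, a ≠ aSP → M₂ a = M₁ a := fun a ha => den_frame _ _ _ (by simp [setR, writes, ha])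
  have hS2 : Same c M M₂ := (Same.of (Z := [aDN]) (fun a ha => h1 a (by simpa using ha))
    (by decide)).trans (Same.of (Z := [aSP]) (fun a ha => h2 a (by simpa using ha)) (by decide))
  have hI2 : Inv φ A c M₂ := h.congr hS2.mem hS2.cap hS2.cup hS2.ins hS2.al hS2.dt
  obtain ⟨hL3, h3⟩ : Lk c M₃ ∧ ∀ a, a ≠ aPR → M₃ a = M₂ a := links_spec hc hI2 η
  have hI3 : Inv φ A c M₃ := hI2.congr (h3 _ (by decide)) (h3 _ (by decide)) (h3 _ (by decide))
    (h3 _ (by decide)) (h3 _ (by decide)) (h3 _ (by decide))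
  obtain ⟨h4, h5, h6, h7⟩ : Shrink c M₃ M₄ ∧ (fam c M₄).sol φ A = (fam c M₃).sol φ A ∧
      (fam c M₄).Cons ∧ _ := clean_spec hc hI3 hL3 η
  have hL : Lkd φ A c M₄ := ⟨h4.inv hI3, h4.lk hL3, h6⟩
  have hf3 : fam c M₃ = fam c M := by
    rw [fam_congr (h3 _ (by decide)) (h3 _ (by decide)) (h3 _ (by decide)), hS2.fam]
  have hdn : M₄ aDN 0 0 0 = 0 := by
    rw [h4.same aDN (by decide) (by decide) (by decide), h3 _ (by decide), h2 _ (by decide)]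
    simp [hM₁, setR, den, ev, cut, wr]
  have hsp : M₄ aSP 0 0 0 = 0 := by
    rw [h4.same aSP (by decide) (by decide) (by decide), h3 _ (by decide)]
    simp [hM₂, setR, den, ev, cut, wr]
  have hm4 : M₄ aM 0 0 0 = maxRelCard φ A := by
    rw [h4.same aM (by decide) (by decide) (by decide), h3 _ (by decide), h2 _ (by decide),
      h1 _ (by decide), hm]
  have hclean : CleanFam φ A c M (fam c M₄) := by
    refine ⟨hL.inv.wf, h6, hf3 ▸ h4.below, hf3 ▸ h4.sets_eq, hf3 ▸ h5, fun S hS => ?_, fun hcons => ?_⟩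
    · obtain ⟨s, hs, -, rfl⟩ := exists_of_mem_sets hS
      exact ncard_rel_le hL.inv hs
    · rw [fam_eq h4 (h7 (hf3 ▸ hcons)), hf3]
  set M₅ := (loop 7 .E (loop 8 .E join)).den c η M₄ with hM₅
  have hA : tickA.den c η M = (loop 7 .E (loop 8 .E split)).den c η M₅ := rfl
  rw [hA]
  have hm5 : M₅ aM = M₄ aM := den_frame _ _ _ (by decide)
  have hj := joins_spec hc hL hdn hsp η
  rw [← hM₅] at hj
  rcases hj with ⟨j1, j2, j3, j4, j5, j6⟩ | ⟨j1, j2, j3, j4⟩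
  · rw [splits_skip j1]
    exact ⟨j3, _, hclean, .join j2 j4 j5 j6⟩
  · have hL5 := j1.lkd hL
    have hf := j1.fam
    rcases splits_spec hc hL5 hε (by rw [hm5, hm4]) j3 j2 η with ⟨s, t, k⟩ | ⟨k1, k2, k3⟩
    · have hf' := k.same.fam.trans hf
      refine ⟨(k.same.lkd hL5).inv, _, hclean, .split s t k.split hf' k.set k.lt.1 ?_ ?_ k.mem.2.2
        (fun i hi ha => ?_) ?_⟩
      · rw [← hf]; exact (mem_sets k.lt.1).2 k.mem.1
      · rw [← hf]; exact (mem_sets k.lt.2).2 k.mem.2.1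
      · simp only [Al, k.same.al] at ha
        rw [k.large i hi ha, row_congr k.same.dt, hf]
      · rw [← hf]; exact k.ex
    · have hf' := k1.fam.trans hf
      refine ⟨(k1.lkd hL5).inv, _, hclean, .idle k2 hf' (fun S hS T hT hST => ?_)
        fun S hS T hT hST => ?_⟩
      · obtain ⟨s, hs, hsI, rfl⟩ := exists_of_mem_sets hS
        obtain ⟨t, ht, htI, rfl⟩ := exists_of_mem_sets hT
        refine j4 s hs t ht hsI htI fun h' => hST ?_
        rw [← fs_or, mem_sets (Nat.or_lt_two_pow hs ht)]
        exact h'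
      · rw [← hf] at hS hT ⊢
        obtain ⟨s, hs, hsI, rfl⟩ := exists_of_mem_sets hS
        obtain ⟨t, ht, htI, rfl⟩ := exists_of_mem_sets hT
        exact k3 s hs t ht hsI htI hST

theorem tickB_spec (η : ℕ → ℕ) :
    (∀ a, a ≠ aAL → a ≠ aALb → tickB.den c η M a = M a) ∧
    ∀ s < c.E, ∀ i < c.D, (Al (tickB.den c η M) s i ↔ Al M s i ∧
      if 0 < M aSP 0 0 0 then s ≠ M aSS 0 0 0 ∨ (0 < M aBT 0 0 0 ↔ 0 < M aLG 0 0 i)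
      else ¬ 0 < M aBT 0 0 0) := by
  refine ⟨fun a h1 h2 => den_frame _ _ _ (by simp [tickB, upd, asg, fors, writes, h1, h2]),
    fun s hs i hi => ?_⟩
  rw [Al, tickB, den_upd (by decide) (by decide)]
  simp only [Bd.val]
  rw [setA_same hs one_pos hi, pos_andE, ev_ifE]
  refine and_congr (by simp [fl2, ev, cut, Al]) ?_
  have e : (reg aSP).ev c M (env3 η s 0 i) = M aSP 0 0 0 := rfl
  rw [e]
  split_ifs
  · simp only [pos_orE, pos_notE, pos_eqE, pos_iffE]
    simp [reg, flat, ev, cut]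
  · rw [pos_notE]
    simp [reg, ev, cut]

end Pr

end

section

open Finset

namespace Pr

open EX Stm

variable {φ : QFCQ} {A : Struct} {c : Cst} {M M' : Mem} {r ε : ℝ}

/-! ### The effect of a time step on the family -/

/-- The parameters match the input. -/
structure Fits (φ : QFCQ) (A : Struct) (c : Cst) (r ε : ℝ) : Prop where
  ok : c.OK
  rho : c.ρ 1 = ε
  one_le : 1 ≤ r
  pos : 0 < ε
  card : c.D = ⌊(maxRelCard φ A : ℝ) ^ r⌋₊
  vars : φ.vars ⊆ range c.X

/-- The invariant of a branch. -/
structure State (φ : QFCQ) (A : Struct) (c : Cst) (M : Mem) : Prop where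
  inv : Inv φ A c M
  atoms : (fam c M).Atoms φ A
  max : M aM 0 0 0 = maxRelCard φ A

noncomputable def tick (c : Cst) (β : Bool) (M : Mem) : Mem :=
  tickB.den c 0 (wr (tickA.den c 0 M) aBT 0 0 0 β.toNat)

theorem tick_frame (β : Bool) (h : a ∉ aBT :: (tickA.writes ++ tickB.writes)) :
    tick c β M a = M a := by
  simp only [List.mem_cons, List.mem_append, not_or] at h
  rw [tick, den_frame _ _ _ h.2.2, wr_ne _ _ _ _ h.1, den_frame _ _ _ h.2.1]

theorem _root_.Fam.Atoms.below {σ τ : Fam} (h : τ.Atoms φ A) (hb : σ.Below τ) : σ.Atoms φ A :=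
  fun α hα => ⟨hb.sets (h α hα).1, fun g hg => (h α hα).2 g (hb.rel _ (h α hα).1 hg)⟩

theorem Shrink.rel_eq (h : Shrink c M M') {s : ℕ} (hs : s < c.E)
    (h' : ∀ i < c.D, Al M s i → Al M' s i) :
    (fam c M').rel (fs c.X s) = (fam c M).rel (fs c.X s) := by
  refine Set.Subset.antisymm (h.rel_subset _) fun g hg => ?_
  obtain ⟨i, hi, ha, e⟩ := (mem_rel hs).1 hg
  exact (mem_rel hs).2 ⟨i, hi, h' i hi ha, by rwa [h.row_eq]⟩

/-- The possible effects of the two versions of a time step. -/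
inductive Step (φ : QFCQ) (A : Struct) (ε : ℝ) (D : ℕ) (τ : Fam) (σ : Bool → Fam) : Prop
  | join (h₁ : (σ false).Below τ) (h₂ : ∃ S ∈ τ.sets, ∃ T ∈ τ.sets, S ∪ T ∉ τ.sets ∧
        (τ.loc (S ∪ T)).ncard ≤ D ∧ S ∪ T ∈ (σ false).sets)
      (h₃ : (σ false).sol φ A = τ.sol φ A) (h₄ : (σ true).Dead)
  | split (S T : Finset ℕ) (h₁ : ∀ β, (σ β).Below τ) (h₂ : S ∈ τ.sets) (h₃ : T ∈ τ.sets)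
      (h₄ : S ⊆ T)
      (h₅ : ∀ β, ∀ g, g ∈ (σ β).rel S ↔ g ∈ τ.rel S ∧ (β = true ↔ Fam.Large φ A ε τ S T g))
      (h₆ : ∀ β, (σ β).sets = τ.sets) (h₇ : ∀ β, ∀ U ∈ τ.sets, U ≠ S → (σ β).rel U = τ.rel U)
      (h₈ : ∃ g, Fam.TooLarge φ A ε τ S T g)
  | idle (h₁ : σ false = τ) (h₂ : (σ true).Dead)
      (h₃ : ∀ S ∈ τ.sets, ∀ T ∈ τ.sets, S ∪ T ∉ τ.sets → D < (τ.loc (S ∪ T)).ncard)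
      (h₄ : ∀ S ∈ τ.sets, ∀ T ∈ τ.sets, S ⊆ T → ∀ g ∈ τ.rel S, ¬ Fam.TooLarge φ A ε τ S T g)

theorem tick_step (F : Fits φ A c r ε) (h : State φ A c M) :
    (∀ β, State φ A c (tick c β M)) ∧
      ∃ τ, CleanFam φ A c M τ ∧ Step φ A ε c.D τ (fun β => fam c (tick c β M)) := by
  obtain ⟨hI, τ, hτ, hmid⟩ := tickA_spec F.ok h.inv F.rho h.max 0
  set N := tickA.den c 0 M with hN
  set W := fun β : Bool => wr N aBT 0 0 0 β.toNat with hW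
  have hWne : ∀ β a, a ≠ aBT → W β a = N a := fun β a ha => wr_ne _ _ _ _ ha
  have hWI : ∀ β, Inv φ A c (W β) := fun β => hI.congr (hWne _ _ (by decide))
    (hWne _ _ (by decide)) (hWne _ _ (by decide)) (hWne _ _ (by decide)) (hWne _ _ (by decide))
    (hWne _ _ (by decide))
  have hWf : ∀ β, fam c (W β) = fam c N := fun β => fam_congr (hWne _ _ (by decide))
    (hWne _ _ (by decide)) (hWne _ _ (by decide))
  have ht : ∀ β, tick c β M = tickB.den c 0 (W β) := fun β => rfl
  have hB := fun β => tickB_spec (c := c) (M := W β) 0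
  have hSh : ∀ β, Shrink c (W β) (tick c β M) := fun β =>
    ⟨fun a h1 h2 _ => (hB β).1 a h1 h2, fun s hs i hi ha => (((hB β).2 s hs i hi).1 ha).1⟩
  have hbit : ∀ β, (0 < W β aBT 0 0 0 ↔ β = true) := fun β => by
    cases β <;> simp [hW, wr]
  have hsets : ∀ β, (fam c (tick c β M)).sets = (fam c N).sets := fun β => by
    rw [(hSh β).sets_eq, hWf]
  have hbelow : ∀ β, (fam c (tick c β M)).Below (fam c N) := fun β => hWf β ▸ (hSh β).below
  have hNτ : (fam c N).Below τ := by
    rcases hmid with ⟨-, h2, -, -⟩ | ⟨-, -, -, h2, -, -, -, -, -, -⟩ | ⟨-, h2, -, -⟩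
    · exact h2
    · rw [h2]; exact Fam.Below.refl _
    · rw [h2]; exact Fam.Below.refl _
  have hatoms := h.atoms.below ((hNτ.trans hτ.below))
  have hfalse : ∀ β, N aSP 0 0 0 = 0 → β = false → fam c (tick c β M) = fam c N := by
    intro β h0 hβ
    rw [fam_eq (hSh β), hWf]
    intro s hs i hi
    refine ⟨(hSh β).le s hs i hi, fun ha => ((hB β).2 s hs i hi).2 ⟨ha, ?_⟩⟩
    rw [hWne _ _ (by decide), if_neg (by omega), hbit, hβ]
    decide
  have hdead : ∀ β, N aSP 0 0 0 = 0 → β = true → (fam c (tick c β M)).Dead := by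
    intro β h0 hβ
    refine Set.eq_empty_iff_forall_notMem.2 fun g hg => ?_
    obtain ⟨s, hs, -, i, hi, ha, -⟩ := hg
    have := (((hB β).2 s hs i hi).1 ha).2
    rw [hWne _ _ (by decide), if_neg (by omega), hbit] at this
    exact this hβ
  refine ⟨fun β => ⟨(hSh β).inv (hWI β), hatoms.below (hbelow β), ?_⟩, τ, hτ, ?_⟩
  · rw [tick_frame β (by decide), h.max]
  rcases hmid with ⟨h1, h2, h3, h4⟩ | ⟨s, t, h1, h2, h3, h4, h5, h6, h7, h8, h9⟩ | ⟨h1, h2, h3, h4⟩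
  · refine .join ((hbelow _).trans h2) ?_ ?_ (hdead true h1 rfl)
    · simpa only [hsets] using h3
    · simpa only [hfalse false h1 rfl] using h4
  · refine .split _ _ (fun β => (hbelow β).trans hNτ) h5 h6 h7 (fun β g => ?_)
      (fun β => by rw [hsets, h2]) (fun β U hU hne => ?_) h9
    · have hrow := (hSh β).row_eq
      have hrow' : row c (W β) = row c N := row_congr (hWne β _ (by decide))
      rw [← h2, mem_rel h4, mem_rel h4]
      simp only [hrow, hrow']
      constructor
      · rintro ⟨i, hi, ha, rfl⟩
        obtain ⟨ha, hb⟩ := ((hB β).2 s h4 i hi).1 ha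
        have ha : Al N s i := by rwa [Al, hWne _ _ (by decide)] at ha
        refine ⟨⟨i, hi, ha, rfl⟩, ?_⟩
        rw [hWne _ _ (by decide), if_pos h1, hbit, hWne _ _ (by decide), hWne _ _ (by decide),
          h8 i hi ha, h3] at hb
        rw [h2]
        exact hb.resolve_left (by simp)
      · rintro ⟨⟨i, hi, ha, rfl⟩, hb⟩
        refine ⟨i, hi, ((hB β).2 s h4 i hi).2 ⟨by rwa [Al, hWne _ _ (by decide)], ?_⟩, rfl⟩
        rw [hWne _ _ (by decide), if_pos h1, hbit, hWne β aLG (by decide), h8 i hi ha]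
        rw [h2] at hb
        exact Or.inr hb
    · rw [← h2] at hU ⊢
      obtain ⟨u, hu, -, rfl⟩ := exists_of_mem_sets hU
      rw [← hWf β, ← (hSh β).rel_eq hu]
      intro i hi ha
      refine ((hB β).2 u hu i hi).2 ⟨ha, ?_⟩
      rw [hWne _ _ (by decide), if_pos h1, hWne _ _ (by decide), h3]
      exact Or.inl fun e => hne (by rw [e])
  · exact .idle ((hfalse false h1 rfl).trans h2) (hdead true h1 rfl) h3 h4

theorem State.empty_mem (h : State φ A c M) : ∅ ∈ (fam c M).sets := h.atoms.empty_mem h.inv.wf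

theorem tick_sol (F : Fits φ A c r ε) (h : State φ A c M) :
    (fam c (tick c false M)).sol φ A ∪ (fam c (tick c true M)).sol φ A = (fam c M).sol φ A ∧
      Disjoint ((fam c (tick c false M)).sol φ A) ((fam c (tick c true M)).sol φ A) := by
  obtain ⟨hS, τ, hτ, hst⟩ := tick_step F h
  rw [← hτ.sol]
  rcases hst with ⟨h1, h2, h3, h4⟩ | ⟨S, T, h1, h2, h3, h4, h5, h6, h7, h8⟩ | ⟨h1, h2, h3, h4⟩
  · rw [h3, h4.sol_eq (hS true).empty_mem]
    simp
  · have key : ∀ β g, g ∈ (fam c (tick c β M)).sol φ A ↔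
        g ∈ τ.sol φ A ∧ (β = true ↔ Fam.Large φ A ε τ S T (g.proj S)) := by
      intro β g
      simp only [Fam.sol, Set.mem_ofPred_eq, h6 β, and_assoc]
      refine and_congr_right fun _ => ⟨fun H => ⟨fun U hU => (h1 β).rel U hU (H U hU),
        ((h5 β _).1 (H S h2)).2⟩, fun H U hU => ?_⟩
      by_cases e : U = S
      · rw [e]; exact (h5 β _).2 ⟨H.1 S h2, H.2⟩
      · rw [h7 β U hU e]; exact H.1 U hU
    constructor
    · ext g
      rw [Set.mem_union, key, key, ← and_or_left]
      refine and_iff_left ?_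
      by_cases hl : Fam.Large φ A ε τ S T (g.proj S) <;> simp [hl]
    · rw [Set.disjoint_left]
      intro g h1 h2
      have h1 := ((key _ _).1 h1).2
      have h2 := ((key _ _).1 h2).2
      simp only [Bool.false_eq_true, false_iff, true_iff] at h1 h2
      exact h1 h2
  · rw [h1, h2.sol_eq (hS true).empty_mem]
    simp

theorem Dead.below {σ τ : Fam} (h : τ.Dead) (h0 : ∅ ∈ τ.sets) (hb : σ.Below τ) : σ.Dead :=
  Set.subset_eq_empty (hb.rel ∅ h0) h

/-- The result of a time step is below the original family. -/
theorem Step.below {τ : Fam} {σ : Bool → Fam} {D : ℕ} (h : Step φ A ε D τ σ) (β : Bool) :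
    (σ β).Below τ ∨ (σ β).Dead := by
  rcases h with ⟨h1, -, -, h4⟩ | ⟨_, _, h1, -, -, -, -, -, -, -⟩ | ⟨h1, h2, -, -⟩
  · cases β
    · exact Or.inl h1
    · exact Or.inr h4
  · exact Or.inl (h1 β)
  · cases β
    · rw [h1]; exact Or.inl (Fam.Below.refl _)
    · exact Or.inr h2

theorem tick_dead (F : Fits φ A c r ε) (h : State φ A c M) (hd : (fam c M).Dead) (β : Bool) :
    (fam c (tick c β M)).Dead := by
  obtain ⟨hS, τ, hτ, hst⟩ := tick_step F h
  rcases hst.below β with h1 | h1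
  · exact Dead.below hd h.empty_mem (h1.trans hτ.below)
  · exact h1

theorem lt_ncard_iff (F : Fits φ A c r ε) {n : ℕ} :
    c.D < n ↔ (maxRelCard φ A : ℝ) ^ r < n := by
  rw [F.card, Nat.floor_lt (by positivity)]

theorem tick_good (F : Fits φ A c r ε) (h : State φ A c M)
    (hg : (fam c M).Good φ A ((maxRelCard φ A : ℝ) ^ r) ε) (β : Bool) :
    (fam c (tick c β M)).Dead ∨
      (fam c (tick c β M)).Good φ A ((maxRelCard φ A : ℝ) ^ r) ε := by
  obtain ⟨hS, τ, hτ, hst⟩ := tick_step F h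
  have e := hτ.eq hg.cons
  rw [← e] at hg
  rcases hst with ⟨h1, h2, h3, h4⟩ | ⟨S, T, h1, h2, h3, h4, h5, h6, h7, h8⟩ | ⟨h1, h2, h3, h4⟩
  · obtain ⟨S, hS, T, hT, hST, hle, -⟩ := h2
    exact absurd ((lt_ncard_iff F).2 (hg.strong S hS T hT hST)) (by omega)
  · exfalso
    obtain ⟨g, hgl⟩ := h8
    by_cases hgS : g ∈ τ.rel S
    · exact Fam.not_tooLarge_iff.2 (hg.unif S h2 T h3 h4 g hgS) hgl
    · refine hgl ?_
      have : {h ∈ τ.rel T | PMap.proj S h = g} = ∅ := by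
        rw [Set.eq_empty_iff_forall_notMem]
        rintro h ⟨h1, h2'⟩
        refine hgS ?_
        rw [hg.cons S h2 T h3 h4]
        exact ⟨h, h1, h2'⟩
      rw [Fam.ext, this]
      simp
      positivity
  · cases β
    · rw [h1]; exact Or.inr hg
    · exact Or.inl h2

open Fam in
theorem tick_pot (F : Fits φ A c r ε) (h : State φ A c M) {n : ℝ}
    (hp : PotLE φ A (range c.X) ((maxRelCard φ A : ℝ) ^ r) (ε / 2 * Real.log (maxRelCard φ A)) n
      (fam c M)) (β : Bool) :
    (fam c (tick c β M)).Dead ∨ (fam c (tick c β M)).Good φ A ((maxRelCard φ A : ℝ) ^ r) ε ∨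
      0 ≤ n ∧ PotLE φ A (range c.X) ((maxRelCard φ A : ℝ) ^ r)
        (ε / 2 * Real.log (maxRelCard φ A)) (n - 1) (fam c (tick c β M)) := by
  obtain ⟨hS, τ, hτ, hst⟩ := tick_step F h
  have h0 : ∅ ∈ τ.sets := by rw [hτ.sets]; exact h.empty_mem
  have hfl : (c.D : ℝ) ≤ (maxRelCard φ A : ℝ) ^ r := by
    rw [F.card]; exact Nat.floor_le (by positivity)
  by_cases hd : τ.Dead
  · refine Or.inl ?_
    rcases hst.below β with h1 | h1
    · exact Dead.below hd h0 h1
    · exact h1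
  have hle : ∀ S ∈ τ.sets, ((τ.rel S).ncard : ℝ) ≤ (maxRelCard φ A : ℝ) ^ r := fun S hS =>
    le_trans (by exact_mod_cast hτ.card S hS) hfl
  have hbd : τ.Bounded ((maxRelCard φ A : ℝ) ^ r) := fun S hS =>
    ⟨hτ.wf.finite hS, hτ.cons.nonempty h0 hd hS, hle S hS⟩
  have hpτ := hp.below hτ.below
  have hδ : 0 ≤ ε / 2 * Real.log (maxRelCard φ A) :=
    mul_nonneg (by linarith [F.pos]) (Real.log_natCast_nonneg _)
  have hn : 0 ≤ n := by
    refine le_trans (pot_nonneg ?_ hδ) (hpτ τ hτ.wf hτ.cons hbd (Below.refl _))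
    obtain ⟨hf, hne, hl⟩ := hbd ∅ h0
    exact Real.log_nonneg (le_trans (by exact_mod_cast (Set.ncard_pos hf).2 hne) hl)
  rcases hst with ⟨h1, h2, h3, h4⟩ | ⟨S, T, h1, h2, h3, h4, h5, h6, h7, h8⟩ | ⟨h1, h2, h3, h4⟩
  · cases β
    · obtain ⟨S, hS, T, hT, hST, -, hm⟩ := h2
      exact Or.inr (Or.inr ⟨hn, hpτ.join F.vars hδ hτ.wf hτ.cons hbd h1 hm hST⟩)
    · exact Or.inl h4
  · obtain ⟨g, hg⟩ := h8
    refine Or.inr (Or.inr ⟨hn, hpτ.split F.vars (by linarith [F.one_le]) F.pos hτ.wf hτ.cons hbd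
      (h1 β) h2 h3 h4 hg ?_⟩)
    cases β
    · exact Or.inr fun g hg => by simpa using ((h5 false g).1 hg).2
    · exact Or.inl fun g hg => by simpa using ((h5 true g).1 hg).2
  · cases β
    · rw [h1]
      exact Or.inr (Or.inl ⟨hτ.cons, hle, fun S hS T hT hST => (lt_ncard_iff F).1 (h3 S hS T hT hST),
        fun S hS T hT hST g hg => not_tooLarge_iff.1 (h4 S hS T hT hST g hg)⟩)
    · exact Or.inl h2

theorem State.run (F : Fits φ A c r ε) (h : State φ A c M) (β : ℕ → Bool) (n : ℕ) :
    State φ A c (runBits (tick c) M β n) := by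
  induction n with
  | zero => exact h
  | succ n ih => exact (tick_step F ih).1 _

theorem run_good (F : Fits φ A c r ε) (h : State φ A c M) (β : ℕ → Bool) {n : ℕ}
    (hn : 2 ^ (2 * c.X + 3 + ⌈r⌉₊ + ⌈1 / ε⌉₊) ≤ n) :
    (fam c (runBits (tick c) M β n)).Dead ∨
      (fam c (runBits (tick c) M β n)).Good φ A ((maxRelCard φ A : ℝ) ^ r) ε := by
  have key : ∀ k, (fam c (runBits (tick c) M β k)).Dead ∨
      (fam c (runBits (tick c) M β k)).Good φ A ((maxRelCard φ A : ℝ) ^ r) ε ∨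
      ((k : ℝ) ≤ n - 1 ∧ Fam.PotLE φ A (range c.X) ((maxRelCard φ A : ℝ) ^ r)
        (ε / 2 * Real.log (maxRelCard φ A)) (n - 2 - k) (fam c (runBits (tick c) M β k))) := by
    intro k
    induction k with
    | zero =>
      refine Or.inr (Or.inr ⟨?_, ?_⟩)
      · have : (1 : ℝ) ≤ n := by exact_mod_cast Nat.one_le_two_pow.trans hn
        push_cast
        linarith
      · intro σ' h1 h2 h3 h4
        have hn' : (2 : ℝ) ^ (2 * c.X + 3 + ⌈r⌉₊ + ⌈1 / ε⌉₊) ≤ n := by exact_mod_cast hn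
        have := Fam.PotLE.init (X := c.X) F.one_le F.pos σ' h1 h2 h3 h4
        push_cast
        linarith
    | succ k ih =>
      have hk := h.run F β k
      rcases ih with h1 | h1 | ⟨h1, h2⟩
      · exact Or.inl (tick_dead F hk h1 _)
      · exact (tick_good F hk h1 (β k)).imp_right Or.inl
      · refine (tick_pot F hk h2 (β k)).imp_right fun h3 => h3.imp_right fun ⟨h4, h5⟩ => ⟨?_, ?_⟩
        · push_cast
          linarith
        · push_cast
          rw [show (n : ℝ) - 2 - (k + 1) = n - 2 - k - 1 by ring]
          exact h5
  rcases key n with h1 | h1 | ⟨h1, -⟩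
  · exact Or.inl h1
  · exact Or.inr h1
  · linarith

end Pr

end

section

open Finset

namespace Pr

open EX Stm

variable {φ : QFCQ} {A : Struct} {c : Cst} {M M' : Mem} {r ε : ℝ}

/-! ### The relations of the atoms -/

/-- Register number `p` is the start of an atom of the query. -/
structure AtomAt (c : Cst) (M : Mem) (p : ℕ) (α : ℕ × List ℕ) : Prop where
  lim : p + 2 + α.2.length ≤ c.LIM
  len : α.2.length < c.X
  lt : ∀ x ∈ α.2, x < c.X
  name : M aQ 0 0 p = α.1
  arity : M aQ 0 0 (p + 1) = α.2.length
  arg : ∀ j (h : j < α.2.length), M aQ 0 0 (p + 2 + j) = α.2[j]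

/-- Register number `p` is the start of a relation. -/
structure RelAt (c : Cst) (M : Mem) (p : ℕ) (e : (ℕ × ℕ) × List (List ℕ)) : Prop where
  lim : p + 3 + e.2.length * (e.1.2 + 1) ≤ c.LIM
  card : e.2.length ≤ c.D
  name : M aR 0 0 p = e.1.1
  arity : M aR 0 0 (p + 1) = e.1.2
  count : M aR 0 0 (p + 2) = e.2.length
  entry : ∀ k (h : k < e.2.length), ∀ j < e.1.2,
    M aR 0 0 (p + 3 + k * (e.1.2 + 1) + 1 + j) = e.2[k].getD j 0

/-- The memory holds the query and the relations. -/
structure Inp (φ : QFCQ) (L : StructListing) (c : Cst) (M : Mem) : Prop where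
  num : M aQ 0 0 0 = φ.atoms.length
  num_le : φ.atoms.length ≤ c.X
  atoms : ∀ i (h : i < φ.atoms.length), AtomAt c M (M aATP 0 0 i) φ.atoms[i]
  rnum : M aR 0 0 0 = L.rels.length
  rnum_le : L.rels.length ≤ c.X
  rels : ∀ i (h : i < L.rels.length), RelAt c M (M aRLP 0 0 i) L.rels[i]

theorem Inp.congr {L : StructListing} (h : Inp φ L c M) (h1 : M' aQ = M aQ) (h2 : M' aR = M aR)
    (h3 : M' aATP = M aATP) (h4 : M' aRLP = M aRLP) : Inp φ L c M' where
  num := by rw [h1]; exact h.num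
  num_le := h.num_le
  atoms i hi := by
    obtain ⟨a1, a2, a3, a4, a5, a6⟩ := h.atoms i hi
    rw [h3]
    exact ⟨a1, a2, a3, by rw [h1]; exact a4, by rw [h1]; exact a5, by rw [h1]; exact a6⟩
  rnum := by rw [h2]; exact h.rnum
  rnum_le := h.rnum_le
  rels i hi := by
    obtain ⟨a1, a2, a3, a4, a5, a6⟩ := h.rels i hi
    rw [h4]
    exact ⟨a1, a2, by rw [h2]; exact a3, by rw [h2]; exact a4, by rw [h2]; exact a5,
      by rw [h2]; exact a6⟩

section

variable {η : ℕ → ℕ} {n p : ℕ} {α : ℕ × List ℕ} (h : AtomAt c M p α) (hn : η 7 = n)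
  (hp : M aATP 0 0 n = p)
include hn hp

theorem ev_atp : atp.ev c M η = p := by
  simp only [atp, flat, ev, cut, hn, hp]

include h

theorem ev_arity : arity.ev c M η = α.2.length := by
  have := h.lim
  rw [← h.arity, arity, flat]
  simp only [ev, cut, ev_atp hn hp]
  rw [min_eq_left (by omega)]

theorem ev_isArg {e : EX} : 0 < (isArg e).ev c M η ↔ e.ev c M η < α.2.length := by
  rw [isArg, pos_leE, ev_arity h hn hp]
  simp only [ev]
  omega

theorem ev_arg {e : EX} (he : e.ev c M η < α.2.length) : (arg e).ev c M η = α.2[e.ev c M η] := by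
  have := h.lim
  rw [← h.arg _ he, arg, flat]
  simp only [ev, cut, ev_atp hn hp]
  rw [min_eq_left (by omega)]

end

theorem presents_rels {L : StructListing} (hL : L.Presents φ.signature A) {α : ℕ × List ℕ}
    (hα : α ∈ φ.atoms) : ∃ i, ∃ h : i < L.rels.length, L.rels[i].1 = (α.1, α.2.length) ∧
      L.rels[i].2.toFinset = A.rel (.base α.1 α.2.length) ∧ L.rels[i].2.Nodup ∧
      ∀ j (hj : j < L.rels.length), L.rels[j].1 = (α.1, α.2.length) → j = i := by
  obtain ⟨-, -, h1, h2, h3⟩ := hL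
  have : RelSym.base α.1 α.2.length ∈ φ.signature := by
    simp only [QFCQ.signature, conjSignature, QFCQ.conj, mem_image, List.mem_toFinset, List.mem_map]
    exact ⟨_, ⟨α, hα, rfl⟩, rfl⟩
  rw [← h2, List.mem_toFinset, List.mem_map] at this
  obtain ⟨q, hq, e⟩ := this
  obtain ⟨i, hi, rfl⟩ := List.getElem_of_mem hq
  injection e with e1 e2
  refine ⟨i, hi, Prod.ext e1 e2, ?_, (h3 _ hq).1, fun j hj e' => ?_⟩
  · rw [(h3 _ hq).2, e1, e2]
  · have hinj := List.nodup_iff_injective_get.1 h1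
    have := @hinj ⟨j, by simpa using hj⟩ ⟨i, by simpa using hi⟩ (by
      simp only [List.get_eq_getElem, List.getElem_map]
      rw [e']; exact (Prod.ext e1 e2).symm)
    simpa using this

/-- The number of the set of variables of an atom, and the matching rows. -/
theorem atom_rows (hc : c.OK) {L : StructListing} (hL : L.Presents φ.signature A)
    (h : Inp φ L c M) (ht : Tab c M) {η : ℕ → ℕ} {n : ℕ} (hn : n < φ.atoms.length) (h7 : η 7 = n) :
    ∃ M₄, atom.den c η M = addlist.den c η M₄ ∧
      (∀ a, a ∉ [aRS, aTA, aXD, aXA, aG] → M₄ a = M a) ∧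
      ∃ G < c.E, M₄ aG 0 0 0 = G ∧ fs c.X G = φ.atoms[n].2.toFinset ∧
      (∀ i < c.D, Xa M₄ i → (xrow c M₄ i).HasDom (fs c.X G) ∧
        ∃ t ∈ A.rel (.base φ.atoms[n].1 φ.atoms[n].2.length),
          φ.atoms[n].2.map (xrow c M₄ i) = t.map some) ∧
      ∀ g : PMap, ∀ t ∈ A.rel (.base φ.atoms[n].1 φ.atoms[n].2.length),
        φ.atoms[n].2.map g = t.map some →
        ∃ i < c.D, Xa M₄ i ∧ ∀ x ∈ fs c.X G, xrow c M₄ i x = g x := by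
  obtain ⟨i₀, hi₀, e1, e2, e3, e4⟩ := presents_rels hL (List.getElem_mem hn)
  have hat := h.atoms n hn
  have hrl := h.rels i₀ hi₀
  set α := φ.atoms[n] with hα
  set T := L.rels[i₀].2 with hT
  have hTlen : ∀ t ∈ T, t.length = α.2.length := fun t ht => by
    have := A.length_eq (.base α.1 α.2.length) t (by rw [← e2]; exact List.mem_toFinset.2 ht)
    exact this
  set p := M aATP 0 0 n with hp
  set q := M aRLP 0 0 i₀ with hq
  obtain ⟨r1, r2, r3, r4, r5, r6⟩ := hrl
  rw [e1] at r1 r3 r4 r6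
  simp only [← hT] at r1 r2 r3 r4 r5 r6
  have hXL : c.X ≤ c.LIM := by
    have := hc.X_lt (k := c.X - 1)
    have h1 := hc.X_le
    have h2 := Nat.lt_two_pow_self (n := c.TK)
    have h3 := Nat.lt_two_pow_self (n := c.P)
    have : c.TK ≤ c.P := by unfold Cst.P Cst.NB; omega
    unfold Cst.LIM
    nlinarith
  have hnl : n ≤ c.LIM := by have := h.num_le; omega
  have hle := hat.len
  set M₁ := (setR aRS findRel).den c η M with hM₁
  set M₂ := (asg aTA .one .one .D (.add (.add (reg aRS) (.c 3))
    (.sum 2 .X (.ite (.v 2) arity (.v 20) (.c 0))))).den c η M₁ with hM₂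
  set M₃ := (asg aXD .one .X .D (.sum 2 .X (ifE (andE (isArg (.v 2)) (andE (eqE (arg (.v 2)) (.v 1))
      (notE (exE 3 .X (andE (ltE (.v 3) (.v 2)) (eqE (arg (.v 3)) (.v 1)))))))
    (.add (entry (.v 20) (.v 2)) (.c 1)) (.c 0)))).den c η M₂ with hM₃
  set M₃' := (asg aXA .one .one .D (andE (ltE (.v 20) count) (allE 2 .X (impE (isArg (.v 2))
    (eqE (.rd aXD (.c 0) (arg (.v 2)) (.v 20)) (.add (entry (.v 20) (.v 2)) (.c 1))))))).den c η M₃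
    with hM₃'
  set M₄ := (setR aG (findE (exE 4 .X (andE (isArg (.v 4)) (eqE (arg (.v 4)) (.v 3)))))).den c η M₃'
    with hM₄
  have f1 : ∀ a, a ≠ aRS → M₁ a = M a := fun a ha => den_frame _ _ _ (by simp [setR, writes, ha])
  have f2 : ∀ a, a ≠ aTA → M₂ a = M₁ a := fun a ha =>
    den_frame _ _ _ (by simp [asg, fors, writes, ha])
  have f3 : ∀ a, a ≠ aXD → M₃ a = M₂ a := fun a ha =>
    den_frame _ _ _ (by simp [asg, fors, writes, ha])
  have f3' : ∀ a, a ≠ aXA → M₃' a = M₃ a := fun a ha =>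
    den_frame _ _ _ (by simp [asg, fors, writes, ha])
  have f4 : ∀ a, a ≠ aG → M₄ a = M₃' a := fun a ha => den_frame _ _ _ (by simp [setR, writes, ha])
  have hI1 : Inp φ L c M₁ := h.congr (f1 _ (by decide)) (f1 _ (by decide)) (f1 _ (by decide))
    (f1 _ (by decide))
  have hI2 : Inp φ L c M₂ := hI1.congr (f2 _ (by decide)) (f2 _ (by decide)) (f2 _ (by decide))
    (f2 _ (by decide))
  have hI3 : Inp φ L c M₃ := hI2.congr (f3 _ (by decide)) (f3 _ (by decide)) (f3 _ (by decide))
    (f3 _ (by decide))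
  have hI3' : Inp φ L c M₃' := hI3.congr (f3' _ (by decide)) (f3' _ (by decide))
    (f3' _ (by decide)) (f3' _ (by decide))
  have p1 : M₁ aATP 0 0 n = p := by rw [f1 _ (by decide)]
  have p2 : M₂ aATP 0 0 n = p := by rw [f2 _ (by decide), p1]
  have p3 : M₃ aATP 0 0 n = p := by rw [f3 _ (by decide), p2]
  have p3' : M₃' aATP 0 0 n = p := by rw [f3' _ (by decide), p3]
  have a1 := p1 ▸ hI1.atoms n hn
  have a2 := p2 ▸ hI2.atoms n hn
  have a3 := p3 ▸ hI3.atoms n hn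
  have a3' := p3' ▸ hI3'.atoms n hn
  rw [← hα] at a1 a2 a3 a3'
  -- the relation
  have hRS : M₁ aRS 0 0 0 = q := by
    have : findRel.ev c M η = q := by
      have hlt : i₀ < c.X := by have := h.rnum_le; omega
      have hcond : ∀ i < c.X, 0 < (andE (leE (.add (.v 2) (.c 1)) (reg aR))
          (andE (eqE (flat aR (flat aRLP (.v 2))) (flat aQ atp))
            (eqE (flat aR (.add (flat aRLP (.v 2)) (.c 1))) arity))).ev c M
          (Function.update η 2 i) ↔ i = i₀ := by
        intro i hi
        have h7' : Function.update η 2 i 7 = n := by simp [h7]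
        rw [pos_andE, pos_leE, pos_andE, pos_eqE, pos_eqE, ev_arity hat h7' rfl]
        have hpl := hat.lim
        have hname : (flat aQ atp).ev c M (Function.update η 2 i) = α.1 := by
          change M aQ 0 0 (min (atp.ev c M _) c.LIM) = _
          rw [ev_atp h7' rfl, min_eq_left (by omega), hat.name]
        rw [hname]
        simp only [flat, ev, cut, reg, h.rnum, Function.update_self]
        constructor
        · rintro ⟨h1, h2, h3⟩
          have hi' : i < L.rels.length := by omega
          have hr := h.rels i hi'
          have hl := hr.lim
          rw [min_eq_left (by omega), hr.name] at h2
          rw [min_eq_left (by omega), hr.arity] at h3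
          exact e4 i hi' (Prod.ext h2 h3)
        · rintro rfl
          rw [min_eq_left (by omega), min_eq_left (by omega)]
          exact ⟨by omega, r3, r4⟩
      simp only [findRel, ev, ev_ifE, Bd.val]
      rw [sum_ite_unique (j := i₀) _ hlt ((hcond i₀ hlt).2 rfl)]
      · simp [flat, ev, cut, hq]
      · intro i hi j hj h1 h2
        rw [(hcond i hi).1 h1, (hcond j hj).1 h2]
    rw [hM₁, ← this]
    simp [setR, den, ev, cut, wr]
  have hTA : ∀ k < c.D, M₂ aTA 0 0 k = q + 3 + k * (α.2.length + 1) := by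
    intro k hk
    rw [hM₂, den_asg (by decide)]
    simp only [Bd.val]
    rw [setA_same one_pos one_pos hk]
    simp only [ev, reg, cut, hRS, Bd.val]
    congr 1
    rw [sum_congr rfl (g := fun y => if y ≤ α.2.length then k else 0)]
    · rw [sum_ite_mul _ _ _ hle, Nat.mul_comm]
    · intro y _
      rw [ev_arity a1 (by simp [env3_of_ne, h7]) p1]
      simp
  have hentry : ∀ (N : Mem), N aTA = M₂ aTA → N aR = M aR → ∀ (η' : ℕ → ℕ) (k j : ℕ),
      η' 20 = k → η' 2 = j → ∀ hk : k < T.length, j < α.2.length →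
      (entry (.v 20) (.v 2)).ev c N η' = T[k].getD j 0 := by
    intro N hN1 hN2 η' k j h20 h2 hk hj
    have hkm : (k + 1) * (α.2.length + 1) ≤ T.length * (α.2.length + 1) :=
      Nat.mul_le_mul_right _ hk
    rw [← r6 k hk j hj, entry]
    simp only [flat, ev, cut, h20, h2, hN1, hN2, hTA k (by omega)]
    rw [min_eq_left (by rw [add_mul] at hkm; omega)]
  have hXD : ∀ k (hk : k < T.length), ∀ v < c.X, (v ∉ α.2 → M₃ aXD 0 v k = 0) ∧
      (v ∈ α.2 → ∃ j, ∃ hj : j < α.2.length, α.2[j] = v ∧ M₃ aXD 0 v k = T[k].getD j 0 + 1) := by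
    classical
    intro k hk v hv
    have hkD : k < c.D := by omega
    have e : M₃ aXD 0 v k = ∑ j ∈ range c.X, if (∃ hj : j < α.2.length, α.2[j] = v ∧
        ∀ i (hi : i < j), α.2[i] ≠ v) then T[k].getD j 0 + 1 else 0 := by
      rw [hM₃, den_asg (by decide)]
      simp only [Bd.val]
      rw [setA_same one_pos hv hkD]
      simp only [ev, Bd.val]
      refine sum_congr rfl fun j hj => ?_
      set η' := Function.update (env3 η 0 v k) 2 j with hη'
      have h7' : η' 7 = n := by simp [hη', env3_of_ne, h7]
      have h7'' : ∀ i, Function.update η' 3 i 7 = n := fun i => by simp [h7']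
      have h20' : η' 20 = k := by simp [hη', env3_row]
      have h1' : η' 1 = v := by simp [hη', env3_one]
      have h2' : η' 2 = j := by simp [hη']
      simp only [ev_ifE, pos_andE, ev_isArg a2 h7' p2, ev, h2']
      by_cases hjl : j < α.2.length
      · rw [hentry M₂ rfl (by rw [f2 _ (by decide), f1 _ (by decide)]) η' k j h20' h2' hk hjl]
        refine if_congr ?_ rfl rfl
        rw [pos_eqE, pos_notE, pos_exE, ev_arg a2 h7' p2 (by simpa only [ev, h2'] using hjl)]
        simp only [ev, h1', h2', hjl, true_and, exists_true_left]
        refine and_congr_right fun _ => ?_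
        simp only [not_exists, not_and]
        refine ⟨fun H i hi e => H i (by simp only [Bd.val]; omega) ?_, fun H i _ hp => ?_⟩
        · rw [pos_andE, pos_ltE, pos_eqE, ev_arg a2 (h7'' i) p2 (by simp [ev]; omega)]
          simp [ev, h1', h2', hi, e]
        · rw [pos_andE, pos_ltE, pos_eqE] at hp
          have hij : i < j := by simpa [ev, h2'] using hp.1
          have := hp.2
          rw [ev_arg a2 (h7'' i) p2 (by simp [ev]; omega)] at this
          simp only [ev, Function.update_self] at this
          refine H i hij ?_
          simpa [h1'] using this
      · rw [if_neg (by tauto), if_neg fun ⟨h', _⟩ => hjl h']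
    constructor
    · intro hva
      rw [e]
      refine sum_eq_zero fun j _ => if_neg ?_
      rintro ⟨hj, e', -⟩
      exact hva (e' ▸ List.getElem_mem hj)
    · intro hva
      have hex : ∃ j, ∃ hj : j < α.2.length, α.2[j] = v := by
        obtain ⟨j, hj, e'⟩ := List.getElem_of_mem hva
        exact ⟨j, hj, e'⟩
      obtain ⟨hj, e'⟩ := Nat.find_spec hex
      refine ⟨Nat.find hex, hj, e', ?_⟩
      rw [e]
      refine sum_ite_unique (f := fun j => T[k].getD j 0 + 1) ?_ (by omega)
        ⟨hj, e', fun i hi e'' => Nat.find_min hex hi ⟨by omega, e''⟩⟩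
      rintro i - j - ⟨hi, ei, hi'⟩ ⟨hj, ej, hj'⟩
      rcases lt_trichotomy i j with hlt | rfl | hlt
      · exact absurd ei (hj' i hlt)
      · rfl
      · exact absurd ej (hi' j hlt)
  have hXA : ∀ k < c.D, (Xa M₄ k ↔ k < T.length ∧ ∀ j (hj : j < α.2.length),
      M₃ aXD 0 α.2[j] k = (entry (.v 20) (.v 2)).ev c M₃
        (Function.update (env3 η 0 0 k) 2 j) + 1) := by
    intro k hk
    rw [Xa, f4 _ (by decide), hM₃', den_asg (by decide)]
    simp only [Bd.val]
    rw [setA_same one_pos one_pos hk, pos_andE, pos_ltE, pos_allE]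
    have hcount : count.ev c M₃ (env3 η 0 0 k) = T.length := by
      have h1 : M₃ aR = M aR := by rw [f3 _ (by decide), f2 _ (by decide), f1 _ (by decide)]
      have h2 : M₃ aRS = M₁ aRS := by rw [f3 _ (by decide), f2 _ (by decide)]
      simp only [count, flat, reg, ev, cut, h1, h2, hRS]
      rw [min_eq_left (by omega), r5]
    rw [hcount]
    simp only [ev, env3_row, Bd.val]
    refine and_congr_right fun _ => ?_
    have h7' : ∀ j, Function.update (env3 η 0 0 k) 2 j 7 = n := fun j => by simp [env3_of_ne, h7]
    have harg : ∀ j (hj : j < α.2.length), (rd aXD (.c 0) (arg (.v 2)) (.v 20)).ev c M₃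
        (Function.update (env3 η 0 0 k) 2 j) = M₃ aXD 0 α.2[j] k := by
      intro j hj
      change M₃ aXD 0 (min ((arg (.v 2)).ev c M₃ _) c.P) (Function.update (env3 η 0 0 k) 2 j 20) = _
      rw [ev_arg a3 (h7' j) p3 (by simpa [ev] using hj),
        min_eq_left (hc.X_lt (hat.lt _ (List.getElem_mem _))).2]
      simp [ev, env3_row]
    constructor
    · intro H j hj
      have := H j (by omega)
      rw [pos_impE, ev_isArg a3 (h7' j) p3, pos_eqE, harg j hj] at this
      exact this (by simpa [ev] using hj)
    · intro H j _
      rw [pos_impE, ev_isArg a3 (h7' j) p3, pos_eqE]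
      intro hj
      have hj : j < α.2.length := by simpa [ev] using hj
      rw [harg j hj]
      exact H j hj
  have hXA' : ∀ k < c.D, (Xa M₄ k ↔ ∃ hk : k < T.length, ∀ j (hj : j < α.2.length),
      M₃ aXD 0 α.2[j] k = T[k].getD j 0 + 1) := by
    intro k hk
    rw [hXA k hk, ← exists_prop]
    refine exists_congr fun hkT => forall₂_congr fun j hj => ?_
    rw [hentry M₃ (f3 _ (by decide)) (by rw [f3 _ (by decide), f2 _ (by decide), f1 _ (by decide)])
      _ k j (by simp [env3_row]) (by simp) hkT hj]
  have hxr : ∀ k, ∀ x, xrow c M₄ k x = if x < c.X then dec (M₃ aXD 0 x k) else none := by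
    intro k x
    simp only [xrow, f4 aXD (by decide), f3' aXD (by decide)]
  obtain ⟨G, hG, hGs⟩ := exists_fs (X := c.X) (S := α.2.toFinset)
    fun x hx => mem_range.2 (hat.lt x (List.mem_toFinset.1 hx))
  refine ⟨M₄, rfl, fun a ha => ?_, G, hG, ?_, hGs, fun k hk hx => ?_, fun g t ht' hgt => ?_⟩
  · simp only [List.mem_cons, List.not_mem_nil, or_false, not_or] at ha
    rw [f4 a ha.2.2.2.2, f3' a ha.2.2.2.1, f3 a ha.2.2.1, f2 a ha.2.1, f1 a ha.1]
  · have hm : M₃' aMEM = M aMEM := by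
      rw [f3' _ (by decide), f3 _ (by decide), f2 _ (by decide), f1 _ (by decide)]
    have : (findE (exE 4 .X (andE (isArg (.v 4)) (eqE (arg (.v 4)) (.v 3))))).ev c M₃' η = G := by
      refine ev_findE hc (by rw [hm]; exact ht.bit) hG fun w _ k hk => ?_
      have hkG : G.testBit k = true ↔ k ∈ α.2 := by
        rw [← List.mem_toFinset, ← hGs, mem_fs]
        simp [hk]
      rw [hkG, pos_exE]
      set η' := Function.update (Function.update η 2 w) 3 k with hη'
      have h7' : ∀ i, Function.update η' 4 i 7 = n := fun i => by simp [hη', h7]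
      constructor
      · rintro ⟨i, _, hi⟩
        rw [pos_andE, ev_isArg a3' (h7' i) p3', pos_eqE] at hi
        rw [ev_arg a3' (h7' i) p3' hi.1] at hi
        have := hi.2
        have e4 : EX.ev c M₃' (Function.update η' 4 i) (.v 3) = k := by simp [ev, hη']
        rw [← e4, ← this]
        exact List.getElem_mem _
      · intro hk'
        obtain ⟨j, hj, rfl⟩ := List.getElem_of_mem hk'
        refine ⟨j, by simp only [Bd.val]; omega, ?_⟩
        have hj' : EX.ev c M₃' (Function.update η' 4 j) (.v 4) < α.2.length := by
          simpa [ev] using hj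
        rw [pos_andE, ev_isArg a3' (h7' j) p3', pos_eqE, ev_arg a3' (h7' j) p3' hj']
        exact ⟨hj', by simp [ev, hη']⟩
    rw [hM₄, ← this]
    simp [setR, den, ev, cut, wr]
  · obtain ⟨hkT, hx⟩ := (hXA' k hk).1 hx
    have hval : ∀ j (hj : j < α.2.length), xrow c M₄ k α.2[j] = some (T[k].getD j 0) := by
      intro j hj
      rw [hxr, if_pos (hat.lt _ (List.getElem_mem hj)), hx j hj, dec]
    refine ⟨fun x => ?_, T[k], by rw [← e2]; exact List.mem_toFinset.2 (List.getElem_mem hkT), ?_⟩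
    · rw [hGs, List.mem_toFinset]
      constructor
      · intro h'
        by_contra hxa
        rw [hxr] at h'
        split_ifs at h' with hX
        · rw [((hXD k hkT x hX).1 hxa), dec] at h'
          simp at h'
        · simp at h'
      · intro hxa
        obtain ⟨j, hj, rfl⟩ := List.getElem_of_mem hxa
        rw [hval j hj]; rfl
    · refine List.ext_getElem (by simp [hTlen _ (List.getElem_mem hkT)]) fun j h1 h2 => ?_
      simp only [List.getElem_map, List.length_map] at h1 h2 ⊢
      rw [hval j h1, List.getD_eq_getElem _ _ h2]
  · rw [← e2, List.mem_toFinset] at ht'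
    obtain ⟨k, hk, rfl⟩ := List.getElem_of_mem ht'
    have hkl := hTlen _ (List.getElem_mem hk)
    have hg : ∀ j (hj : j < α.2.length), g α.2[j] = some (T[k].getD j 0) := by
      intro j hj
      have := List.getElem_of_eq hgt (i := j) (by simpa using hj)
      rw [List.getD_eq_getElem _ _ (by omega)]
      simpa using this
    have hval : ∀ v < c.X, v ∈ α.2 → some (M₃ aXD 0 v k) = (g v).map (· + 1) := by
      intro v hv hva
      obtain ⟨j, hj, rfl, h2⟩ := (hXD k hk v hv).2 hva
      rw [h2, hg j hj]; rfl
    refine ⟨k, by omega, (hXA' k (by omega)).2 ⟨hk, fun j hj => ?_⟩, fun x hx => ?_⟩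
    · have := hval _ (hat.lt _ (List.getElem_mem hj)) (List.getElem_mem hj)
      rw [hg j hj] at this
      simpa using this
    · rw [hGs, List.mem_toFinset] at hx
      have hX := hat.lt x hx
      rw [hxr, if_pos hX]
      have := hval x hX hx
      cases hgx : g x with
      | none => rw [hgx] at this; simp at this
      | some b => rw [hgx] at this; simp only [Option.map_some, Option.some.injEq] at this; rw [this, dec]

end Pr

end

section

open Finset

namespace Pr

open EX Stm

variable {φ : QFCQ} {A : Struct} {c : Cst} {M M' : Mem} {r ε : ℝ}

/-- The effect of adding the relations of the first `n` atoms. -/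
structure AtomsTo (φ : QFCQ) (A : Struct) (c : Cst) (M M' : Mem) (n : ℕ) : Prop where
  same : ∀ a, a ∉ atom.writes → M' a = M a
  inv : Inv φ A c M'
  sol : (fam c M').sol φ A = (fam c M).sol φ A
  atoms : ∀ i (h : i < φ.atoms.length), i < n → φ.atoms[i].2.toFinset ∈ (fam c M').sets ∧
    ∀ g ∈ (fam c M').rel φ.atoms[i].2.toFinset,
      (Atom.mk (.base φ.atoms[i].1 φ.atoms[i].2.length) φ.atoms[i].2).Holds A g

theorem mem_conj {i : ℕ} (h : i < φ.atoms.length) :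
    Atom.mk (.base φ.atoms[i].1 φ.atoms[i].2.length) φ.atoms[i].2 ∈ φ.conj := by
  simp only [QFCQ.conj, List.mem_toFinset, List.mem_map]
  exact ⟨_, List.getElem_mem h, rfl⟩

theorem AtomsTo.step (hc : c.OK) {L : StructListing} (hL : L.Presents φ.signature A)
    (hI : Inp φ L c M) {n : ℕ} (h : AtomsTo φ A c M M' n) (hn : n < φ.atoms.length) {η : ℕ → ℕ}
    (h7 : η 7 = n) : AtomsTo φ A c M (atom.den c η M') (n + 1) := by
  have hI' : Inp φ L c M' := hI.congr (h.same _ (by decide)) (h.same _ (by decide))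
    (h.same _ (by decide)) (h.same _ (by decide))
  obtain ⟨M₄, e, f, G, hG, hG', hGs, hrow, hsol⟩ := atom_rows hc hL hI' h.inv.tab hn h7
  have hfam : fam c M₄ = fam c M' := fam_congr (f _ (by decide)) (f _ (by decide)) (f _ (by decide))
  have hinv : Inv φ A c M₄ := h.inv.congr (f _ (by decide)) (f _ (by decide)) (f _ (by decide))
    (f _ (by decide)) (f _ (by decide)) (f _ (by decide))
  have hvars : fs c.X G ⊆ φ.vars := by
    rw [hGs]
    exact fun x hx => mem_biUnion.2 ⟨_, mem_conj hn, hx⟩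
  have hholds : ∀ i < c.D, Xa M₄ i →
      (Atom.mk (.base φ.atoms[n].1 φ.atoms[n].2.length) φ.atoms[n].2).Holds A (xrow c M₄ i) :=
    fun i hi hx => (hrow i hi hx).2
  have hnew : NewRows φ A c M₄ G := ⟨hG, hG', hvars, fun i hi hx => ⟨(hrow i hi hx).1, by
    intro x a hxa
    refine (hholds i hi hx).mem x ?_ a hxa
    have := ((hrow i hi hx).1 x).1 (by rw [hxa]; rfl)
    rwa [hGs] at this⟩⟩
  obtain ⟨hadd, hinv'⟩ := addlist_spec hc hinv hnew η
  rw [← e] at hadd hinv'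
  have hb : (fam c (atom.den c η M')).Below (fam c M') := hfam ▸ hadd.below
  refine ⟨fun a ha => ?_, hinv', ?_, fun i hi hin => ?_⟩
  · rw [den_frame _ _ _ ha, h.same a ha]
  · rw [hadd.sol_eq, hfam, h.sol]
    rw [hfam]
    rintro g ⟨hg, -⟩
    obtain ⟨t, ht, hgt⟩ := hg.2 _ (mem_conj hn)
    obtain ⟨i, hi, hx, hx'⟩ := hsol g t ht hgt
    exact ⟨i, hi, hx, hx'⟩
  · rcases Nat.lt_succ_iff_lt_or_eq.1 hin with hlt | rfl
    · obtain ⟨h1, h2⟩ := h.atoms i hi hlt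
      exact ⟨hb.sets h1, fun g hg => h2 g (hb.rel _ h1 hg)⟩
    · rw [← hGs]
      refine ⟨hadd.mem_sets' hG, fun g hg => ?_⟩
      obtain ⟨-, j, hj, hx, rfl⟩ := (hadd.rel_sub G hG (Subset.refl _) g).1 hg
      rw [PMap.proj_self (hrow j hj hx).1]
      exact hholds j hj hx

theorem atoms_spec (hc : c.OK) {L : StructListing} (hL : L.Presents φ.signature A)
    (hI : Inp φ L c M) (h : Inv φ A c M) (η : ℕ → ℕ) :
    Inv φ A c (atoms.den c η M) ∧ (fam c (atoms.den c η M)).Atoms φ A ∧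
      (fam c (atoms.den c η M)).sol φ A = (fam c M).sol φ A := by
  have key := den_loop_inv (c := c) (x := 7) (b := .X) (p := whenS (ltE (.v 7) (reg aQ)) atom)
    (η := η) (M := M) (fun n M' => AtomsTo φ A c M M' n)
    ⟨fun _ _ => rfl, h, rfl, fun i _ hi => absurd hi (by omega)⟩ ?_
  · refine ⟨key.inv, fun α hα => ?_, key.sol⟩
    simp only [QFCQ.conj, List.mem_toFinset, List.mem_map] at hα
    obtain ⟨p, hp, rfl⟩ := hα
    obtain ⟨i, hi, rfl⟩ := List.getElem_of_mem hp
    exact key.atoms i hi (lt_of_lt_of_le hi hI.num_le)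
  · intro n hn M' hM'
    rw [den_whenS]
    have hcond : 0 < (ltE (.v 7) (reg aQ)).ev c M' (Function.update η 7 n) ↔
        n < φ.atoms.length := by
      rw [pos_ltE, ← hI.num, ← hM'.same aQ (by decide)]
      simp [ev, reg, cut]
    by_cases h' : n < φ.atoms.length
    · rw [if_pos (hcond.2 h')]
      exact hM'.step hc hL hI h' (by simp)
    · rw [if_neg fun h'' => h' (hcond.1 h'')]
      exact ⟨hM'.same, hM'.inv, hM'.sol, fun i hi _ => hM'.atoms i hi (by omega)⟩

/-- The memory in which the family is empty. -/
theorem Inv.zero (ht : Tab c M) (h1 : ∀ s < c.E, M aIN s 0 0 = 0)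
    (h2 : ∀ s < c.E, ∀ i < c.D, M aAL s 0 i = 0) :
    Inv φ A c M ∧ (fam c M).sol φ A = evalConj φ.conj A := by
  have hs : ∀ S, S ∉ (fam c M).sets := fun S hS => by
    obtain ⟨s, hs, hi, -⟩ := exists_of_mem_sets hS
    rw [In, h1 s hs] at hi
    exact lt_irrefl _ hi
  have ha : ∀ s < c.E, ∀ i < c.D, ¬ Al M s i := fun s hs i hi ha => by
    rw [Al, h2 s hs i hi] at ha
    exact lt_irrefl _ ha
  refine ⟨⟨ht, ⟨fun S hS => absurd hS (hs S), fun S hS => absurd hS (hs S),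
    fun S hS => absurd hS (hs S)⟩, fun s hs i hi h => absurd h (ha s hs i hi),
    fun s hs i hi _ _ h => absurd h (ha s hs i hi)⟩, ?_⟩
  ext g
  exact ⟨fun h => h.1, fun h => ⟨h, fun S hS => absurd hS (hs S)⟩⟩

end Pr

end

section

open Finset

namespace Pr

open EX Stm

variable {φ : QFCQ} {A : Struct} {c : Cst} {M M' : Mem} {r ε : ℝ}

/-! ### The list that represents a family -/

theorem varTuple_fs (X s : ℕ) : varTuple (fs X s) = (List.range X).filter fun k => s.testBit k := by
  have hn : ((List.range X).filter fun k => s.testBit k).Nodup := List.nodup_range.filter _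
  have : fs X s = ((List.range X).filter fun k => s.testBit k).toFinset := by
    ext k
    simp [mem_fs]
  rw [varTuple, this, List.toFinset_sort _ hn]
  exact List.Pairwise.filter _ (List.pairwise_lt_range.imp fun h => h.le)

theorem varTuple_toFinset (S : Finset ℕ) : (varTuple S).toFinset = S := sort_toFinset S _

theorem varTuple_inj {S T : Finset ℕ} (h : varTuple S = varTuple T) : S = T := by
  rw [← varTuple_toFinset S, h, varTuple_toFinset]

def relList (c : Cst) (M : Mem) (s : ℕ) : List (List ℕ) :=
  ((List.range c.D).filter fun i => 0 < M aAL s 0 i).map fun i =>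
    (varTuple (fs c.X s)).map fun k => M aDT s k i - 1

def famList (c : Cst) (M : Mem) : List (List ℕ × List (List ℕ)) :=
  ((List.range c.E).filter fun s => 0 < M aIN s 0 0).map fun s =>
    (varTuple (fs c.X s), relList c M s)

theorem famList_congr (h1 : M' aIN = M aIN) (h2 : M' aAL = M aAL) (h3 : M' aDT = M aDT) :
    famList c M' = famList c M := by
  simp only [famList, relList, h1, h2, h3]

theorem getD_dec (n : ℕ) : (dec n).getD 0 = n - 1 := by cases n <;> rfl

theorem listing_famList (h : Inv φ A c M) (hA : A.IsOver φ.signature) :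
    RefinementListing (famList c M) ((fam c M).ref h.wf hA) := by
  refine ⟨?_, ?_, ?_⟩
  · rw [famList, List.map_map]
    refine List.Nodup.map_on ?_ (List.nodup_range.filter _)
    intro s hs t ht e
    simp only [List.mem_filter, List.mem_range] at hs ht
    exact fs_inj hs.1 ht.1 (varTuple_inj e)
  · ext l
    simp only [famList, List.map_map, List.mem_toFinset, List.mem_map, List.mem_filter,
      List.mem_range, decide_eq_true_eq, Function.comp_apply, mem_image]
    constructor
    · rintro ⟨s, ⟨hs, hi⟩, rfl⟩
      exact ⟨_, (mem_sets hs).2 hi, rfl⟩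
    · rintro ⟨S, hS, rfl⟩
      obtain ⟨s, hs, hi, rfl⟩ := exists_of_mem_sets hS
      exact ⟨s, ⟨hs, hi⟩, rfl⟩
  · intro p hp
    simp only [famList, List.mem_map, List.mem_filter, List.mem_range, decide_eq_true_eq] at hp
    obtain ⟨s, ⟨hs, hi⟩, rfl⟩ := hp
    have hrow : ∀ i, (varTuple (fs c.X s)).map (fun k => M aDT s k i - 1) =
        (varTuple (fs c.X s)).map fun k => (row c M s i k).getD 0 := by
      intro i
      refine List.map_congr_left fun k hk => ?_
      rw [← List.mem_toFinset, varTuple_toFinset] at hk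
      simp only [row, (mem_fs.1 hk).1, if_true, getD_dec]
    constructor
    · refine List.Nodup.map_on ?_ (List.nodup_range.filter _)
      intro i hi j hj e
      simp only [List.mem_filter, List.mem_range, decide_eq_true_eq] at hi hj
      refine h.inj s hs i hi.1 j hj.1 hi.2 hj.2 ?_
      rw [hrow, hrow, List.map_inj_left] at e
      have d1 := h.hasDom hs hi.1 hi.2
      have d2 := h.hasDom hs hj.1 hj.2
      refine d1.ext d2 fun x hx => ?_
      have := e x (by rwa [← List.mem_toFinset, varTuple_toFinset])
      obtain ⟨a, ha⟩ := Option.isSome_iff_exists.1 ((d1 x).2 hx)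
      obtain ⟨b, hb⟩ := Option.isSome_iff_exists.1 ((d2 x).2 hx)
      rw [ha, hb] at this ⊢
      exact congrArg some this
    · have hS := (mem_sets (c := c) hs).2 hi
      ext t
      have e : ((fam c M).ref h.wf hA).str = (fam c M).str h.wf := rfl
      simp only [e, Fam.str, varTuple_toFinset, dif_pos hS, relList, List.mem_toFinset,
        List.mem_map, List.mem_filter, List.mem_range, decide_eq_true_eq, mem_image,
        Set.Finite.mem_toFinset, mem_rel hs]
      constructor
      · rintro ⟨i, ⟨hi, ha⟩, rfl⟩
        exact ⟨_, ⟨i, hi, ha, rfl⟩, (hrow i).symm⟩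
      · rintro ⟨_, ⟨i, hi, ha, rfl⟩, rfl⟩
        exact ⟨i, ⟨hi, ha⟩, hrow i⟩

/-! ### Output statements -/

/-- The list `l` has been output; a part that is too long is ignored. -/
structure Em (c : Cst) (M : Mem) (l : List ℕ) : Prop where
  op : M aOP 0 0 0 = l.length + 1
  out : ∀ i (h : i < l.length), i + 1 < c.LIM → M aOUT 0 0 (i + 1) = l[i]

/-- The list `l` is output between the memories `M` and `M'`. -/
structure Emits (c : Cst) (M M' : Mem) (l : List ℕ) : Prop where
  same : ∀ a, a ∉ [aOUT, aOP] → M' a = M a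
  em : ∀ l₀, Em c M l₀ → Em c M' (l₀ ++ l)

theorem Emits.refl (c : Cst) (M : Mem) : Emits c M M [] := ⟨fun _ _ => rfl, fun l h => by simpa⟩

theorem Emits.trans {M'' : Mem} {l l' : List ℕ} (h : Emits c M M' l) (h' : Emits c M' M'' l') :
    Emits c M M'' (l ++ l') :=
  ⟨fun a ha => (h'.same a ha).trans (h.same a ha), fun l₀ hl => by
    rw [← List.append_assoc]; exact h'.em _ (h.em _ hl)⟩

theorem emits_emit {η : ℕ → ℕ} (e : EX) :
    Emits c M ((emit e).den c η M) [e.ev c M η] := by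
  refine ⟨fun a ha => den_frame _ _ _ (by
    simp only [List.mem_cons, List.not_mem_nil, or_false, not_or] at ha
    simp [emit, blk, setR, writes, ha.1, ha.2]), fun l hl => ?_⟩
  have e2 : ∀ i, (emit e).den c η M aOUT 0 0 i =
      if i = min (l.length + 1) c.LIM then e.ev c M η else M aOUT 0 0 i := by
    intro i
    simp [emit, blk, setR, den, wr, ev, cut, reg, hl.op]
  refine ⟨?_, fun i hi hL => ?_⟩
  · simp [emit, blk, setR, den, wr, ev, cut, reg, hl.op]
  · rw [e2]
    simp only [List.length_append, List.length_singleton] at hi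
    rcases Nat.lt_succ_iff_lt_or_eq.1 hi with h | rfl
    · rw [if_neg (by omega), List.getElem_append_left h]
      exact hl.out i h hL
    · rw [if_pos (by omega)]
      simp

theorem emits_loop {x : ℕ} {b : Bd} {p : Stm} {η : ℕ → ℕ} {f : ℕ → List ℕ}
    (h : ∀ i < b.val c, ∀ M', (∀ a, a ∉ [aOUT, aOP] → M' a = M a) →
      Emits c M' (p.den c (Function.update η x i) M') (f i)) :
    Emits c M ((loop x b p).den c η M) ((List.range (b.val c)).flatMap f) := by
  refine den_loop_inv (fun n M' => Emits c M M' ((List.range n).flatMap f)) (Emits.refl c M) ?_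
  intro i hi M' hM'
  rw [List.range_succ, List.flatMap_append]
  refine hM'.trans ?_
  simpa using h i hi M' hM'.same

theorem flatMap_filter {α β : Type*} (l : List α) (p : α → Bool) (f : α → List β) :
    (l.filter p).flatMap f = l.flatMap fun x => if p x then f x else [] := by
  induction l with
  | nil => rfl
  | cons a l ih =>
    rw [List.filter_cons, List.flatMap_cons, ← ih]
    split_ifs <;> simp

theorem sum_flag (n : ℕ) (p : ℕ → Prop) [DecidablePred p] :
    (∑ i ∈ range n, if p i then 1 else 0) = ((List.range n).filter fun i => p i).length := by
  induction n with
  | zero => rfl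
  | succ n ih =>
    rw [sum_range_succ, ih, List.range_succ, List.filter_append, List.length_append]
    congr 1
    by_cases h : p n <;> simp [h]

theorem emits_tuple (hc : c.OK) (ht : Tab c M) {η : ℕ → ℕ} {s : ℕ} (hs : s < c.E) (h7 : η 7 = s)
    {e : EX} {f : ℕ → ℕ} (he : ∀ k < c.X, ∀ M' : Mem, (∀ a, a ∉ [aOUT, aOP] → M' a = M a) →
      e.ev c M' (Function.update η 11 k) = f k) :
    Emits c M ((emitTuple e).den c η M) (serTuple ((varTuple (fs c.X s)).map f)) := by
  have hbit : ∀ k < c.X, ∀ M' : Mem, (∀ a, a ∉ [aOUT, aOP] → M' a = M a) →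
      (0 < M' aMEM s k 0 ↔ s.testBit k = true) := fun k hk M' hM' => by
    rw [hM' _ (by decide)]
    exact ht.bit s (hc.E_lt hs).1 k (hc.X_lt hk).1
  have h1 := emits_emit (c := c) (M := M) (η := η) (.sum 12 .X (flag (mem (.v 7) (.v 12))))
  have e1 : (EX.sum 12 .X (flag (mem (.v 7) (.v 12)))).ev c M η = (varTuple (fs c.X s)).length := by
    have hf := sum_flag c.X fun k => s.testBit k = true
    simp only [Bool.decide_eq_true] at hf
    rw [varTuple_fs, ← hf]
    simp only [ev, ev_flag, Bd.val]
    refine sum_congr rfl fun k hk => ?_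
    refine if_congr ?_ rfl rfl
    rw [← hbit k (mem_range.1 hk) M fun _ _ => rfl]
    simp [mem, two, ev, cut, h7]
  rw [e1] at h1
  have h2 := emits_loop (c := c) (x := 11) (b := .X) (p := whenS (mem (.v 7) (.v 11)) (emit e))
    (η := η) (M := (emit (.sum 12 .X (flag (mem (.v 7) (.v 12))))).den c η M)
    (f := fun k => if s.testBit k then [f k] else []) ?_
  · have e3 : serTuple ((varTuple (fs c.X s)).map f) = [(varTuple (fs c.X s)).length] ++
        (List.range c.X).flatMap fun k => if s.testBit k then [f k] else [] := by
      rw [← flatMap_filter (List.range c.X) (fun k => s.testBit k) fun k => [f k], ← varTuple_fs,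
        serTuple, List.length_map, List.map_eq_flatMap]
      rfl
    rw [e3]
    exact h1.trans h2
  · intro k hk M' hM'
    have hM'' : ∀ a, a ∉ [aOUT, aOP] → M' a = M a := fun a ha => (hM' a ha).trans (h1.same a ha)
    rw [den_whenS]
    have hb := hbit k hk M' hM''
    have e4 : (mem (.v 7) (.v 11)).ev c M' (Function.update η 11 k) = M' aMEM s k 0 := by
      simp [mem, two, ev, cut, h7]
    rw [e4]
    by_cases hk' : s.testBit k = true
    · rw [if_pos (hb.2 hk'), if_pos hk', ← he k hk M' hM'']
      exact emits_emit e
    · rw [if_neg fun h => hk' (hb.1 h), if_neg hk']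
      exact Emits.refl _ _

theorem emits_fam (hc : c.OK) (ht : Tab c M) (η : ℕ → ℕ) :
    Emits c M (emitFam.den c η M)
      (serList (fun p => serTuple p.1 ++ serList serTuple p.2) (famList c M)) := by
  have h1 := emits_emit (c := c) (M := M) (η := η) (.sum 12 .E (flag (fst aIN (.v 12))))
  set M₁ := (emit (.sum 12 .E (flag (fst aIN (.v 12))))).den c η M with hM₁
  have e1 : (EX.sum 12 .E (flag (fst aIN (.v 12)))).ev c M η = (famList c M).length := by
    rw [famList, List.length_map, ← sum_flag c.E fun s => 0 < M aIN s 0 0]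
    simp only [ev, ev_flag, Bd.val]
    refine sum_congr rfl fun k hk => ?_
    simp [fst, ev, cut]
  rw [e1] at h1
  have e2 : serList (fun p => serTuple p.1 ++ serList serTuple p.2) (famList c M) =
      [(famList c M).length] ++ (List.range c.E).flatMap fun s => if 0 < M aIN s 0 0 then
        serTuple (varTuple (fs c.X s)) ++ ([(relList c M s).length] ++
          (List.range c.D).flatMap fun i => if 0 < M aAL s 0 i then
            serTuple ((varTuple (fs c.X s)).map fun k => M aDT s k i - 1) else []) else [] := by
    rw [serList, famList, List.flatMap_map]
    have := flatMap_filter (List.range c.E) (fun s => decide (0 < M aIN s 0 0))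
      fun s => serTuple (varTuple (fs c.X s)) ++ serList serTuple (relList c M s)
    simp only [decide_eq_true_eq] at this
    rw [this, List.singleton_append]
    congr 2
    funext s
    have := flatMap_filter (List.range c.D) (fun i => decide (0 < M aAL s 0 i))
      fun i => serTuple ((varTuple (fs c.X s)).map fun k => M aDT s k i - 1)
    simp only [decide_eq_true_eq] at this
    rw [← this, serList, relList, List.flatMap_map]
    rfl
  rw [e2]
  refine h1.trans (emits_loop (x := 7) (b := .E) fun s hs M' hM' => ?_)
  have hM : ∀ a, a ∉ [aOUT, aOP] → M' a = M a := fun a ha => (hM' a ha).trans (h1.same a ha)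
  set η' := Function.update η 7 s with hη'
  have h7 : η' 7 = s := by simp [hη']
  have hs : s < c.E := hs
  have htab : ∀ N : Mem, (∀ a, a ∉ [aOUT, aOP] → N a = M a) → Tab c N := fun N hN =>
    ht.congr (hN _ (by decide)) (hN _ (by decide)) (hN _ (by decide))
  rw [den_whenS]
  have e3 : (fst aIN (.v 7)).ev c M' η' = M aIN s 0 0 := by
    simp [fst, ev, cut, h7, hM]
  rw [e3]
  split_ifs with hin
  swap
  · exact Emits.refl _ _
  have k1 := emits_tuple hc (htab M' hM) hs h7 (e := .v 11) (f := id)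
    fun k _ N _ => by simp [ev]
  rw [List.map_id] at k1
  refine k1.trans ?_
  set M₂ := (emitTuple (.v 11)).den c η' M' with hM₂
  have hM2 : ∀ a, a ∉ [aOUT, aOP] → M₂ a = M a := fun a ha => (k1.same a ha).trans (hM a ha)
  have k2 := emits_emit (c := c) (M := M₂) (η := η') (cardE (.v 7))
  have e4 : (cardE (.v 7)).ev c M₂ η' = (relList c M s).length := by
    rw [relList, List.length_map, ← sum_flag c.D fun i => 0 < M aAL s 0 i]
    simp only [cardE, ev, ev_flag, Bd.val]
    refine sum_congr rfl fun k hk => ?_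
    simp [fl2, ev, cut, h7, hM2]
  rw [e4] at k2
  refine k2.trans (?_ : Emits c _ (den c η' (seq (loop 22 .D _) skip) _) _)
  refine emits_loop (x := 22) (b := .D) fun i hi N hN => ?_
  have hN' : ∀ a, a ∉ [aOUT, aOP] → N a = M a := fun a ha =>
    (hN a ha).trans ((k2.same a ha).trans (hM2 a ha))
  rw [den_whenS]
  have e5 : (fl2 aAL (.v 7) (.v 22)).ev c N (Function.update η' 22 i) = M aAL s 0 i := by
    simp [fl2, ev, cut, h7, hN']
  rw [e5]
  split_ifs with hal
  · refine emits_tuple hc (htab N hN') hs (by simp [h7]) fun k _ N' hN'' => ?_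
    have : N' aDT = M aDT := (hN'' _ (by decide)).trans (hN' _ (by decide))
    simp [ev, cut, h7, this]
  · exact Emits.refl _ _

end Pr

end

section

open Finset

namespace Pr

open EX Stm

variable {φ : QFCQ} {A : Struct} {c : Cst} {M M' : Mem} {r ε : ℝ}

/-! ### The branches -/

theorem zeros_spec (l : List ℕ) (η : ℕ → ℕ) (M : Mem) (a p q k : ℕ) :
    (blk (l.map fun a => asg a .PP .PP .LL (.c 0))).den c η M a p q k =
      if a ∈ l ∧ p ≤ c.P ∧ q ≤ c.P ∧ k ≤ c.LIM then 0 else M a p q k := by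
  induction l generalizing M with
  | nil => simp [blk, den]
  | cons b l ih =>
    rw [List.map_cons, blk, den, ih, den_asg rfl]
    by_cases h : a ∈ l ∧ p ≤ c.P ∧ q ≤ c.P ∧ k ≤ c.LIM
    · rw [if_pos h, if_pos ⟨List.mem_cons_of_mem _ h.1, h.2⟩]
    · rw [if_neg h]
      simp only [setA, ev, Bd.val, Nat.lt_succ_iff]
      refine if_congr ?_ rfl rfl
      rw [List.mem_cons]
      tauto

/-- The memory of a branch before the first time step. -/
noncomputable def start (c : Cst) (M : Mem) : Mem := atoms.den c 0 (zero.den c 0 M)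

/-- The memory of branch number `b` after the last time step. -/
noncomputable def final (c : Cst) (M : Mem) (b : ℕ) : Mem :=
  runBits (tick c) (start c M) b.testBit c.TK

def Alive (c : Cst) (M : Mem) : Prop := ∃ i < c.D, 0 < M aAL 0 0 i

/-- The arrays that matter in a branch are as in `M`. -/
def Ready (c : Cst) (M M' : Mem) : Prop :=
  ∀ a, a ∉ [aOUT, aOP, aLC] → zero.den c 0 M' a = zero.den c 0 M a

theorem Ready.of_outside (h : Ready c M M') {M'' : Mem}
    (h1 : ∀ a, a ∉ branchArrays → a ∉ [aOUT, aOP, aLC] → M'' a = M' a)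
    (h2 : ∀ a p q k, ¬ (p ≤ c.P ∧ q ≤ c.P ∧ k ≤ c.LIM) → M'' a p q k = M' a p q k) :
    Ready c M M'' := by
  intro a ha
  rw [← h a ha]
  funext p q k
  rw [zero, zeros_spec, zeros_spec]
  by_cases hb : a ∈ branchArrays
  · by_cases hr : p ≤ c.P ∧ q ≤ c.P ∧ k ≤ c.LIM
    · rw [if_pos ⟨hb, hr⟩, if_pos ⟨hb, hr⟩]
    · rw [h2 a p q k hr]
  · rw [h1 a hb ha]

theorem ticks_spec (hst : ∀ n b, Tab c (runBits (tick c) (start c M) (Nat.testBit b) n))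
    {η : ℕ → ℕ} {b : ℕ} (hb : b < c.NB) (h5 : η 5 = b)
    (h : ∀ a, a ∉ [aOUT, aOP, aLC] → M' a = start c M a) :
    ∀ a, a ∉ [aOUT, aOP, aLC] → ticks.den c η M' a = final c M b a := by
  refine den_loop_inv (b := .TK) (fun n N => ∀ a, a ∉ [aOUT, aOP, aLC] →
    N a = runBits (tick c) (start c M) b.testBit n a) h fun i hi N hN => ?_
  have hi : i < c.TK := hi
  simp only [blk, den, runBits]
  set R := runBits (tick c) (start c M) b.testBit i with hR
  set η' := Function.update η 6 i with hη'
  have h1 : ∀ a, a ∉ [aOUT, aOP, aLC] → tickA.den c η' N a = tickA.den c 0 R a := by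
    rw [den_env tickA (Γ := []) (η := η') (η' := 0) (by decide +kernel) (by simp)]
    exact den_congr _ _ _ _ (by decide +kernel) hN
  have hbit : (flag (mem (.v 5) (.v 6))).ev c (tickA.den c η' N) η' = (b.testBit i).toNat := by
    have e1 : (mem (.v 5) (.v 6)).ev c (tickA.den c η' N) η' = R aMEM b i 0 := by
      have : tickA.den c η' N aMEM = R aMEM := by
        rw [h1 _ (by decide), den_frame _ _ _ (by decide)]
      rw [← this]
      simp [mem, two, ev, cut, hη', h5]
    rw [ev_flag, e1]
    have := (hst i b).bit b hb i hi
    cases hb : b.testBit i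
    · rw [hb] at this
      rw [if_neg (by rw [this]; simp)]; rfl
    · rw [hb] at this
      rw [if_pos (by rw [this])]; rfl
  have h2 : (setR aBT (flag (mem (.v 5) (.v 6)))).den c η' (tickA.den c η' N) =
      wr (tickA.den c η' N) aBT 0 0 0 (b.testBit i).toNat := by
    rw [← hbit]
    simp [setR, den, ev, cut]
  rw [h2, tick, den_env tickB (Γ := []) (η := η') (η' := 0) (by decide +kernel) (by simp)]
  refine den_congr _ _ _ _ (by decide +kernel) fun a ha => ?_
  by_cases haB : a = aBT
  · rw [haB]
    funext p q k
    simp only [wr]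
    rw [h1 _ (by decide)]
  · rw [wr_ne _ _ _ _ haB, wr_ne _ _ _ _ haB, h1 a ha]

/-- The output for a family. -/
def serFam (d : List (List ℕ × List (List ℕ))) : List ℕ :=
  serList (fun p => serTuple p.1 ++ serList serTuple p.2) d

open Classical in
theorem branch_spec (hc : c.OK) (hst : ∀ n b, Tab c (runBits (tick c) (start c M) (Nat.testBit b) n))
    {η : ℕ → ℕ} {b : ℕ} (hb : b < c.NB) (h5 : η 5 = b) (h : Ready c M M') :
    Ready c M (branch.den c η M') ∧
    branch.den c η M' aLC 0 0 0 = M' aLC 0 0 0 + (if Alive c (final c M b) then 1 else 0) ∧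
    ∀ l, Em c M' l → Em c (branch.den c η M')
      (l ++ if Alive c (final c M b) then serFam (famList c (final c M b)) else []) := by
  constructor
  · refine h.of_outside (fun a h1 h2 => den_frame _ _ _ fun h3 => ?_) fun a p q k hr => ?_
    · have : ∀ a ∈ branch.writes, a ∈ branchArrays ∨ a ∈ [aOUT, aOP, aLC] := by decide +kernel
      exact (this a h3).elim h1 h2
    · have hle := c.le_LIM
      refine den_outside hc branch (Γ := [5]) hr M' (by decide +kernel) fun x hx => ?_
      rw [List.mem_singleton.1 hx, h5]
      have : c.P = c.NB := rfl
      omega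
  simp only [branch, blk, den]
  set M₁ := zero.den c η M' with hM₁
  set M₂ := atoms.den c η M₁ with hM₂
  set M₃ := ticks.den c η M₂ with hM₃
  have h1 : ∀ a, a ∉ [aOUT, aOP, aLC] → M₁ a = zero.den c 0 M a := by
    rw [hM₁, den_env zero (Γ := []) (η := η) (η' := 0) (by decide +kernel) (by simp)]
    exact h
  have h2 : ∀ a, a ∉ [aOUT, aOP, aLC] → M₂ a = start c M a := by
    rw [hM₂, den_env atoms (Γ := []) (η := η) (η' := 0) (by decide +kernel) (by simp)]
    exact den_congr _ _ _ _ (by decide +kernel) h1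
  have h3 := ticks_spec hst hb h5 h2
  rw [← hM₃] at h3
  have h4 : ∀ a ∈ [aOUT, aOP, aLC], M₃ a = M' a := by
    intro a ha
    have e : ∀ p ∈ [zero, atoms, ticks], ∀ a ∈ [aOUT, aOP, aLC], a ∉ p.writes := by
      decide +kernel
    rw [hM₃, den_frame _ _ _ (e _ (by simp) a ha), hM₂, den_frame _ _ _ (e _ (by simp) a ha), hM₁,
      den_frame _ _ _ (e _ (by simp) a ha)]
  have hcond : 0 < (exE 21 .D (flat aAL (.v 21))).ev c M₃ η ↔ Alive c (final c M b) := by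
    rw [pos_exE, Alive, ← h3 _ (by decide)]
    refine exists_congr fun i => and_congr_right fun _ => ?_
    simp [flat, ev, cut]
  rw [den_whenS]
  by_cases ha : Alive c (final c M b)
  · rw [if_pos (hcond.2 ha), if_pos ha, if_pos ha]
    simp only [den]
    set M₄ := (setR aLC (.add (reg aLC) (.c 1))).den c η M₃ with hM₄
    have h5 : ∀ a, a ≠ aLC → M₄ a = M₃ a := fun a ha => den_frame _ _ _ (by simp [setR, writes, ha])
    have htab : Tab c M₄ := (hst c.TK b).congr (by rw [h5 _ (by decide), h3 _ (by decide)]; rfl)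
      (by rw [h5 _ (by decide), h3 _ (by decide)]; rfl)
      (by rw [h5 _ (by decide), h3 _ (by decide)]; rfl)
    have hE := emits_fam hc htab η
    have hf : famList c M₄ = famList c (final c M b) := by
      refine famList_congr ?_ ?_ ?_ <;> rw [h5 _ (by decide), h3 _ (by decide)]
    rw [hf] at hE
    refine ⟨?_, fun l hl => hE.em l ⟨?_, ?_⟩⟩
    · rw [hE.same _ (by decide), hM₄]
      simp [setR, den, wr, ev, cut, reg, h4]
    · rw [h5 _ (by decide), h4 _ (by simp), hl.op]
    · rw [h5 _ (by decide), h4 _ (by simp)]; exact hl.out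
  · rw [if_neg fun h => ha (hcond.1 h), if_neg ha, if_neg ha]
    simp only [List.append_nil, Nat.add_zero]
    refine ⟨by rw [h4 _ (by simp)], fun l hl => ⟨?_, ?_⟩⟩
    · rw [h4 _ (by simp), hl.op]
    · rw [h4 _ (by simp)]; exact hl.out

open Classical in
theorem branches_spec (hc : c.OK)
    (hst : ∀ n b, Tab c (runBits (tick c) (start c M) (Nat.testBit b) n)) {η : ℕ → ℕ}
    (h : Ready c M M') (hLC : M' aLC 0 0 0 = 0) (hem : Em c M' []) :
    (loop 5 .NB branch).den c η M' aLC 0 0 0 =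
      ((List.range c.NB).filter fun b => Alive c (final c M b)).length ∧
    Em c ((loop 5 .NB branch).den c η M')
      (((List.range c.NB).filter fun b => Alive c (final c M b)).flatMap fun b =>
        serFam (famList c (final c M b))) := by
  have := den_loop_inv (c := c) (x := 5) (b := .NB) (p := branch) (η := η) (M := M')
    (fun n N => Ready c M N ∧
      N aLC 0 0 0 = ((List.range n).filter fun b => Alive c (final c M b)).length ∧
      Em c N (((List.range n).filter fun b => Alive c (final c M b)).flatMap fun b =>
        serFam (famList c (final c M b)))) ⟨h, hLC, hem⟩ ?_
  · exact this.2
  · rintro n hn N ⟨h1, h2, h3⟩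
    obtain ⟨k1, k2, k3⟩ := branch_spec hc hst (η := Function.update η 5 n) hn (by simp) h1
    refine ⟨k1, ?_, ?_⟩
    · rw [k2, h2, List.range_succ, List.filter_append, List.length_append]
      congr 1
      by_cases ha : Alive c (final c M n) <;> simp [ha]
    · have := k3 _ h3
      rw [List.range_succ, List.filter_append, List.flatMap_append]
      convert this using 2
      by_cases ha : Alive c (final c M n) <;> simp [ha]

theorem length_flatMap_le {α β : Type*} {l : List α} {f : α → List β} {n k : ℕ} (hl : l.length ≤ n)
    (h : ∀ x ∈ l, (f x).length ≤ k) : (l.flatMap f).length ≤ n * k := by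
  refine le_trans ?_ (Nat.mul_le_mul_right k hl)
  clear hl
  induction l with
  | nil => simp
  | cons a l ih =>
    have := h a List.mem_cons_self
    have := ih fun x hx => h x (List.mem_cons_of_mem _ hx)
    rw [List.flatMap_cons, List.length_append, List.length_cons, add_mul]
    omega

theorem length_filter_range_le (n : ℕ) (p : ℕ → Bool) : ((List.range n).filter p).length ≤ n :=
  (List.length_filter_le _ _).trans (by simp)

theorem length_varTuple_fs (X s : ℕ) : (varTuple (fs X s)).length ≤ X := by
  rw [varTuple_fs]; exact length_filter_range_le _ _

theorem length_serFam (c : Cst) (M : Mem) :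
    (serFam (famList c M)).length ≤ c.E * (1 + c.X + (1 + c.D * (1 + c.X))) + 1 := by
  rw [serFam, serList, List.length_cons, famList, List.flatMap_map, add_le_add_iff_right]
  refine length_flatMap_le (length_filter_range_le _ _) fun s _ => ?_
  have h0 := length_varTuple_fs c.X s
  rw [List.length_append, serTuple, serList, List.length_cons, List.length_cons, relList,
    List.flatMap_map]
  have h2 := length_flatMap_le (l := (List.range c.D).filter fun i => 0 < M aAL s 0 i)
    (f := fun i => serTuple ((varTuple (fs c.X s)).map fun k => M aDT s k i - 1)) (k := 1 + c.X)
    (length_filter_range_le _ _) (fun i _ => by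
      rw [serTuple, List.length_cons, List.length_map]; omega)
  dsimp only
  omega

theorem output_le_LIM (hT : 2 * c.X + 3 ≤ c.TK) :
    1 + c.NB * (c.E * (1 + c.X + (1 + c.D * (1 + c.X))) + 1) ≤ c.LIM := by
  have h1 : c.E * (c.X + 2) * 4 ≤ c.NB := by
    have hx : c.X + 2 ≤ 2 ^ (c.X + 1) := by
      have := Nat.lt_two_pow_self (n := c.X)
      rw [pow_succ]
      have : 1 ≤ 2 ^ c.X := Nat.one_le_two_pow
      omega
    calc c.E * (c.X + 2) * 4 ≤ 2 ^ c.X * 2 ^ (c.X + 1) * 4 :=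
          Nat.mul_le_mul_right _ (Nat.mul_le_mul_left _ hx)
      _ = 2 ^ (2 * c.X + 3) := by rw [← pow_add, show (4 : ℕ) = 2 ^ 2 from rfl, ← pow_add]; congr 1; ring
      _ ≤ _ := Nat.pow_le_pow_right (by omega) hT
  have h8 : 8 ≤ c.NB := le_trans (by norm_num)
    (Nat.pow_le_pow_right (n := 2) (by omega) (show 3 ≤ c.TK by omega))
  have h2 : c.NB * c.NB ≤ 2 ^ c.NB := by
    unfold Cst.NB
    rw [← pow_add]
    refine Nat.pow_le_pow_right (by omega) ?_
    obtain ⟨k, hk⟩ : ∃ k, c.TK = k + 1 := ⟨c.TK - 1, by omega⟩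
    have := Nat.lt_two_pow_self (n := k)
    rw [hk, pow_succ]
    omega
  unfold Cst.LIM Cst.P
  refine le_trans ?_ (Nat.mul_le_mul_left _ h2)
  set u := c.E * (c.X + 2) with hu
  have h3 : c.E * (1 + c.X + (1 + c.D * (1 + c.X))) + 1 ≤ (c.D + 1) * (1 + u) := by
    have : c.E * (1 + c.X + (1 + c.D * (1 + c.X))) ≤ (c.D + 1) * u := by
      rw [hu, ← Nat.mul_assoc, Nat.mul_comm (c.D + 1), Nat.mul_assoc]
      refine Nat.mul_le_mul_left _ ?_
      nlinarith
    nlinarith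
  calc 1 + c.NB * (c.E * (1 + c.X + (1 + c.D * (1 + c.X))) + 1)
      ≤ (c.D + 1) * 1 + c.NB * ((c.D + 1) * (1 + u)) :=
        Nat.add_le_add (by omega) (Nat.mul_le_mul_left _ h3)
    _ = (c.D + 1) * (1 + c.NB * (1 + u)) := by ring
    _ ≤ _ := Nat.mul_le_mul_left _ (by nlinarith)

end Pr

end

section

open Finset

namespace Pr

open EX Stm

variable {φ : QFCQ} {A : Struct} {c : Cst} {M M' : Mem} {r ε : ℝ}

/-! ### The result of the program -/

theorem start_spec (hc : c.OK) {L : StructListing} (hL : L.Presents φ.signature A)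
    (hI : Inp φ L c M) (ht : Tab c M) (hm : M aM 0 0 0 = maxRelCard φ A) :
    State φ A c (start c M) ∧ (fam c (start c M)).sol φ A = evalConj φ.conj A := by
  have hz : ∀ a, a ∉ branchArrays → zero.den c 0 M a = M a := fun a ha => by
    funext p q k
    rw [zero, zeros_spec, if_neg fun h => ha h.1]
  have hz0 : ∀ a ∈ branchArrays, ∀ s < c.E, ∀ i ≤ c.LIM, zero.den c 0 M a s 0 i = 0 :=
    fun a ha s hs i hi => by
      rw [zero, zeros_spec, if_pos ⟨ha, (hc.E_lt hs).2, Nat.zero_le _, hi⟩]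
  have hD : ∀ i < c.D, i ≤ c.LIM := fun i hi => by
    have := hc.val_le' .D
    simp only [Bd.val] at this
    omega
  obtain ⟨h1, h2⟩ := Inv.zero (φ := φ) (A := A) (ht.congr (hz _ (by decide)) (hz _ (by decide)) (hz _ (by decide)))
    (fun s hs => hz0 _ (by decide) s hs 0 (Nat.zero_le _))
    (fun s hs i hi => hz0 _ (by decide) s hs i (hD i hi))
  have hI' : Inp φ L c (zero.den c 0 M) := hI.congr (hz _ (by decide)) (hz _ (by decide))
    (hz _ (by decide)) (hz _ (by decide))
  obtain ⟨h3, h4, h5⟩ := atoms_spec hc hL hI' h1 0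
  refine ⟨⟨h3, h4, ?_⟩, h5.trans h2⟩
  rw [start, den_frame _ _ _ (by decide +kernel), hz _ (by decide), hm]

theorem alive_iff : Alive c M ↔ ¬ (fam c M).Dead := by
  have h0 : fs c.X 0 = ∅ := by ext k; simp [mem_fs]
  have hE : 0 < c.E := Nat.two_pow_pos _
  rw [Fam.Dead, ← h0, ← Ne, ← Set.nonempty_iff_ne_empty]
  constructor
  · rintro ⟨i, hi, ha⟩
    exact ⟨_, (mem_rel hE).2 ⟨i, hi, ha, rfl⟩⟩
  · rintro ⟨g, hg⟩
    obtain ⟨i, hi, ha, -⟩ := (mem_rel hE).1 hg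
    exact ⟨i, hi, ha⟩

/-- The content of the output array, as computed from the branches. -/
theorem serOutput_eq (l : List ℕ) (f : ℕ → List (List ℕ × List (List ℕ))) :
    serOutput (l.map f) = l.length :: l.flatMap fun b => serFam (f b) := by
  rw [serOutput, serList, List.length_map, List.flatMap_map]
  rfl

open Classical in
theorem main_output (hc : c.OK) (hT : 2 * c.X + 3 ≤ c.TK) (hpw : ∀ k < c.TK, M aPW 0 0 k = 2 ^ k)
    (hLC : M aLC 0 0 0 = 0) {L : StructListing} (hI : Inp φ L c M)
    (hm : M aM 0 0 0 = maxRelCard φ A) :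
    ∃ N, Tab c N ∧ Inp φ L c N ∧ N aM 0 0 0 = maxRelCard φ A ∧
      ((∀ n b, Tab c (runBits (tick c) (start c N) (Nat.testBit b) n)) →
      ∀ i (h : i < (serOutput (((List.range c.NB).filter fun b => Alive c (final c N b)).map
        fun b => famList c (final c N b))).length), i ≤ c.LIM ∧
        main.den c 0 M aOUT 0 0 i = (serOutput (((List.range c.NB).filter fun b =>
          Alive c (final c N b)).map fun b => famList c (final c N b)))[i]) := by
  obtain ⟨h1, h2⟩ := tables_spec hc (M := M) 0 hpw
  set M₁ := tables.den c 0 M with hM₁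
  set M₂ := (setR aOP (.c 1)).den c 0 M₁ with hM₂
  have h3 : ∀ a, a ≠ aOP → M₂ a = M₁ a := fun a ha => den_frame _ _ _ (by simp [setR, writes, ha])
  have h4 : ∀ a, a ≠ aOP → a ≠ aMEM → a ≠ aCAP → a ≠ aCUP → M₂ a = M a := fun a ha hb hd he =>
    (h3 a ha).trans (h2 a hb hd he)
  refine ⟨M₂, h1.congr (h3 _ (by decide)) (h3 _ (by decide)) (h3 _ (by decide)),
    hI.congr (h4 _ (by decide) (by decide) (by decide) (by decide))
      (h4 _ (by decide) (by decide) (by decide) (by decide))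
      (h4 _ (by decide) (by decide) (by decide) (by decide))
      (h4 _ (by decide) (by decide) (by decide) (by decide)),
    by rw [h4 _ (by decide) (by decide) (by decide) (by decide), hm], fun hst => ?_⟩
  obtain ⟨k1, k2⟩ := branches_spec hc hst (η := 0) (M' := M₂) (fun _ _ => rfl)
    (by rw [h4 _ (by decide) (by decide) (by decide) (by decide), hLC])
    ⟨by simp [hM₂, setR, den, wr, ev, cut], fun i hi => absurd hi (by simp)⟩
  set M₃ := (loop 5 .NB branch).den c 0 M₂ with hM₃
  rw [serOutput_eq]
  have e : main.den c 0 M = wr M₃ aOUT 0 0 0 (M₃ aLC 0 0 0) := rfl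
  rw [e]
  intro i hi
  have hlen : (((List.range c.NB).filter fun b => Alive c (final c M₂ b)).flatMap fun b =>
      serFam (famList c (final c M₂ b))).length ≤
      c.NB * (c.E * (1 + c.X + (1 + c.D * (1 + c.X))) + 1) :=
    length_flatMap_le (length_filter_range_le _ _) fun b _ => length_serFam c _
  have hle := output_le_LIM hT
  rw [List.length_cons] at hi
  refine ⟨by omega, ?_⟩
  cases i with
  | zero => simp [wr, k1]
  | succ i =>
    rw [List.getElem_cons_succ, ← k2.out i (by omega) (by omega)]
    simp [wr]

theorem sol_run_subset (F : Fits φ A c r ε) (h : State φ A c M) (β : ℕ → Bool) (n : ℕ) :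
    (fam c (runBits (tick c) M β n)).sol φ A ⊆ (fam c M).sol φ A := by
  induction n with
  | zero => exact subset_rfl
  | succ n ih =>
    refine Set.Subset.trans ?_ ih
    rw [← (tick_sol F (h.run F β n)).1, runBits]
    cases β n
    · exact Set.subset_union_left
    · exact Set.subset_union_right

theorem main_spec (F : Fits φ A c r ε) (hT : 2 ^ (2 * c.X + 3 + ⌈r⌉₊ + ⌈1 / ε⌉₊) ≤ c.TK)
    (hA : A.IsOver φ.signature) (hpw : ∀ k < c.TK, M aPW 0 0 k = 2 ^ k) (hLC : M aLC 0 0 0 = 0)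
    {L : StructListing} (hL : L.Presents φ.signature A) (hI : Inp φ L c M)
    (hm : M aM 0 0 0 = maxRelCard φ A) :
    ∃ (D : List (List (List ℕ × List (List ℕ)))) (rs : List (Refinement φ A)),
      List.Forall₂ RefinementListing D rs ∧
      (∀ i (h : i < (serOutput D).length), i ≤ c.LIM ∧
        main.den c 0 M aOUT 0 0 i = (serOutput D)[i]) ∧
      rs.length ≤ c.NB ∧
      (∀ r' ∈ rs, r'.StronglyMConsistent ((maxRelCard φ A : ℝ) ^ r) ∧ r'.Uniform ε) ∧
      rs.Pairwise (fun r r' => Disjoint r.result r'.result) ∧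
      evalConj φ.conj A = ⋃ r' ∈ rs, r'.result := by
  classical
  have hT' : 2 * c.X + 3 ≤ c.TK := by
    have := Nat.lt_two_pow_self (n := 2 * c.X + 3 + ⌈r⌉₊ + ⌈1 / ε⌉₊)
    omega
  obtain ⟨N, h1, h2, h3, h4⟩ := main_output F.ok hT' hpw hLC hI hm
  obtain ⟨hst, hsol⟩ := start_spec F.ok hL h2 h1 h3
  have hrun : ∀ b, State φ A c (final c N b) := fun b => hst.run F _ _
  have hout := h4 fun n b => (hst.run F _ n).inv.tab
  set l := (List.range c.NB).filter fun b => Alive c (final c N b) with hl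
  have hmem : ∀ b, b ∈ l ↔ b < c.NB ∧ Alive c (final c N b) := fun b => by
    simp [hl]
  have hres : ∀ b, ((fam c (final c N b)).ref (hrun b).inv.wf hA).result =
      (fam c (final c N b)).sol φ A := fun b => Fam.result_ref _ _
  have huniq := fun g (hg : g ∈ (fam c (start c N)).sol φ A) =>
    runBits_unique (step := tick c) (x := start c N) (S := fun M => (fam c M).sol φ A)
      (I := State φ A c) hst (fun b y hy => (tick_step F hy).1 b) (fun y hy => tick_sol F hy)
      c.TK hg
  refine ⟨l.map fun b => famList c (final c N b),
    l.map fun b => (fam c (final c N b)).ref (hrun b).inv.wf hA, ?_, hout, ?_, ?_, ?_, ?_⟩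
  · rw [List.forall₂_map_left_iff, List.forall₂_map_right_iff, List.forall₂_same]
    exact fun b _ => listing_famList (hrun b).inv hA
  · rw [List.length_map]
    exact length_filter_range_le _ _
  · intro r' hr'
    obtain ⟨b, hb, rfl⟩ := List.mem_map.1 hr'
    have hal := alive_iff.1 ((hmem b).1 hb).2
    have hg := (run_good F hst b.testBit hT).resolve_left hal
    exact ⟨Fam.strongly_ref _ hA (hrun b).atoms hg,
      Fam.uniform_ref _ hA (hrun b).atoms hg (Set.nonempty_iff_ne_empty.2 hal)⟩
  · rw [List.pairwise_map]
    refine (List.nodup_range.filter _).imp_of_mem fun {b b'} hb hb' hne => ?_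
    rw [hres, hres, Set.disjoint_left]
    intro g hg hg'
    refine hne (Nat.eq_of_testBit_eq fun i => ?_)
    by_cases hi : i < c.TK
    · exact (huniq g (sol_run_subset F hst _ _ hg)).2 _ _ hg hg' i hi
    · have hp : c.NB ≤ 2 ^ i := Nat.pow_le_pow_right (by omega) (by omega)
      rw [Nat.testBit_lt_two_pow (lt_of_lt_of_le ((hmem b).1 hb).1 hp),
        Nat.testBit_lt_two_pow (lt_of_lt_of_le ((hmem b').1 hb').1 hp)]
  · rw [← hsol]
    ext g
    simp only [Set.mem_iUnion, List.mem_map, exists_prop]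
    constructor
    · intro hg
      obtain ⟨b, hb, hgb⟩ := (huniq g hg).1
      refine ⟨_, ⟨b, (hmem b).2 ⟨hb, alive_iff.2 fun hd => ?_⟩, rfl⟩, ?_⟩
      · exact Set.eq_empty_iff_forall_notMem.1 (hd.sol_eq (hrun b).empty_mem) g hgb
      · rw [hres]; exact hgb
    · rintro ⟨_, ⟨b, -, rfl⟩, hg⟩
      rw [hres] at hg
      exact sol_run_subset F hst _ _ hg

end Pr

end

section

open Finset

/-! ### Filling loops -/

section Fill

variable {ρ : Fin 2 → ℝ} {B : ℕ} {μ ν : Memory}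

/-- Register `0` of an array. -/
def Expr.reg (a : ℕ) : Expr := .read a (.const 0)

/-- The register of the array `a` whose index is in register `0` of the array `i`. -/
def Expr.at (a i : ℕ) : Expr := .read a (.reg i)

theorem Expr.fits_read {a : ℕ} {i : Expr} :
    (Expr.read a i).Fits ρ B μ ↔ (a < 200 ∧ i.eval ρ μ < B) ∧ i.Fits ρ B μ := by
  simp [Expr.Fits, Expr.cells, Finset.insert_subset_iff]

theorem Expr.fits_add {e f : Expr} :
    (Expr.add e f).Fits ρ B μ ↔ e.Fits ρ B μ ∧ f.Fits ρ B μ := by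
  simp [Expr.Fits, Expr.cells, Finset.union_subset_iff]

theorem Expr.fits_sub {e f : Expr} :
    (Expr.sub e f).Fits ρ B μ ↔ e.Fits ρ B μ ∧ f.Fits ρ B μ := by
  simp [Expr.Fits, Expr.cells, Finset.union_subset_iff]

theorem Expr.fits_powLE {j : Fin 2} {a b x : Expr} :
    (Expr.powLE j a b x).Fits ρ B μ ↔ (a.Fits ρ B μ ∧ b.Fits ρ B μ) ∧ x.Fits ρ B μ := by
  simp [Expr.Fits, Expr.cells, Finset.union_subset_iff, and_assoc]

theorem Expr.fits_reg {a : ℕ} : (Expr.reg a).Fits ρ B μ ↔ a < 200 ∧ 0 < B := by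
  simp [Expr.reg, Expr.fits_read, Expr.fits_const, Expr.eval]

theorem Expr.eval_reg (a : ℕ) : (Expr.reg a).eval ρ μ = μ a 0 := rfl

theorem Expr.eval_at (a i : ℕ) : (Expr.at a i).eval ρ μ = μ a (μ i 0) := rfl

theorem Expr.fits_at {a i : ℕ} :
    (Expr.at a i).Fits ρ B μ ↔ (a < 200 ∧ μ i 0 < B) ∧ i < 200 ∧ 0 < B := by
  simp [Expr.at, Expr.fits_read, Expr.fits_reg, Expr.eval_reg]

/-- Storing a number in register `0` of an array. -/
def Prog.set (a : ℕ) (e : Expr) : Prog := .store a (.const 0) e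

theorem notMem_mono {a : ℕ} {l l' : List ℕ} (h : a ∉ l') (hl : l ⊆ l' := by decide) : a ∉ l :=
  fun h' => h (hl h')

theorem Runs.set {a : ℕ} {e : Expr} (he : e.Fits ρ B μ) (ha : a < 200) (hB : 0 < B) :
    Runs ρ B (.set a e) μ (μ.write a 0 (e.eval ρ μ)) (e.cost + 2) :=
  (Runs.store (Expr.fits_const 0) he ha hB).mono (by simp [Expr.cost]; omega)

/-- The loop that stores the successive values of `v` in the array `a`. -/
def Prog.fill (a v i : ℕ) (e₁ e₂ e : Expr) : Prog :=
  .whileLT e₁ e₂ (.seq (.store a (.reg i) (.reg v))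
    (.seq (.set v (.add (.reg v) e)) (.set i (.add (.reg i) (.const 1)))))

theorem Runs.fill {a v i : ℕ} {e₁ e₂ e : Expr}
    (hd : (a < 200 ∧ v < 200 ∧ i < 200) ∧ a ≠ v ∧ a ≠ i ∧ v ≠ i) {n : ℕ} (hn : n < B) (s : ℕ → ℕ)
    (h0 : μ v 0 = s 0) (hi0 : μ i 0 = 0)
    (hc : e₁.cost + e₂.cost + e.cost ≤ 40)
    (h : ∀ k ≤ n, ∀ ν : Memory, (∀ b ∉ [a, v, i], ν b = μ b) → ν v 0 = s k →
      ν i 0 = k → e₁.Fits ρ B ν ∧ e₂.Fits ρ B ν ∧ (e₁.eval ρ ν < e₂.eval ρ ν ↔ k < n) ∧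
        (k < n → e.Fits ρ B ν ∧ s k + e.eval ρ ν = s (k + 1))) :
    ∃ ν, Runs ρ B (.fill a v i e₁ e₂ e) μ ν (60 * (n + 1)) ∧
      (∀ b ∉ [a, v, i], ν b = μ b) ∧ ν v 0 = s n ∧ ν i 0 = n ∧
        ∀ k < n, ν a k = s k := by
  obtain ⟨⟨ha, hv, hi⟩, hav, hai, hvi⟩ := hd
  obtain ⟨ν, r, h1, h2, h3, h4⟩ := Runs.while (ρ := ρ) (B := B) (μ := μ) (e₁ := e₁) (e₂ := e₂)
    (p := .seq (.store a (.reg i) (.reg v))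
      (.seq (.set v (.add (.reg v) e)) (.set i (.add (.reg i) (.const 1)))))
    (T := e.cost + 17)
    (fun k ν => (∀ b ∉ [a, v, i], ν b = μ b) ∧ ν v 0 = s k ∧ ν i 0 = k ∧
      ∀ j < k, ν a j = s j) n
    (fun k hk ν hν => ⟨(h k hk ν hν.1 hν.2.1 hν.2.2.1).1, (h k hk ν hν.1 hν.2.1 hν.2.2.1).2.1⟩)
    (fun k hk ν hν => (h k hk.le ν hν.1 hν.2.1 hν.2.2.1).2.2.1.2 hk)
    (fun ν hν => by
      rw [(h n le_rfl ν hν.1 hν.2.1 hν.2.2.1).2.2.1]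
      omega)
    (fun k hk ν ⟨hf, hv', hi', ha'⟩ => by
      have hB : 0 < B := by omega
      have r1 := Runs.store (ρ := ρ) (B := B) (μ := ν) (a := a) (i := .reg i) (e := .reg v)
        (Expr.fits_reg.2 ⟨hi, hB⟩) (Expr.fits_reg.2 ⟨hv, hB⟩) ha
        (by rw [Expr.eval_reg, hi']; omega)
      simp only [Expr.eval_reg, hi', hv'] at r1
      obtain ⟨-, -, -, g⟩ := h k hk.le (ν.write a k (s k))
        (fun b hb => by rw [Memory.write_ne _ _ _ (by rintro rfl; simp at hb), hf b hb])
        (by rw [Memory.write_ne _ _ _ hav.symm, hv']) (by rw [Memory.write_ne _ _ _ hai.symm, hi'])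
      obtain ⟨g1, g2⟩ := g hk
      have r2 := Runs.set (ρ := ρ) (a := v) (e := .add (.reg v) e)
        (Expr.fits_add.2 ⟨Expr.fits_reg.2 ⟨hv, hB⟩, g1⟩) hv hB
      have e2 : (Expr.add (.reg v) e).eval ρ (ν.write a k (s k)) = s (k + 1) := by
        rw [Expr.eval, Expr.eval_reg, Memory.write_ne _ _ _ hav.symm, hv', g2]
      rw [e2] at r2
      have r3 := Runs.set (ρ := ρ) (a := i) (e := .add (.reg i) (.const 1))
        (μ := (ν.write a k (s k)).write v 0 (s (k + 1)))
        (Expr.fits_add.2 ⟨Expr.fits_reg.2 ⟨hi, hB⟩, Expr.fits_const 1⟩) hi hB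
      have e3 : (Expr.add (.reg i) (.const 1)).eval ρ
          ((ν.write a k (s k)).write v 0 (s (k + 1))) = k + 1 := by
        rw [Expr.eval, Expr.eval_reg, Memory.write_ne _ _ _ hvi.symm,
          Memory.write_ne _ _ _ hai.symm, hi']
        rfl
      rw [e3] at r3
      refine ⟨_, (r1.seq (r2.seq r3)).mono (by simp [Expr.cost, Expr.reg]; omega), ?_, ?_, ?_, ?_⟩
      · intro b hb
        have hb' := hb
        simp only [List.mem_cons, List.not_mem_nil, or_false, not_or] at hb'
        rw [Memory.write_ne _ _ _ hb'.2.2, Memory.write_ne _ _ _ hb'.2.1,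
          Memory.write_ne _ _ _ hb'.1, hf b hb]
      · rw [Memory.write_ne _ _ _ hvi, Memory.write_same]
      · rw [Memory.write_same]
      · intro j hj
        rw [Memory.write_ne _ _ _ hai, Memory.write_ne _ _ _ hav, Memory.write]
        by_cases hjk : j = k
        · simp [hjk]
        · simp [hjk, ha' j (by omega)])
    ⟨fun b _ => rfl, h0, hi0, by simp⟩
  refine ⟨ν, r.mono ?_, h1, h2, h3, h4⟩
  have : n * (e₁.cost + e₂.cost + 1 + (e.cost + 17)) ≤ n * 60 := Nat.mul_le_mul_left _ (by omega)
  omega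

/-- The loop that doubles a number `n` times. -/
theorem Runs.double {a v i t : ℕ}
    (hd : (a < 200 ∧ v < 200 ∧ i < 200) ∧ a ≠ v ∧ a ≠ i ∧ v ≠ i) (ht : t < 200)
    (hta : t ∉ [a, v, i])
    (hn : μ t 0 < B) (hi0 : μ i 0 = 0) :
    ∃ ν, Runs ρ B (.fill a v i (.reg i) (.reg t) (.reg v)) μ ν (60 * (μ t 0 + 1)) ∧
      (∀ b ∉ [a, v, i], ν b = μ b) ∧ ν v 0 = μ v 0 * 2 ^ μ t 0 ∧
        ∀ k < μ t 0, ν a k = μ v 0 * 2 ^ k := by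
  have hB : 0 < B := by omega
  obtain ⟨ν, r, h1, h2, -, h4⟩ := Runs.fill (ρ := ρ) (e₁ := .reg i) (e₂ := .reg t) (e := .reg v)
    hd hn (fun k => μ v 0 * 2 ^ k) (by simp) hi0 (by simp [Expr.cost, Expr.reg])
    (fun k hk ν hf hvk hik => by
      refine ⟨Expr.fits_reg.2 ⟨hd.1.2.2, hB⟩, Expr.fits_reg.2 ⟨ht, hB⟩, ?_,
        fun _ => ⟨Expr.fits_reg.2 ⟨hd.1.2.1, hB⟩, ?_⟩⟩
      · rw [Expr.eval_reg, Expr.eval_reg, hik, hf t hta]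
      · rw [Expr.eval_reg, hvk]; ring)
  exact ⟨ν, r, h1, h2, h4⟩

/-- The loop that tabulates the multiples of a number. -/
theorem Runs.multiples {a v i t w : ℕ}
    (hd : (a < 200 ∧ v < 200 ∧ i < 200) ∧ a ≠ v ∧ a ≠ i ∧ v ≠ i) (ht : t < 200) (hw : w < 200)
    (hta : t ∉ [a, v, i]) (hwa : w ∉ [a, v, i])
    (hn : μ t 0 < B) (hi0 : μ i 0 = 0) (hv0 : μ v 0 = 0) :
    ∃ ν, Runs ρ B (.fill a v i (.reg i) (.reg t) (.reg w)) μ ν (60 * (μ t 0 + 1)) ∧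
      (∀ b ∉ [a, v, i], ν b = μ b) ∧ ν v 0 = μ t 0 * μ w 0 ∧
        ∀ k < μ t 0, ν a k = k * μ w 0 := by
  have hB : 0 < B := by omega
  obtain ⟨ν, r, h1, h2, -, h4⟩ := Runs.fill (ρ := ρ) (e₁ := .reg i) (e₂ := .reg t) (e := .reg w)
    hd hn (fun k => k * μ w 0) (by simp [hv0]) hi0 (by simp [Expr.cost, Expr.reg])
    (fun k hk ν hf hvk hik => by
      refine ⟨Expr.fits_reg.2 ⟨hd.1.2.2, hB⟩, Expr.fits_reg.2 ⟨ht, hB⟩, ?_,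
        fun _ => ⟨Expr.fits_reg.2 ⟨hw, hB⟩, ?_⟩⟩
      · rw [Expr.eval_reg, Expr.eval_reg, hik, hf t hta]
      · rw [Expr.eval_reg, hf w hwa]; ring)
  exact ⟨ν, r, h1, h2, h4⟩

end Fill

namespace Pr

variable {ρ : Fin 2 → ℝ} {B : ℕ} {μ ν : Memory}

/-- Reading the query: the positions of the atoms, and a bound for all numbers in the query. -/
def scanQuery : Prog :=
  .seq (.set 100 (.const 1))
    (.seq (.fill aATP 100 101 (.reg 101) (.reg 0)
        (.add (.const 2) (.read 0 (.add (.reg 100) (.const 1)))))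
      (.seq (.set 46 (.reg 100))
        (.fill 199 46 102 (.reg 102) (.reg 100) (.at 0 102))))

theorem scanQuery_run (o : ℕ → ℕ) (ho : o 0 = 1)
    (hs : ∀ k < μ 0 0, o k + 1 < B ∧ o (k + 1) = o k + (2 + μ 0 (o k + 1)))
    (hz : ∀ a, 3 ≤ a → ∀ i, μ a i = 0) (hn : μ 0 0 < B) (hl : o (μ 0 0) < B) :
    ∃ ν, Runs ρ B scanQuery μ ν (60 * (μ 0 0 + o (μ 0 0) + 3)) ∧
      (∀ b, b ∉ [aATP, 100, 101, 46, 199, 102] → ν b = μ b) ∧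
      (∀ k < μ 0 0, ν aATP k = o k) ∧
      ν 46 0 = o (μ 0 0) + ∑ i ∈ range (o (μ 0 0)), μ 0 i := by
  have hB : 0 < B := by omega
  have r1 := Runs.set (ρ := ρ) (B := B) (μ := μ) (a := 100) (Expr.fits_const 1) (by norm_num) hB
  simp only [Expr.eval, Expr.cost] at r1
  have z1 : ∀ b, b ≠ 100 → μ.write 100 0 1 b = μ b := fun b hb => Memory.write_ne _ _ _ hb
  obtain ⟨ν₂, r2, f2, v2, -, a2⟩ := Runs.fill (ρ := ρ) (B := B) (μ := μ.write 100 0 1) (a := aATP)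
    (v := 100) (i := 101) (e₁ := .reg 101) (e₂ := .reg 0)
    (e := .add (.const 2) (.read 0 (.add (.reg 100) (.const 1)))) (by decide) hn o (by simp [ho])
    (by rw [z1 _ (by decide), hz _ (by decide)]) (by decide)
    (fun k hk ν hf hv hi => by
      have e0 : ν 0 = μ 0 := by rw [hf 0 (by decide), z1 _ (by decide)]
      simp only [Expr.fits_reg, Expr.fits_add, Expr.fits_read, Expr.fits_const, Expr.eval,
        Expr.eval_reg, e0, hv, hi, hB, and_true, true_and]
      exact ⟨by decide, by decide, fun h => ⟨⟨⟨by decide, (hs k h).1⟩, by decide⟩, (hs k h).2.symm⟩⟩)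
  have r3 := Runs.set (ρ := ρ) (B := B) (μ := ν₂) (a := 46) (e := .reg 100)
    (Expr.fits_reg.2 ⟨by decide, hB⟩) (by norm_num) hB
  rw [Expr.eval_reg, v2] at r3
  simp only [Expr.reg, Expr.cost] at r3
  have z2 : ∀ b ∉ [aATP, 100, 101], ν₂ b = μ b := fun b hb => by
    rw [f2 b hb, z1 b (by rintro rfl; simp at hb)]
  have z3 : ∀ b, b ≠ 46 → ν₂.write 46 0 (o (μ 0 0)) b = ν₂ b := fun b hb => Memory.write_ne _ _ _ hb
  obtain ⟨ν₄, r4, f4, v4, -, -⟩ := Runs.fill (ρ := ρ) (B := B) (μ := ν₂.write 46 0 (o (μ 0 0)))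
    (a := 199) (v := 46) (i := 102) (e₁ := .reg 102) (e₂ := .reg 100) (e := .at 0 102)
    (by decide) hl
    (fun k => o (μ 0 0) + ∑ i ∈ range k, μ 0 i) (by simp)
    (by rw [z3 _ (by decide), z2 _ (by decide), hz _ (by decide)])
    (by decide)
    (fun k hk ν hf hv hi => by
      have e0 : ν 0 = μ 0 := by
        rw [hf 0 (by decide), z3 _ (by decide),
          z2 _ (by decide)]
      have e1 : ν 100 0 = o (μ 0 0) := by
        rw [hf 100 (by decide), z3 _ (by decide), v2]
      simp only [Expr.fits_reg, Expr.fits_at, Expr.eval_at,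
        Expr.eval_reg, e0, e1, hi, hB, and_true, true_and]
      exact ⟨by decide, by decide, fun h => ⟨⟨⟨by decide, by omega⟩, by decide⟩, by
        rw [sum_range_succ, add_assoc]⟩⟩)
  refine ⟨ν₄, (r1.seq (r2.seq (r3.seq r4))).mono (by omega), ?_, ?_, v4⟩
  · intro b hb
    rw [f4 b (notMem_mono hb), z3 b (by rintro rfl; simp at hb), z2 b (notMem_mono hb)]
  · intro k hk
    rw [f4 _ (by decide), z3 _ (by decide), a2 k hk]

/-- Reading the relations: their positions, and the largest number of tuples. -/
def scanRels : Prog :=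
  .seq (.set 103 (.const 1))
    (.whileLT (.reg 104) (.reg 2)
      (.seq (.set 105 (.const 0)) (.seq (.set 106 (.const 0))
        (.seq (.fill 199 105 106 (.reg 106) (.read 2 (.add (.reg 103) (.const 2)))
            (.add (.read 2 (.add (.reg 103) (.const 1))) (.const 1)))
          (.seq (.store aRLP (.reg 104) (.reg 103))
            (.seq (.set aM (.add (.reg aM)
                (.sub (.read 2 (.add (.reg 103) (.const 2))) (.reg aM))))
              (.seq (.set 103 (.add (.reg 103) (.add (.const 3) (.reg 105))))
                (.set 104 (.add (.reg 104) (.const 1))))))))))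

theorem scanRels_run (o : ℕ → ℕ) (ho : o 0 = 1) (N : ℕ)
    (hs : ∀ k < μ 2 0, o k + 2 < B ∧ μ 2 (o k + 2) ≤ N ∧
      o (k + 1) = o k + (3 + μ 2 (o k + 2) * (μ 2 (o k + 1) + 1)))
    (hz : ∀ a, 102 < a ∨ a = aRLP ∨ a = aM → a ≠ 199 → ∀ i, μ a i = 0)
    (hn : μ 2 0 < B) (hN : N < B) :
    ∃ ν, Runs ρ B scanRels μ ν (200 * ((μ 2 0 + 1) * (N + 2))) ∧
      (∀ b, b ∉ [aRLP, 103, 104, 105, 106, 199, aM] → ν b = μ b) ∧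
      (∀ k < μ 2 0, ν aRLP k = o k) ∧
      ν aM 0 = (range (μ 2 0)).sup fun k => μ 2 (o k + 2) := by
  have hB : 0 < B := by omega
  have r1 := Runs.set (ρ := ρ) (B := B) (μ := μ) (a := 103) (Expr.fits_const 1) (by norm_num) hB
  simp only [Expr.eval, Expr.cost] at r1
  obtain ⟨ν, r, h⟩ := Runs.while (ρ := ρ) (B := B) (μ := μ.write 103 0 1) (e₁ := .reg 104)
    (e₂ := .reg 2) (p := (.seq (.set 105 (.const 0)) (.seq (.set 106 (.const 0))
        (.seq (.fill 199 105 106 (.reg 106) (.read 2 (.add (.reg 103) (.const 2)))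
            (.add (.read 2 (.add (.reg 103) (.const 1))) (.const 1)))
          (.seq (.store aRLP (.reg 104) (.reg 103))
            (.seq (.set aM (.add (.reg aM)
                (.sub (.read 2 (.add (.reg 103) (.const 2))) (.reg aM))))
              (.seq (.set 103 (.add (.reg 103) (.add (.const 3) (.reg 105))))
                (.set 104 (.add (.reg 104) (.const 1)))))))))) (T := 60 * (N + 1) + 60)
    (fun k ν => (∀ b, b ∉ [aRLP, 103, 104, 105, 106, 199, aM] → ν b = μ b) ∧
      (∀ j < k, ν aRLP j = o j) ∧ ν 103 0 = o k ∧ ν 104 0 = k ∧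
      ν aM 0 = (range k).sup fun k => μ 2 (o k + 2)) (μ 2 0)
    (fun k hk ν hν => by simp [Expr.fits_reg, hB])
    (fun k hk ν hν => by
      rw [Expr.eval_reg, Expr.eval_reg, hν.2.2.2.1, hν.1 2 (by decide)]; exact hk)
    (fun ν hν => by
      rw [Expr.eval_reg, Expr.eval_reg, hν.2.2.2.1, hν.1 2 (by decide)]; omega)
    (fun k hk ν ⟨hf, ha, hp, hi, hm⟩ => by
      obtain ⟨s1, s2, s3⟩ := hs k hk
      have e2 : ν 2 = μ 2 := hf 2 (by decide)
      have r1 := Runs.set (ρ := ρ) (B := B) (μ := ν) (a := 105) (Expr.fits_const 0) (by norm_num) hB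
      have r2 := Runs.set (ρ := ρ) (B := B) (μ := ν.write 105 0 0) (a := 106) (Expr.fits_const 0)
        (by norm_num) hB
      have z2 : ∀ b ∉ [105, 106], (ν.write 105 0 0).write 106 0 0 b = ν b := fun b hb => by
        simp only [List.mem_cons, List.not_mem_nil, or_false, not_or] at hb
        rw [Memory.write_ne _ _ _ hb.2, Memory.write_ne _ _ _ hb.1]
      obtain ⟨ν₃, r3, f3, v3, -, -⟩ := Runs.fill (ρ := ρ) (B := B)
        (μ := (ν.write 105 0 0).write 106 0 0) (a := 199) (v := 105) (i := 106)
        (e₁ := .reg 106) (e₂ := .read 2 (.add (.reg 103) (.const 2)))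
        (e := .add (.read 2 (.add (.reg 103) (.const 1))) (.const 1))
        (by decide)
        (s2.trans_lt hN) (fun j => j * (μ 2 (o k + 1) + 1)) (by simp [Memory.write]) (by simp)
        (by decide)
        (fun j hj ξ hf' hv hi => by
          have e2' : ξ 2 = μ 2 := by
            rw [hf' 2 (by decide), z2 _ (by decide), e2]
          have e3 : ξ 103 0 = o k := by
            rw [hf' _ (by decide), z2 _ (by decide), hp]
          simp only [Expr.fits_reg, Expr.fits_add, Expr.fits_read, Expr.fits_const, Expr.eval,
            Expr.eval_reg, e2', e3, hi, hB, and_true, true_and]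
          exact ⟨by decide, ⟨⟨by decide, s1⟩, by decide⟩, fun _ =>
            ⟨⟨⟨by decide, by omega⟩, by decide⟩, by ring⟩⟩)
      have z3 : ∀ b ∉ [199, 105, 106], ν₃ b = ν b := fun b hb => by
        rw [f3 b hb, z2 b (notMem_mono hb)]
      have r4 := Runs.store (ρ := ρ) (B := B) (μ := ν₃) (a := aRLP) (i := .reg 104) (e := .reg 103)
        (Expr.fits_reg.2 ⟨by decide, hB⟩) (Expr.fits_reg.2 ⟨by decide, hB⟩) (by decide)
        (by rw [Expr.eval_reg, z3 _ (by decide), hi]; omega)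
      simp only [Expr.eval_reg, z3 103 (by decide),
        z3 104 (by decide), hi, hp] at r4
      have z4 : ∀ b, b ≠ aRLP → ν₃.write aRLP k (o k) b = ν₃ b :=
        fun b hb => Memory.write_ne _ _ _ hb
      have r5 := Runs.set (ρ := ρ) (B := B) (μ := ν₃.write aRLP k (o k)) (a := aM)
        (e := .add (.reg aM) (.sub (.read 2 (.add (.reg 103) (.const 2))) (.reg aM)))
        (by
          simp only [Expr.fits_reg, Expr.fits_add, Expr.fits_sub, Expr.fits_read, Expr.fits_const,
            Expr.eval, Expr.eval_reg, hB, and_true,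
            z4 103 (by decide), z3 103 (by decide), hp]
          exact ⟨by decide, ⟨⟨by decide, s1⟩, by decide⟩, by decide⟩) (by decide) hB
      simp only [Expr.eval, Expr.eval_reg, z4 103 (by decide), z4 aM (by decide), z4 2 (by decide),
        z3 103 (by decide), z3 aM (by decide),
        z3 2 (by decide), hp, hm, e2] at r5
      set m' := (range k).sup (fun k => μ 2 (o k + 2)) +
        (μ 2 (o k + 2) - (range k).sup fun k => μ 2 (o k + 2)) with hm'
      have z5 : ∀ b, b ≠ aM → (ν₃.write aRLP k (o k)).write aM 0 m' b = ν₃.write aRLP k (o k) b :=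
        fun b hb => Memory.write_ne _ _ _ hb
      have r6 := Runs.set (ρ := ρ) (B := B) (μ := (ν₃.write aRLP k (o k)).write aM 0 m') (a := 103)
        (e := .add (.reg 103) (.add (.const 3) (.reg 105)))
        (by simp [Expr.fits_reg, Expr.fits_add, Expr.fits_const, hB]) (by decide) hB
      simp only [Expr.eval, Expr.eval_reg, z5 103 (by decide), z5 105 (by decide),
        z4 103 (by decide), z4 105 (by decide), z3 103 (by decide), hp,
        v3, ← s3] at r6
      have r7 := Runs.set (ρ := ρ) (B := B)
        (μ := ((ν₃.write aRLP k (o k)).write aM 0 m').write 103 0 (o (k + 1))) (a := 104)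
        (e := .add (.reg 104) (.const 1))
        (by simp [Expr.fits_reg, Expr.fits_add, Expr.fits_const, hB]) (by decide) hB
      have e7 : (((ν₃.write aRLP k (o k)).write aM 0 m').write 103 0 (o (k + 1))) 104 0 = k := by
        rw [Memory.write_ne _ _ _ (by decide), z5 _ (by decide), z4 _ (by decide),
          z3 _ (by decide), hi]
      simp only [Expr.eval, Expr.eval_reg, e7] at r7
      refine ⟨_, (r1.seq (r2.seq (r3.seq (r4.seq (r5.seq (r6.seq r7)))))).mono ?_,
        ?_, ?_, ?_, ?_, ?_⟩
      · simp only [Expr.cost, Expr.reg]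
        omega
      · intro b hb
        have hb' := hb
        simp only [List.mem_cons, List.not_mem_nil, or_false, not_or] at hb'
        rw [Memory.write_ne _ _ _ hb'.2.2.1, Memory.write_ne _ _ _ hb'.2.1, z5 b hb'.2.2.2.2.2.2,
          z4 b hb'.1, z3 b (notMem_mono hb), hf b hb]
      · intro j hj
        rw [Memory.write_ne _ _ _ (by decide), Memory.write_ne _ _ _ (by decide), z5 _ (by decide),
          Memory.write]
        by_cases hjk : j = k
        · simp [hjk]
        · simp only [hjk, and_false, if_false]
          rw [z3 _ (by decide), ha j (by omega)]
      · rw [Memory.write_ne _ _ _ (by decide), Memory.write_same]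
      · rw [Memory.write_same]
      · rw [Memory.write_ne _ _ _ (by decide), Memory.write_ne _ _ _ (by decide),
          Memory.write_same, range_add_one, sup_insert, hm', max_def]
        split_ifs <;> omega)
    ⟨fun b hb => Memory.write_ne _ _ _ (by rintro rfl; simp at hb), by simp,
      by rw [Memory.write_same, ho],
      by rw [Memory.write_ne _ _ _ (by decide), hz _ (by decide) (by decide)],
      by rw [Memory.write_ne _ _ _ (by decide), hz _ (by decide) (by decide)]; simp⟩
  refine ⟨ν, (r1.seq r).mono ?_, h.1, h.2.1, h.2.2.2.2⟩
  simp only [Expr.cost, Expr.reg]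
  nlinarith [Nat.zero_le (μ 2 0 * N)]

end Pr

end

section

open Finset

namespace Pr

variable {μ ν : Memory} {c : Cst}

/-- Computing the constants of the computation. -/
def numbers : Prog :=
  .seq (.fill 199 50 107 (.const 0) (.powLE 0 (.add (.reg 50) (.const 1)) (.const 1) (.reg aM))
      (.const 1))
    (.seq (.seq (.set 108 (.const 1))
      (.fill 199 108 109 (.const 0) (.powLE 0 (.reg 108) (.const 1) (.const 2)) (.reg 108)))
    (.seq (.seq (.set 110 (.const 1))
      (.fill 199 110 111 (.powLE 1 (.const 2) (.const 1) (.reg 110)) (.const 1) (.reg 110)))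
    (.set 112 (.add (.add (.add (.reg 46) (.reg 46)) (.const 3)) (.add (.reg 109) (.reg 111))))))

/-- Computing the bounds of the loops. -/
def bounds : Prog :=
  .seq (.seq (.set 48 (.const 1)) (.fill 199 48 113 (.reg 113) (.reg 112) (.reg 48)))
    (.seq (.seq (.set 49 (.const 1)) (.fill aPW 49 114 (.reg 114) (.reg 48) (.reg 49)))
    (.seq (.seq (.set 47 (.const 1)) (.fill 199 47 115 (.reg 115) (.reg 46) (.reg 47)))
    (.seq (.set 54 (.add (.reg 50) (.const 1))) (.fill 199 54 116 (.reg 116) (.reg 49) (.reg 54)))))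

/-- Computing the tables for address computations. -/
def addressTables : Prog :=
  .seq (.seq (.set 53 (.reg 49)) (.seq (.set 51 (.add (.reg 49) (.const 1)))
      (.seq (.set 52 (.add (.reg 54) (.const 1))) (.set 45 (.const 1)))))
    (.seq (.fill 56 117 118 (.reg 118) (.reg 51) (.reg 52))
      (.fill 55 119 120 (.reg 120) (.reg 51) (.reg 117)))

theorem numbers_run {m : ℕ} (h0 : 1 ≤ c.ρ 0) (h1 : 0 < c.ρ 1) (hm : μ aM 0 = m)
    (hD : c.D = ⌊(m : ℝ) ^ c.ρ 0⌋₊) (hX : μ 46 0 = c.X) {B W : ℕ}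
    (hz : ∀ a, a = 50 ∨ 106 < a → a ≠ 199 → μ a 0 = 0)
    (w1 : c.D < W) (w2 : ⌊c.ρ 0⌋₊ + 1 < W) (w3 : ⌈1 / c.ρ 1⌉₊ < W) (hW : W ≤ B) :
    ∃ ν, Runs c.ρ B numbers μ ν (300 * W) ∧
      (∀ b ∉ [199, 50, 107, 108, 109, 110, 111, 112], ν b = μ b) ∧
      ν 50 0 = c.D ∧ ν 112 0 = 2 * c.X + 3 + ((⌊c.ρ 0⌋₊ + 1) + ⌈1 / c.ρ 1⌉₊) := by
  have hB : 0 < B := by omega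
  obtain ⟨ν₁, r1, f1, v1, -, -⟩ := Runs.fill (ρ := c.ρ) (B := B) (μ := μ) (a := 199) (v := 50)
    (i := 107) (e₁ := .const 0)
    (e₂ := .powLE 0 (.add (.reg 50) (.const 1)) (.const 1) (.reg aM)) (e := .const 1)
    (by decide) (w1.trans_le hW)
    (fun k => k) (hz _ (by decide) (by decide)) (hz _ (by decide) (by decide)) (by decide)
    (fun k hk ν hf hv hi => by
      have e1 : ν aM 0 = m := by rw [hf _ (by decide), hm]
      refine ⟨Expr.fits_const 0, by
        simp [Expr.fits_powLE, Expr.fits_add, Expr.fits_reg, Expr.fits_const, hB, aM], ?_,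
        fun _ => ⟨Expr.fits_const 1, rfl⟩⟩
      simp only [Expr.eval, Expr.eval_reg, hv, e1]
      have : (((k + 1 : ℕ) : ℝ) ≤ ((1 : ℕ) : ℝ) * (m : ℝ) ^ c.ρ 0) ↔ k < c.D := by
        rw [hD, ← Nat.succ_le_iff (m := k), Nat.le_floor_iff (by positivity), Nat.cast_one, one_mul]
      rw [← this]
      split_ifs with h
      · exact iff_of_true (by decide) h
      · exact iff_of_false (by decide) h)
  have z1 : ∀ b ∉ [199, 50, 107], ν₁ b = μ b := f1
  have r2 := Runs.set (ρ := c.ρ) (B := B) (μ := ν₁) (a := 108) (Expr.fits_const 1) (by norm_num) hB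
  simp only [Expr.eval, Expr.cost] at r2
  have y2 : ∀ b, b ≠ 108 → ν₁.write 108 0 1 b = ν₁ b := fun b hb => Memory.write_ne _ _ _ hb
  obtain ⟨ν₂, r2', f2, -, v2, -⟩ := Runs.fill (ρ := c.ρ) (B := B) (μ := ν₁.write 108 0 1) (a := 199)
    (v := 108) (i := 109) (e₁ := .const 0)
    (e₂ := .powLE 0 (.reg 108) (.const 1) (.const 2)) (e := .reg 108)
    (by decide) (w2.trans_le hW)
    (fun k => 2 ^ k) (by simp)
    (by rw [y2 _ (by decide), z1 _ (by decide),
          hz _ (by decide) (by decide)]) (by decide)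
    (fun k hk ν hf hv hi => by
      refine ⟨Expr.fits_const 0, by
        simp [Expr.fits_powLE, Expr.fits_reg, Expr.fits_const, hB], ?_,
        fun _ => ⟨by simp [Expr.fits_reg, hB], by rw [Expr.eval_reg, hv]; ring⟩⟩
      simp only [Expr.eval, Expr.eval_reg, hv]
      rw [Nat.lt_succ_iff, Nat.le_floor_iff (by linarith)]
      have : (((2 ^ k : ℕ) : ℝ) ≤ ((1 : ℕ) : ℝ) * ((2 : ℕ) : ℝ) ^ c.ρ 0) ↔ (k : ℝ) ≤ c.ρ 0 := by
        push_cast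
        rw [one_mul, ← Real.rpow_natCast, Real.rpow_le_rpow_left_iff (by norm_num)]
      rw [← this]
      split_ifs with h
      · exact iff_of_true (by decide) h
      · exact iff_of_false (by decide) h)
  have z2 : ∀ b ∉ [199, 108, 109], ν₂ b = ν₁ b :=
    fun b hb => by rw [f2 b hb, y2 b (by rintro rfl; simp at hb)]
  have r3 := Runs.set (ρ := c.ρ) (B := B) (μ := ν₂) (a := 110) (Expr.fits_const 1) (by norm_num) hB
  simp only [Expr.eval, Expr.cost] at r3
  have y3 : ∀ b, b ≠ 110 → ν₂.write 110 0 1 b = ν₂ b := fun b hb => Memory.write_ne _ _ _ hb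
  obtain ⟨ν₃, r3', f3, -, v3, -⟩ := Runs.fill (ρ := c.ρ) (B := B) (μ := ν₂.write 110 0 1) (a := 199)
    (v := 110) (i := 111) (e₁ := .powLE 1 (.const 2) (.const 1) (.reg 110))
    (e₂ := .const 1) (e := .reg 110)
    (by decide) (w3.trans_le hW)
    (fun k => 2 ^ k) (by simp)
    (by rw [y3 _ (by decide), z2 _ (by decide),
          z1 _ (by decide), hz _ (by decide) (by decide)]) (by decide)
    (fun k hk ν hf hv hi => by
      refine ⟨by
        simp [Expr.fits_powLE, Expr.fits_reg, Expr.fits_const, hB], Expr.fits_const 1, ?_,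
        fun _ => ⟨by simp [Expr.fits_reg, hB], by rw [Expr.eval_reg, hv]; ring⟩⟩
      simp only [Expr.eval, Expr.eval_reg, hv]
      have : (((2 : ℕ) : ℝ) ≤ ((1 : ℕ) : ℝ) * ((2 ^ k : ℕ) : ℝ) ^ c.ρ 1) ↔ ¬ k < ⌈1 / c.ρ 1⌉₊ := by
        push_cast
        rw [one_mul, ← Real.rpow_natCast, ← Real.rpow_mul (by norm_num), Nat.lt_ceil, not_lt,
          div_le_iff₀ h1]
        conv_lhs => lhs; rw [← Real.rpow_one 2]
        rw [Real.rpow_le_rpow_left_iff (by norm_num)]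
      rw [← not_iff_not, ← this]
      split_ifs with h
      · exact iff_of_true (by decide) h
      · exact iff_of_false (by decide) h)
  have z3 : ∀ b ∉ [199, 110, 111], ν₃ b = ν₂ b :=
    fun b hb => by rw [f3 b hb, y3 b (by rintro rfl; simp at hb)]
  have r4 := Runs.set (ρ := c.ρ) (B := B) (μ := ν₃) (a := 112)
    (e := .add (.add (.add (.reg 46) (.reg 46)) (.const 3)) (.add (.reg 109) (.reg 111)))
    (by simp [Expr.fits_add, Expr.fits_reg, Expr.fits_const, hB]) (by norm_num) hB
  refine ⟨_, (r1.seq ((r2.seq r2').seq ((r3.seq r3').seq r4))).mono ?_, ?_, ?_, ?_⟩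
  · simp only [Expr.cost, Expr.reg]; omega
  · intro b hb
    rw [Memory.write_ne _ _ _ (by rintro rfl; simp at hb), z3 b (notMem_mono hb),
      z2 b (notMem_mono hb), z1 b (notMem_mono hb)]
  · rw [Memory.write_ne _ _ _ (by decide), z3 _ (by decide),
      z2 _ (by decide), v1]
  · rw [Memory.write_same]
    simp only [Expr.eval, Expr.eval_reg]
    rw [v3, z3 109 (by decide), v2, z3 46 (by decide),
      z2 46 (by decide), z1 46 (by decide), hX]
    ring

theorem set_double {ρ : Fin 2 → ℝ} {B : ℕ} {a v i t : ℕ} {e : Expr} {x n : ℕ} (he : e.Fits ρ B μ)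
    (hx : e.eval ρ μ = x) (hn : μ t 0 = n)
    (hd : ((a < 200 ∧ v < 200 ∧ i < 200) ∧ a ≠ v ∧ a ≠ i ∧ v ≠ i) ∧ t < 200 ∧ t ∉ [a, v, i]) (hB : n < B) (hi0 : μ i 0 = 0) :
    ∃ ν, Runs ρ B (.seq (.set v e) (.fill a v i (.reg i) (.reg t) (.reg v))) μ ν
        (60 * (n + 1) + e.cost + 2) ∧
      (∀ b ∉ [a, v, i], ν b = μ b) ∧ ν v 0 = x * 2 ^ n ∧
        ∀ k < n, ν a k = x * 2 ^ k := by
  have r1 := Runs.set (ρ := ρ) (B := B) (μ := μ) (a := v) he hd.1.1.2.1 (by omega)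
  have htv : t ≠ v := fun h => hd.2.2 (by simp [h])
  rw [hx] at r1
  have z : ∀ b, b ≠ v → μ.write v 0 x b = μ b := fun b hb => Memory.write_ne _ _ _ hb
  obtain ⟨ν, r, f, v1, v2⟩ := Runs.double (ρ := ρ) (B := B) (μ := μ.write v 0 x) hd.1 hd.2.1
    hd.2.2 (by rw [z _ htv]; omega) (by rw [z _ hd.1.2.2.2.symm, hi0])
  rw [z _ htv, hn, Memory.write_same] at v1 v2
  rw [z _ htv, hn] at r
  exact ⟨ν, (r1.seq r).mono (by omega), fun b hb => by
    rw [f b hb, z b (by rintro rfl; simp at hb)], v1, v2⟩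

theorem bounds_run (hD : μ 50 0 = c.D) (hX : μ 46 0 = c.X) {t : ℕ} (ht : μ 112 0 = t)
    (hTK : c.TK = 2 ^ t) {B W : ℕ} (hz : ∀ a, 112 < a → a < 117 → μ a 0 = 0)
    (w1 : t < W) (w2 : c.TK < W) (w3 : c.X < W) (w4 : c.NB < W) (hW : W ≤ B) :
    ∃ ν, Runs c.ρ B bounds μ ν (300 * W) ∧
      (∀ b, b ∉ [aPW, 199, 48, 113, 49, 114, 47, 115, 54, 116] → ν b = μ b) ∧
      ν 48 0 = c.TK ∧ ν 49 0 = c.NB ∧ ν 47 0 = c.E ∧ ν 54 0 = c.LIM ∧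
      ∀ k < c.TK, ν aPW k = 2 ^ k := by
  have hB : 0 < B := by omega
  obtain ⟨ν₁, r1, f1, v1, -⟩ := set_double (ρ := c.ρ) (B := B) (μ := μ) (a := 199) (v := 48)
    (i := 113) (t := 112) (x := 1) (Expr.fits_const 1) rfl ht (by decide)     (by omega) (hz _ (by decide) (by decide))
  rw [one_mul, ← hTK] at v1
  obtain ⟨ν₂, r2, f2, v2, p2⟩ := set_double (ρ := c.ρ) (B := B) (μ := ν₁) (a := aPW) (v := 49)
    (i := 114) (t := 48) (x := 1) (Expr.fits_const 1) rfl v1 (by decide)     (by omega) (by rw [f1 _ (by decide), hz _ (by decide) (by decide)])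
  obtain ⟨ν₃, r3, f3, v3, -⟩ := set_double (ρ := c.ρ) (B := B) (μ := ν₂) (a := 199) (v := 47)
    (i := 115) (t := 46) (n := c.X) (x := 1) (Expr.fits_const 1) rfl
    (by rw [f2 _ (by decide), f1 _ (by decide), hX])
    (by decide)     (by omega) (by rw [f2 _ (by decide),
      f1 _ (by decide), hz _ (by decide) (by decide)])
  obtain ⟨ν₄, r4, f4, v4, -⟩ := set_double (ρ := c.ρ) (B := B) (μ := ν₃) (a := 199) (v := 54)
    (i := 116) (t := 49) (n := c.NB) (e := .add (.reg 50) (.const 1)) (x := c.D + 1)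
    (by simp [Expr.fits_add, Expr.fits_reg, Expr.fits_const, hB])
    (by
      simp only [Expr.eval, Expr.eval_reg]
      rw [f3 _ (by decide), f2 _ (by decide),
        f1 _ (by decide), hD])
    (by rw [f3 _ (by decide), v2, one_mul]; rfl)
    (by decide)     (by omega) (by rw [f3 _ (by decide),
      f2 _ (by decide),
      f1 _ (by decide), hz _ (by decide) (by decide)])
  refine ⟨ν₄, (r1.seq (r2.seq (r3.seq r4))).mono ?_, ?_, ?_, ?_, ?_, ?_, ?_⟩
  · simp only [Expr.cost, Expr.reg]; omega
  · intro b hb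
    rw [f4 b (notMem_mono hb), f3 b (notMem_mono hb), f2 b (notMem_mono hb),
      f1 b (notMem_mono hb)]
  · rw [f4 _ (by decide), f3 _ (by decide),
      f2 _ (by decide), v1]
  · rw [f4 _ (by decide), f3 _ (by decide),
      v2, one_mul]; rfl
  · rw [f4 _ (by decide), v3, one_mul]; rfl
  · rw [v4]; rfl
  · intro k hk
    rw [f4 _ (by decide), f3 _ (by decide),
      p2 k hk, one_mul]

theorem addressTables_run (hN : μ 49 0 = c.NB) (hL : μ 54 0 = c.LIM) {B W : ℕ}
    (hz : ∀ a, 116 < a → a < 121 → μ a 0 = 0) (w1 : c.P + 1 < W) (hW : W ≤ B) :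
    ∃ ν, Runs c.ρ B addressTables μ ν (150 * W) ∧
      (∀ b, b ∉ [53, 51, 52, 45, 56, 117, 118, 55, 119, 120] → ν b = μ b) ∧
      ν 53 0 = c.P ∧ ν 51 0 = c.P + 1 ∧ ν 52 0 = c.LIM + 1 ∧ ν 45 0 = 1 ∧
      (∀ p ≤ c.P, ν 55 p = p * c.C1) ∧ (∀ p ≤ c.P, ν 56 p = p * (c.LIM + 1)) := by
  have hB : 0 < B := by omega
  have r1 := Runs.set (ρ := c.ρ) (B := B) (μ := μ) (a := 53) (e := .reg 49)
    (Expr.fits_reg.2 ⟨by decide, hB⟩) (by norm_num) hB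
  rw [Expr.eval_reg, hN] at r1
  have r2 := Runs.set (ρ := c.ρ) (B := B) (μ := μ.write 53 0 c.NB) (a := 51)
    (e := .add (.reg 49) (.const 1))
    (by simp [Expr.fits_add, Expr.fits_reg, Expr.fits_const, hB]) (by norm_num) hB
  have e2 : (Expr.add (.reg 49) (.const 1)).eval c.ρ (μ.write 53 0 c.NB) = c.P + 1 := by
    simp only [Expr.eval, Expr.eval_reg]
    rw [Memory.write_ne _ _ _ (by decide), hN]; rfl
  rw [e2] at r2
  have r3 := Runs.set (ρ := c.ρ) (B := B) (μ := (μ.write 53 0 c.NB).write 51 0 (c.P + 1)) (a := 52)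
    (e := .add (.reg 54) (.const 1))
    (by simp [Expr.fits_add, Expr.fits_reg, Expr.fits_const, hB]) (by norm_num) hB
  have e3 : (Expr.add (.reg 54) (.const 1)).eval c.ρ
      ((μ.write 53 0 c.NB).write 51 0 (c.P + 1)) = c.LIM + 1 := by
    simp only [Expr.eval, Expr.eval_reg]
    rw [Memory.write_ne _ _ _ (by decide), Memory.write_ne _ _ _ (by decide), hL]
  rw [e3] at r3
  have r4 := Runs.set (ρ := c.ρ) (B := B)
    (μ := ((μ.write 53 0 c.NB).write 51 0 (c.P + 1)).write 52 0 (c.LIM + 1)) (a := 45)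
    (Expr.fits_const 1) (by norm_num) hB
  simp only [Expr.eval] at r4
  set ξ := ((((μ.write 53 0 c.NB).write 51 0 (c.P + 1)).write 52 0 (c.LIM + 1)).write 45 0 1)
    with hξ
  have z : ∀ b ∉ [53, 51, 52, 45], ξ b = μ b := fun b hb => by
    simp only [List.mem_cons, List.not_mem_nil, or_false, not_or] at hb
    rw [hξ, Memory.write_ne _ _ _ hb.2.2.2, Memory.write_ne _ _ _ hb.2.2.1,
      Memory.write_ne _ _ _ hb.2.1, Memory.write_ne _ _ _ hb.1]
  have x51 : ξ 51 0 = c.P + 1 := by simp [hξ, Memory.write]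
  have x52 : ξ 52 0 = c.LIM + 1 := by simp [hξ, Memory.write]
  have x53 : ξ 53 0 = c.NB := by simp [hξ, Memory.write]
  have x45 : ξ 45 0 = 1 := by simp [hξ]
  obtain ⟨ν₁, r5, f5, v5, t5⟩ := Runs.multiples (ρ := c.ρ) (B := B) (μ := ξ) (a := 56) (v := 117)
    (i := 118) (t := 51) (w := 52) (by decide) (by decide) (by decide) (by decide)
    (by decide) (by omega)
    (by rw [z _ (by decide), hz _ (by decide) (by decide)])
    (by rw [z _ (by decide), hz _ (by decide) (by decide)])
  have y51 : ν₁ 51 0 = c.P + 1 := by rw [f5 _ (by decide), x51]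
  obtain ⟨ν₂, r6, f6, v6, t6⟩ := Runs.multiples (ρ := c.ρ) (B := B) (μ := ν₁) (a := 55) (v := 119)
    (i := 120) (t := 51) (w := 117) (by decide) (by decide) (by decide) (by decide)
    (by decide) (by omega)
    (by rw [f5 _ (by decide),
          z _ (by decide), hz _ (by decide) (by decide)])
    (by rw [f5 _ (by decide),
          z _ (by decide), hz _ (by decide) (by decide)])
  rw [x51, x52] at v5 t5
  rw [y51, v5] at t6
  rw [x51] at r5
  rw [y51] at r6
  refine ⟨ν₂, ((r1.seq (r2.seq (r3.seq r4))).seq (r5.seq r6)).mono ?_,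
    ?_, ?_, ?_, ?_, ?_, ?_, ?_⟩
  · simp only [Expr.cost, Expr.reg]; omega
  · intro b hb
    rw [f6 b (notMem_mono hb), f5 b (notMem_mono hb), z b (notMem_mono hb)]
  · rw [f6 _ (by decide), f5 _ (by decide), x53]; rfl
  · rw [f6 _ (by decide), y51]
  · rw [f6 _ (by decide), f5 _ (by decide), x52]
  · rw [f6 _ (by decide), f5 _ (by decide), x45]
  · exact fun p hp => t6 p (by omega)
  · intro p hp
    rw [f6 _ (by decide), t5 p (by omega)]

end Pr

end

section

open Finset

/-! ### Positions in serialised lists -/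

section Serial

variable {α : Type} {ser : α → List ℕ} {l : List α}

/-- The position of the item `k` of a serialised list. -/
def serPos (ser : α → List ℕ) (l : List α) (k : ℕ) : ℕ := 1 + ((l.take k).flatMap ser).length

theorem serPos_zero : serPos ser l 0 = 1 := by simp [serPos]

theorem serPos_succ {k : ℕ} (h : k < l.length) :
    serPos ser l (k + 1) = serPos ser l k + (ser l[k]).length := by
  rw [serPos, serPos, ← List.take_concat_get' _ _ h, List.flatMap_append, List.length_append]
  simp [add_assoc]

theorem serPos_length : serPos ser l l.length = (serList ser l).length := by
  simp [serPos, serList, add_comm]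

theorem serPos_le {k : ℕ} : serPos ser l k ≤ (serList ser l).length := by
  rw [← serPos_length, serPos, serPos, List.take_length]
  conv_rhs => rw [← List.take_append_drop k l]
  rw [List.flatMap_append, List.length_append]
  omega

theorem getD_serList {k t : ℕ} (h : k < l.length) (ht : t < (ser l[k]).length) :
    (serList ser l).getD (serPos ser l k + t) 0 = (ser l[k]).getD t 0 := by
  have e : serList ser l = l.length :: ((l.take k).flatMap ser ++
      (ser l[k] ++ (l.drop (k + 1)).flatMap ser)) := by
    rw [serList]
    conv_lhs => enter [2]; rw [← List.take_append_drop k l, List.drop_eq_getElem_cons h,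
      List.flatMap_append, List.flatMap_cons]
  rw [e, serPos, show 1 + ((l.take k).flatMap ser).length + t =
    (((l.take k).flatMap ser).length + t) + 1 by omega, List.getD_cons_succ,
    List.getD_append_right _ _ _ _ (by omega), Nat.add_sub_cancel_left,
    List.getD_append _ _ _ _ ht]

theorem serPos_const {n k : ℕ} (h : ∀ x ∈ l, (ser x).length = n) (hk : k ≤ l.length) :
    serPos ser l k = 1 + k * n := by
  induction k with
  | zero => simp [serPos_zero]
  | succ k ih => rw [serPos_succ (by omega), ih (by omega), h _ (List.getElem_mem _)]; ring

theorem length_serList_const {n : ℕ} (h : ∀ x ∈ l, (ser x).length = n) :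
    (serList ser l).length = 1 + l.length * n := by
  rw [← serPos_length, serPos_const h le_rfl]

end Serial

/-- The serialisation of an atom. -/
def serAtom (α : ℕ × List ℕ) : List ℕ := α.1 :: serTuple α.2

/-- The serialisation of a relation. -/
def serRel (p : (ℕ × ℕ) × List (List ℕ)) : List ℕ := p.1.1 :: p.1.2 :: serList serTuple p.2

theorem serQuery_eq (l : List (ℕ × List ℕ)) : serQuery l = serList serAtom l := rfl

theorem serRels_eq (l : List ((ℕ × ℕ) × List (List ℕ))) : serRels l = serList serRel l := rfl

/-- A bound for all numbers that describe a query. -/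
def querySize (l : List (ℕ × List ℕ)) : ℕ := (serQuery l).length + (serQuery l).sum

theorem lt_querySize {l : List (ℕ × List ℕ)} {x : ℕ} (hx : x ∈ serQuery l) : x < querySize l := by
  have h1 := List.le_sum_of_mem hx
  have h2 := List.length_pos_of_mem hx
  unfold querySize
  omega

theorem mem_serQuery {l : List (ℕ × List ℕ)} {α : ℕ × List ℕ} (hα : α ∈ l) {x : ℕ}
    (hx : x ∈ serAtom α) : x ∈ serQuery l :=
  List.mem_cons_of_mem _ (List.mem_flatMap.2 ⟨α, hα, hx⟩)

theorem StructListing.Presents.exists_atom {φ : QFCQ} {A : Struct} {L : StructListing}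
    (hL : L.Presents φ.signature A) {e : (ℕ × ℕ) × List (List ℕ)} (he : e ∈ L.rels) :
    ∃ α ∈ φ.atoms, α.1 = e.1.1 ∧ α.2.length = e.1.2 := by
  have h : RelSym.base e.1.1 e.1.2 ∈ φ.signature := by
    rw [← hL.2.2.2.1]
    exact List.mem_toFinset.2 (List.mem_map.2 ⟨e, he, rfl⟩)
  obtain ⟨a, ha, h2⟩ := Finset.mem_image.1 h
  obtain ⟨α, hα, rfl⟩ := List.mem_map.1 (List.mem_toFinset.1 ha)
  simp only [RelSym.base.injEq] at h2
  exact ⟨α, hα, h2⟩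

theorem StructListing.Presents.length_le {φ : QFCQ} {A : Struct} {L : StructListing}
    (hL : L.Presents φ.signature A) : L.rels.length ≤ φ.atoms.length := by
  have h : L.rels.map Prod.fst ⊆ φ.atoms.map fun α => (α.1, α.2.length) := by
    intro x hx
    obtain ⟨e, he, rfl⟩ := List.mem_map.1 hx
    obtain ⟨α, hα, h1, h2⟩ := hL.exists_atom he
    exact List.mem_map.2 ⟨α, hα, by rw [h1, h2]⟩
  have := (hL.2.2.1.subperm h).length_le
  simpa using this

theorem StructListing.Presents.length_eq {φ : QFCQ} {A : Struct} {L : StructListing}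
    (hL : L.Presents φ.signature A) {e : (ℕ × ℕ) × List (List ℕ)} (he : e ∈ L.rels) :
    ∀ t ∈ e.2, t.length = e.1.2 := fun t ht => by
  have h := (hL.2.2.2.2 e he).2
  have : t ∈ A.rel (RelSym.base e.1.1 e.1.2) := by rw [← h]; exact List.mem_toFinset.2 ht
  exact A.length_eq _ _ this

theorem StructListing.Presents.card_eq {φ : QFCQ} {A : Struct} {L : StructListing}
    (hL : L.Presents φ.signature A) {e : (ℕ × ℕ) × List (List ℕ)} (he : e ∈ L.rels) :
    (A.rel (RelSym.base e.1.1 e.1.2)).card = e.2.length := by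
  obtain ⟨h1, h2⟩ := hL.2.2.2.2 e he
  rw [← h2, List.toFinset_card_of_nodup h1]

theorem StructListing.Presents.card_le {φ : QFCQ} {A : Struct} {L : StructListing}
    (hL : L.Presents φ.signature A) {e : (ℕ × ℕ) × List (List ℕ)} (he : e ∈ L.rels) :
    e.2.length ≤ maxRelCard φ A := by
  rw [← hL.card_eq he]
  refine Finset.le_sup (f := fun R => (A.rel R).card) ?_
  rw [← hL.2.2.2.1]
  exact List.mem_toFinset.2 (List.mem_map.2 ⟨e, he, rfl⟩)

theorem StructListing.Presents.maxRelCard_eq {φ : QFCQ} {A : Struct} {L : StructListing}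
    (hL : L.Presents φ.signature A) {f : ℕ → ℕ}
    (hf : ∀ k (h : k < L.rels.length), f k = L.rels[k].2.length) :
    (range L.rels.length).sup f = maxRelCard φ A := by
  apply le_antisymm
  · refine Finset.sup_le fun k hk => ?_
    rw [hf k (mem_range.1 hk)]
    exact hL.card_le (List.getElem_mem _)
  · refine Finset.sup_le fun R hR => ?_
    rw [← hL.2.2.2.1] at hR
    obtain ⟨e, he, rfl⟩ := List.mem_map.1 (List.mem_toFinset.1 hR)
    obtain ⟨k, hk, rfl⟩ := List.getElem_of_mem he
    rw [hL.card_eq he, ← hf k hk]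
    exact Finset.le_sup (f := f) (mem_range.2 hk)

theorem StructListing.Presents.length_serRels {φ : QFCQ} {A : Struct} {L : StructListing}
    (hL : L.Presents φ.signature A) :
    (serRels L.rels).length ≤
      1 + querySize φ.atoms * (3 + maxRelCard φ A * querySize φ.atoms) := by
  have h1 : (serRels L.rels).length = 1 + (L.rels.flatMap serRel).length := by
    rw [serRels_eq, serList, List.length_cons, add_comm]
  rw [h1]
  refine Nat.add_le_add_left (Pr.length_flatMap_le ?_ fun e he => ?_) _
  · exact hL.length_le.trans (lt_querySize (List.mem_cons_self)).le
  · have h2 := length_serList_const (ser := serTuple) (l := e.2) (n := e.1.2 + 1)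
      (fun t ht => by simp [serTuple, hL.length_eq he t ht])
    obtain ⟨α, hα, -, h3⟩ := hL.exists_atom he
    have h4 : e.1.2 < querySize φ.atoms :=
      lt_querySize (mem_serQuery hα (by simp [serAtom, serTuple, h3]))
    rw [serRel, List.length_cons, List.length_cons, h2]
    have := Nat.mul_le_mul (hL.card_le he) (Nat.succ_le_of_lt h4)
    simp only [Nat.succ_eq_add_one] at this
    omega

theorem getD_serQuery {l : List (ℕ × List ℕ)} {k t : ℕ} (h : k < l.length)
    (ht : t < l[k].2.length + 2) :
    (serQuery l).getD (serPos serAtom l k + t) 0 = (serAtom l[k]).getD t 0 :=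
  getD_serList (ser := serAtom) h (by simp only [serAtom, serTuple, List.length_cons]; omega)

theorem serPos_serAtom {l : List (ℕ × List ℕ)} {k : ℕ} (h : k < l.length) :
    serPos serAtom l (k + 1) = serPos serAtom l k + (2 + l[k].2.length) := by
  rw [serPos_succ h]; simp only [serAtom, serTuple, List.length_cons]; ring

theorem serPos_serRel {l : List ((ℕ × ℕ) × List (List ℕ))} {k : ℕ} (h : k < l.length)
    (hl : ∀ t ∈ l[k].2, t.length = l[k].1.2) :
    serPos serRel l (k + 1) = serPos serRel l k + (3 + l[k].2.length * (l[k].1.2 + 1)) := by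
  rw [serPos_succ h, serRel, List.length_cons, List.length_cons,
    length_serList_const (ser := serTuple) (n := l[k].1.2 + 1)
      (fun t ht => by simp [serTuple, hl t ht])]
  omega

theorem getD_serRels {l : List ((ℕ × ℕ) × List (List ℕ))} {k t : ℕ} (h : k < l.length)
    (ht : t < 2 + (serList serTuple l[k].2).length) :
    (serRels l).getD (serPos serRel l k + t) 0 = (serRel l[k]).getD t 0 :=
  getD_serList (ser := serRel) h (by rw [serRel, List.length_cons, List.length_cons]; omega)

theorem getD_serRels_entry {l : List ((ℕ × ℕ) × List (List ℕ))} {k i j : ℕ} (h : k < l.length)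
    (hl : ∀ t ∈ l[k].2, t.length = l[k].1.2) (hi : i < l[k].2.length) (hj : j < l[k].1.2) :
    (serRels l).getD (serPos serRel l k + 3 + i * (l[k].1.2 + 1) + 1 + j) 0 =
      l[k].2[i].getD j 0 := by
  have hc : ∀ t ∈ l[k].2, (serTuple t).length = l[k].1.2 + 1 :=
    fun t ht => by simp [serTuple, hl t ht]
  have hp := serPos_const (ser := serTuple) (l := l[k].2) hc hi.le
  have ht : j + 1 < (serTuple l[k].2[i]).length := by rw [hc _ (List.getElem_mem _)]; omega
  have h1 := getD_serList (ser := serTuple) (l := l[k].2) hi ht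
  have hle : serPos serTuple l[k].2 i + (j + 1) < (serList serTuple l[k].2).length := by
    have := serPos_le (ser := serTuple) (l := l[k].2) (k := i + 1)
    rw [serPos_succ hi] at this
    omega
  rw [show serPos serRel l k + 3 + i * (l[k].1.2 + 1) + 1 + j =
    serPos serRel l k + (serPos serTuple l[k].2 i + (j + 1) + 2) by rw [hp]; ring,
    getD_serRels h (by omega), serRel, List.getD_cons_succ, List.getD_cons_succ, h1, serTuple,
    List.getD_cons_succ]

end

section

open Finset

namespace Pr

open EX Stm

variable {φ : QFCQ} {A : Struct} {r ε : ℝ} {L : StructListing}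

theorem sum_getD (l : List ℕ) : ∑ i ∈ range l.length, l.getD i 0 = l.sum := by
  induction l with
  | nil => rfl
  | cons a l ih => rw [List.length_cons, sum_range_succ']; simp [← ih, add_comm]

/-- The constants of the computation for given input. -/
noncomputable def cst (φ : QFCQ) (A : Struct) (r ε : ℝ) : Cst where
  ρ := ![r, ε]
  X := querySize φ.atoms
  TK := 2 ^ (2 * querySize φ.atoms + 3 + ((⌊r⌋₊ + 1) + ⌈1 / ε⌉₊))
  D := ⌊(maxRelCard φ A : ℝ) ^ r⌋₊

theorem cst_t_lt : 2 * (cst φ A r ε).X + 3 + ((⌊r⌋₊ + 1) + ⌈1 / ε⌉₊) < (cst φ A r ε).TK :=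
  Nat.lt_two_pow_self

theorem cst_X_lt : (cst φ A r ε).X < (cst φ A r ε).TK := by
  have := cst_t_lt (φ := φ) (A := A) (r := r) (ε := ε)
  omega

theorem cst_TK_lt (c : Cst) : c.TK < c.P := Nat.lt_two_pow_self

theorem Cst.D_lt_LIM {c : Cst} : c.D < c.LIM :=
  (Nat.lt_succ_self _).trans_le (Nat.le_mul_of_pos_right _ (by positivity))

theorem Cst.LIM_lt_C1 (c : Cst) : c.LIM < c.C1 :=
  (Nat.lt_succ_self _).trans_le (Nat.le_mul_of_pos_left _ (by omega))

theorem Cst.C1_le_BX (c : Cst) : c.C1 ≤ c.BX := Nat.le_mul_of_pos_left _ (by omega)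

theorem maxRelCard_le_D (hr : 1 ≤ r) : maxRelCard φ A ≤ (cst φ A r ε).D := by
  refine Nat.le_floor ?_
  rcases Nat.eq_zero_or_pos (maxRelCard φ A) with h | h
  · rw [h, Nat.cast_zero, Real.zero_rpow (by linarith)]
  · conv_lhs => rw [← Real.rpow_one (maxRelCard φ A : ℝ)]
    exact Real.rpow_le_rpow_of_exponent_le (by exact_mod_cast h) hr

theorem length_serRels_le (hr : 1 ≤ r) (hL : L.Presents φ.signature A) :
    (serRels L.rels).length ≤ (cst φ A r ε).LIM := by
  set c := cst φ A r ε with hc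
  refine hL.length_serRels.trans ?_
  have h1 : querySize φ.atoms = c.X := rfl
  have hX : c.X + 2 ≤ 2 ^ (c.X + 1) := by
    have : c.X < 2 ^ c.X := Nat.lt_two_pow_self
    rw [pow_succ]; omega
  have h2 : (c.X + 2) * (c.X + 2) ≤ 2 ^ c.P := by
    calc (c.X + 2) * (c.X + 2) ≤ 2 ^ (c.X + 1) * 2 ^ (c.X + 1) := Nat.mul_le_mul hX hX
      _ = 2 ^ (2 * c.X + 2) := by rw [← pow_add]; congr 1; ring
      _ ≤ 2 ^ c.P := Nat.pow_le_pow_right (by norm_num) (by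
        have : 2 * c.X + 3 + ((⌊r⌋₊ + 1) + ⌈1 / ε⌉₊) < c.TK := cst_t_lt
        have := cst_TK_lt c
        omega)
  rw [h1]
  calc 1 + c.X * (3 + maxRelCard φ A * c.X) ≤ 1 + c.X * (3 + c.D * c.X) := by
        gcongr; exact maxRelCard_le_D hr
    _ ≤ (c.D + 1) * ((c.X + 2) * (c.X + 2)) := by nlinarith [Nat.zero_le (c.D * c.X)]
    _ ≤ c.LIM := Nat.mul_le_mul_left _ h2

/-- The first part of the program: reading the input and computing the constants. -/
def setup : Prog :=
  .seq scanQuery (.seq scanRels (.seq numbers (.seq bounds addressTables)))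

theorem setup_run (hr : 1 ≤ r) (hε : 0 < ε) (hL : L.Presents φ.signature A) :
    ∃ ν, Runs ![r, ε] (cst φ A r ε).BX setup (inputMemory φ L) ν (1200 * (cst φ A r ε).C1) ∧
      (∀ i, ν aQ i = (serQuery φ.atoms).getD i 0) ∧ (∀ i, ν aR i = (serRels L.rels).getD i 0) ∧
      (∀ i < φ.atoms.length, ν aATP i = serPos serAtom φ.atoms i) ∧
      (∀ i < L.rels.length, ν aRLP i = serPos serRel L.rels i) ∧
      ν aM 0 = maxRelCard φ A ∧ (∀ k < (cst φ A r ε).TK, ν aPW k = 2 ^ k) ∧ ν aLC 0 = 0 ∧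
      Holds3 (cst φ A r ε) [] 0 (fun a p q i => ν a ((cst φ A r ε).adr p q i)) ν := by
  set c := cst φ A r ε with hc
  set μ := inputMemory φ L with hμ
  have hz : ∀ a, 3 ≤ a → ∀ i, μ a i = 0 := fun a ha i => by
    obtain ⟨n, rfl⟩ := Nat.exists_eq_add_of_le' ha
    rfl
  have q1 : ∀ i, μ 0 i = (serQuery φ.atoms).getD i 0 := fun i => rfl
  have q2 : ∀ i, μ 2 i = (serRels L.rels).getD i 0 := fun i => rfl
  have n1 : μ 0 0 = φ.atoms.length := rfl
  have n2 : μ 2 0 = L.rels.length := rfl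
  have t1 := cst_t_lt (φ := φ) (A := A) (r := r) (ε := ε)
  rw [← hc] at t1
  have t2 := cst_TK_lt c
  have t3 := c.le_LIM
  have t4 := Cst.LIM_lt_C1 c
  have t5 := Cst.C1_le_BX c
  have t6 : c.D < c.LIM := Cst.D_lt_LIM
  have t7 := maxRelCard_le_D (φ := φ) (A := A) (ε := ε) hr
  rw [← hc] at t7
  have s1 : (serQuery φ.atoms).length ≤ c.X := Nat.le_add_right _ _
  have s2 : (serRels L.rels).length ≤ c.LIM := length_serRels_le hr hL
  have s3 : φ.atoms.length < c.X := lt_querySize List.mem_cons_self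
  have s4 := hL.length_le
  obtain ⟨ν₁, r1, f1, a1, x1⟩ := scanQuery_run (ρ := c.ρ) (B := c.BX) (μ := μ)
    (serPos serAtom φ.atoms) serPos_zero (fun k hk => by
      rw [n1] at hk
      have h1 := serPos_serAtom hk
      have h2 := serPos_le (ser := serAtom) (l := φ.atoms) (k := k + 1)
      rw [← serQuery_eq] at h2
      refine ⟨by omega, ?_⟩
      rw [h1, q1, getD_serQuery hk (by omega)]
      rfl) hz (by omega) (by
      have := serPos_le (ser := serAtom) (l := φ.atoms) (k := μ 0 0)
      rw [← serQuery_eq] at this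
      omega)
  rw [n1, serPos_length, ← serQuery_eq] at x1 r1
  simp only [q1] at x1
  rw [sum_getD] at x1
  have g1 : ∀ b, b ∉ [aATP, 100, 101, 46, 199, 102] → ν₁ b = μ b := f1
  have e1 : ν₁ 2 = μ 2 := g1 2 (by decide)
  have hcnt : ∀ k (h : k < L.rels.length),
      μ 2 (serPos serRel L.rels k + 2) = L.rels[k].2.length := fun k h => by
    rw [q2, getD_serRels h (by simp [serList])]; rfl
  have har : ∀ k (h : k < L.rels.length),
      μ 2 (serPos serRel L.rels k + 1) = L.rels[k].1.2 := fun k h => by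
    rw [q2, getD_serRels h (by omega)]; rfl
  obtain ⟨ν₂, r2, f2, a2, m2⟩ := scanRels_run (ρ := c.ρ) (B := c.BX) (μ := ν₁)
    (serPos serRel L.rels) serPos_zero (maxRelCard φ A) (fun k hk => by
      rw [e1, n2] at hk
      have h1 := serPos_serRel hk (hL.length_eq (List.getElem_mem hk))
      have h2 := serPos_le (ser := serRel) (l := L.rels) (k := k + 1)
      rw [← serRels_eq] at h2
      rw [e1, hcnt k hk, har k hk]
      exact ⟨by omega, hL.card_le (List.getElem_mem hk), h1⟩)
    (fun a ha h i => by
      rw [g1 a (by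
        simp only [List.mem_cons, List.not_mem_nil, or_false, aATP, aRLP, aM] at ha ⊢; omega)]
      exact hz a (by simp only [aRLP, aM] at ha; omega) i)
    (by rw [e1, n2]; omega) (by omega)
  rw [e1, n2] at r2 a2 m2
  rw [hL.maxRelCard_eq hcnt] at m2
  obtain ⟨ν₃, r3, f3, d3, t3'⟩ := numbers_run (c := c) (μ := ν₂) (m := maxRelCard φ A) hr hε m2
    rfl (by rw [f2 46 (by decide), x1]; rfl) (B := c.BX) (W := c.C1)
    (fun a ha h => by
      by_cases h' : a = 50
      · rw [h', f2 _ (by decide), g1 _ (by decide), hz _ (by decide)]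
      · rw [f2 a (by simp only [List.mem_cons, List.not_mem_nil, or_false, aRLP, aM]; omega),
          g1 a (by simp only [List.mem_cons, List.not_mem_nil, or_false, aATP]; omega),
          hz a (by omega)])
    (by omega)
    (by change ⌊r⌋₊ + 1 < _; omega)
    (by change ⌈1 / ε⌉₊ < _; omega) t5
  have z3 : ∀ a, 112 < a → a < 121 → ν₃ a = μ a := fun a h1 h2 => by
    rw [f3 a (by simp only [List.mem_cons, List.not_mem_nil, or_false]; omega),
      f2 a (by simp only [List.mem_cons, List.not_mem_nil, or_false, aRLP, aM]; omega),
      g1 a (by simp only [List.mem_cons, List.not_mem_nil, or_false, aATP]; omega)]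
  have w3 : ∀ a, a < 50 → ν₃ a = ν₂ a := fun a h => f3 a (by
    simp only [List.mem_cons, List.not_mem_nil, or_false]; omega)
  have x2 : ν₂ 46 0 = c.X := by rw [f2 46 (by decide), x1]; rfl
  obtain ⟨ν₄, r4, f4, b48, b49, b47, b54, p4⟩ := bounds_run (c := c) (μ := ν₃) (B := c.BX)
    (W := c.C1) d3 (by rw [w3 46 (by decide), x2]) t3' rfl
    (fun a h1 h2 => by rw [z3 a h1 (by omega), hz a (by omega)])
    (by change 2 * c.X + 3 + (⌊r⌋₊ + 1 + ⌈1 / ε⌉₊) < _; omega) (by omega) (by omega)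
    (by change c.P < _; omega) t5
  obtain ⟨ν₅, r5, f5, b53, b51, b52, b45, p5, p6⟩ := addressTables_run (c := c) (μ := ν₄)
    (B := c.BX) (W := c.C1) b49 b54
    (fun a h1 h2 => by
      rw [f4 a (by simp only [List.mem_cons, List.not_mem_nil, or_false, aPW]; omega),
        z3 a (by omega) h2, hz a (by omega)]) (by omega) t5
  have k5 : ∀ a, a < 45 → a ≠ aPW → ν₅ a = ν₂ a := fun a h1 h2 => by
    rw [f5 a (by simp only [List.mem_cons, List.not_mem_nil, or_false]; omega),
      f4 a (by simp only [List.mem_cons, List.not_mem_nil, or_false]; omega), w3 a (by omega)]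
  refine ⟨ν₅, (r1.seq (r2.seq (r3.seq (r4.seq r5)))).mono ?_, ?_, ?_, ?_, ?_, ?_, ?_, ?_, ?_⟩
  · have h1 : (L.rels.length + 1) * (maxRelCard φ A + 2) ≤ c.C1 :=
      Nat.mul_le_mul (by omega) (by omega)
    omega
  · intro i
    rw [k5 _ (by decide) (by decide), f2 _ (by decide), g1 _ (by decide), q1]
  · intro i
    rw [k5 _ (by decide) (by decide), f2 _ (by decide), e1, q2]
  · intro i hi
    rw [k5 _ (by decide) (by decide), f2 _ (by decide), a1 i hi]
  · intro i hi
    rw [k5 _ (by decide) (by decide), a2 i hi]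
  · rw [k5 _ (by decide) (by decide), m2]
  · intro k hk
    rw [f5 _ (by decide), p4 k hk]
  · rw [k5 _ (by decide) (by decide), f2 _ (by decide), g1 _ (by decide), hz _ (by decide)]
  · have c46 : ν₅ 46 0 = c.X := by
      rw [f5 _ (by decide), f4 _ (by decide), w3 _ (by decide), x2]
    have c50 : ν₅ 50 0 = c.D := by rw [f5 _ (by decide), f4 _ (by decide), d3]
    exact
      { data := fun a _ p _ q _ i _ => rfl
        bd := fun b => by
          cases b
          · exact b45
          · exact c46
          · exact (by rw [Bd.arr, f5 _ (by decide), b47]; rfl)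
          · exact (by rw [Bd.arr, f5 _ (by decide), b48]; rfl)
          · exact (by rw [Bd.arr, f5 _ (by decide), b49]; rfl)
          · exact c50
          · exact b51
          · exact b52
        regP := b53
        regL := by rw [f5 _ (by decide), b54]
        row1 := p5
        row2 := p6
        lt := by simp
        env := fun x hx => by simp at hx
        var := by simp }

theorem inp_of_memory (hr : 1 ≤ r) (hL : L.Presents φ.signature A) {M : Mem}
    (h1 : ∀ i, M aQ 0 0 i = (serQuery φ.atoms).getD i 0)
    (h2 : ∀ i, M aR 0 0 i = (serRels L.rels).getD i 0)
    (h3 : ∀ i < φ.atoms.length, M aATP 0 0 i = serPos serAtom φ.atoms i)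
    (h4 : ∀ i < L.rels.length, M aRLP 0 0 i = serPos serRel L.rels i) :
    Inp φ L (cst φ A r ε) M := by
  set c := cst φ A r ε with hc
  have s1 : (serQuery φ.atoms).length ≤ c.X := Nat.le_add_right _ _
  have s2 : (serRels L.rels).length ≤ c.LIM := length_serRels_le hr hL
  have s3 : φ.atoms.length < c.X := lt_querySize List.mem_cons_self
  have s4 := hL.length_le
  have t1 : c.X < c.TK := cst_X_lt
  have t2 := cst_TK_lt c
  have t3 := c.le_LIM
  refine ⟨by rw [h1]; rfl, s3.le, fun i hi => ?_, by rw [h2]; rfl, by omega, fun i hi => ?_⟩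
  · have hm : ∀ x ∈ serAtom φ.atoms[i], x < c.X := fun x hx =>
      lt_querySize (mem_serQuery (List.getElem_mem hi) hx)
    have p1 := serPos_serAtom hi
    have p2 := serPos_le (ser := serAtom) (l := φ.atoms) (k := i + 1)
    rw [← serQuery_eq] at p2
    rw [h3 i hi]
    refine ⟨by omega, hm _ (by simp [serAtom, serTuple]), fun x hx => hm x (by
      simp [serAtom, serTuple, hx]), ?_, ?_, fun j hj => ?_⟩
    · rw [h1, ← add_zero (serPos _ _ _), getD_serQuery hi (by omega)]; rfl
    · rw [h1, getD_serQuery hi (by omega)]; rfl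
    · rw [h1, add_assoc, getD_serQuery hi (by omega), serAtom, serTuple, add_comm 2 j,
        List.getD_cons_succ, List.getD_cons_succ, List.getD_eq_getElem _ _ hj]
  · have hl := hL.length_eq (List.getElem_mem hi)
    have p1 := serPos_serRel hi hl
    have p2 := serPos_le (ser := serRel) (l := L.rels) (k := i + 1)
    rw [← serRels_eq] at p2
    rw [h4 i hi]
    refine ⟨by omega, (hL.card_le (List.getElem_mem hi)).trans (maxRelCard_le_D hr), ?_, ?_, ?_,
      fun k hk j hj => ?_⟩
    · rw [h2, ← add_zero (serPos _ _ _), getD_serRels hi (by omega)]; rfl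
    · rw [h2, getD_serRels hi (by omega)]; rfl
    · rw [h2, getD_serRels hi (by simp [serList])]; rfl
    · rw [h2, getD_serRels_entry hi hl hk hj]

end Pr

end

section

open Finset

namespace Pr

open EX Stm

variable {φ : QFCQ} {A : Struct} {r ε : ℝ} {L : StructListing}

/-- A bound for `c.P`. -/
def paramBound (X a b : ℕ) : ℕ := 2 ^ 2 ^ (2 * X + 4 + a + b)

/-- The bound for time, space and the length of the output, without the dependence on the data. -/
def resourceBound (K d X a b : ℕ) : ℕ :=
  K * (paramBound X a b + 1) ^ (d + 2) * (2 * (2 ^ paramBound X a b + 1)) ^ 2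

theorem primrec_querySize : Primrec querySize := by
  have h1 : Primrec serQuery := by
    refine Primrec.list_cons.comp Primrec.list_length
      (Primrec.list_flatMap Primrec.id (Primrec₂.mk ?_))
    exact Primrec.list_cons.comp (Primrec.fst.comp Primrec.snd)
      (Primrec.list_cons.comp (Primrec.list_length.comp (Primrec.snd.comp Primrec.snd))
        (Primrec.snd.comp Primrec.snd))
  have h2 : Primrec (List.sum : List ℕ → ℕ) := by
    have := Primrec.list_foldr (f := fun l : List ℕ => l) (g := fun _ => 0)
      (h := fun _ p => p.1 + p.2) Primrec.id (Primrec.const 0)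
      (Primrec₂.mk (Primrec.nat_add.comp (Primrec.fst.comp Primrec.snd)
        (Primrec.snd.comp Primrec.snd)))
    refine this.of_eq fun l => ?_
    rw [List.sum]
  exact Primrec.nat_add.comp (Primrec.list_length.comp h1) (h2.comp h1)

theorem primrec_pow : Primrec₂ ((· ^ ·) : ℕ → ℕ → ℕ) := Primrec₂.unpaired'.1 Nat.Primrec.pow

theorem computable_resourceBound (K d : ℕ) : Computable fun p : List (ℕ × List ℕ) × ℕ × ℕ =>
    resourceBound K d (querySize p.1) p.2.1 p.2.2 := by
  have hP : Primrec fun p : List (ℕ × List ℕ) × ℕ × ℕ =>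
      paramBound (querySize p.1) p.2.1 p.2.2 :=
    primrec_pow.comp (Primrec.const 2) (primrec_pow.comp (Primrec.const 2)
      (Primrec.nat_add.comp (Primrec.nat_add.comp (Primrec.nat_add.comp
        (Primrec.nat_mul.comp (Primrec.const 2) (primrec_querySize.comp Primrec.fst))
        (Primrec.const 4)) (Primrec.fst.comp Primrec.snd)) (Primrec.snd.comp Primrec.snd)))
  have h1 : ∀ f : List (ℕ × List ℕ) × ℕ × ℕ → ℕ, Primrec f → Primrec fun p => f p + 1 :=
    fun f hf => Primrec.nat_add.comp hf (Primrec.const 1)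
  exact (Primrec.nat_mul.comp (Primrec.nat_mul.comp (Primrec.const K)
    (primrec_pow.comp (h1 _ hP) (Primrec.const (d + 2))))
    (primrec_pow.comp (Primrec.nat_mul.comp (Primrec.const 2)
      (h1 _ (primrec_pow.comp (Primrec.const 2) hP))) (Primrec.const 2))).to_comp

theorem P_le_paramBound :
    (cst φ A r ε).P ≤ paramBound (querySize φ.atoms) ⌈r⌉₊ ⌈1 / ε⌉₊ := by
  refine Nat.pow_le_pow_right (by norm_num) (Nat.pow_le_pow_right (by norm_num) ?_)
  have := Nat.floor_le_ceil r
  omega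

theorem LIM_le (hr : 1 ≤ r) : ((cst φ A r ε).LIM + 1 : ℝ) ≤
    (2 * (2 ^ paramBound (querySize φ.atoms) ⌈r⌉₊ ⌈1 / ε⌉₊ + 1) : ℕ) *
      (max (maxRelCard φ A : ℝ) 1) ^ r := by
  set c := cst φ A r ε with hc
  set Q := paramBound (querySize φ.atoms) ⌈r⌉₊ ⌈1 / ε⌉₊
  set Y := (max (maxRelCard φ A : ℝ) 1) ^ r with hY
  have hY1 : 1 ≤ Y := Real.one_le_rpow (le_max_right _ _) (by linarith)
  have hD : (c.D : ℝ) ≤ Y := (Nat.floor_le (by positivity)).trans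
    (Real.rpow_le_rpow (by positivity) (le_max_left _ _) (by linarith))
  have hP : (2 : ℝ) ^ c.P ≤ 2 ^ Q := pow_le_pow_right₀ (by norm_num) P_le_paramBound
  have hQ : (0 : ℝ) ≤ 2 ^ Q := by positivity
  have h1 : (c.LIM : ℝ) = (c.D + 1) * 2 ^ c.P := by simp [Cst.LIM]
  have h2 : ((c.D : ℝ) + 1) * 2 ^ c.P ≤ (2 * Y) * 2 ^ Q :=
    mul_le_mul (by linarith) hP (by positivity) (by positivity)
  rw [h1]
  push_cast
  linarith

theorem resource_le {K d n t a b : ℕ} (hr : 1 ≤ r)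
    (ha : a ≤ d + 2) (hn : n ≤ K)
    (hb : b ≤ 2) (h : t ≤ n * ((cst φ A r ε).P + 1) ^ a * ((cst φ A r ε).LIM + 1) ^ b) :
    (t : ℝ) ≤ (resourceBound K d (querySize φ.atoms) ⌈r⌉₊ ⌈1 / ε⌉₊ : ℝ) *
      ((max (maxRelCard φ A : ℝ) 1) ^ r) ^ b := by
  have hL := LIM_le (φ := φ) (A := A) (ε := ε) hr
  set c := cst φ A r ε with hc
  set Q := paramBound (querySize φ.atoms) ⌈r⌉₊ ⌈1 / ε⌉₊ with hQ
  have hP : c.P ≤ Q := P_le_paramBound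
  set Y := (max (maxRelCard φ A : ℝ) 1) ^ r with hY
  set Z := 2 * (2 ^ Q + 1) with hZ
  have hY0 : 0 ≤ Y := by positivity
  have h1 : n * (c.P + 1) ^ a ≤ K * (Q + 1) ^ (d + 2) :=
    Nat.mul_le_mul hn ((Nat.pow_le_pow_left (by omega) a).trans
      (Nat.pow_le_pow_right (by omega) ha))
  have h2 : ((c.LIM : ℝ) + 1) ^ b ≤ (Z : ℝ) ^ 2 * Y ^ b := by
    calc ((c.LIM : ℝ) + 1) ^ b ≤ (Z * Y) ^ b := pow_le_pow_left₀ (by positivity) hL b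
      _ = (Z : ℝ) ^ b * Y ^ b := mul_pow _ _ _
      _ ≤ _ := mul_le_mul_of_nonneg_right
        (pow_le_pow_right₀ (Nat.one_le_cast.2 (Nat.succ_le_of_lt (by positivity))) hb) (by positivity)
  have h3 : (t : ℝ) ≤ (n * (c.P + 1) ^ a : ℕ) * ((c.LIM : ℝ) + 1) ^ b := by exact_mod_cast h
  have h4 : ((n * (c.P + 1) ^ a : ℕ) : ℝ) ≤ (K * (Q + 1) ^ (d + 2) : ℕ) := by exact_mod_cast h1
  refine h3.trans ((mul_le_mul h4 h2 (by positivity) (by positivity)).trans_eq ?_)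
  rw [resourceBound, ← hQ, ← hZ]
  push_cast
  ring

end Pr

end

theorem mainTheorem4 :
    ∃ f : List (ℕ × List ℕ) → ℕ → ℕ → ℕ,
      Computable (fun p : List (ℕ × List ℕ) × ℕ × ℕ => f p.1 p.2.1 p.2.2) ∧
      ∃ P : Prog,
        ∀ (φ : QFCQ) (A : Struct), A.IsOver φ.signature →
        ∀ (c ε : ℝ), 1 ≤ c → 0 < ε →
        ∀ L : StructListing, L.Presents φ.signature A →
          ∃ (ν : Memory) (time : ℕ) (cells : Finset (ℕ × ℕ)) (rs : List (Refinement φ A)),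
            Exec ![c, ε] P (inputMemory φ L) ν time cells ∧
            Outputs ν rs ∧
            (time : ℝ) ≤
              (f φ.atoms ⌈c⌉₊ ⌈1 / ε⌉₊ : ℝ) * (max (maxRelCard φ A : ℝ) 1) ^ (2 * c) ∧
            (cells.card : ℝ) ≤
              (f φ.atoms ⌈c⌉₊ ⌈1 / ε⌉₊ : ℝ) * (max (maxRelCard φ A : ℝ) 1) ^ c ∧
            rs.length ≤ f φ.atoms ⌈c⌉₊ ⌈1 / ε⌉₊ ∧
            (∀ r ∈ rs, r.StronglyMConsistent ((maxRelCard φ A : ℝ) ^ c) ∧ r.Uniform ε) ∧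
            rs.Pairwise (fun r r' => Disjoint r.result r'.result) ∧
            evalConj φ.conj A = ⋃ r ∈ rs, r.result := by
  obtain ⟨K, hK⟩ : ∃ K, 1200 + Pr.main.size ≤ K := ⟨_, le_rfl⟩
  obtain ⟨d, hd⟩ : ∃ d, Pr.main.paramDepth ≤ d := ⟨_, le_rfl⟩
  refine ⟨fun l a b => Pr.resourceBound K d (querySize l) a b,
    Pr.computable_resourceBound _ _, .seq Pr.setup Pr.main.cp, ?_⟩
  intro φ A hA r ε hr hε L hL
  have hX : (Pr.cst φ A r ε).X < (Pr.cst φ A r ε).TK := Pr.cst_X_lt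
  have hok : (Pr.cst φ A r ε).OK := ⟨hX.le⟩
  obtain ⟨ν, r1, m1, m2, m3, m4, m5, m6, m7, hH⟩ := Pr.setup_run hr hε hL
  obtain ⟨ξ, r2, hH'⟩ := Stm.exec hok Pr.main Pr.main_wf hH
  obtain ⟨t, C, hex, ht, hC⟩ := r1.seq r2
  have h0 : ∀ a i, ν a ((Pr.cst φ A r ε).adr 0 0 i) = ν a i := fun a i => by simp [Cst.adr]
  have F : Pr.Fits φ A (Pr.cst φ A r ε) r ε :=
    { ok := hok
      rho := rfl
      one_le := hr
      pos := hε
      card := rfl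
      vars := fun x hx => by
        obtain ⟨a, ha, hx⟩ := Finset.mem_biUnion.1 hx
        obtain ⟨α, hα, rfl⟩ := List.mem_map.1 (List.mem_toFinset.1 ha)
        exact Finset.mem_range.2 (lt_querySize (mem_serQuery hα
          (List.mem_cons_of_mem _ (List.mem_cons_of_mem _ (List.mem_toFinset.1 hx))))) }
  obtain ⟨D, rs, o1, o2, o3, o4, o5, o6⟩ := Pr.main_spec
    (M := fun a p q i => ν a ((Pr.cst φ A r ε).adr p q i)) F
    (Nat.pow_le_pow_right (by norm_num) (by
      have := Nat.ceil_le_floor_add_one r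
      change 2 * querySize φ.atoms + 3 + _ + _ ≤ _
      omega)) hA
    (fun k hk => (h0 _ _).trans (m6 k hk)) ((h0 _ _).trans m7) hL
    (Pr.inp_of_memory hr hL (fun i => (h0 _ _).trans (m1 i)) (fun i => (h0 _ _).trans (m2 i))
      (fun i hi => (h0 _ _).trans (m3 i hi)) (fun i hi => (h0 _ _).trans (m4 i hi)))
    ((h0 _ _).trans m5)
  refine ⟨ξ, t, C, rs, hex, ⟨D, o1, fun i hi => ?_⟩, ?_, ?_, ?_, o4, o5, o6⟩
  · obtain ⟨q1, q2⟩ := o2 i hi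
    have := hH'.data 3 (by norm_num) 0 (Nat.zero_le _) 0 (Nat.zero_le _) i q1
    rw [← q2, ← this, Cst.adr]
    simp
  · have he : (max (maxRelCard φ A : ℝ) 1) ^ (2 * r) = ((max (maxRelCard φ A : ℝ) 1) ^ r) ^ 2 := by
      rw [mul_comm, Real.rpow_mul (by positivity)]; norm_cast
    rw [he]
    refine Pr.resource_le (n := 1200 + Pr.main.size) (a := Pr.main.paramDepth + 1) hr (by omega)
      hK le_rfl (ht.trans ?_)
    have hc := Stm.cost_le hok Pr.main
    rw [Pr.main_dataDepth] at hc
    generalize Pr.cst φ A r ε = c at hc ⊢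
    have h1 : c.C1 ≤ (c.P + 1) ^ (Pr.main.paramDepth + 1) * (c.LIM + 1) ^ 2 :=
      Nat.mul_le_mul (Nat.le_self_pow (by omega) _) (Nat.le_self_pow (by omega) _)
    have h2 : Pr.main.size * (c.P + 1) ^ Pr.main.paramDepth * (c.LIM + 1) ^ 2 ≤
        Pr.main.size * (c.P + 1) ^ (Pr.main.paramDepth + 1) * (c.LIM + 1) ^ 2 := by
      gcongr <;> omega
    calc _ ≤ 1200 * ((c.P + 1) ^ (Pr.main.paramDepth + 1) * (c.LIM + 1) ^ 2) +
          Pr.main.size * (c.P + 1) ^ (Pr.main.paramDepth + 1) * (c.LIM + 1) ^ 2 :=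
        add_le_add (Nat.mul_le_mul_left _ h1) (hc.trans h2)
      _ = _ := by ring
  · have hcard := Finset.card_le_card hC
    rw [Finset.card_product, Finset.card_range, Finset.card_range] at hcard
    rw [← pow_one ((max (maxRelCard φ A : ℝ) 1) ^ r)]
    refine Pr.resource_le (n := 200) (a := 2) hr (by omega) (by omega) (by omega)
      (hcard.trans_eq ?_)
    rw [Cst.BX, Cst.C1]
    ring
  · refine o3.trans (Pr.P_le_paramBound.trans ?_)
    simp only [Pr.resourceBound]
    set Q := Pr.paramBound (querySize φ.atoms) ⌈r⌉₊ ⌈1 / ε⌉₊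
    have h1 : Q ≤ (Q + 1) ^ (d + 2) :=
      (Nat.le_succ _).trans (Nat.le_self_pow (by omega) _)
    have h2 : 0 < (2 * (2 ^ Q + 1)) ^ 2 := by positivity
    calc Q ≤ K * (Q + 1) ^ (d + 2) :=
          h1.trans (Nat.le_mul_of_pos_left _ (by omega))
      _ ≤ _ := Nat.le_mul_of_pos_right _ h2
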